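/- Let $q$ be an indeterminate and $K=\mathbb C[q,q^{-1}]$. For sequences $(u_i)_{i\ge1}$, $(m_i)_{i\ge 1}$ put $u(\lambda)=\sum_{i\ge0}(-1)^iu_{i+1}\lambda^{-i}$, $m(\lambda)=\sum_{i\ge0}(-1)^im_{i+1}\lambda^{-i}$. Let $\mathbb C[H_-\backslash B_-]_q$ be the $K$-algebra with generators $u_i,m_i$ $(i\ge 1)$ and relations $$(\lambda^{-1}u(\lambda)-\mu^{-1}u(\mu))(u(\lambda)-u(\mu))=q\,(u(\lambda)-u(\mu))(\lambda^{-1}u(\lambda)-\mu^{-1}u(\mu)),$$ $$(\lambda^{-1}m(\lambda)-\mu^{-1}m(\mu))(m(\lambda)-m(\mu))=q^{-1}(m(\lambda)-m(\mu))(\lambda^{-1}m(\lambda)-\mu^{-1}m(\mu)),\qquad u(\lambda)m(\mu)=q^{-1}m(\mu)u(\lambda).$$ Let $\mathbb C[H_-\backslash B_-N_+]_q$ be the $K$-algebra with the additional generators $\bar\Sigma_+,\bar\Sigma_-$ and the additional relations $u(\lambda)\bar\Sigma_\pm=q^{\pm1}\bar\Sigma_\pm u(\lambda)$, $m(\lambda)\bar\Sigma_+-q^{-1}\bar\Sigma_+m(\lambda)=1-q^{-1}$,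 $m(\lambda)\bar\Sigma_--q\bar\Sigma_-m(\lambda)=-(q-1)\lambda^{-1}m(\lambda)^2$ and $\bar\Sigma_\pm^3\bar\Sigma_\mp-(q+1+q^{-1})(\bar\Sigma_\pm^2\bar\Sigma_\mp\bar\Sigma_\pm-\bar\Sigma_\pm\bar\Sigma_\mp\bar\Sigma_\pm^2)-\bar\Sigma_\mp\bar\Sigma_\pm^3=0$. Put $v(\mu)=-(u(\mu)+\mu m(\mu)^{-1})^{-1}=-\mu^{-1}m(\mu)(1+\mu^{-1}u(\mu)m(\mu))^{-1}$ and $w(\mu)=-(m(\mu)+\mu u(\mu)^{-1})^{-1}=-\mu^{-1}u(\mu)(1+\mu^{-1}m(\mu)u(\mu))^{-1}$. **(1) Existence.** On $\mathbb C[H_-\backslash B_-]_q$ there is exactly one family $(H_n)_{n\ge1}$ of $K$-linear derivations such that $H(\mu)=\sum_{k\ge1}(-1)^kH_k\mu^{-k}$ satisfies $$H(\mu)(u(\lambda))=\tfrac{1}{\lambda^{-1}-\mu^{-1}}(\lambda^{-1}u(\lambda)-\mu^{-1}u(\mu))v(\mu)u(\lambda)-\tfrac{\mu^{-1}}{\lambda^{-1}-\mu^{-1}}(u(\lambda)-u(\mu))(1+v(\mu)u(\mu)),$$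 $$H(\mu)(m(\lambda))=\tfrac{\mu^{-1}}{\lambda^{-1}-\mu^{-1}}(1+m(\mu)w(\mu))(m(\lambda)-m(\mu))-\tfrac{1}{\lambda^{-1}-\mu^{-1}}m(\lambda)w(\mu)(\lambda^{-1}m(\lambda)-\mu^{-1}m(\mu)).$$ On $\mathbb C[H_-\backslash B_-N_+]_q$ there is exactly one family $(H_n)_{n\ge 1}$ of $K$-linear derivations satisfying the same two formulas together with $H(\mu)(\bar\Sigma_+)=-\mu^{-1}(u(\mu)+u(\mu)v(\mu)u(\mu))$ and $H(\mu)(\bar\Sigma_-)=v(\mu)$. The natural algebra map $\mathbb C[H_-\backslash B_-]_q\to\mathbb C[H_-\backslash B_-N_+]_q$ intertwines the two families. **(2) Commutativity.** In both cases $H_nH_k=H_kH_n$ for all $n,k\ge1$. **(3) Equivariance.** Let $U_q\hat{\mathfrak b}_-$ be the $K$-algebra generated by $k_\varepsilon^{\pm1},f_\varepsilon$ $(\varepsilon=\pm)$, with commuting $k_\varepsilon$, $k_\varepsilon f_{\varepsilon'}k_\varepsilon^{-1}=q^{\varepsilon\varepsilon'}f_{\varepsilon'}$, and the above cubic Serre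 relations for $f_\pm,f_\mp$; let $\Delta(k_\varepsilon)=k_\varepsilon\otimes k_\varepsilon$, $\Delta(f_\varepsilon)=f_\varepsilon\otimes1+k_\varepsilon\otimes f_\varepsilon$. There is exactly one $U_q\hat{\mathfrak b}_-$-module-algebra structure on $\mathbb C[H_-\backslash B_-N_+]_q$ with $k_\pm.u(\lambda)=q^{\pm1}u(\lambda)$, $k_\pm.m(\lambda)=q^{\mp1}m(\lambda)$, $k_\varepsilon.\bar\Sigma_{\varepsilon'}=q^{\varepsilon\varepsilon'}\bar\Sigma_{\varepsilon'}$, $f_+.u(\lambda)=-(q-1)\lambda^{-1}u(\lambda)^2-(q-q^{-1})u(\lambda)\bar\Sigma_+$, $f_-.u(\lambda)=(1-q^{-1})+(q-q^{-1})u(\lambda)\bar\Sigma_-$, $f_+.m(\lambda)=1-q+(q-q^{-1})m(\lambda)\bar\Sigma_+$, $f_-.m(\lambda)=(1-q^{-1})\lambda^{-1}m(\lambda)^2-(q-q^{-1})m(\lambda)\bar\Sigma_-$, $f_\varepsilon.\bar\Sigma_{\varepsilon'}=\bar\Sigma_\varepsilon\bar\Sigma_{\varepsilon'}-q^{\varepsilon\varepsilon'}\bar\Sigma_{\varepsilon'}\bar\Sigma_\varepsilon$.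 The derivations $H_n$ of $\mathbb C[H_-\backslash B_-N_+]_q$ commute with this action. **(4) Classical limit.** Let $G=SL_2(\mathbb C((\lambda^{-1})))$; let $B_-$ be the group of matrices in $SL_2(\mathbb C[[\lambda^{-1}]])$ that are lower triangular at $\lambda^{-1}=0$, $N_+$ the group of matrices in $SL_2(\mathbb C[\lambda])$ that are upper unipotent at $\lambda=0$, $H_-\subset B_-$ the diagonal matrices, and $\mathfrak h_+=\{\mathrm{diag}(a,-a):a\in\lambda\mathbb C[\lambda]\}$, with basis $h_n=\mathrm{diag}(\lambda^n,-\lambda^n)$, $n\ge1$. Every class in $H_-\backslash B_-$ has a unique representative $\begin{pmatrix}1&v\\0&1\end{pmatrix}\begin{pmatrix}1&0\\u&1\end{pmatrix}$, $u\in\mathbb C[[\lambda^{-1}]]$, $v\in\lambda^{-1}\mathbb C[[\lambda^{-1}]]$; put $m=-\lambda v(1+uv)^{-1}$, and let $u_{i,\rm cl},m_{i,\rm cl}$ be the coefficients of $u$ and $m$, with the same sign convention as above. Let $\mathbb C[H_-\backslash B_-]$ be the algebra of functions generated by the $u_{i,\rm cl},m_{i,\rm cl}$, and $\mathbb C[H_-\backslash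 B_-N_+]$ the algebra of functions on $H_-\backslash B_-N_+\cong (H_-\backslash B_-)\times N_+$ generated by these and the coefficients $a_{s,t}^{(r)}$ of $\lambda^r$ in the entries of the $N_+$-component. Infinitesimal left translation $g\mapsto(1+\epsilon x)g$, $x\in\mathfrak h_+$, $\epsilon^2=0$, on $H_-\backslash B_-\subset H_-\backslash G/N_+$ and on $H_-\backslash B_-N_+\subset H_-\backslash G$ gives a linear action $\rho$ of the abelian Lie algebra $\mathfrak h_+$ by pairwise commuting derivations on each of these function algebras. There is a surjective ring homomorphism $\sigma:\mathbb C[H_-\backslash B_-]_q\to\mathbb C[H_-\backslash B_-]$, $\mathbb C$-linear, with $q\mapsto 1$, $u_i\mapsto u_{i,\rm cl}$, $m_i\mapsto m_{i,\rm cl}$, whose kernel is generated by $q-1$; and a $\mathbb C$-linear ring homomorphism $\sigma:\mathbb C[H_-\backslash B_-N_+]_q\to\mathbb C[H_-\backslash B_-N_+]$ with in addition $\bar\Sigma_+\mapsto a_{2,1}^{(1)}$, $\bar\Sigma_-\mapsto a_{1,2}^{(0)}$, whose kernel is the two-sided ideal generated by $q-1$ and $\bar\Sigma_+\bar\Sigma_--\bar\Sigma_-\bar\Sigma_+$.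 In both cases the derivations $H_n$ deform the action of $\mathfrak h_+$: $$\sigma\circ\bigl((-1)^nH_n\bigr)=\tfrac12\,\rho(h_n)\circ\sigma\qquad(n\ge1).$$ -/

import Mathlib

open scoped PowerSeries Polynomial LaurentPolynomial

namespace QDS

noncomputable section

/-! ## Generating series

Bivariate series in `x = λ⁻¹` and `y = μ⁻¹` over a (noncommutative) ring `A` are elements of
`A⟦X⟧⟦X⟧`: the inner variable is `x = λ⁻¹`, the outer variable is `y = μ⁻¹`. -/

/-- The ground ring `ℂ[q, q⁻¹]`. -/
abbrev Kq : Type := ℂ[T;T⁻¹]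

/-- The element `q ^ n` of `ℂ[q, q⁻¹]`. -/
def qp (n : ℤ) : Kq := LaurentPolynomial.T n

section Series

variable {A : Type} [Ring A]

/-- The series `∑_{i ≥ 0} (-1)^i c_{i+1} λ^{-i}`; the entry `c_{i+1}` is stored as `c i`. -/
def genSer (c : ℕ → A) : A⟦X⟧ := PowerSeries.mk fun i => (-1) ^ i * c i

/-- A series `s(λ)` seen as a bivariate series. -/
def inLam (s : A⟦X⟧) : A⟦X⟧⟦X⟧ := PowerSeries.C s

/-- The series `s(μ)` seen as a bivariate series. -/
def inMu (s : A⟦X⟧) : A⟦X⟧⟦X⟧ := PowerSeries.map PowerSeries.C s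

variable (A) in
/-- The variable `λ⁻¹`. -/
def xLam : A⟦X⟧⟦X⟧ := PowerSeries.C PowerSeries.X

variable (A) in
/-- The variable `μ⁻¹`. -/
def xMu : A⟦X⟧⟦X⟧ := PowerSeries.X

/-- `(λ⁻¹ s(λ) - μ⁻¹ s(μ)) (s(λ) - s(μ))` -/
def quadLeft (s : A⟦X⟧) : A⟦X⟧⟦X⟧ :=
  (xLam A * inLam s - xMu A * inMu s) * (inLam s - inMu s)

/-- `(s(λ) - s(μ)) (λ⁻¹ s(λ) - μ⁻¹ s(μ))` -/
def quadRight (s : A⟦X⟧) : A⟦X⟧⟦X⟧ :=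
  (inLam s - inMu s) * (xLam A * inLam s - xMu A * inMu s)

/-- The coefficient of `λ^{-i} μ^{-j}`. -/
def coeffLM (i j : ℕ) (s : A⟦X⟧⟦X⟧) : A := PowerSeries.coeff i (PowerSeries.coeff j s)

/-- For two series `s(μ)`, `t(μ)`: the series
`-(s(μ) + μ t(μ)⁻¹)⁻¹ = - μ⁻¹ t(μ) (1 + μ⁻¹ s(μ) t(μ))⁻¹`,
since `s + μ t⁻¹ = μ (1 + μ⁻¹ s t) t⁻¹`. -/
def negInvAdd (s t : A⟦X⟧) : A⟦X⟧ :=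
  -(PowerSeries.X * t * PowerSeries.invOfUnit (1 + PowerSeries.X * s * t) 1)

variable [Algebra Kq A]

/-- A linear map applied to all coefficients of a series. -/
def applySer (L : A →ₗ[Kq] A) (s : A⟦X⟧) : A⟦X⟧ :=
  PowerSeries.mk fun i => L (PowerSeries.coeff i s)

/-- A `ℂ[q, q⁻¹]`-linear derivation of a noncommutative algebra. -/
def IsDeriv (D : A →ₗ[Kq] A) : Prop := ∀ a b : A, D (a * b) = D a * b + a * D b

/-- `H(μ)(a) = ∑_{k ≥ 1} (-1)^k H_k(a) μ^{-k}` -/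
def flowSer (H : ℕ+ → A →ₗ[Kq] A) (a : A) : A⟦X⟧ :=
  PowerSeries.mk fun k => if h : 0 < k then (-1) ^ k * H ⟨k, h⟩ a else 0

/-- `H(μ)(s(λ)) = ∑_{k ≥ 1} (-1)^k H_k(s(λ)) μ^{-k}` -/
def flowSerLam (H : ℕ+ → A →ₗ[Kq] A) (s : A⟦X⟧) : A⟦X⟧⟦X⟧ :=
  PowerSeries.mk fun k => if h : 0 < k then (-1) ^ k * applySer (H ⟨k, h⟩) s else 0

/-- The formulas for `H(μ)(u(λ))` and `H(μ)(m(λ))`, where `U = u(·)`, `M = m(·)`,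
`v(μ) = -(u(μ) + μ m(μ)⁻¹)⁻¹` and `w(μ) = -(m(μ) + μ u(μ)⁻¹)⁻¹`. Division by the central non-zero
divisor `λ⁻¹ - μ⁻¹` is written as multiplication on the other side. -/
structure FlowFormulas (U M : A⟦X⟧) (H : ℕ+ → A →ₗ[Kq] A) : Prop where
  on_u : (xLam A - xMu A) * flowSerLam H U =
    (xLam A * inLam U - xMu A * inMu U) * inMu (negInvAdd U M) * inLam U
      - xMu A * (inLam U - inMu U) * (1 + inMu (negInvAdd U M) * inMu U)
  on_m : (xLam A - xMu A) * flowSerLam H M =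
    xMu A * (1 + inMu M * inMu (negInvAdd M U)) * (inLam M - inMu M)
      - inLam M * inMu (negInvAdd M U) * (xLam A * inLam M - xMu A * inMu M)

/-- The quantum Serre expression. -/
def serre (a b : A) : A :=
  a ^ 3 * b - (qp 1 + 1 + qp (-1)) • (a ^ 2 * b * a - a * b * a ^ 2) - b * a ^ 3

end Series

/-! ## The algebra `ℂ[H₋\B₋]_q` -/

/-- Generators: `u i`, `m i` stand for `u_{i+1}`, `m_{i+1}`. -/
inductive GenB : Type
  | u (i : ℕ)
  | m (i : ℕ)

namespace GenB

/-- `u(·)` in the free algebra. -/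
def U : (FreeAlgebra Kq GenB)⟦X⟧ := genSer fun i => FreeAlgebra.ι Kq (u i)

/-- `m(·)` in the free algebra. -/
def M : (FreeAlgebra Kq GenB)⟦X⟧ := genSer fun i => FreeAlgebra.ι Kq (m i)

end GenB

/-- The defining relations, coefficient by coefficient. -/
inductive RelB : FreeAlgebra Kq GenB → FreeAlgebra Kq GenB → Prop
  | uu (i j : ℕ) :
      RelB (coeffLM i j (quadLeft GenB.U)) (qp 1 • coeffLM i j (quadRight GenB.U))
  | mm (i j : ℕ) :
      RelB (coeffLM i j (quadLeft GenB.M)) (qp (-1) • coeffLM i j (quadRight GenB.M))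
  | um (i j : ℕ) :
      RelB (coeffLM i j (inLam GenB.U * inMu GenB.M))
        (qp (-1) • coeffLM i j (inMu GenB.M * inLam GenB.U))

/-- The algebra `ℂ[H₋\B₋]_q`. -/
def QB : Type := RingQuot RelB

instance : Ring QB := inferInstanceAs (Ring (RingQuot RelB))

instance : Algebra Kq QB := inferInstanceAs (Algebra Kq (RingQuot RelB))

namespace QB

/-- The projection from the free algebra. -/
def proj : FreeAlgebra Kq GenB →ₐ[Kq] QB := RingQuot.mkAlgHom Kq RelB

/-- `u i` is the generator `u_{i+1}`. -/
def u (i : ℕ) : QB := proj (FreeAlgebra.ι Kq (GenB.u i))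

/-- `m i` is the generator `m_{i+1}`. -/
def m (i : ℕ) : QB := proj (FreeAlgebra.ι Kq (GenB.m i))

end QB

/-! ## The algebra `ℂ[H₋\B₋N₊]_q` -/

/-- Generators: `u i`, `m i` stand for `u_{i+1}`, `m_{i+1}`, and `S 1`, `S (-1)` for the half
screening charges `Σ̄₊`, `Σ̄₋`. -/
inductive GenBN : Type
  | u (i : ℕ)
  | m (i : ℕ)
  | S (ε : ℤˣ)

namespace GenBN

/-- `u(·)` in the free algebra. -/
def U : (FreeAlgebra Kq GenBN)⟦X⟧ := genSer fun i => FreeAlgebra.ι Kq (u i)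

/-- `m(·)` in the free algebra. -/
def M : (FreeAlgebra Kq GenBN)⟦X⟧ := genSer fun i => FreeAlgebra.ι Kq (m i)

/-- `Σ̄₊`, `Σ̄₋` in the free algebra. -/
def Sg (ε : ℤˣ) : FreeAlgebra Kq GenBN := FreeAlgebra.ι Kq (S ε)

end GenBN

open GenBN in
/-- The defining relations, coefficient by coefficient. -/
inductive RelBN : FreeAlgebra Kq GenBN → FreeAlgebra Kq GenBN → Prop
  | uu (i j : ℕ) : RelBN (coeffLM i j (quadLeft U)) (qp 1 • coeffLM i j (quadRight U))
  | mm (i j : ℕ) : RelBN (coeffLM i j (quadLeft M)) (qp (-1) • coeffLM i j (quadRight M))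
  | um (i j : ℕ) :
      RelBN (coeffLM i j (inLam U * inMu M)) (qp (-1) • coeffLM i j (inMu M * inLam U))
  | uS (ε : ℤˣ) (i : ℕ) :
      RelBN (PowerSeries.coeff i (U * PowerSeries.C (Sg ε)))
        (qp ε • PowerSeries.coeff i (PowerSeries.C (Sg ε) * U))
  | mSp (i : ℕ) :
      RelBN (PowerSeries.coeff i
          (M * PowerSeries.C (Sg 1) - qp (-1) • (PowerSeries.C (Sg 1) * M)))
        (PowerSeries.coeff i ((1 - qp (-1)) • (1 : (FreeAlgebra Kq GenBN)⟦X⟧)))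
  | mSm (i : ℕ) :
      RelBN (PowerSeries.coeff i
          (M * PowerSeries.C (Sg (-1)) - qp 1 • (PowerSeries.C (Sg (-1)) * M)))
        (PowerSeries.coeff i (-(qp 1 - 1) • (PowerSeries.X * M ^ 2)))
  | SS (ε : ℤˣ) : RelBN (serre (Sg ε) (Sg (-ε))) 0

/-- The algebra `ℂ[H₋\B₋N₊]_q`. -/
def QBN : Type := RingQuot RelBN

instance : Ring QBN := inferInstanceAs (Ring (RingQuot RelBN))

instance : Algebra Kq QBN := inferInstanceAs (Algebra Kq (RingQuot RelBN))

namespace QBN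

/-- The projection from the free algebra. -/
def proj : FreeAlgebra Kq GenBN →ₐ[Kq] QBN := RingQuot.mkAlgHom Kq RelBN

/-- `u i` is the generator `u_{i+1}`. -/
def u (i : ℕ) : QBN := proj (FreeAlgebra.ι Kq (GenBN.u i))

/-- `m i` is the generator `m_{i+1}`. -/
def m (i : ℕ) : QBN := proj (FreeAlgebra.ι Kq (GenBN.m i))

/-- `S 1 = Σ̄₊` and `S (-1) = Σ̄₋`. -/
def S (ε : ℤˣ) : QBN := proj (FreeAlgebra.ι Kq (GenBN.S ε))

end QBN

/-! ## The quantum flows -/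

/-- A family of derivations of `ℂ[H₋\B₋]_q` given by the formulas for `H(μ)`. -/
structure IsFlowB (H : ℕ+ → QB →ₗ[Kq] QB) : Prop where
  deriv : ∀ n, IsDeriv (H n)
  formulas : FlowFormulas (genSer QB.u) (genSer QB.m) H

/-- A family of derivations of `ℂ[H₋\B₋N₊]_q` given by the formulas for `H(μ)`. -/
structure IsFlowBN (H : ℕ+ → QBN →ₗ[Kq] QBN) : Prop where
  deriv : ∀ n, IsDeriv (H n)
  formulas : FlowFormulas (genSer QBN.u) (genSer QBN.m) H
  on_Sp : flowSer H (QBN.S 1) =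
    -(PowerSeries.X * (genSer QBN.u +
        genSer QBN.u * negInvAdd (genSer QBN.u) (genSer QBN.m) * genSer QBN.u))
  on_Sm : flowSer H (QBN.S (-1)) = negInvAdd (genSer QBN.u) (genSer QBN.m)

/-! ## The quantum group `U_q(b̂₋)` and its action -/

/-- Generators `k_ε`, `k_ε⁻¹`, `f_ε`. -/
inductive GenUq : Type
  | k (ε : ℤˣ)
  | kinv (ε : ℤˣ)
  | f (ε : ℤˣ)

open FreeAlgebra GenUq in
/-- The defining relations of `U_q(b̂₋)`. -/
inductive RelUq : FreeAlgebra Kq GenUq → FreeAlgebra Kq GenUq → Prop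
  | k_kinv (ε : ℤˣ) : RelUq (ι Kq (k ε) * ι Kq (kinv ε)) 1
  | kinv_k (ε : ℤˣ) : RelUq (ι Kq (kinv ε) * ι Kq (k ε)) 1
  | kk (ε ε₂ : ℤˣ) : RelUq (ι Kq (k ε) * ι Kq (k ε₂)) (ι Kq (k ε₂) * ι Kq (k ε))
  | kf (ε ε₂ : ℤˣ) :
      RelUq (ι Kq (k ε) * ι Kq (f ε₂) * ι Kq (kinv ε)) (qp ((ε * ε₂ : ℤˣ) : ℤ) • ι Kq (f ε₂))
  | ff (ε : ℤˣ) : RelUq (serre (ι Kq (f ε)) (ι Kq (f (-ε)))) 0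

/-- The algebra `U_q(b̂₋)`. -/
def Uq : Type := RingQuot RelUq

instance : Ring Uq := inferInstanceAs (Ring (RingQuot RelUq))

instance : Algebra Kq Uq := inferInstanceAs (Algebra Kq (RingQuot RelUq))

namespace Uq

/-- The projection from the free algebra. -/
def proj : FreeAlgebra Kq GenUq →ₐ[Kq] Uq := RingQuot.mkAlgHom Kq RelUq

/-- The generator `k_ε`. -/
def k (ε : ℤˣ) : Uq := proj (FreeAlgebra.ι Kq (GenUq.k ε))

/-- The generator `f_ε`. -/
def f (ε : ℤˣ) : Uq := proj (FreeAlgebra.ι Kq (GenUq.f ε))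

end Uq

/-- The action of `U_q(b̂₋)` on `ℂ[H₋\B₋N₊]_q`: the module-algebra structure for the
comultiplication `Δ(k_ε) = k_ε ⊗ k_ε`, `Δ(f_ε) = f_ε ⊗ 1 + k_ε ⊗ f_ε` with the given values on
generators. In `f_S`, the bracket `[Σ̄_ε, Σ̄_δ]_q` is `Σ̄_ε Σ̄_δ - q^{εδ} Σ̄_δ Σ̄_ε`. -/
structure IsUqAction (act : Uq →ₐ[Kq] Module.End Kq QBN) : Prop where
  k_mul : ∀ (ε : ℤˣ) (a b : QBN), act (Uq.k ε) (a * b) = act (Uq.k ε) a * act (Uq.k ε) b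
  f_mul : ∀ (ε : ℤˣ) (a b : QBN),
    act (Uq.f ε) (a * b) = act (Uq.f ε) a * b + act (Uq.k ε) a * act (Uq.f ε) b
  k_one : ∀ ε : ℤˣ, act (Uq.k ε) 1 = 1
  f_one : ∀ ε : ℤˣ, act (Uq.f ε) 1 = 0
  k_u : ∀ (ε : ℤˣ) (i : ℕ), act (Uq.k ε) (QBN.u i) = qp ε • QBN.u i
  k_m : ∀ (ε : ℤˣ) (i : ℕ), act (Uq.k ε) (QBN.m i) = qp (-ε) • QBN.m i
  k_S : ∀ ε δ : ℤˣ, act (Uq.k ε) (QBN.S δ) = qp ((ε * δ : ℤˣ) : ℤ) • QBN.S δ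
  fp_u : applySer (act (Uq.f 1)) (genSer QBN.u) =
    -(qp 1 - 1) • (PowerSeries.X * genSer QBN.u ^ 2)
      - (qp 1 - qp (-1)) • (genSer QBN.u * PowerSeries.C (QBN.S 1))
  fm_u : applySer (act (Uq.f (-1))) (genSer QBN.u) =
    (1 - qp (-1)) • 1 + (qp 1 - qp (-1)) • (genSer QBN.u * PowerSeries.C (QBN.S (-1)))
  fp_m : applySer (act (Uq.f 1)) (genSer QBN.m) =
    (1 - qp 1) • 1 + (qp 1 - qp (-1)) • (genSer QBN.m * PowerSeries.C (QBN.S 1))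
  fm_m : applySer (act (Uq.f (-1))) (genSer QBN.m) =
    (1 - qp (-1)) • (PowerSeries.X * genSer QBN.m ^ 2)
      - (qp 1 - qp (-1)) • (genSer QBN.m * PowerSeries.C (QBN.S (-1)))
  f_S : ∀ ε δ : ℤˣ, act (Uq.f ε) (QBN.S δ) =
    QBN.S ε * QBN.S δ - qp ((ε * δ : ℤˣ) : ℤ) • (QBN.S δ * QBN.S ε)

/-! ## The classical homogeneous spaces

All groups are taken with points in a commutative ring `R`, which will be `ℂ` or the ring
`ℂ[ε]` of dual numbers. The power series variable is `λ⁻¹`, the polynomial variable is `λ`, and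
`LaurentSeries R` is `R((λ⁻¹))`. -/

open Matrix

section Groups

variable (R : Type) [CommRing R]

/-- Lower triangular matrices in `SL₂(R)`. -/
def lowerTri : Subgroup (SpecialLinearGroup (Fin 2) R) where
  carrier := {g | g 0 1 = 0}
  one_mem' := by simp
  mul_mem' := by
    intro a b ha hb
    simp only [Set.mem_ofPred_eq] at ha hb ⊢
    simp [Matrix.mul_apply, Fin.sum_univ_two, ha, hb]
  inv_mem' := by
    intro a ha
    simp only [Set.mem_ofPred_eq] at ha ⊢
    simp [Matrix.adjugate_fin_two, ha]

/-- Upper triangular matrices in `SL₂(R)` with unit diagonal. -/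
def upperUnip : Subgroup (SpecialLinearGroup (Fin 2) R) where
  carrier := {g | g 0 0 = 1 ∧ g 1 0 = 0 ∧ g 1 1 = 1}
  one_mem' := by simp
  mul_mem' := by
    rintro a b ⟨h1, h2, h3⟩ ⟨h4, h5, h6⟩
    simp [Matrix.mul_apply, Fin.sum_univ_two, h1, h2, h3, h4, h5, h6]
  inv_mem' := by
    rintro a ⟨h1, h2, h3⟩
    simp [Matrix.adjugate_fin_two, h1, h2, h3]

/-- `B₋`: the matrices in `SL₂(R[[λ⁻¹]])` whose value at `λ⁻¹ = 0` is lower triangular. -/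
def Bminus : Subgroup (SpecialLinearGroup (Fin 2) R⟦X⟧) :=
  (lowerTri R).comap (SpecialLinearGroup.map (PowerSeries.constantCoeff (R := R)))

/-- `N₊`: the matrices in `SL₂(R[λ])` whose value at `λ = 0` is upper unipotent. -/
def Nplus : Subgroup (SpecialLinearGroup (Fin 2) R[X]) :=
  (upperUnip R).comap (SpecialLinearGroup.map (Polynomial.constantCoeff (R := R)))

/-- `H₋`: the diagonal matrices in `SL₂(R[[λ⁻¹]])`. -/
def Hminus : Subgroup (SpecialLinearGroup (Fin 2) R⟦X⟧) where
  carrier := {g | g 0 1 = 0 ∧ g 1 0 = 0}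
  one_mem' := by simp
  mul_mem' := by
    rintro a b ⟨h1, h2⟩ ⟨h3, h4⟩
    simp [Matrix.mul_apply, Fin.sum_univ_two, h1, h2, h3, h4]
  inv_mem' := by
    rintro a ⟨h1, h2⟩
    simp [Matrix.adjugate_fin_two, h1, h2]

/-- The inclusion `R[λ] → R((λ⁻¹))`. -/
def polyToLaurent : R[X] →+* LaurentSeries R :=
  Polynomial.eval₂RingHom (HahnSeries.C : R →+* LaurentSeries R) (HahnSeries.single (-1) 1)

/-- The inclusion `SL₂(R[[λ⁻¹]]) → G(R) = SL₂(R((λ⁻¹)))`. -/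
def loopB : SpecialLinearGroup (Fin 2) R⟦X⟧ →* SpecialLinearGroup (Fin 2) (LaurentSeries R) :=
  SpecialLinearGroup.map (HahnSeries.ofPowerSeries ℤ R)

/-- The inclusion `SL₂(R[λ]) → G(R) = SL₂(R((λ⁻¹)))`. -/
def loopN : SpecialLinearGroup (Fin 2) R[X] →* SpecialLinearGroup (Fin 2) (LaurentSeries R) :=
  SpecialLinearGroup.map (polyToLaurent R)

variable {R}

/-- The coordinate series `u` of a matrix `g` in `B₋`. Modulo `H₋` on the left, `g` is
`(1, v; 0, 1) (1, 0; u, 1)`. For `g = (a, b; c, d)` this means `u = c / d` and `v = b d`. -/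
def uCl (g : SpecialLinearGroup (Fin 2) R⟦X⟧) : R⟦X⟧ := g 1 0 * Ring.inverse (g 1 1)

/-- The coordinate series `v` of a matrix in `B₋`; its constant term is `0`. -/
def vCl (g : SpecialLinearGroup (Fin 2) R⟦X⟧) : R⟦X⟧ := g 0 1 * g 1 1

/-- The coordinate series `m = - λ v (1 + u v)⁻¹` of a matrix in `B₋`. -/
def mCl (g : SpecialLinearGroup (Fin 2) R⟦X⟧) : R⟦X⟧ :=
  PowerSeries.mk fun i =>
    -PowerSeries.coeff (i + 1) (vCl g * Ring.inverse (1 + uCl g * vCl g))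

/-- The coordinate function `u_{i+1}`, where `u = ∑ (-1)^i u_{i+1} λ^{-i}`. -/
def uCoord (g : SpecialLinearGroup (Fin 2) R⟦X⟧) (i : ℕ) : R :=
  (-1) ^ i * PowerSeries.coeff i (uCl g)

/-- The coordinate function `m_{i+1}`, where `m = ∑ (-1)^i m_{i+1} λ^{-i}`. -/
def mCoord (g : SpecialLinearGroup (Fin 2) R⟦X⟧) (i : ℕ) : R :=
  (-1) ^ i * PowerSeries.coeff i (mCl g)

/-- The coordinates do not change under left multiplication by `H₋`. -/
theorem uCl_vCl_of_mem {h : SpecialLinearGroup (Fin 2) R⟦X⟧} (hh : h ∈ Hminus R)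
    (g : SpecialLinearGroup (Fin 2) R⟦X⟧) : uCl (h * g) = uCl g ∧ vCl (h * g) = vCl g := by
  obtain ⟨h1, h2⟩ := hh
  have e : ∀ i j, (h * g) i j = h i 0 * g 0 j + h i 1 * g 1 j := by
    intro i j
    change (h.1 * g.1) i j = _
    rw [Matrix.mul_apply, Fin.sum_univ_two]
  have hd : h 0 0 * h 1 1 = 1 := by
    have hdet := h.det_coe
    rw [Matrix.det_fin_two] at hdet
    simpa [h1, h2] using hdet
  have hu : h 1 1 * Ring.inverse (h 1 1) = 1 :=
    Ring.mul_inverse_cancel _ (IsUnit.of_mul_eq_one_right _ hd)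
  constructor
  · rw [uCl, uCl, e, e, h2, zero_mul, zero_mul, zero_add, zero_add, Ring.mul_inverse_rev]
    linear_combination (g 1 0 * Ring.inverse (g 1 1)) * hu
  · rw [vCl, vCl, e, e, h1, h2]
    linear_combination (g 0 1 * g 1 1) * hd

end Groups

/-- The homogeneous space `H₋\B₋` (complex points). -/
abbrev HB : Type := Quotient (QuotientGroup.rightRel ((Hminus ℂ).subgroupOf (Bminus ℂ)))

/-- The class in `H₋\B₋` of an element of `B₋`. -/
def HB.mk (b : Bminus ℂ) : HB := Quotient.mk _ b

theorem coord_invariant (a b : Bminus ℂ)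
    (h : QuotientGroup.rightRel ((Hminus ℂ).subgroupOf (Bminus ℂ)) a b) :
    uCl b.1 = uCl a.1 ∧ mCl b.1 = mCl a.1 := by
  rw [QuotientGroup.rightRel_apply, Subgroup.mem_subgroupOf] at h
  obtain ⟨h1, h2⟩ := uCl_vCl_of_mem h a.1
  have e : ((b * a⁻¹ : Bminus ℂ) : SpecialLinearGroup (Fin 2) ℂ⟦X⟧) * a.1 = b.1 := by
    simp
  rw [e] at h1 h2
  exact ⟨h1, by simp only [mCl, h1, h2]⟩

/-- The coordinate function `u_{i+1}` on `H₋\B₋`. -/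
def uFun (i : ℕ) : HB → ℂ :=
  Quotient.lift (fun b : Bminus ℂ => uCoord b.1 i) fun a b h => by
    simp only [uCoord, (coord_invariant a b h).1]

/-- The coordinate function `m_{i+1}` on `H₋\B₋`. -/
def mFun (i : ℕ) : HB → ℂ :=
  Quotient.lift (fun b : Bminus ℂ => mCoord b.1 i) fun a b h => by
    simp only [mCoord, (coord_invariant a b h).2]

/-- The function algebra `ℂ[H₋\B₋]`. -/
def OB : Subalgebra ℂ (HB → ℂ) := Algebra.adjoin ℂ (Set.range uFun ∪ Set.range mFun)

/-- `u_{i+1}` as an element of `ℂ[H₋\B₋]`. -/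
def OB.u (i : ℕ) : OB := ⟨uFun i, Algebra.subset_adjoin (Or.inl ⟨i, rfl⟩)⟩

/-- `m_{i+1}` as an element of `ℂ[H₋\B₋]`. -/
def OB.m (i : ℕ) : OB := ⟨mFun i, Algebra.subset_adjoin (Or.inr ⟨i, rfl⟩)⟩

/-- The space `H₋\B₋N₊` (complex points): the pair of the class of `b` and of `n` stands for the
class of `b n`. The product map `B₋ × N₊ → B₋N₊` is bijective because `B₋ ∩ N₊ = {1}`. -/
abbrev HBN : Type := HB × Nplus ℂ

/-- The coordinate function `u_{i+1}` on `H₋\B₋N₊`. -/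
def uFunN (i : ℕ) (p : HBN) : ℂ := uFun i p.1

/-- The coordinate function `m_{i+1}` on `H₋\B₋N₊`. -/
def mFunN (i : ℕ) (p : HBN) : ℂ := mFun i p.1

/-- The coefficient `a_{s,t}^{(r)}` of `λ^r` in an entry of the `N₊`-component. -/
def aFunN (c : Fin 2 × Fin 2 × ℕ) (p : HBN) : ℂ := (p.2.1 c.1 c.2.1).coeff c.2.2

/-- The function algebra `ℂ[H₋\B₋N₊]`. -/
def OBN : Subalgebra ℂ (HBN → ℂ) :=
  Algebra.adjoin ℂ (Set.range uFunN ∪ Set.range mFunN ∪ Set.range aFunN)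

/-- `u_{i+1}` as an element of `ℂ[H₋\B₋N₊]`. -/
def OBN.u (i : ℕ) : OBN := ⟨uFunN i, Algebra.subset_adjoin (Or.inl (Or.inl ⟨i, rfl⟩))⟩

/-- `m_{i+1}` as an element of `ℂ[H₋\B₋N₊]`. -/
def OBN.m (i : ℕ) : OBN := ⟨mFunN i, Algebra.subset_adjoin (Or.inl (Or.inr ⟨i, rfl⟩))⟩

/-- `a_{s,t}^{(r)}` as an element of `ℂ[H₋\B₋N₊]`. -/
def OBN.a (s t : Fin 2) (r : ℕ) : OBN :=
  ⟨aFunN (s, t, r), Algebra.subset_adjoin (Or.inr ⟨(s, t, r), rfl⟩)⟩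

/-! ## The classical action of the abelian Lie algebra `h₊ = {diag(a, -a) : a ∈ λ ℂ[λ]}` -/

/-- `h₊`, identified with `λ ℂ[λ]` through `a ↦ diag(a, -a)`. -/
def hPlus : Submodule ℂ ℂ[X] := LinearMap.ker (Polynomial.lcoeff ℂ 0)

/-- The element `h_n = diag(λ^n, -λ^n)` of `h₊`, for `n ≥ 1`. -/
def hGen (n : ℕ+) : hPlus :=
  ⟨Polynomial.X ^ (n : ℕ), by
    simp [hPlus, LinearMap.mem_ker, Polynomial.lcoeff_apply, Polynomial.coeff_X_pow,
      n.pos.ne]⟩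

/-- `ε a(λ)` in `ℂ[ε]((λ⁻¹))`. -/
def epsMul (a : ℂ[X]) : LaurentSeries (DualNumber ℂ) :=
  HahnSeries.C (DualNumber.eps : DualNumber ℂ) *
    polyToLaurent (DualNumber ℂ) (a.map (algebraMap ℂ (DualNumber ℂ)))

theorem epsMul_mul_self (a : ℂ[X]) : epsMul a * epsMul a = 0 := by
  have h : (HahnSeries.C (DualNumber.eps : DualNumber ℂ) : LaurentSeries (DualNumber ℂ)) *
      HahnSeries.C (DualNumber.eps : DualNumber ℂ) = 0 := by
    rw [← map_mul, DualNumber.eps_mul_eps, map_zero]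
  unfold epsMul
  calc _ = (HahnSeries.C (DualNumber.eps : DualNumber ℂ) *
          HahnSeries.C (DualNumber.eps : DualNumber ℂ)) *
        (polyToLaurent (DualNumber ℂ) (a.map (algebraMap ℂ (DualNumber ℂ))) *
          polyToLaurent (DualNumber ℂ) (a.map (algebraMap ℂ (DualNumber ℂ)))) := by ring
    _ = 0 := by rw [h, zero_mul]

/-- The infinitesimal group element `1 + ε diag(a, -a)` of `G(ℂ[ε])`. -/
def infTrans (a : ℂ[X]) : SpecialLinearGroup (Fin 2) (LaurentSeries (DualNumber ℂ)) :=
  ⟨!![1 + epsMul a, 0; 0, 1 - epsMul a], by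
    rw [Matrix.det_fin_two_of]
    linear_combination -epsMul_mul_self a⟩

/-- A complex point seen as a point over the dual numbers. -/
def liftB (b : Bminus ℂ) : SpecialLinearGroup (Fin 2) (LaurentSeries (DualNumber ℂ)) :=
  loopB (DualNumber ℂ)
    (SpecialLinearGroup.map (PowerSeries.map (algebraMap ℂ (DualNumber ℂ))) b.1)

/-- A complex point seen as a point over the dual numbers. -/
def liftN (n : Nplus ℂ) : SpecialLinearGroup (Fin 2) (LaurentSeries (DualNumber ℂ)) :=
  loopN (DualNumber ℂ)
    (SpecialLinearGroup.map (Polynomial.mapRingHom (algebraMap ℂ (DualNumber ℂ))) n.1)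

/-- `z = x + ε y` -/
def IsFirstOrder (z : DualNumber ℂ) (x y : ℂ) : Prop :=
  z = TrivSqZeroExt.inl x + TrivSqZeroExt.inr y

/-- The derivation `D` of `ℂ[H₋\B₋]` is the vector field of the left translation action of
`diag(a, -a)` on `H₋\B₋`, seen as an open part of `H₋\G/N₊`: for every `b` in `B₋` the element
`(1 + ε diag(a, -a)) b` is equal to `η b₁ n₁` with `η`, `b₁`, `n₁` points of `H₋`, `B₋`, `N₊` over
`ℂ[ε]`, and the coordinates of `b₁` are `f(b) + ε (D f)(b)`. -/
def IsVectorFieldB (a : ℂ[X]) (D : Derivation ℂ OB OB) : Prop :=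
  ∀ b : Bminus ℂ, ∃ η ∈ Hminus (DualNumber ℂ), ∃ b₁ ∈ Bminus (DualNumber ℂ),
    ∃ n₁ ∈ Nplus (DualNumber ℂ),
      infTrans a * liftB b =
        loopB (DualNumber ℂ) η * loopB (DualNumber ℂ) b₁ * loopN (DualNumber ℂ) n₁ ∧
      (∀ i, IsFirstOrder (uCoord b₁ i) (uCoord b.1 i) ((D (OB.u i)).1 (HB.mk b))) ∧
      ∀ i, IsFirstOrder (mCoord b₁ i) (mCoord b.1 i) ((D (OB.m i)).1 (HB.mk b))

/-- The derivation `D` of `ℂ[H₋\B₋N₊]` is the vector field of the left translation action of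
`diag(a, -a)` on `H₋\B₋N₊`, an open part of `H₋\G`. -/
def IsVectorFieldBN (a : ℂ[X]) (D : Derivation ℂ OBN OBN) : Prop :=
  ∀ (b : Bminus ℂ) (n : Nplus ℂ), ∃ η ∈ Hminus (DualNumber ℂ), ∃ b₁ ∈ Bminus (DualNumber ℂ),
    ∃ n₁ ∈ Nplus (DualNumber ℂ),
      infTrans a * (liftB b * liftN n) =
        loopB (DualNumber ℂ) η * loopB (DualNumber ℂ) b₁ * loopN (DualNumber ℂ) n₁ ∧
      (∀ i, IsFirstOrder (uCoord b₁ i) (uCoord b.1 i) ((D (OBN.u i)).1 (HB.mk b, n))) ∧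
      (∀ i, IsFirstOrder (mCoord b₁ i) (mCoord b.1 i) ((D (OBN.m i)).1 (HB.mk b, n))) ∧
      ∀ s t r, IsFirstOrder ((n₁ s t).coeff r) ((n.1 s t).coeff r)
        ((D (OBN.a s t r)).1 (HB.mk b, n))

/-! ## Classical limits -/

/-- A ring homomorphism to a commutative `ℂ`-algebra that sends `q` to `1` and is `ℂ`-linear. -/
structure SpecializesAtOne {A F : Type} [Ring A] [Algebra Kq A] [CommRing F] [Algebra ℂ F]
    (σ : A →+* F) : Prop where
  map_q : σ (algebraMap Kq A (qp 1)) = 1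
  map_const : ∀ c : ℂ, σ (algebraMap Kq A (LaurentPolynomial.C c)) = algebraMap ℂ F c

/-- The classical limit `ℂ[H₋\B₋]_q → ℂ[H₋\B₋]`. It identifies `ℂ[H₋\B₋]` with the quotient by
`q - 1`. -/
structure IsLimitB (σ : QB →+* OB) : Prop extends SpecializesAtOne σ where
  map_u : ∀ i, σ (QB.u i) = OB.u i
  map_m : ∀ i, σ (QB.m i) = OB.m i
  surj : Function.Surjective σ
  ker : ∀ x, σ x = 0 ↔ ∃ y, x = (qp 1 - 1) • y

/-- The classical limit `ℂ[H₋\B₋N₊]_q → ℂ[H₋\B₋N₊]`, with `Σ̄₊ ↦ a_{2,1}^{(1)}` and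
`Σ̄₋ ↦ a_{1,2}^{(0)}`. At `q = 1` the half screening charges still generate the noncommutative
algebra `U(n₋)`, so that passing to functions also makes them commute. -/
structure IsLimitBN (σ : QBN →+* OBN) : Prop extends SpecializesAtOne σ where
  map_u : ∀ i, σ (QBN.u i) = OBN.u i
  map_m : ∀ i, σ (QBN.m i) = OBN.m i
  map_Sp : σ (QBN.S 1) = OBN.a 1 0 1
  map_Sm : σ (QBN.S (-1)) = OBN.a 0 1 0
  ker : ∀ x, σ x = 0 ↔ x ∈ TwoSidedIdeal.span
    {algebraMap Kq QBN (qp 1 - 1), QBN.S 1 * QBN.S (-1) - QBN.S (-1) * QBN.S 1}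

end

end QDS

/-!
The flows, the action of the quantum group and the classical limit on the quantized function
algebras of `H₋\B₋` and `H₋\B₋N₊`.

A derivation, or a skew derivation, of an algebra given by generators and relations may be
prescribed on the generators as soon as the relations are respected (`exists_skew_of_rel`). So the
existence of the flow `H(μ)` amounts to identities in `u(λ)`, `m(λ)`, `u(μ)`, `m(μ)` and the
resolvents `G = (1 + μ⁻¹ m(μ) u(μ))⁻¹`, `G' = (1 + μ⁻¹ u(μ) m(μ))⁻¹`. They become accessible in the
variable `p = (λ⁻¹u(λ) - μ⁻¹u(μ)) / (λ⁻¹ - μ⁻¹)`, called a letter: a letter obeys the relation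
`p (p - c) = q (p - c) p` with `c = u(μ)`, up to elementary terms the flow is `p ↦ p v p`, and `v`
`q`-commutes with `p` up to `v p² v`. Relations between `u` and `u` reduce to `quad_two_letters`,
relations between `u` and `m` to the fact that `p G y` and `y G' p` commute (`sandwich`), and
relations with the half screening charges to its degenerate cases. The opposite ring exchanges
`u` and `m`. Uniqueness holds because `λ⁻¹ - μ⁻¹` is not a zero divisor.

For commutativity, `H(μ₁)(v(μ₂))` is symmetric in the two points (`flow_v`); then the flows of
`u(λ)`, which are of Riccati type, commute by an identity in free variables (`flow_comm_u`). On the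
half screening charges, commutativity is the symmetry itself, since their derivatives are `v` and
`w`.

The generator `f_ε` acts by the inner skew derivation of `Σ̄_ε` plus an outer one that only moves
`u` (`QBN.shift`). Left multiplication, twisted right multiplication and the outer part `q`-commute
in such a way that the Serre expression is additive on them (`serre_add`), which gives the action.
Its compatibility with the flows says that the commutator of the outer part with `H(μ)` is the
inner skew derivation of `H(μ)(Σ̄_ε)` (`shiftFlow_eq`), which is checked on generators.

At `q = 1` the quotient by the stated ideal is commutative, and the images of the generators are
algebraically independent functions, because points with arbitrary coordinates exist; this gives
the kernel of the specialization (`eq_zero_of_specialization`). The classical flows are constructed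
as vector fields: on `u`, `m` by the limit formulas, and on `N₊` by the component of
`b⁻¹ diag(λ^n, -λ^n) b / 2` in the Lie algebra of `N₊`. They commute by the same Riccati identity and by a zero curvature
equation. That they are infinitesimal left translations is the Gauss factorization over the dual
numbers: the decomposition of `b⁻¹ a h b` into parts in the Lie algebras of `B₋` and `N₊` yields
`(1 + ε a h) b = b (1 + ε X₋) (1 + ε X₊)` (`infinitesimal_factorization`), and the part `X₋` moves
`u` and `m` exactly by the limit of the flow (`infFactor_X_pow`).
-/

open scoped PowerSeries Polynomial LaurentPolynomial

namespace QDS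

noncomputable section

/-! ### Skew identities at one point of the flow -/

section Resolvent
variable {R A : Type*} [CommRing R] [Ring A] [Algebra R A]

/-- If `v` `q`-commutes with `p` and `p'` up to terms of the form `v w v`, then it `q²`-commutes
with `p p'` up to a term of the same form. -/
theorem smul_leibniz_of_resolvent (q : R) {v p p' w w' : A} (hp : v * p - q • (p * v) = -(v * w * v))
    (hp' : v * p' - q • (p' * v) = -(v * w' * v)) :
    v * (p * p') - q ^ 2 • (p * p' * v) = -(v * (q • (w * p') + p * w') * v) := by
  linear_combination (norm := (simp only [mul_add, add_mul, mul_sub, sub_mul, smul_sub,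
    smul_mul_assoc, mul_smul_comm, mul_assoc, neg_mul, mul_neg, smul_neg]; module))
    hp * p' + q • (p * hp') - v * w * hp' + hp * (w' * v)

/-- The identity through which `p ↦ p v p` respects the quadratic relation of two letters `σ - x₂
τ` and `σ - x₁ τ`, with `e = x₁ + x₂` and `f = x₁ x₂`. Both sides agree after multiplication by
the unit in `hu`. -/
theorem quad_resolvent (q e f : R) {v σ τ : A} (hστ : σ * τ = q • (τ * σ))
    (hσ : v * σ - q • (σ * v) = -(v * ((1 - q) • (σ * σ - f • (τ * τ))) * v))
    (hτ : v * τ - q • (τ * v) = -(v * ((1 - q) • (σ * τ + τ * σ - e • (τ * τ))) * v))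
    (hu : IsUnit (1 + ((1 - q) • ((1 + q) • σ - e • τ)) * v)) :
    (σ * σ - e • (σ * τ) + (f * q) • (τ * τ)) * v * τ =
      τ * v * (q • (σ * σ) - e • (σ * τ) + f • (τ * τ)) := by
  have hστ' : ∀ b, σ * (τ * b) = q • (τ * (σ * b)) := fun b => by
    rw [← mul_assoc, hστ, smul_mul_assoc, mul_assoc]
  have h1 : v * τ * (1 + ((1 - q) • ((1 + q) • σ - e • τ)) * v) = q • (τ * v) := by
    linear_combination (norm := (simp only [mul_add, add_mul, mul_sub, sub_mul, smul_add, smul_sub,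
      smul_mul_assoc, mul_smul_comm, mul_assoc, mul_one, hστ]; module)) hτ
  have h2 : v * (q • (σ * σ) - e • (σ * τ) + f • (τ * τ)) *
      (1 + ((1 - q) • ((1 + q) • σ - e • τ)) * v) =
      q ^ 2 • ((q • (σ * σ) - e • (σ * τ) + f • (τ * τ)) * v) := by
    linear_combination (norm := (simp only [mul_add, add_mul, mul_sub, sub_mul, smul_add, smul_sub,
      smul_mul_assoc, mul_smul_comm, mul_assoc, smul_neg, mul_one, hστ, hστ']; module))
      q • smul_leibniz_of_resolvent q hσ hσ - e • smul_leibniz_of_resolvent q hσ hτ +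
        f • smul_leibniz_of_resolvent q hτ hτ
  refine hu.mul_right_cancel ?_
  rw [mul_assoc _ v τ, mul_assoc _ (v * τ), h1, mul_assoc τ v, mul_assoc τ, h2]
  simp only [mul_add, add_mul, mul_sub, sub_mul, smul_add, smul_sub,
      smul_mul_assoc, mul_smul_comm, mul_assoc, hστ, hστ']
  module

/-- For `p, r, s, y` that `q`-commute pairwise, `p G y` and `y G' p` commute, where `G` and `G'`
are the inverses of `1 + z n c` and `1 + z c n`. The point is that `p`, `y` can be moved past the
factors `1 + z n c` and `1 + z c n` at the price of replacing `c`, `n` by `p - q^i r`, `y - q^j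
s`. -/
theorem sandwich_core (q z : R) {p r y s c n G G' : A}
    (hpr : p * r = q • (r * p)) (hsy : s * y = q • (y * s))
    (hyp : y * p = q • (p * y)) (hyr : y * r = q • (r * y))
    (hsp : s * p = q • (p * s)) (hsr : s * r = q • (r * s))
    (hc : c = p - q ^ 2 • r) (hn : n = y - q • s)
    (hG : (1 + z • (n * c)) * G = 1) (hG2 : G * (1 + z • (n * c)) = 1)
    (hG' : (1 + z • (c * n)) * G' = 1) (hG2' : G' * (1 + z • (c * n)) = 1)
    (hz : ∀ b : A, IsUnit (1 + z • b)) :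
    p * G * y * (y * G' * p) = y * G' * p * (p * G * y) := by
  have hpr' : ∀ b, p * (r * b) = q • (r * (p * b)) := fun b => by
    rw [← mul_assoc, hpr, smul_mul_assoc, mul_assoc]
  have hsy' : ∀ b, s * (y * b) = q • (y * (s * b)) := fun b => by
    rw [← mul_assoc, hsy, smul_mul_assoc, mul_assoc]
  have hyp' : ∀ b, y * (p * b) = q • (p * (y * b)) := fun b => by
    rw [← mul_assoc, hyp, smul_mul_assoc, mul_assoc]
  have hyr' : ∀ b, y * (r * b) = q • (r * (y * b)) := fun b => by
    rw [← mul_assoc, hyr, smul_mul_assoc, mul_assoc]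
  have hsp' : ∀ b, s * (p * b) = q • (p * (s * b)) := fun b => by
    rw [← mul_assoc, hsp, smul_mul_assoc, mul_assoc]
  have hsr' : ∀ b, s * (r * b) = q • (r * (s * b)) := fun b => by
    rw [← mul_assoc, hsr, smul_mul_assoc, mul_assoc]
  set J₁ : A := 1 + z • (q • ((p - q • r) * n)) with hJ₁
  set J₂ : A := 1 + z • ((p - q ^ 3 • r) * n) with hJ₂
  set J₃ : A := 1 + z • (q • (c * (y - s))) with hJ₃
  set J₄ : A := 1 + z • (c * (y - q ^ 2 • s)) with hJ₄
  set K₂ : A := 1 + z • ((p - q • r) * (y - q ^ 3 • s)) with hK₂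
  set K₃ : A := 1 + z • (q • ((p - r) * (y - q ^ 2 • s))) with hK₃
  have e1 : (1 + z • (c * n)) * p = p * J₁ := by
    simp only [hJ₁, hc, hn, mul_add, add_mul, mul_sub, sub_mul, smul_sub, smul_mul_assoc,
      mul_smul_comm, mul_assoc, one_mul, mul_one, hyp, hsp, hpr']
    module
  have e2 : p * (1 + z • (n * c)) = J₂ * p := by
    simp only [hJ₂, hc, hn, mul_add, add_mul, mul_sub, sub_mul, smul_sub, smul_mul_assoc,
      mul_smul_comm, mul_assoc, one_mul, mul_one, hyp, hyr, hsp, hsr, hpr']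
    module
  have e3 : y * (1 + z • (c * n)) = J₃ * y := by
    simp only [hJ₃, hc, hn, mul_add, add_mul, mul_sub, sub_mul, smul_sub, smul_mul_assoc,
      mul_smul_comm, mul_assoc, one_mul, mul_one, hsy, hyp',
      hyr']
    module
  have e4 : (1 + z • (n * c)) * y = y * J₄ := by
    simp only [hJ₄, hc, hn, mul_add, add_mul, mul_sub, sub_mul, smul_sub, smul_mul_assoc,
      mul_smul_comm, mul_assoc, one_mul, mul_one, hsy, hyp, hyr, hsp, hsr, hyp',
      hyr']
    module
  have e5 : J₂ * (y * p * p * y) = (y * p * p * y) * K₂ := by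
    simp only [hJ₂, hK₂, hn, mul_add, add_mul, mul_sub, sub_mul, smul_add, smul_sub,
      smul_mul_assoc,
      mul_smul_comm, mul_assoc, one_mul, mul_one, hsy, hyp, hpr', hsy', hyp',
      hyr', hsp']
    module
  have e6 : J₃ * (y * p * p * y) = (y * p * p * y) * K₃ := by
    simp only [hJ₃, hK₃, hc, mul_add, add_mul, mul_sub, sub_mul, smul_add, smul_sub,
      smul_mul_assoc,
      mul_smul_comm, mul_assoc, one_mul, mul_one, hsy, hyp, hpr', hsy', hyp',
      hyr', hsp']
    module
  have e7 : J₄ * K₃ = J₁ * K₂ := by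
    simp only [hJ₁, hJ₄, hK₂, hK₃, hc, hn, mul_add, add_mul, mul_sub, sub_mul, smul_add, smul_sub,
      smul_mul_assoc,
      mul_smul_comm, mul_assoc, one_mul, mul_one, hsy, hpr', hyp',
      hyr', hsp', hsr']
    module
  have e8 : p * y * y * p = y * p * p * y := by
    simp only [smul_mul_assoc, mul_smul_comm, mul_assoc, hyp, hyp']
  have f1 : G' * p * J₁ = p := by rw [mul_assoc, ← e1, ← mul_assoc, hG2', one_mul]
  have f2 : J₂ * (p * G) = p := by rw [← mul_assoc, ← e2, mul_assoc, hG, mul_one]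
  have f3 : J₃ * (y * G') = y := by rw [← mul_assoc, ← e3, mul_assoc, hG', mul_one]
  have f4 : G * y * J₄ = y := by rw [mul_assoc, ← e4, ← mul_assoc, hG2, one_mul]
  have u1 : IsUnit J₁ := hz _
  have u2 : IsUnit J₂ := hz _
  have u3 : IsUnit J₃ := hz _
  have u4 : IsUnit J₄ := hz _
  have k2 : IsUnit K₂ := hz _
  have k3 : IsUnit K₃ := hz _
  -- both sides become equal after multiplication by units
  have hX : J₂ * (p * G * y * (y * G' * p)) * J₁ = y * p * p * y := by
    calc _ = (J₂ * (p * G)) * y * y * (G' * p * J₁) := by simp only [mul_assoc]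
      _ = _ := by rw [f2, f1, e8]
  have hY : J₃ * (y * G' * p * (p * G * y)) * J₄ = y * p * p * y := by
    calc _ = (J₃ * (y * G')) * p * p * (G * y * J₄) := by simp only [mul_assoc]
      _ = _ := by rw [f3, f4]
  obtain ⟨j1, hj1⟩ := u1
  obtain ⟨j2, hj2⟩ := u2
  obtain ⟨j3, hj3⟩ := u3
  obtain ⟨j4, hj4⟩ := u4
  obtain ⟨i2, hi2⟩ := k2
  obtain ⟨i3, hi3⟩ := k3
  rw [← hj2, ← hj1] at hX
  rw [← hj3, ← hj4] at hY
  rw [← hj2, ← hi2] at e5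
  rw [← hj3, ← hi3] at e6
  rw [← hj4, ← hi3, ← hj1, ← hi2, ← Units.val_mul, ← Units.val_mul, Units.val_inj] at e7
  have hX' : p * G * y * (y * G' * p) = ↑(j2⁻¹) * (y * p * p * y) * ↑(j1⁻¹) := by
    rw [← hX]; simp [mul_assoc]
  have hY' : y * G' * p * (p * G * y) = ↑(j3⁻¹) * (y * p * p * y) * ↑(j4⁻¹) := by
    rw [← hY]; simp [mul_assoc]
  have g5 : ↑(j2⁻¹) * (y * p * p * y) = (y * p * p * y) * ↑(i2⁻¹) := by
    rw [Units.inv_mul_eq_iff_eq_mul, ← mul_assoc, e5, Units.mul_inv_cancel_right]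
  have g6 : ↑(j3⁻¹) * (y * p * p * y) = (y * p * p * y) * ↑(i3⁻¹) := by
    rw [Units.inv_mul_eq_iff_eq_mul, ← mul_assoc, e6, Units.mul_inv_cancel_right]
  rw [hX', hY', g5, g6, mul_assoc _ _ (↑(j1⁻¹) : A), mul_assoc _ _ (↑(j4⁻¹) : A), ← Units.val_mul,
    ← Units.val_mul, ← mul_inv_rev, ← mul_inv_rev, e7]

/-- The case `y = 1` of `sandwich_core`, in which `n` itself `q`-commutes with `p` and `r`. -/
theorem sandwich_one_core (q z : R) {p r c n G G' : A}
    (hpr : p * r = q • (r * p)) (hnp : n * p = q • (p * n)) (hnr : n * r = q • (r * n))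
    (hc : c = p - q ^ 2 • r)
    (hG : (1 + z • (n * c)) * G = 1) (hG2 : G * (1 + z • (n * c)) = 1)
    (hG' : (1 + z • (c * n)) * G' = 1) (hG2' : G' * (1 + z • (c * n)) = 1)
    (hz : ∀ b : A, IsUnit (1 + z • b)) :
    p * G * (G' * p) = G' * p * (p * G) := by
  have hpr' : ∀ b, p * (r * b) = q • (r * (p * b)) := fun b => by
    rw [← mul_assoc, hpr, smul_mul_assoc, mul_assoc]
  have hnp' : ∀ b, n * (p * b) = q • (p * (n * b)) := fun b => by
    rw [← mul_assoc, hnp, smul_mul_assoc, mul_assoc]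
  have hnr' : ∀ b, n * (r * b) = q • (r * (n * b)) := fun b => by
    rw [← mul_assoc, hnr, smul_mul_assoc, mul_assoc]
  set J₁ : A := 1 + z • (q • ((p - q • r) * n)) with hJ₁
  set J₂ : A := 1 + z • ((p - q ^ 3 • r) * n) with hJ₂
  set K₂ : A := 1 + z • (q ^ 2 • ((p - q • r) * n)) with hK₂
  set K₃ : A := 1 + z • (q ^ 2 • ((p - r) * n)) with hK₃
  have e1 : (1 + z • (c * n)) * p = p * J₁ := by
    simp only [hJ₁, hc, mul_add, add_mul, mul_sub, sub_mul, smul_sub, smul_mul_assoc,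
      mul_smul_comm, mul_assoc, one_mul, mul_one, hnp, hpr']
    module
  have e2 : p * (1 + z • (n * c)) = J₂ * p := by
    simp only [hJ₂, hc, mul_add, add_mul, mul_sub, sub_mul, smul_sub, smul_mul_assoc,
      mul_smul_comm, mul_assoc, one_mul, mul_one, hnp, hnr, hpr']
    module
  have e5 : J₂ * (p * p) = (p * p) * K₂ := by
    simp only [hJ₂, hK₂, mul_add, add_mul, mul_sub, sub_mul, smul_sub,
      smul_mul_assoc, mul_smul_comm, mul_assoc, one_mul, mul_one, hnp, hpr', hnp']
    module
  have e6 : (1 + z • (c * n)) * (p * p) = (p * p) * K₃ := by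
    simp only [hK₃, hc, mul_add, add_mul, mul_sub, sub_mul, smul_sub,
      smul_mul_assoc, mul_smul_comm, mul_assoc, one_mul, mul_one, hnp, hpr', hnp']
    module
  have e7 : (1 + z • (n * c)) * K₃ = J₁ * K₂ := by
    simp only [hJ₁, hK₂, hK₃, hc, mul_add, add_mul, mul_sub, sub_mul, smul_add, smul_sub,
      smul_mul_assoc, mul_smul_comm, mul_assoc, one_mul, mul_one, hnp, hnr, hpr', hnp', hnr']
    module
  have f1 : G' * p * J₁ = p := by rw [mul_assoc, ← e1, ← mul_assoc, hG2', one_mul]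
  have f2 : J₂ * (p * G) = p := by rw [← mul_assoc, ← e2, mul_assoc, hG, mul_one]
  have u1 : IsUnit J₁ := hz _
  have u2 : IsUnit J₂ := hz _
  have u3 : IsUnit (1 + z • (c * n)) := hz _
  have u4 : IsUnit (1 + z • (n * c)) := hz _
  have k2 : IsUnit K₂ := hz _
  have k3 : IsUnit K₃ := hz _
  -- both sides become equal after multiplication by units
  have hX : J₂ * (p * G * (G' * p)) * J₁ = p * p := by
    calc _ = (J₂ * (p * G)) * (G' * p * J₁) := by simp only [mul_assoc]
      _ = _ := by rw [f2, f1]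
  have hY : (1 + z • (c * n)) * (G' * p * (p * G)) * (1 + z • (n * c)) = p * p := by
    calc _ = ((1 + z • (c * n)) * G') * p * p * (G * (1 + z • (n * c))) := by
          simp only [mul_assoc]
      _ = _ := by rw [hG', hG2, one_mul, mul_one]
  obtain ⟨j1, hj1⟩ := u1
  obtain ⟨j2, hj2⟩ := u2
  obtain ⟨j3, hj3⟩ := u3
  obtain ⟨j4, hj4⟩ := u4
  obtain ⟨i2, hi2⟩ := k2
  obtain ⟨i3, hi3⟩ := k3
  rw [← hj2, ← hj1] at hX
  rw [← hj3, ← hj4] at hY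
  rw [← hj2, ← hi2] at e5
  rw [← hj3, ← hi3] at e6
  rw [← hj4, ← hi3, ← hj1, ← hi2, ← Units.val_mul, ← Units.val_mul, Units.val_inj] at e7
  have hX' : p * G * (G' * p) = ↑(j2⁻¹) * (p * p) * ↑(j1⁻¹) := by
    rw [← hX]; simp [mul_assoc]
  have hY' : G' * p * (p * G) = ↑(j3⁻¹) * (p * p) * ↑(j4⁻¹) := by
    rw [← hY]; simp [mul_assoc]
  have g5 : ↑(j2⁻¹) * (p * p) = (p * p) * ↑(i2⁻¹) := by
    rw [Units.inv_mul_eq_iff_eq_mul, ← mul_assoc, e5, Units.mul_inv_cancel_right]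
  have g6 : ↑(j3⁻¹) * (p * p) = (p * p) * ↑(i3⁻¹) := by
    rw [Units.inv_mul_eq_iff_eq_mul, ← mul_assoc, e6, Units.mul_inv_cancel_right]
  rw [hX', hY', g5, g6, mul_assoc _ _ (↑(j1⁻¹) : A), mul_assoc _ _ (↑(j4⁻¹) : A), ← Units.val_mul,
    ← Units.val_mul, ← mul_inv_rev, ← mul_inv_rev, e7]

/-- The values at a point `μ` of the series that determine the flow `H(μ)`: here `z = μ⁻¹`, `c =
u(μ)`, `n = m(μ)`, `v = v(μ)`, `w = w(μ)`, and `G = (1 + z n c)⁻¹`, `G' = (1 + z c n)⁻¹`. The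
scalar ring `R` is a commutative ring over which everything is linear; invertibility of all `1 + z
b` holds in power series in `z`. -/
structure FlowPoint (q z : R) (c n G G' v w : A) : Prop where
  nc : n * c = q • (c * n)
  hz : ∀ b : A, IsUnit (1 + z • b)
  mul_G : (1 + z • (n * c)) * G = 1
  G_mul : G * (1 + z • (n * c)) = 1
  mul_G' : (1 + z • (c * n)) * G' = 1
  G'_mul : G' * (1 + z • (c * n)) = 1
  v_eq : v = -(z • (G * n))
  v_eq' : v = -(z • (n * G'))
  w_eq : w = -(z • (c * G))
  w_eq' : w = -(z • (G' * c))

/-- The relations with `c = u(μ)` and `n = m(μ)` satisfied by `p = c` and by `p = (λ⁻¹u(λ) -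
μ⁻¹u(μ)) / (λ⁻¹ - μ⁻¹)`. The flow of `u(λ)` is assembled from the expressions `p v p` in these two
letters. -/
structure IsULetter (q : R) (c n p : A) : Prop where
  quad : p * (p - c) = q • ((p - c) * p)
  comm : n * p = q • (p * n)

/-- The counterpart of `IsULetter` for `m`; the two are exchanged by passing to the opposite ring.
-/
structure IsMLetter (q : R) (c n y : A) : Prop where
  quad : (y - n) * y = q • (y * (y - n))
  comm : y * c = q • (c * y)

open MulOpposite in
theorem IsMLetter.toOp {q : R} {c n y : A} (h : IsMLetter q c n y) :
    IsULetter q (op n) (op c) (op y) :=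
  ⟨congrArg op h.quad, congrArg op h.comm⟩

open MulOpposite in
theorem IsULetter.toOp {q : R} {c n y : A} (h : IsULetter q c n y) :
    IsMLetter q (op n) (op c) (op y) :=
  ⟨congrArg op h.quad, congrArg op h.comm⟩

namespace FlowPoint
variable {q z : R} {c n G G' v w : A}

open MulOpposite in
/-- Passing to the opposite ring exchanges `u` and `m`, and `v` and `w`, so that every identity
has a mirror image. -/
theorem toOp (h : FlowPoint q z c n G G' v w) :
    FlowPoint q z (op n) (op c) (op G) (op G') (op w) (op v) where
  nc := congrArg op h.nc
  hz b := by
    have := (h.hz b.unop).op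
    simpa using this
  mul_G := congrArg op h.G_mul
  G_mul := congrArg op h.mul_G
  mul_G' := congrArg op h.G'_mul
  G'_mul := congrArg op h.mul_G'
  v_eq := congrArg op h.w_eq
  v_eq' := congrArg op h.w_eq'
  w_eq := congrArg op h.v_eq
  w_eq' := congrArg op h.v_eq'

theorem G_eq (h : FlowPoint q z c n G G' v w) : 1 + v * c = G := by
  rw [h.v_eq]
  linear_combination (norm := (simp only [mul_add, smul_mul_assoc, mul_smul_comm,
    mul_assoc, neg_mul, mul_one]; module)) -h.G_mul

theorem G'_eq (h : FlowPoint q z c n G G' v w) : 1 + c * v = G' := by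
  rw [h.v_eq']
  linear_combination (norm := (simp only [add_mul, smul_mul_assoc, mul_smul_comm,
    mul_assoc, mul_neg, one_mul]; module)) -h.mul_G'

theorem G_eq' (h : FlowPoint q z c n G G' v w) : 1 + n * w = G := by
  rw [h.w_eq]
  linear_combination (norm := (simp only [add_mul, smul_mul_assoc, mul_smul_comm,
    mul_assoc, mul_neg, one_mul]; module)) -h.mul_G

theorem G'_eq' (h : FlowPoint q z c n G G' v w) : 1 + w * n = G' := by
  rw [h.w_eq']
  linear_combination (norm := (simp only [mul_add, smul_mul_assoc, mul_smul_comm,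
    mul_assoc, neg_mul, mul_one]; module)) -h.G'_mul

theorem G_comm (h : FlowPoint q z c n G G' v w) : G * G' = G' * G := by
  have h1 : (1 + z • (n * c)) * (1 + z • (c * n)) = (1 + z • (c * n)) * (1 + z • (n * c)) := by
    rw [h.nc]
    simp only [mul_add, add_mul, smul_mul_assoc, mul_smul_comm, mul_one, one_mul]
    module
  have u1 := h.hz (n * c)
  have u2 := h.hz (c * n)
  refine u2.mul_left_cancel (u1.mul_left_cancel (u2.mul_right_cancel (u1.mul_right_cancel ?_)))
  calc _ = ((1 + z • (n * c)) * (1 + z • (c * n))) * G * (G' * (1 + z • (c * n)))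
        * (1 + z • (n * c)) := by simp only [mul_assoc]
    _ = ((1 + z • (c * n)) * ((1 + z • (n * c)) * G)) * (1 + z • (n * c)) := by
        rw [h.G'_mul, mul_one, h1]; simp only [mul_assoc]
    _ = (1 + z • (n * c)) * (1 + z • (c * n)) := by rw [h.mul_G, mul_one, h1]
    _ = (1 + z • (n * c)) * ((1 + z • (c * n)) * G') * G * ((1 + z • (n * c)) *
        (1 + z • (c * n))) := by
        rw [h.mul_G', mul_one, ← mul_assoc, mul_assoc _ G, h.G_mul, mul_one]
    _ = _ := by rw [h1]; simp only [mul_assoc]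

theorem v_mul_u (h : FlowPoint q z c n G G' v w) {p : A} (hp : n * p = q • (p * n)) :
    v * p - q • (p * v) = v * (q • (c * p) - p * c) * v := by
  have h1 : z • n + v + z • (v * c * n) = 0 := by
    have e := h.v_eq
    rw [← h.G_eq] at e
    linear_combination (norm := (simp only [add_mul, one_mul]; module)) e
  have h2 : z • n + v + z • (n * c * v) = 0 := by
    have e := h.v_eq'
    rw [← h.G'_eq] at e
    linear_combination (norm := (simp only [mul_add, mul_assoc, mul_one]; module)) e
  linear_combination (norm := (
      simp only [mul_add, add_mul, mul_sub, sub_mul, smul_add, smul_mul_assoc,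
        mul_smul_comm, mul_assoc, one_mul, mul_one, mul_zero, zero_mul]
      module))
    h1 * p * (1 + c * v) - z • ((1 + v * c) * hp * (1 + c * v)) - q • ((1 + v * c) * p * h2)

/-- A `u`-letter `q`-commutes with `v` up to a term `v p² v`. -/
theorem v_mul_uLetter (h : FlowPoint q z c n G G' v w) {p : A} (hp : IsULetter q c n p) :
    v * p - q • (p * v) = -(v * ((1 - q) • (p * p)) * v) := by
  rw [h.v_mul_u hp.comm]
  linear_combination (norm := (simp only [mul_sub, sub_mul, smul_sub,
    smul_mul_assoc, mul_smul_comm, mul_assoc]; module))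
    v * hp.quad * v

theorem v_mul_mLetter (h : FlowPoint q z c n G G' v w) {y : A} (hy : IsMLetter q c n y) :
    v * y - q • (y * v) = ((q - 1) * z) • (G * (y * y) * G') := by
  have u1 := h.hz (n * c)
  have u2 := h.hz (c * n)
  refine u1.mul_left_cancel (u2.mul_right_cancel ?_)
  have e1 : (1 + z • (n * c)) * v = -(z • n) := by
    rw [h.v_eq, mul_neg, mul_smul_comm, ← mul_assoc, h.mul_G, one_mul]
  have e2 : v * (1 + z • (c * n)) = -(z • n) := by
    rw [h.v_eq', neg_mul, smul_mul_assoc, mul_assoc, h.G'_mul, mul_one]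
  have e3 : (1 + z • (n * c)) * (((q - 1) * z) • (G * (y * y) * G')) * (1 + z • (c * n)) =
      ((q - 1) * z) • (y * y) := by
    rw [mul_smul_comm, smul_mul_assoc]
    congr 1
    calc _ = ((1 + z • (n * c)) * G) * (y * y) * (G' * (1 + z • (c * n))) := by
          simp only [mul_assoc]
      _ = _ := by rw [h.mul_G, h.G'_mul, one_mul, mul_one]
  rw [e3]
  linear_combination (norm := (
      simp only [mul_add, add_mul, mul_sub, sub_mul, smul_add, smul_sub, smul_mul_assoc,
        mul_smul_comm, mul_assoc, neg_mul, mul_neg, smul_neg, one_mul, mul_one]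
      module))
    e1 * y * (1 + z • (c * n)) - q • ((1 + z • (n * c)) * y * e2) + z • hy.quad
      - (z * z) • (n * hy.comm * n)

open MulOpposite in
theorem mLetter_mul_w (h : FlowPoint q z c n G G' v w) {y : A} (hy : IsMLetter q c n y) :
    y * w - q • (w * y) = -(w * ((1 - q) • (y * y)) * w) := by
  have := congrArg unop (h.toOp.v_mul_uLetter hy.toOp)
  simpa [mul_assoc] using this

open MulOpposite in
theorem uLetter_mul_w (h : FlowPoint q z c n G G' v w) {p : A} (hp : IsULetter q c n p) :
    p * w - q • (w * p) = ((q - 1) * z) • (G' * (p * p) * G) := by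
  have := congrArg unop (h.toOp.v_mul_mLetter hp.toOp)
  simpa [mul_assoc] using this

/-- The crucial commutation for the relation between `u` and `m`; with `y` or `p` absent, its
variants below serve the relations that involve the half screening charges. -/
theorem sandwich (h : FlowPoint q z c n G G' v w) {q' : R} (hq : q * q' = 1) {p y : A}
    (hp : IsULetter q c n p) (hy : IsMLetter q c n y) (hyp : y * p = q • (p * y)) :
    p * G * y * (y * G' * p) = y * G' * p * (p * G * y) := by
  have hq2 : ∀ b : A, q • (q' • b) = b := fun b => by rw [smul_smul, hq, one_smul]
  refine sandwich_core q z (r := q' • (q' • (p - c))) (s := q' • (y - n)) (n := n) (c := c)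
    ?_ ?_ hyp ?_ ?_ ?_ ?_ ?_ h.mul_G h.G_mul h.mul_G' h.G'_mul h.hz
  · rw [mul_smul_comm, mul_smul_comm, hp.quad, smul_mul_assoc, smul_mul_assoc]
    module
  · rw [smul_mul_assoc, mul_smul_comm, hy.quad]
    module
  · rw [mul_smul_comm, mul_smul_comm, mul_sub, hyp, hy.comm, smul_mul_assoc, smul_mul_assoc, sub_mul]
    module
  · rw [smul_mul_assoc, mul_smul_comm, sub_mul, hyp, hp.comm, mul_sub]
    module
  · rw [smul_mul_assoc, sub_mul, mul_smul_comm, mul_smul_comm, mul_smul_comm, mul_smul_comm,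
      mul_sub, mul_sub, hyp, hy.comm, hp.comm, h.nc, smul_mul_assoc, smul_mul_assoc, mul_smul_comm,
      sub_mul, mul_sub, mul_sub]
    module
  · rw [pow_two, mul_smul, hq2, hq2]; abel
  · rw [hq2]; abel

theorem uLetter_G_G'_uLetter (h : FlowPoint q z c n G G' v w) {q' : R} (hq : q * q' = 1) {p : A}
    (hp : IsULetter q c n p) : p * G * (G' * p) = G' * p * (p * G) := by
  have hq2 : ∀ b : A, q • (q' • b) = b := fun b => by rw [smul_smul, hq, one_smul]
  refine sandwich_one_core q z (r := q' • (q' • (p - c))) (n := n) (c := c)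
    ?_ hp.comm ?_ ?_ h.mul_G h.G_mul h.mul_G' h.G'_mul h.hz
  · rw [mul_smul_comm, mul_smul_comm, hp.quad, smul_mul_assoc, smul_mul_assoc]
    module
  · rw [mul_smul_comm, mul_smul_comm, mul_sub, hp.comm, h.nc, smul_mul_assoc, smul_mul_assoc, sub_mul]
    module
  · rw [pow_two, mul_smul, hq2, hq2]; abel

open MulOpposite in
theorem mLetter_G'_G_mLetter (h : FlowPoint q z c n G G' v w) {q' : R} (hq : q * q' = 1) {y : A}
    (hy : IsMLetter q c n y) : y * G' * (G * y) = G * y * (y * G') := by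
  have := congrArg unop (h.toOp.uLetter_G_G'_uLetter hq hy.toOp)
  simpa [mul_assoc] using this

theorem isULetter (h : FlowPoint q z c n G G' v w) : IsULetter q c n c :=
  ⟨by simp, h.nc⟩

theorem isMLetter (h : FlowPoint q z c n G G' v w) : IsMLetter q c n n :=
  ⟨by simp, h.nc⟩

theorem uLetter_v_v_uLetter (h : FlowPoint q z c n G G' v w) {q' : R} (hq : q * q' = 1) {p : A}
    (hp : IsULetter q c n p) : p * v * (v * p) = v * p * (p * v) := by
  have h1 := h.sandwich hq hp h.isMLetter hp.comm
  have e1 : p * v = -(z • (p * G * n)) := by rw [h.v_eq]; simp [mul_assoc]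
  have e2 : v * p = -(z • (n * G' * p)) := by rw [h.v_eq']; simp [mul_assoc]
  rw [e1, e2]
  simp only [neg_mul, mul_neg, smul_mul_assoc, mul_smul_comm, h1]

open MulOpposite in
theorem mLetter_w_w_mLetter (h : FlowPoint q z c n G G' v w) {q' : R} (hq : q * q' = 1) {y : A}
    (hy : IsMLetter q c n y) : y * w * (w * y) = w * y * (y * w) := by
  have := congrArg unop (h.toOp.uLetter_v_v_uLetter hq hy.toOp)
  simpa [mul_assoc] using this

end FlowPoint
end Resolvent

/-! ### The quadratic relation of two letters -/

namespace FlowPoint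
variable {R A : Type*} [CommRing R] [Ring A] [Algebra R A]
variable {q z : R} {c n G G' v w : A}

/-- The infinitesimal motion `p ↦ p v p` preserves the quadratic relation between two letters. -/
theorem quad_two_letters (h : FlowPoint q z c n G G' v w) {x₁ x₂ : R}
    (hu : ∀ b : A, IsUnit (1 + b * v))
    (hδ : ∀ b : A, (x₁ - x₂) • b = 0 → b = 0) {s₁ s₂ τ : A} (hs₁ : IsULetter q c n s₁)
    (hs₂ : IsULetter q c n s₂) (hτ : s₁ - s₂ = (x₁ - x₂) • τ)
    (h12 : (x₁ • s₁ - x₂ • s₂) * (s₁ - s₂) = q • ((s₁ - s₂) * (x₁ • s₁ - x₂ • s₂))) :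
    (x₁ • (s₁ * v * s₁) - x₂ • (s₂ * v * s₂)) * (s₁ - s₂)
      + (x₁ • s₁ - x₂ • s₂) * (s₁ * v * s₁ - s₂ * v * s₂)
      = q • ((s₁ * v * s₁ - s₂ * v * s₂) * (x₁ • s₁ - x₂ • s₂)
        + (s₁ - s₂) * (x₁ • (s₁ * v * s₁) - x₂ • (s₂ * v * s₂))) := by
  have hreg : ∀ b b' : A, (x₁ - x₂) • b = (x₁ - x₂) • b' → b = b' := fun b b' hb =>
    sub_eq_zero.1 (hδ _ (by rw [smul_sub, hb, sub_self]))
  -- in terms of `σ`, `τ` with `sᵢ = σ - xⱼ τ` the quadratic relation is `σ τ = q τ σ`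
  obtain ⟨σ, hσ⟩ : ∃ σ, σ = s₁ + x₂ • τ := ⟨_, rfl⟩
  have e1 : s₁ = σ - x₂ • τ := by rw [hσ]; abel
  have e2 : s₂ = σ - x₁ • τ := by
    linear_combination (norm := module) e1 - hτ
  have hστ : σ * τ = q • (τ * σ) := by
    apply hreg; apply hreg
    rw [e1, e2] at h12
    linear_combination (norm := (
      simp only [mul_sub, sub_mul, smul_sub, smul_mul_assoc,
        mul_smul_comm]
      module)) h12
  have hστ' : ∀ b, σ * (τ * b) = q • (τ * (σ * b)) := fun b => by
    rw [← mul_assoc, hστ, smul_mul_assoc, mul_assoc]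
  have v1 := h.v_mul_uLetter hs₁
  have v2 := h.v_mul_uLetter hs₂
  rw [e1] at v1
  rw [e2] at v2
  have key := quad_resolvent q (x₁ + x₂) (x₁ * x₂) (v := v) hστ ?_ ?_ (hu _)
  · rw [e1, e2]
    linear_combination (norm := (
      simp only [mul_add, add_mul, mul_sub, sub_mul, smul_add, smul_sub, smul_mul_assoc,
        mul_smul_comm, mul_assoc, hστ, hστ']
      module)) ((x₁ - x₂) ^ 2) • key
  · apply hreg
    linear_combination (norm := (
      simp only [mul_sub, sub_mul, smul_sub, smul_mul_assoc,
        mul_smul_comm, mul_assoc, smul_neg]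
      module)) x₁ • v1 - x₂ • v2
  · apply hreg
    linear_combination (norm := (
      simp only [mul_add, add_mul, mul_sub, sub_mul, smul_add, smul_sub, smul_mul_assoc,
        mul_smul_comm, mul_assoc, smul_neg]
      module)) v1 - v2

/-- The infinitesimal motion `p ↦ p v p` preserves the relation between a letter and `c`; this is
the case `x₁ = 1`, `x₂ = 0` of `quad_two_letters`, `c` being the value of the letter at `λ⁻¹ = 0`.
-/
theorem quad_letter_point (h : FlowPoint q z c n G G' v w) (hu : ∀ b : A, IsUnit (1 + b * v))
    {s : A} (hs : IsULetter q c n s) :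
    (1 - q) • (s * v * s * s + s * s * v * s) =
      s * v * s * c + s * c * v * c - q • (c * v * c * s + c * s * v * s) := by
  have := h.quad_two_letters (x₁ := 1) (x₂ := 0) hu (by simp) hs h.isULetter (τ := s - c)
    (by simp) (by simpa using hs.quad)
  linear_combination (norm := (
      simp only [mul_sub, sub_mul, smul_add, smul_sub, smul_mul_assoc,
        mul_smul_comm, mul_assoc]
      module)) this

/-- The derivation preserves the quadratic relation between `a₁ = u(λ₁)` and `a₂ = u(λ₂)`. Here
`sᵢ` are the letters, `Dᵢ = H(μ)(u(λᵢ))`, and `xᵢ = λᵢ⁻¹`; written in letters, both sides are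
combinations of the relations between `s₁`, `s₂` and `c`. -/
theorem flow_uu (h : FlowPoint q z c n G G' v w) (hu : ∀ b : A, IsUnit (1 + b * v))
    {x₁ x₂ : R} (hx₁ : ∀ b : A, x₁ • b = 0 → b = 0) (hx₂ : ∀ b : A, x₂ • b = 0 → b = 0)
    (hA₁ : ∀ b : A, (x₁ - z) • b = 0 → b = 0) (hA₂ : ∀ b : A, (x₂ - z) • b = 0 → b = 0)
    (hδ : ∀ b : A, (x₁ - x₂) • b = 0 → b = 0) {a₁ a₂ s₁ s₂ τ D₁ D₂ : A}
    (hs₁ : IsULetter q c n s₁) (hs₂ : IsULetter q c n s₂)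
    (ha₁ : x₁ • a₁ = (x₁ - z) • s₁ + z • c) (ha₂ : x₂ • a₂ = (x₂ - z) • s₂ + z • c)
    (hτ : s₁ - s₂ = (x₁ - x₂) • τ)
    (hD₁ : x₁ • D₁ = (x₁ - z) • (s₁ * v * s₁) + z • (c * v * c) - z • (s₁ - c))
    (hD₂ : x₂ • D₂ = (x₂ - z) • (s₂ * v * s₂) + z • (c * v * c) - z • (s₂ - c))
    (h12 : (x₁ • a₁ - x₂ • a₂) * (a₁ - a₂) = q • ((a₁ - a₂) * (x₁ • a₁ - x₂ • a₂))) :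
    (x₁ • D₁ - x₂ • D₂) * (a₁ - a₂) + (x₁ • a₁ - x₂ • a₂) * (D₁ - D₂)
      = q • ((D₁ - D₂) * (x₁ • a₁ - x₂ • a₂) + (a₁ - a₂) * (x₁ • D₁ - x₂ • D₂)) := by
  have regx : ∀ b b' : A, x₁ • x₂ • b = x₁ • x₂ • b' → b = b' := fun b b' hb =>
    sub_eq_zero.1 (hx₂ _ (hx₁ _ (by rw [smul_sub, smul_sub, hb, sub_self])))
  have regA : ∀ b b' : A, (x₁ - z) • (x₂ - z) • b = (x₁ - z) • (x₂ - z) • b' → b = b' :=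
    fun b b' hb => sub_eq_zero.1 (hA₂ _ (hA₁ _ (by rw [smul_sub, smul_sub, hb, sub_self])))
  have r1 := hs₁.quad
  have r2 := hs₂.quad
  have k1 := h.quad_letter_point hu hs₁
  have k2 := h.quad_letter_point hu hs₂
  -- the letters also satisfy the quadratic relation of `a₁`, `a₂`
  have e12 : (x₁ • s₁ - x₂ • s₂) * (s₁ - s₂) = q • ((s₁ - s₂) * (x₁ • s₁ - x₂ • s₂)) := by
    apply regA
    have e : ((x₁ - z) • s₁ - (x₂ - z) • s₂) *
        (x₂ • ((x₁ - z) • s₁ + z • c) - x₁ • ((x₂ - z) • s₂ + z • c)) =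
        q • ((x₂ • ((x₁ - z) • s₁ + z • c) - x₁ • ((x₂ - z) • s₂ + z • c)) *
          ((x₁ - z) • s₁ - (x₂ - z) • s₂)) := by
      rw [← ha₁, ← ha₂]
      have : (x₁ - z) • s₁ - (x₂ - z) • s₂ = x₁ • a₁ - x₂ • a₂ := by rw [ha₁, ha₂]; abel
      rw [this]
      linear_combination (norm := (
        simp only [mul_sub, sub_mul, smul_sub, smul_mul_assoc,
          mul_smul_comm]
        module)) (x₁ * x₂) • h12
    linear_combination (norm := (
      simp only [mul_add, add_mul, mul_sub, sub_mul, smul_add, smul_sub, smul_mul_assoc,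
        mul_smul_comm, mul_assoc]
      module)) e - (z * (x₁ - x₂) * (x₁ - z)) • r1 + (z * (x₁ - x₂) * (x₂ - z)) • r2
  have k12 := h.quad_two_letters hu hδ hs₁ hs₂ hτ e12
  apply regx
  have key : ((x₁ • D₁) - (x₂ • D₂)) * (x₂ • (x₁ • a₁) - x₁ • (x₂ • a₂))
      + ((x₁ • a₁) - (x₂ • a₂)) * (x₂ • (x₁ • D₁) - x₁ • (x₂ • D₂))
      = q • ((x₂ • (x₁ • D₁) - x₁ • (x₂ • D₂)) * ((x₁ • a₁) - (x₂ • a₂))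
      + (x₂ • (x₁ • a₁) - x₁ • (x₂ • a₂)) * ((x₁ • D₁) - (x₂ • D₂))) := by
    rw [ha₁, ha₂, hD₁, hD₂]
    linear_combination (norm := (
      simp only [mul_add, add_mul, mul_sub, sub_mul, smul_add, smul_sub, smul_mul_assoc,
        mul_smul_comm, mul_assoc]
      module)) ((x₁ - z) * (x₂ - z)) • k12 + (z * (x₁ - x₂) * (x₁ - z)) • k1
        - (z * (x₁ - x₂) * (x₂ - z)) • k2
        - (z * (x₁ + x₂ - 2 * z)) • e12 + (z * (x₁ - x₂) * (x₁ - z - z)) • r1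
        - (z * (x₁ - x₂) * (x₂ - z - z)) • r2
  linear_combination (norm := (
    simp only [mul_sub, sub_mul, smul_add, smul_sub, smul_mul_assoc,
        mul_smul_comm]
    module)) key

end FlowPoint

/-! ### The remaining relations -/

namespace FlowPoint
variable {R A : Type*} [CommRing R] [Ring A] [Algebra R A]
variable {q z : R} {c n G G' v w : A}

theorem isUnit_one_add_mul_v (h : FlowPoint q z c n G G' v w) (b : A) : IsUnit (1 + b * v) := by
  have := h.hz (-(b * (G * n)))
  rw [h.v_eq, mul_neg, mul_smul_comm]
  simpa using this

open MulOpposite in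
/-- The derivation preserves the quadratic relation between `m(λ₁)` and `m(λ₂)`: the opposite-ring
image of `flow_uu`. -/
theorem flow_mm (h : FlowPoint q z c n G G' v w)
    {x₁ x₂ : R} (hx₁ : ∀ b : A, x₁ • b = 0 → b = 0) (hx₂ : ∀ b : A, x₂ • b = 0 → b = 0)
    (hA₁ : ∀ b : A, (x₁ - z) • b = 0 → b = 0) (hA₂ : ∀ b : A, (x₂ - z) • b = 0 → b = 0)
    (hδ : ∀ b : A, (x₁ - x₂) • b = 0 → b = 0) {b₁ b₂ s₁ s₂ τ D₁ D₂ : A}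
    (hs₁ : IsMLetter q c n s₁) (hs₂ : IsMLetter q c n s₂)
    (hb₁ : x₁ • b₁ = (x₁ - z) • s₁ + z • n) (hb₂ : x₂ • b₂ = (x₂ - z) • s₂ + z • n)
    (hτ : s₁ - s₂ = (x₁ - x₂) • τ)
    (hD₁ : x₁ • D₁ = -((x₁ - z) • (s₁ * w * s₁) + z • (n * w * n) - z • (s₁ - n)))
    (hD₂ : x₂ • D₂ = -((x₂ - z) • (s₂ * w * s₂) + z • (n * w * n) - z • (s₂ - n)))
    (h12 : (b₁ - b₂) * (x₁ • b₁ - x₂ • b₂) = q • ((x₁ • b₁ - x₂ • b₂) * (b₁ - b₂))) :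
    (D₁ - D₂) * (x₁ • b₁ - x₂ • b₂) + (b₁ - b₂) * (x₁ • D₁ - x₂ • D₂)
      = q • ((x₁ • D₁ - x₂ • D₂) * (b₁ - b₂) + (x₁ • b₁ - x₂ • b₂) * (D₁ - D₂)) := by
  have reg : ∀ {r : R}, (∀ b : A, r • b = 0 → b = 0) → ∀ b : Aᵐᵒᵖ, r • b = 0 → b = 0 := by
    intro r hr b hb
    exact unop_injective (hr _ (congrArg unop hb))
  have := congrArg unop (h.toOp.flow_uu h.toOp.isUnit_one_add_mul_v (reg hx₁) (reg hx₂) (reg hA₁)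
    (reg hA₂) (reg hδ) (a₁ := op b₁) (a₂ := op b₂) hs₁.toOp hs₂.toOp (congrArg op hb₁) (congrArg op hb₂)
    (τ := op τ) (congrArg op hτ) (D₁ := op (-D₁)) (D₂ := op (-D₂))
    (by rw [← op_smul, smul_neg, hD₁, neg_neg]; simp [mul_assoc])
    (by rw [← op_smul, smul_neg, hD₂, neg_neg]; simp [mul_assoc])
    (congrArg op h12))
  simp only [unop_add, unop_mul, unop_sub, unop_smul, unop_op] at this
  linear_combination (norm := (
    simp only [mul_sub, sub_mul, smul_add, smul_sub, smul_mul_assoc,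
        mul_smul_comm, neg_mul, mul_neg, smul_neg]
    module)) -this

/-- The motions `p ↦ p v p`, `y ↦ -y w y` preserve the relation between a `u`-letter and an
`m`-letter. -/
theorem letter_um (h : FlowPoint q z c n G G' v w) {q' : R} (hq : q * q' = 1) {p y : A}
    (hp : IsULetter q c n p) (hy : IsMLetter q c n y) (hyp : y * p = q • (p * y)) :
    y * (p * v * p) - y * w * y * p = q • (p * v * p * y - p * (y * w * y)) := by
  have h1 := h.sandwich hq hp hy hyp
  have h2 := h.v_mul_mLetter hy
  have h3 := h.uLetter_mul_w hp
  linear_combination (norm := (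
    simp only [mul_sub, sub_mul, smul_sub, smul_mul_assoc,
        mul_smul_comm, mul_assoc]
    module)) hyp * (v * p) - p * h2 * p + p * v * hyp - y * w * hyp + y * h3 * y - hyp * (w * y)
      - ((q - 1) * z) • h1

/-- The derivation preserves the relation between `u(λ₁)` and `m(λ₂)`: it is bilinear in the
letters, so that `letter_um` applies termwise. -/
theorem flow_um (h : FlowPoint q z c n G G' v w) {q' : R} (hq : q * q' = 1) {x₁ x₂ : R}
    (hx₁ : ∀ b : A, x₁ • b = 0 → b = 0) (hx₂ : ∀ b : A, x₂ • b = 0 → b = 0)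
    {a b s y D E : A} (hs : IsULetter q c n s) (hy : IsMLetter q c n y)
    (hys : y * s = q • (s * y))
    (ha : x₁ • a = (x₁ - z) • s + z • c) (hb : x₂ • b = (x₂ - z) • y + z • n)
    (hD : x₁ • D = (x₁ - z) • (s * v * s) + z • (c * v * c) - z • (s - c))
    (hE : x₂ • E = -((x₂ - z) • (y * w * y) + z • (n * w * n) - z • (y - n))) :
    E * a + b * D = q • (D * b + a * E) := by
  have regx : ∀ b b' : A, x₁ • x₂ • b = x₁ • x₂ • b' → b = b' := fun b b' hb =>
    sub_eq_zero.1 (hx₂ _ (hx₁ _ (by rw [smul_sub, smul_sub, hb, sub_self])))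
  apply regx
  have k1 := h.letter_um hq hs hy hys
  have k2 := h.letter_um hq hs h.isMLetter hs.comm
  have k3 := h.letter_um hq h.isULetter hy hy.comm
  have k4 := h.letter_um hq h.isULetter h.isMLetter h.nc
  have key : (x₂ • E) * (x₁ • a) + (x₂ • b) * (x₁ • D) =
      q • ((x₁ • D) * (x₂ • b) + (x₁ • a) * (x₂ • E)) := by
    rw [ha, hb, hD, hE]
    linear_combination (norm := (
      simp only [mul_add, add_mul, mul_sub, sub_mul, smul_add, smul_sub, smul_mul_assoc,
        mul_smul_comm, mul_assoc, neg_mul, mul_neg, smul_neg]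
      module)) ((x₁ - z) * (x₂ - z)) • k1 + ((x₁ - z) * z) • k2 + (z * (x₂ - z)) • k3
        + (z * z) • k4 + (z * (x₁ - x₂)) • hys + (z * x₂) • hy.comm - (z * x₁) • hs.comm
  linear_combination (norm := (
    simp only [smul_add, smul_mul_assoc,
        mul_smul_comm]
    module)) key

section Charges

variable {S T : A}

/-- In this and the following lemmas, `S` and `T` are `Σ̄₊` and `Σ̄₋`, and `w` and `v` their
derivatives. -/
theorem v_mul_Sp (h : FlowPoint q z c n G G' v w) (hc : c * S = q • (S * c))
    (hn : q • (n * S) = S * n + (q - 1) • 1) :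
    q • (v * S) = S * v - ((q - 1) * z) • (G * G') := by
  refine (h.hz (n * c)).mul_left_cancel ((h.hz (c * n)).mul_right_cancel ?_)
  have e1 : (1 + z • (n * c)) * v = -(z • n) := by
    rw [h.v_eq, mul_neg, mul_smul_comm, ← mul_assoc, h.mul_G, one_mul]
  have e2 : v * (1 + z • (c * n)) = -(z • n) := by
    rw [h.v_eq', neg_mul, smul_mul_assoc, mul_assoc, h.G'_mul, mul_one]
  linear_combination (norm := (
    simp only [mul_add, add_mul, mul_sub, sub_mul, smul_add, smul_sub, smul_mul_assoc,
      mul_smul_comm, mul_assoc, neg_mul, mul_neg, smul_neg, one_mul, mul_one]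
    module)) q • (e1 * S * (1 + z • (c * n))) - (1 + z • (n * c)) * S * e2
      + ((q - 1) * z) • (h.mul_G * G' * (1 + z • (c * n)) + h.G'_mul)
      - z • hn + (z * z) • (n * hc * n)

theorem w_mul_Sp (h : FlowPoint q z c n G G' v w) (hc : c * S = q • (S * c))
    (hn : q • (n * S) = S * n + (q - 1) • 1) :
    w * S = q • (S * w) + (q - 1) • (w * w) := by
  refine (h.hz (c * n)).mul_left_cancel ((h.hz (n * c)).mul_right_cancel ?_)
  have e1 : (1 + z • (c * n)) * w = -(z • c) := by
    rw [h.w_eq', mul_neg, mul_smul_comm, ← mul_assoc, h.mul_G', one_mul]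
  have e2 : w * (1 + z • (n * c)) = -(z • c) := by
    rw [h.w_eq, neg_mul, smul_mul_assoc, mul_assoc, h.G_mul, mul_one]
  linear_combination (norm := (
    simp only [mul_add, add_mul, smul_add, smul_mul_assoc,
      mul_smul_comm, mul_assoc, neg_mul, mul_neg, smul_neg, one_mul, mul_one]
    module)) e1 * S * (1 + z • (n * c)) - q • ((1 + z • (c * n)) * S * e2)
      - (q - 1) • (e1 * w * (1 + z • (n * c)) - z • (c * e2))
      - z • hc + (z * z) • (c * hn * c)

theorem v_mul_Sm (h : FlowPoint q z c n G G' v w) (hc : q • (c * T) = T * c)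
    (hn : n * T = q • (T * n) - ((q - 1) * z) • (n * n)) :
    v * T = q • (T * v) + (q - 1) • (v * v) := by
  refine (h.hz (n * c)).mul_left_cancel ((h.hz (c * n)).mul_right_cancel ?_)
  have e1 : (1 + z • (n * c)) * v = -(z • n) := by
    rw [h.v_eq, mul_neg, mul_smul_comm, ← mul_assoc, h.mul_G, one_mul]
  have e2 : v * (1 + z • (c * n)) = -(z • n) := by
    rw [h.v_eq', neg_mul, smul_mul_assoc, mul_assoc, h.G'_mul, mul_one]
  linear_combination (norm := (
    simp only [mul_add, add_mul, sub_mul, smul_add, smul_sub, smul_mul_assoc,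
      mul_smul_comm, mul_assoc, neg_mul, mul_neg, smul_neg, one_mul, mul_one]
    module)) e1 * T * (1 + z • (c * n)) - q • ((1 + z • (n * c)) * T * e2)
      - (q - 1) • (e1 * v * (1 + z • (c * n)) - z • (n * e2)) - z • hn
      + (z * z) • (n * hc * n)

theorem w_mul_Sm (h : FlowPoint q z c n G G' v w) (hc : q • (c * T) = T * c)
    (hn : n * T = q • (T * n) - ((q - 1) * z) • (n * n)) :
    q • (w * T) = T * w - ((q - 1) * z) • (w * (n * n) * w) := by
  refine (h.hz (c * n)).mul_left_cancel ((h.hz (n * c)).mul_right_cancel ?_)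
  have e1 : (1 + z • (c * n)) * w = -(z • c) := by
    rw [h.w_eq', mul_neg, mul_smul_comm, ← mul_assoc, h.mul_G', one_mul]
  have e2 : w * (1 + z • (n * c)) = -(z • c) := by
    rw [h.w_eq, neg_mul, smul_mul_assoc, mul_assoc, h.G_mul, mul_one]
  linear_combination (norm := (
    simp only [mul_add, add_mul, mul_sub, sub_mul, smul_add, smul_sub, smul_mul_assoc,
      mul_smul_comm, mul_assoc, neg_mul, mul_neg, smul_neg, one_mul, mul_one]
    module)) q • (e1 * T * (1 + z • (n * c))) - (1 + z • (c * n)) * T * e2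
      + ((q - 1) * z) • (e1 * (n * n) * w * (1 + z • (n * c)) - z • (c * (n * n) * e2)) - z • hc
      + (z * z) • (c * hn * c)

theorem letter_Sp_u (h : FlowPoint q z c n G G' v w) {q' : R} (hq : q * q' = 1)
    (hc : c * S = q • (S * c)) (hn : q • (n * S) = S * n + (q - 1) • 1) {p : A}
    (hp : IsULetter q c n p) (hpS : p * S = q • (S * p)) :
    p * v * p * S + p * w = q • (w * p + S * (p * v * p)) := by
  have h1 := h.v_mul_Sp hc hn
  have h2 := h.uLetter_mul_w hp
  have h3 := h.uLetter_G_G'_uLetter hq hp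
  linear_combination (norm := (
    simp only [mul_sub, sub_mul, smul_add, smul_mul_assoc,
      mul_smul_comm, mul_assoc, one_mul]
    module)) p * v * hpS + p * h1 * p + hpS * (v * p) + h2
      - ((q - 1) * z) • h3

theorem flow_uSp (h : FlowPoint q z c n G G' v w) {q' : R} (hq : q * q' = 1)
    (hc : c * S = q • (S * c)) (hn : q • (n * S) = S * n + (q - 1) • 1) {x : R}
    (hx : ∀ b : A, x • b = 0 → b = 0) {a s D : A} (hs : IsULetter q c n s)
    (hsS : s * S = q • (S * s)) (ha : x • a = (x - z) • s + z • c)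
    (hD : x • D = (x - z) • (s * v * s) + z • (c * v * c) - z • (s - c)) :
    D * S + a * w = q • (w * a + S * D) := by
  rw [← sub_eq_zero]
  apply hx
  have k1 := h.letter_Sp_u hq hc hn hs hsS
  have k2 := h.letter_Sp_u hq hc hn h.isULetter hc
  linear_combination (norm := (
    simp only [mul_add, add_mul, mul_sub, sub_mul, smul_add, smul_sub, smul_mul_assoc,
      mul_smul_comm, mul_assoc]
    module)) hD * S + ha * w - q • (w * ha + S * hD)
      + (x - z) • k1 + z • k2 - z • hsS + z • hc

theorem letter_Sm_u (h : FlowPoint q z c n G G' v w) {q' : R} (hq : q * q' = 1)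
    (hc : q • (c * T) = T * c) (hn : n * T = q • (T * n) - ((q - 1) * z) • (n * n)) {p : A}
    (hp : IsULetter q c n p) (hpT : q • (p * T) = T * p) :
    q • (p * v * p * T + p * v) = v * p + T * (p * v * p) := by
  have h1 := h.v_mul_Sm hc hn
  have h2 := h.v_mul_uLetter hp
  have h3 := h.uLetter_v_v_uLetter hq hp
  linear_combination (norm := (
    simp only [mul_add, add_mul, smul_add, smul_mul_assoc,
      mul_smul_comm, mul_assoc]
    module)) p * v * hpT + p * h1 * p + hpT * (v * p) - h2
      + (q - 1) • h3

theorem flow_uSm (h : FlowPoint q z c n G G' v w) {q' : R} (hq : q * q' = 1)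
    (hc : q • (c * T) = T * c) (hn : n * T = q • (T * n) - ((q - 1) * z) • (n * n)) {x : R}
    (hx : ∀ b : A, x • b = 0 → b = 0) {a s D : A} (hs : IsULetter q c n s)
    (hsT : q • (s * T) = T * s) (ha : x • a = (x - z) • s + z • c)
    (hD : x • D = (x - z) • (s * v * s) + z • (c * v * c) - z • (s - c)) :
    q • (D * T + a * v) = v * a + T * D := by
  rw [← sub_eq_zero]
  apply hx
  have k1 := h.letter_Sm_u hq hc hn hs hsT
  have k2 := h.letter_Sm_u hq hc hn h.isULetter hc
  linear_combination (norm := (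
    simp only [mul_add, add_mul, mul_sub, sub_mul, smul_add, smul_sub, smul_mul_assoc,
      mul_smul_comm, mul_assoc]
    module)) q • (hD * T + ha * v) - (v * ha + T * hD)
      + (x - z) • k1 + z • k2 - z • hsT + z • hc

theorem letter_Sp_m (h : FlowPoint q z c n G G' v w) {q' : R} (hq : q * q' = 1)
    (hc : c * S = q • (S * c)) (hn : q • (n * S) = S * n + (q - 1) • 1) {y : A}
    (hy : IsMLetter q c n y) (hyS : q • (y * S) = S * y + (q - 1) • 1) :
    q • (y * w * y * S - y * w) = S * (y * w * y) - w * y := by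
  have h1 := h.w_mul_Sp hc hn
  have h2 := h.mLetter_mul_w hy
  have h3 := h.mLetter_w_w_mLetter hq hy
  linear_combination (norm := (
    simp only [mul_add, add_mul, smul_sub, smul_mul_assoc,
      mul_smul_comm, mul_assoc, one_mul, mul_one]
    module)) y * w * hyS + y * h1 * y + hyS * (w * y) - h2
      + (q - 1) • h3

theorem flow_mSp (h : FlowPoint q z c n G G' v w) {q' : R} (hq : q * q' = 1)
    (hc : c * S = q • (S * c)) (hn : q • (n * S) = S * n + (q - 1) • 1) {x : R}
    (hx : ∀ b : A, x • b = 0 → b = 0) {b y E : A} (hy : IsMLetter q c n y)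
    (hyS : q • (y * S) = S * y + (q - 1) • 1) (hb : x • b = (x - z) • y + z • n)
    (hE : x • E = -((x - z) • (y * w * y) + z • (n * w * n) - z • (y - n))) :
    q • (E * S + b * w) = w * b + S * E := by
  rw [← sub_eq_zero]
  apply hx
  have k1 := h.letter_Sp_m hq hc hn hy hyS
  have k2 := h.letter_Sp_m hq hc hn h.isMLetter hn
  linear_combination (norm := (
    simp only [mul_add, add_mul, mul_sub, sub_mul, smul_add, smul_sub, smul_mul_assoc,
      mul_smul_comm, mul_assoc, neg_mul, mul_neg, smul_neg]
    module)) q • (hE * S + hb * w) - (w * hb + S * hE)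
      - (x - z) • k1 - z • k2 + z • hyS - z • hn

theorem uLetter_c_G (h : FlowPoint q z c n G G' v w) {p : A} (hp : IsULetter q c n p) :
    p * c * G - q • (c * G * p) = -((q - 1) • (G' * (p * p) * G)) := by
  have h2 := h.v_mul_uLetter hp
  rw [← h.G_eq, ← h.G'_eq]
  linear_combination (norm := (
    simp only [mul_add, add_mul, mul_sub, sub_mul, smul_add, smul_sub, smul_mul_assoc,
      mul_smul_comm, mul_assoc, neg_mul, mul_neg, one_mul, mul_one]
    module)) -hp.quad - hp.quad * v * c - c * v * hp.quad - c * h2 * c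

/-- An identity needed twice: in the opposite ring it shows that the flow preserves the relation
between `m(λ)` and `Σ̄₋`, and as it stands that the flow commutes with the action of `f₊` on
`u(λ)`. -/
theorem star_identity (h : FlowPoint q z c n G G' v w) {q' : R} (hq : q * q' = 1) (B : R) {s : A}
    (hs : IsULetter q c n s) :
    (q - 1) • (B • ((B • (s * s) + z • (s * c + c * s)) * v * s + z • (s * v * (c * c) * v * s)
        + s * v * (B • (s * s) + z • (s * c + c * s)))
      + z • (z • (c * c) * v * c + z • (c * v * (c * c) * v * c) + c * v * (z • (c * c)))
      - z • (B • (s * s) + z • (s * c + c * s) - z • (c * c))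
      - (B • (s * v * s) + z • (c * v * c) - z • (s - c)) * (B • s + z • c)
      - (B • s + z • c) * (B • (s * v * s) + z • (c * v * c) - z • (s - c)))
      = q • ((B • s + z • c) * w) - w * (B • s + z • c) := by
  have key : ∀ {p : A}, IsULetter q c n p →
      (q - 1) • (p * G * (G' * p) - c * G * p - p * c * G) = c * G * p - q • (p * (c * G)) := by
    intro p hp
    have h1 := h.uLetter_c_G hp
    have h2 := h.uLetter_G_G'_uLetter hq hp
    linear_combination (norm := (
    simp only [smul_sub, mul_assoc]
    module)) h1 + (q - 1) • h2
  have k1 := key hs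
  have k2 := key h.isULetter
  rw [h.w_eq]
  rw [← h.G_eq, ← h.G'_eq] at *
  linear_combination (norm := (
    simp only [mul_add, add_mul, mul_sub, sub_mul, smul_add, smul_sub, smul_mul_assoc,
      mul_smul_comm, mul_assoc, neg_mul, mul_neg, smul_neg, one_mul, mul_one]
    module)) (B * z) • k1 + (z * z) • k2

open MulOpposite in
theorem flow_mSm (h : FlowPoint q z c n G G' v w) {q' : R} (hq : q * q' = 1)
    (hc : q • (c * T) = T * c) (hn : n * T = q • (T * n) - ((q - 1) * z) • (n * n)) {x : R}
    (hx : ∀ b : A, x • b = 0 → b = 0) {b y E : A} (hy : IsMLetter q c n y)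
    (hyT : y * T = q • (T * y) - (q - 1) • ((x - z) • (y * y) + z • (y * n + n * y)))
    (hb : x • b = (x - z) • y + z • n)
    (hE : x • E = -((x - z) • (y * w * y) + z • (n * w * n) - z • (y - n))) :
    E * T + b * v = q • (v * b + T * E) - ((q - 1) * x) • (E * b + b * E) := by
  rw [← sub_eq_zero]
  apply hx
  have h1 := h.w_mul_Sm hc hn
  have k := congrArg unop (h.toOp.star_identity hq (x - z) hy.toOp)
  simp only [unop_add, unop_mul, unop_sub, unop_smul, unop_op] at k
  linear_combination (norm := (
    simp only [mul_add, add_mul, mul_sub, sub_mul, smul_add, smul_sub, smul_mul_assoc,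
      mul_smul_comm, mul_assoc, neg_mul, mul_neg, smul_neg, one_mul]
    module)) hE * T + hb * v - q • (v * hb + T * hE)
      + (q - 1) • (hE * (x • b) + (x • b) * hE - ((x - z) • (y * w * y) + z • (n * w * n) - z • (y - n)) * hb - hb * ((x - z) • (y * w * y) + z • (n * w * n) - z • (y - n)))
      + k - (x - z) • (y * w * hyT + y * h1 * y + hyT * w * y)
      - z • (n * w * hn + n * h1 * n + hn * w * n) + z • (hyT - hn)

end Charges

end FlowPoint

/-! ### The Serre relations and the action of `f_ε` -/

section
variable {R A : Type*} [CommRing R] [Ring A] [Algebra R A]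

/-- The derivative of the Serre expression `a³ b - k (a² b a - a b a²) - b a³` in the direction
`(a', b')`. -/
def serreVar (k : R) (a b a' b' : A) : A :=
  a' * a * a * b + a * a' * a * b + a * a * a' * b + a * a * a * b'
    - k • (a' * a * b * a + a * a' * b * a + a * a * b' * a + a * a * b * a'
      - (a' * b * a * a + a * b' * a * a + a * b * a' * a + a * b * a * a'))
    - (b' * a * a * a + b * a' * a * a + b * a * a' * a + b * a * a * a')

namespace FlowPoint
variable {q z : R} {c n G G' v w S T : A}

theorem v_eq_n (h : FlowPoint q z c n G G' v w) : v = -(z • (n + n * w * n)) := by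
  rw [h.v_eq, ← h.G_eq', add_mul, one_mul]

theorem n_mul_w (h : FlowPoint q z c n G G' v w) {q' : R} (hq : q * q' = 1) :
    n * w - q • (w * n) = (q - 1) • (n * w * w * n) := by
  have h1 := h.mLetter_mul_w h.isMLetter
  have h2 := h.mLetter_w_w_mLetter hq h.isMLetter
  linear_combination (norm := (
    simp only [smul_mul_assoc,
      mul_smul_comm, mul_assoc]
    module)) h1 - (q - 1) • h2

theorem v_c_c_v (h : FlowPoint q z c n G G' v w) {q' : R} (hq : q * q' = 1) :
    v * (c * c) * v = w * (n * n) * w := by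
  have h1 := h.sandwich hq h.isULetter h.isMLetter h.nc
  have e1 : v * (c * c) * v = (z * z) • (n * G' * c * (c * G * n)) := by
    have : v * (c * c) * v = -(z • (n * G')) * (c * c) * -(z • (G * n)) := by
      rw [← h.v_eq, ← h.v_eq']
    rw [this]
    simp [mul_assoc, smul_smul]
  have e2 : w * (n * n) * w = (z * z) • (c * G * n * (n * G' * c)) := by
    have : w * (n * n) * w = -(z • (c * G)) * (n * n) * -(z • (G' * c)) := by
      rw [← h.w_eq, ← h.w_eq']
    rw [this]
    simp [mul_assoc, smul_smul]
  rw [e1, e2, h1]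

set_option maxHeartbeats 2000000 in
/-- The derivation `S ↦ w`, `T ↦ v` preserves the Serre relations. Once `n`, `w` are moved to the
right of `S`, `T`, what is left is a multiple of a relation between powers of `w` and `n`. -/
theorem flow_serre (h : FlowPoint q z c n G G' v w) {q' : R} (hq : q * q' = 1)
    (hcS : c * S = q • (S * c)) (hnS : q • (n * S) = S * n + (q - 1) • 1)
    (hcT : q • (c * T) = T * c) (hnT : n * T = q • (T * n) - ((q - 1) * z) • (n * n)) :
    serreVar (q + 1 + q') S T w v = 0 ∧ serreVar (q + 1 + q') T S v w = 0 := by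
  have inv : ∀ {a b : A}, q • a = b → a = q' • b := by
    rintro a _ rfl
    rw [smul_smul, mul_comm, hq, one_smul]
  have wS := h.w_mul_Sp hcS hnS
  have nS := inv hnS
  have nw := h.n_mul_w hq
  have wT : w * T = q' • (T * w - z • (n * w - q • (w * n))) := by
    apply inv
    rw [nw, h.w_mul_Sm hcT hnT, smul_smul, mul_comm z]
    congr 2
    simpa [mul_assoc] using (h.mLetter_w_w_mLetter hq h.isMLetter).symm
  have wS' : ∀ b, w * (S * b) = (q • (S * w) + (q - 1) • (w * w)) * b := fun b => by
    rw [← mul_assoc, wS]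
  have nS' : ∀ b, n * (S * b) = (q' • (S * n + (q - 1) • 1)) * b := fun b => by
    rw [← mul_assoc, nS]
  have wT' : ∀ b, w * (T * b) = (q' • (T * w - z • (n * w - q • (w * n)))) * b := fun b => by
    rw [← mul_assoc, wT]
  have nT' : ∀ b, n * (T * b) = (q • (T * n) - ((q - 1) * z) • (n * n)) * b := fun b => by
    rw [← mul_assoc, hnT]
  -- the powers of `w` are moved past `n` by the same rule
  have nw2 : n * w * w - q ^ 2 • (w * w * n) = (q ^ 2 - 1) • (n * w * w * w * n) := by
    linear_combination (norm := (
      simp only [mul_sub, sub_mul, smul_add, smul_sub, smul_mul_assoc,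
        mul_smul_comm, mul_assoc]
      module)) nw * w + q • (w * nw) + (q - 1) • (n * w * w * nw - nw * w * w * n)
  have nw3 : n * w * w * w - q ^ 3 • (w * w * w * n) = (q ^ 3 - 1) • (n * w * w * w * w * n) := by
    linear_combination (norm := (
      simp only [mul_sub, sub_mul, smul_sub, smul_mul_assoc,
        mul_smul_comm, mul_assoc]
      module)) nw2 * w + q ^ 2 • (w * w * nw) + (q ^ 2 - 1) • (n * w * w * w * nw)
        - (q - 1) • (nw2 * w * w * n)
  rw [h.v_eq_n]
  constructor
  · have key : z • ((q' + q' ^ 2 - q' ^ 3 - 1) • (n * w * w * w - q ^ 3 • (w * w * w * n)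
        - (q ^ 3 - 1) • (n * w * w * w * w * n))) = 0 := by
      rw [nw3, sub_self, smul_zero, smul_zero]
    rw [← key]
    simp only [serreVar, mul_add, add_mul, mul_sub, sub_mul, smul_add, smul_sub, smul_mul_assoc,
      mul_smul_comm, mul_assoc, neg_mul, mul_neg, smul_neg, one_mul, mul_one, wS, nS, wT,
      wS', nS', wT']
    match_scalars <;> grind
  · have key : z ^ 3 • (q' • (n * n * (n * w - q • (w * n) - (q - 1) • (n * w * w * n)))
        - (1 + q') • (n * (n * w - q • (w * n) - (q - 1) • (n * w * w * n)) * n)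
        + (n * w - q • (w * n) - (q - 1) • (n * w * w * n)) * (n * n)) = 0 := by
      simp [nw]
    rw [← key]
    simp only [serreVar, mul_add, add_mul, mul_sub, sub_mul, smul_add, smul_sub, smul_mul_assoc,
      mul_smul_comm, mul_assoc, neg_mul, mul_neg, smul_neg, one_mul, mul_one, nS, wT,
      hnT, wS', nS', wT', nT']
    match_scalars <;> grind

/-- The three identities that follow express that the flow commutes with the action of `f₊` on
`m(λ)`, of `f₋` on `u(λ)`, and of `f₋` on `m(λ)`. -/
theorem equiv_plus_m (h : FlowPoint q z c n G G' v w) {q' : R} (hq : q * q' = 1) (B : R) {y : A}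
    (hy : IsMLetter q c n y) :
    -((q - 1) • (B • (y * (w * w) * y) + z • (n * (w * w) * n))) =
      q • (w * (B • y + z • n)) - (B • y + z • n) * w := by
  have key : ∀ {y : A}, IsMLetter q c n y →
      -((q - 1) • (y * (w * w) * y)) = q • (w * y) - y * w := fun hy => by
    have h1 := h.mLetter_mul_w hy
    have h2 := h.mLetter_w_w_mLetter hq hy
    linear_combination (norm := (
      simp only [smul_mul_assoc,
        mul_smul_comm, mul_assoc]
      module)) h1 - (q - 1) • h2
  have k1 := key hy
  have k2 := key h.isMLetter
  linear_combination (norm := (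
      simp only [mul_add, add_mul, smul_add, smul_sub, smul_mul_assoc,
        mul_smul_comm, mul_assoc, smul_neg]
      module)) B • k1 + z • k2

theorem equiv_minus_u (h : FlowPoint q z c n G G' v w) {q' : R} (hq : q * q' = 1) (B : R) {s : A}
    (hs : IsULetter q c n s) :
    (q - 1) • (B • (v * s + s * v + s * (v * v) * s) + z • (v * c + c * v + c * (v * v) * c)) =
      q • (v * (B • s + z • c)) - (B • s + z • c) * v := by
  have key : ∀ {s : A}, IsULetter q c n s →
      (q - 1) • (v * s + s * v + s * (v * v) * s) = q • (v * s) - s * v := fun hs => by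
    have h1 := h.v_mul_uLetter hs
    have h2 := h.uLetter_v_v_uLetter hq hs
    linear_combination (norm := (
      simp only [smul_add, smul_mul_assoc,
        mul_smul_comm, mul_assoc]
      module)) -h1 + (q - 1) • h2
  have k1 := key hs
  have k2 := key h.isULetter
  linear_combination (norm := (
      simp only [mul_add, add_mul, smul_add, smul_sub, smul_mul_assoc,
        mul_smul_comm, mul_assoc]
      module)) B • k1 + z • k2

theorem equiv_minus_m (h : FlowPoint q z c n G G' v w) {q' : R} (hq : q * q' = 1) (B : R) {y : A}
    (hy : IsMLetter q c n y) :
    ((q - 1) * z) • (B • (y * G' * (G * y)) + z • (n * G' * (G * n))) =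
      v * (B • y + z • n) - q • ((B • y + z • n) * v) := by
  have key : ∀ {y : A}, IsMLetter q c n y →
      ((q - 1) * z) • (y * G' * (G * y)) = v * y - q • (y * v) := fun hy => by
    have h1 := h.v_mul_mLetter hy
    have h2 := h.mLetter_G'_G_mLetter hq hy
    linear_combination (norm := (
      simp only [sub_mul, mul_assoc, one_mul]
      module)) -h1 + ((q - 1) * z) • h2
  have k1 := key hy
  have k2 := key h.isMLetter
  linear_combination (norm := (
      simp only [mul_add, add_mul, sub_mul, smul_add, smul_sub, smul_mul_assoc,
        mul_smul_comm, mul_assoc, one_mul]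
      module)) B • k1 + z • k2

end FlowPoint
end

/-! ### The derivatives of `v` and `u`, and the Riccati identity -/

section
variable {R A : Type*} [CommRing R] [Ring A] [Algebra R A]

namespace FlowPoint
variable {q z₁ z₂ : R} {c₁ n₁ G₁ G₁' v₁ w₁ c₂ n₂ G₂ G₂' v₂ w₂ : A}

/-- The derivative `V = H(μ₁)(v(μ₂))`, computed from `X = H(μ₁)(u(μ₂))` and `Y = H(μ₁)(m(μ₂))`. Up
to the factor `μ₂⁻¹ - μ₁⁻¹` it is antisymmetric in the two points, hence `V` itself is symmetric.
-/
theorem flow_v (h₁ : FlowPoint q z₁ c₁ n₁ G₁ G₁' v₁ w₁) (h₂ : FlowPoint q z₂ c₂ n₂ G₂ G₂' v₂ w₂)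
    {X Y V : A}
    (hX : (z₂ - z₁) • X = (z₂ • c₂ - z₁ • c₁) * v₁ * c₂ - z₁ • ((c₂ - c₁) * (1 + v₁ * c₁)))
    (hY : (z₂ - z₁) • Y = z₁ • ((1 + n₁ * w₁) * (n₂ - n₁)) - n₂ * w₁ * (z₂ • n₂ - z₁ • n₁))
    (hV : -(z₂ • Y) = V + z₂ • (V * c₂ * n₂ + v₂ * X * n₂ + v₂ * c₂ * Y)) :
    (z₂ - z₁) • V = z₁ • v₂ - z₂ • v₁ - z₂ • (v₂ * c₂ * v₁ + v₁ * c₂ * v₂)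
      + z₁ • (v₁ * c₁ * v₂ + v₂ * c₁ * v₁) := by
  have e1 : V = -(z₂ • (G₂ * Y * G₂')) + v₂ * X * v₂ := by
    refine (h₂.hz (c₂ * n₂)).mul_right_cancel ?_
    have a1 := h₂.G'_mul
    have a2 : v₂ * (1 + z₂ • (c₂ * n₂)) = -(z₂ • n₂) := by
      rw [h₂.v_eq', neg_mul, smul_mul_assoc, mul_assoc, a1, mul_one]
    have a3 := h₂.G_eq
    linear_combination (norm := (
      simp only [mul_add, add_mul, smul_add, smul_mul_assoc,
        mul_smul_comm, mul_assoc, neg_mul, mul_neg, smul_neg, one_mul, mul_one]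
      module)) -hV + z₂ • (G₂ * Y * a1) - v₂ * X * a2 - z₂ • (a3 * Y)
  have b1 : z₂ • (G₂ * n₂) = -v₂ := by rw [h₂.v_eq, neg_neg]
  have b2 : z₂ • (n₂ * G₂') = -v₂ := by rw [h₂.v_eq', neg_neg]
  have b3 : z₁ • (G₁ * n₁) = -v₁ := by rw [h₁.v_eq, neg_neg]
  have b4 : w₁ * n₁ = c₁ * v₁ := by
    have := h₁.G'_eq'.trans h₁.G'_eq.symm
    linear_combination (norm := module) this
  have b5 : w₁ = -(z₁ • (c₁ * (1 + v₁ * c₁))) := by rw [h₁.w_eq, h₁.G_eq]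
  rw [h₁.G_eq', ← h₁.G_eq] at hY
  rw [← h₁.G_eq] at b3
  rw [e1]
  have e2 : (z₂ - z₁) • (-(z₂ • (G₂ * Y * G₂')) + v₂ * X * v₂) =
      z₁ • (G₂ * (1 + v₁ * c₁) * v₂) - z₂ • (G₂ * v₁ * G₂') + v₂ * w₁ * v₂
        + z₁ • (v₂ * (c₁ * v₁) * G₂') + v₂ * ((z₂ - z₁) • X) * v₂ := by
    linear_combination (norm := (
      simp only [mul_add, add_mul, mul_sub, sub_mul, smul_add, smul_sub, smul_mul_assoc,
        mul_smul_comm, mul_assoc, neg_mul, mul_neg, smul_neg, one_mul, mul_one]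
      module)) -(z₂ • (G₂ * hY * G₂')) - z₁ • (G₂ * (1 + v₁ * c₁) * b2)
        + z₂ • (G₂ * b3 * G₂') + z₂ • (b1 * w₁ * n₂ * G₂') - v₂ * w₁ * b2
        - z₁ • (b1 * w₁ * n₁ * G₂') + z₁ • (v₂ * b4 * G₂')
  rw [e2, hX, b5, ← h₂.G_eq, ← h₂.G'_eq]
  simp only [mul_add, add_mul, mul_sub, sub_mul, smul_add, smul_sub, smul_mul_assoc,
    mul_smul_comm, mul_assoc, neg_mul, mul_neg, one_mul, mul_one]
  module

open MulOpposite in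
theorem flow_w (h₁ : FlowPoint q z₁ c₁ n₁ G₁ G₁' v₁ w₁) (h₂ : FlowPoint q z₂ c₂ n₂ G₂ G₂' v₂ w₂)
    {X Y W : A}
    (hX : (z₂ - z₁) • X = (z₂ • c₂ - z₁ • c₁) * v₁ * c₂ - z₁ • ((c₂ - c₁) * (1 + v₁ * c₁)))
    (hY : (z₂ - z₁) • Y = z₁ • ((1 + n₁ * w₁) * (n₂ - n₁)) - n₂ * w₁ * (z₂ • n₂ - z₁ • n₁))
    (hW : -(z₂ • X) = W + z₂ • (X * n₂ * w₂ + c₂ * Y * w₂ + c₂ * n₂ * W)) :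
    -((z₂ - z₁) • W) = z₁ • w₂ - z₂ • w₁ - z₂ • (w₁ * n₂ * w₂ + w₂ * n₂ * w₁)
      + z₁ • (w₂ * n₁ * w₁ + w₁ * n₁ * w₂) := by
  have hG : v₁ * c₁ = n₁ * w₁ := by
    have := h₁.G_eq'.trans h₁.G_eq.symm
    linear_combination (norm := module) -this
  have := congrArg unop (h₁.toOp.flow_v h₂.toOp (X := op (-Y)) (Y := op (-X)) (V := op (-W))
    (unop_injective ?_) (unop_injective ?_) (unop_injective ?_))
  · simp only [unop_add, unop_mul, unop_sub, unop_smul, unop_op, smul_neg] at this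
    rw [this]
    simp only [mul_assoc]
  · simp only [unop_add, unop_mul, unop_sub, unop_smul, unop_op, smul_neg, unop_one]
    linear_combination (norm := (
      simp only [add_mul, mul_sub, smul_add, smul_sub, mul_smul_comm, mul_assoc, one_mul]
      module)) -hY
  · simp only [unop_add, unop_mul, unop_sub, unop_smul, unop_op, smul_neg, unop_one]
    linear_combination (norm := (
      simp only [mul_add, sub_mul, smul_add, smul_sub, smul_mul_assoc,
        mul_assoc, mul_one]
      module)) -hX
  · simp only [unop_add, unop_mul, unop_smul, unop_op, unop_neg, smul_neg]
    linear_combination (norm := (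
      simp only [smul_add, mul_assoc, neg_mul, mul_neg, smul_neg, neg_neg]
      module)) -hW

end FlowPoint

/-- The second derivatives of `a = u(λ)` along `H(μ₁)` and `H(μ₂)` agree. Given `flow_v`, this is
an identity in free variables, as for two Riccati equations with compatible coefficients; the
hypotheses need only be cleared of the denominators `x - z₁`, `x - z₂`, `z₂ - z₁`. -/
theorem flow_comm_u {x z₁ z₂ : R} {a c₁ c₂ v₁ v₂ E₁ E₂ C₁₂ C₂₁ V₁₂ V₂₁ P₁₂ P₂₁ : A}
    (r₁ : ∀ b : A, (x - z₁) • b = 0 → b = 0) (r₂ : ∀ b : A, (x - z₂) • b = 0 → b = 0)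
    (r₃ : ∀ b : A, (z₂ - z₁) • b = 0 → b = 0)
    (hE₁ : (x - z₁) • E₁ = (x • a - z₁ • c₁) * v₁ * a - z₁ • ((a - c₁) * (1 + v₁ * c₁)))
    (hE₂ : (x - z₂) • E₂ = (x • a - z₂ • c₂) * v₂ * a - z₂ • ((a - c₂) * (1 + v₂ * c₂)))
    (hC₁₂ : (z₂ - z₁) • C₁₂ = (z₂ • c₂ - z₁ • c₁) * v₁ * c₂ - z₁ • ((c₂ - c₁) * (1 + v₁ * c₁)))
    (hC₂₁ : (z₁ - z₂) • C₂₁ = (z₁ • c₁ - z₂ • c₂) * v₂ * c₁ - z₂ • ((c₁ - c₂) * (1 + v₂ * c₂)))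
    (hV₁₂ : (z₂ - z₁) • V₁₂ = z₁ • v₂ - z₂ • v₁ - z₂ • (v₂ * c₂ * v₁ + v₁ * c₂ * v₂)
      + z₁ • (v₁ * c₁ * v₂ + v₂ * c₁ * v₁))
    (hV₂₁ : (z₁ - z₂) • V₂₁ = z₂ • v₁ - z₁ • v₂ - z₁ • (v₁ * c₁ * v₂ + v₂ * c₁ * v₁)
      + z₂ • (v₂ * c₂ * v₁ + v₁ * c₂ * v₂))
    (hP₁₂ : (x - z₂) • P₁₂ = (x • E₁ - z₂ • C₁₂) * v₂ * a + (x • a - z₂ • c₂) * V₁₂ * a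
      + (x • a - z₂ • c₂) * v₂ * E₁ - z₂ • ((E₁ - C₁₂) * (1 + v₂ * c₂)
      + (a - c₂) * (V₁₂ * c₂ + v₂ * C₁₂)))
    (hP₂₁ : (x - z₁) • P₂₁ = (x • E₂ - z₁ • C₂₁) * v₁ * a + (x • a - z₁ • c₁) * V₂₁ * a
      + (x • a - z₁ • c₁) * v₁ * E₂ - z₁ • ((E₂ - C₂₁) * (1 + v₁ * c₁)
      + (a - c₁) * (V₂₁ * c₁ + v₁ * C₂₁))) :
    P₁₂ = P₂₁ := by
  rw [← sub_eq_zero]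
  apply r₃; apply r₁; apply r₂
  linear_combination (norm := (
      simp only [mul_add, add_mul, mul_sub, sub_mul, smul_add, smul_sub, smul_mul_assoc,
        mul_smul_comm, mul_assoc, mul_one]
      module)) ((z₂ - z₁) * (x - z₁)) • hP₁₂ - ((z₂ - z₁) * (x - z₂)) • hP₂₁
    + (z₂ - z₁) • (x • (hE₁ * v₂ * a) + (x • a - z₂ • c₂) * v₂ * hE₁ - z₂ • (hE₁ * (1 + v₂ * c₂)))
    - (z₂ - z₁) • (x • (hE₂ * v₁ * a) + (x • a - z₁ • c₁) * v₁ * hE₂ - z₁ • (hE₂ * (1 + v₁ * c₁)))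
    + (x - z₁) • (-(z₂ • (hC₁₂ * v₂ * a)) + (x • a - z₂ • c₂) * hV₁₂ * a
      + z₂ • (hC₁₂ * (1 + v₂ * c₂)) - z₂ • ((a - c₂) * (hV₁₂ * c₂ + v₂ * hC₁₂)))
    + (x - z₂) • (-(z₁ • (hC₂₁ * v₁ * a)) + (x • a - z₁ • c₁) * hV₂₁ * a
      + z₁ • (hC₂₁ * (1 + v₁ * c₁)) - z₁ • ((a - c₁) * (hV₂₁ * c₁ + v₁ * hC₂₁)))

end

/-! ### Coefficientwise maps, skew derivations and divided differences -/

section SerMap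
variable {A B C : Type*} [Ring A] [Ring B] [Ring C]

/-- An additive map applied to all coefficients of a power series. -/
def serMap (D : A →+ B) : A⟦X⟧ →+ B⟦X⟧ where
  toFun s := PowerSeries.mk fun i => D (PowerSeries.coeff i s)
  map_zero' := by ext; simp
  map_add' _ _ := by ext; simp

@[simp] theorem coeff_serMap (D : A →+ B) (i : ℕ) (s : A⟦X⟧) :
    PowerSeries.coeff i (serMap D s) = D (PowerSeries.coeff i s) :=
  PowerSeries.coeff_mk i fun i => D (PowerSeries.coeff i s)

@[simp] theorem serMap_C (D : A →+ B) (a : A) :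
    serMap D (PowerSeries.C a) = PowerSeries.C (D a) := by
  ext i
  simp only [coeff_serMap, PowerSeries.coeff_C]
  split_ifs <;> simp

@[simp] theorem serMap_X_mul (D : A →+ B) (s : A⟦X⟧) :
    serMap D (PowerSeries.X * s) = PowerSeries.X * serMap D s := by
  ext i
  cases i with
  | zero => simp [PowerSeries.coeff_zero_X_mul]
  | succ i => simp [PowerSeries.coeff_succ_X_mul]

theorem serMap_C_mul {D : A →+ B} {a : A} {b : B} (h : ∀ c, D (a * c) = b * D c) (s : A⟦X⟧) :
    serMap D (PowerSeries.C a * s) = PowerSeries.C b * serMap D s := by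
  ext i
  simp [PowerSeries.coeff_C_mul, h]

theorem serMap_map (D : B →+ C) (f : A →+* B) (s : A⟦X⟧) :
    serMap D (PowerSeries.map f s) = serMap (D.comp f.toAddMonoidHom) s := by
  ext i; simp

theorem map_serMap (g : B →+* C) (D : A →+ B) (s : A⟦X⟧) :
    PowerSeries.map g (serMap D s) = serMap (g.toAddMonoidHom.comp D) s := by
  ext i; simp

/-- `D` is a skew derivation between the ring homomorphisms `g` and `f`. -/
def IsSkew (g f : A →+* B) (D : A →+ B) : Prop := ∀ a b, D (a * b) = D a * f b + g a * D b

theorem IsSkew.serMap {g f : A →+* B} {D : A →+ B} (h : IsSkew g f D) :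
    IsSkew (PowerSeries.map g) (PowerSeries.map f) (serMap D) := by
  intro s t
  ext i
  simp only [coeff_serMap, PowerSeries.coeff_mul, map_sum, map_add, PowerSeries.coeff_map,
    ← Finset.sum_add_distrib]
  exact Finset.sum_congr rfl fun p _ => h _ _

theorem IsSkew.map_one {g f : A →+* B} {D : A →+ B} (h : IsSkew g f D) : D 1 = 0 := by
  have := h 1 1
  simpa using this

theorem IsSkew.comp_left {g f : A →+* B} {D : A →+ B} (h : IsSkew g f D) (φ : B →+* C) :
    IsSkew (φ.comp g) (φ.comp f) (φ.toAddMonoidHom.comp D) := by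
  intro a b
  simp [h a b]

theorem IsSkew.comp_right {g f : A →+* B} {D : A →+ B} (h : IsSkew g f D) (φ : C →+* A) :
    IsSkew (g.comp φ) (f.comp φ) (D.comp φ.toAddMonoidHom) := by
  intro a b
  simp [h (φ a) (φ b)]

end SerMap

section Swap
variable {A B : Type*} [Ring A] [Ring B]

/-- Exchange of the two variables of a bivariate power series. -/
def serSwap : A⟦X⟧⟦X⟧ →+* A⟦X⟧⟦X⟧ where
  toFun s := PowerSeries.mk fun i => PowerSeries.mk fun j =>
    PowerSeries.coeff i (PowerSeries.coeff j s)
  map_zero' := by ext; simp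
  map_one' := by
    ext i j
    simp only [PowerSeries.coeff_mk, PowerSeries.coeff_one]
    split_ifs <;> simp_all [PowerSeries.coeff_one]
  map_add' _ _ := by ext; simp
  map_mul' s t := by
    ext i j
    simp only [PowerSeries.coeff_mk, PowerSeries.coeff_mul, map_sum]
    rw [Finset.sum_comm]

@[simp] theorem coeff_coeff_serSwap (i j : ℕ) (s : A⟦X⟧⟦X⟧) :
    PowerSeries.coeff i (PowerSeries.coeff j (serSwap s)) =
      PowerSeries.coeff j (PowerSeries.coeff i s) := by
  simp [serSwap]

@[simp] theorem serSwap_serSwap (s : A⟦X⟧⟦X⟧) : serSwap (serSwap s) = s := by ext; simp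

@[simp] theorem serSwap_C (s : A⟦X⟧) :
    serSwap (PowerSeries.C s) = PowerSeries.map PowerSeries.C s := by
  ext i j
  simp only [coeff_coeff_serSwap, PowerSeries.coeff_C, PowerSeries.coeff_map]
  split_ifs <;> simp

@[simp] theorem serSwap_map_C (s : A⟦X⟧) :
    serSwap (PowerSeries.map PowerSeries.C s) = PowerSeries.C s := by
  rw [← serSwap_C, serSwap_serSwap]

@[simp] theorem serSwap_X : serSwap (PowerSeries.X : A⟦X⟧⟦X⟧) = PowerSeries.C PowerSeries.X := by
  rw [← PowerSeries.map_X (PowerSeries.C (R := A)), serSwap_map_C]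

end Swap

section DivDiff
variable {A : Type*} [Ring A]

/-- The divided difference `(s(x) - s(y)) / (x - y)`, with `x` the outer and `y` the inner
variable. -/
def divDiff (s : A⟦X⟧) : A⟦X⟧⟦X⟧ :=
  PowerSeries.mk fun i => PowerSeries.mk fun j => PowerSeries.coeff (i + j + 1) s

theorem mul_divDiff (s : A⟦X⟧) :
    (PowerSeries.X - PowerSeries.C PowerSeries.X) * divDiff s =
      PowerSeries.map PowerSeries.C s - PowerSeries.C s := by
  have hc : ∀ i j, PowerSeries.coeff j (PowerSeries.coeff i (divDiff s)) =
      PowerSeries.coeff (i + j + 1) s := fun i j => by simp [divDiff]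
  ext i j
  rw [sub_mul]
  simp only [map_sub, PowerSeries.coeff_C_mul, PowerSeries.coeff_map]
  rcases i with _ | i <;> rcases j with _ | j
  · simp [PowerSeries.coeff_zero_X_mul]
  · simp [PowerSeries.coeff_zero_X_mul, PowerSeries.coeff_succ_X_mul, PowerSeries.coeff_C]
    simpa using hc 0 j
  · simp [PowerSeries.coeff_zero_X_mul, PowerSeries.coeff_succ_X_mul, PowerSeries.coeff_C, hc]
  · simp [PowerSeries.coeff_succ_X_mul, hc,
      show i + 1 + j + 1 = i + (j + 1) + 1 by ring]

end DivDiff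

section Regular
variable {A : Type*} [Ring A]

/-- `r` is not a left zero divisor. -/
def Reg (r : A) : Prop := ∀ b, r * b = 0 → b = 0

theorem Reg.cancel {r : A} (h : Reg r) {b c : A} (hbc : r * b = r * c) : b = c :=
  sub_eq_zero.1 (h _ (by rw [mul_sub, hbc, sub_self]))

theorem reg_X : Reg (PowerSeries.X : A⟦X⟧) := by
  intro b hb
  ext i
  have := congrArg (PowerSeries.coeff (i + 1)) hb
  simpa [PowerSeries.coeff_succ_X_mul] using this

theorem Reg.C {r : A} (h : Reg r) : Reg (PowerSeries.C r : A⟦X⟧) := by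
  intro b hb
  ext i
  have := congrArg (PowerSeries.coeff i) hb
  rw [PowerSeries.coeff_C_mul] at this
  exact h _ (by simpa using this)

theorem Reg.X_sub_C {r : A} (h : Reg r) : Reg (PowerSeries.X - PowerSeries.C r : A⟦X⟧) := by
  intro b hb
  have e : PowerSeries.C r * b = PowerSeries.X * b := by
    rw [sub_mul, sub_eq_zero] at hb
    exact hb.symm
  ext i
  induction i with
  | zero =>
    have := congrArg (PowerSeries.coeff 0) e
    rw [PowerSeries.coeff_C_mul, PowerSeries.coeff_zero_X_mul] at this
    exact h _ this
  | succ i ih =>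
    have := congrArg (PowerSeries.coeff (i + 1)) e
    rw [PowerSeries.coeff_C_mul, PowerSeries.coeff_succ_X_mul, ih] at this
    exact h _ (by simpa using this)

theorem Reg.neg {r : A} (h : Reg r) : Reg (-r) := fun b hb => h b (by simpa using hb)

theorem Reg.sub_comm {r s : A} (h : Reg (r - s)) : Reg (s - r) := by
  rw [← neg_sub]; exact h.neg

theorem isUnit_one_add_of_constantCoeff {s : A⟦X⟧}
    (h : IsUnit (1 + PowerSeries.constantCoeff s)) : IsUnit (1 + s) := by
  rw [PowerSeries.isUnit_iff_constantCoeff]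
  simpa using h

theorem isUnit_one_add_X_mul (b : A⟦X⟧) : IsUnit (1 + PowerSeries.X * b) :=
  isUnit_one_add_of_constantCoeff (by simp)

theorem isUnit_one_add_C_mul {z : A} (h : ∀ b, IsUnit (1 + z * b)) (b : A⟦X⟧) :
    IsUnit (1 + PowerSeries.C z * b) :=
  isUnit_one_add_of_constantCoeff (by simpa using h _)

end Regular

/-! ### Letters, and scalars in the center -/

section Letters
variable {R A : Type*} [CommRing R] [Ring A] [Algebra R A] {q x z : R} {a c n t v w b D : A}

/-- In this part `t = (a - c) / (x - z)` is a divided difference, and `a + z t` the letter. -/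
theorem smul_eq_letter (ht : (x - z) • t = a - c) : x • a = (x - z) • (a + z • t) + z • c := by
  linear_combination (norm := module) -z • ht

theorem isULetter_of_rel (hxz : ∀ b : A, (x - z) • b = 0 → b = 0) (ht : (x - z) • t = a - c)
    (hr : (x • a - z • c) * (a - c) = q • ((a - c) * (x • a - z • c)))
    (hna : n * a = q • (a * n)) (hnc : n * c = q • (c * n)) :
    IsULetter q c n (a + z • t) := by
  have hx : (a + z • t) - c = x • t := by linear_combination (norm := module) -ht
  have hs : (x - z) • (a + z • t) = x • a - z • c := by
    linear_combination (norm := module) -(smul_eq_letter ht)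
  constructor
  · rw [← sub_eq_zero, hx]
    apply hxz; apply hxz
    rw [← hs, ← ht] at hr
    linear_combination (norm := (
      simp only [mul_add, add_mul, smul_add, smul_sub, smul_mul_assoc,
        mul_smul_comm]
      module)) x • hr
  · rw [← sub_eq_zero]
    apply hxz
    linear_combination (norm := (
      simp only [mul_add, add_mul, mul_sub, sub_mul, smul_add, smul_sub, smul_mul_assoc,
        mul_smul_comm]
      module)) z • (n * ht) + x • hna - z • hnc - (q * z) • (ht * n)

theorem isMLetter_of_rel (hxz : ∀ b : A, (x - z) • b = 0 → b = 0) (ht : (x - z) • t = b - n)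
    (hr : (b - n) * (x • b - z • n) = q • ((x • b - z • n) * (b - n)))
    (hbc : b * c = q • (c * b)) (hnc : n * c = q • (c * n)) :
    IsMLetter q c n (b + z • t) := by
  have hx : (b + z • t) - n = x • t := by linear_combination (norm := module) -ht
  have hs : (x - z) • (b + z • t) = x • b - z • n := by
    linear_combination (norm := module) -(smul_eq_letter ht)
  constructor
  · rw [← sub_eq_zero, hx]
    apply hxz; apply hxz
    rw [← hs, ← ht] at hr
    linear_combination (norm := (
      simp only [mul_add, add_mul, smul_add, smul_sub, smul_mul_assoc,
        mul_smul_comm]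
      module)) x • hr
  · rw [← sub_eq_zero]
    apply hxz
    linear_combination (norm := (
      simp only [mul_add, add_mul, mul_sub, sub_mul, smul_add, smul_sub, smul_mul_assoc,
        mul_smul_comm]
      module)) z • (ht * c) + x • hbc - z • hnc - (q * z) • (c * ht)

theorem smul_flow_u (ht : (x - z) • t = a - c)
    (hD : D = (a + z • t) * v * a - z • (t * (1 + v * c))) :
    x • D = (x - z) • ((a + z • t) * v * (a + z • t)) + z • (c * v * c)
      - z • ((a + z • t) - c) := by
  have hx : (a + z • t) - c = x • t := by linear_combination (norm := module) -ht
  rw [hD, hx]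
  linear_combination (norm := (
      simp only [mul_add, add_mul, sub_mul, smul_add, smul_sub, smul_mul_assoc,
        mul_smul_comm, mul_assoc, mul_one]
      module)) (a + z • t) * v * smul_eq_letter ht + z • (hx * (v * c))

theorem smul_flow_m (ht : (x - z) • t = b - n)
    (hD : D = -(b * w * (b + z • t) - z • ((1 + n * w) * t))) :
    x • D = -((x - z) • ((b + z • t) * w * (b + z • t)) + z • (n * w * n)
      - z • ((b + z • t) - n)) := by
  have hx : (b + z • t) - n = x • t := by linear_combination (norm := module) -ht
  rw [hD, hx]
  linear_combination (norm := (
      simp only [mul_add, add_mul, mul_sub, smul_add, smul_sub, smul_mul_assoc,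
        mul_smul_comm, mul_assoc, one_mul, smul_neg]
      module)) -(smul_eq_letter ht * w * (b + z • t)) - z • (n * w * hx)

end Letters

section CenterInstances
variable (W : Type*) [Ring W]

/-- Shortcut instances: series rings are regarded as algebras over their centers, which contain
`q` as well as the variables. -/
instance centerAlgebra : Algebra (Subring.center W) W := inferInstance

instance centerModule : Module (Subring.center W) W := (centerAlgebra W).toModule

instance centerSMul : SMul (Subring.center W) W := (centerAlgebra W).toSMul

instance centerDistribMulAction : DistribMulAction (Subring.center W) W :=
  (centerModule W).toDistribMulAction

instance centerMulAction : MulAction (Subring.center W) W :=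
  (centerDistribMulAction W).toMulAction

instance centerDistribSMul : DistribSMul (Subring.center W) W :=
  (centerDistribMulAction W).toDistribSMul

instance centerSMulZeroClass : SMulZeroClass (Subring.center W) W :=
  (centerDistribSMul W).toSMulZeroClass

end CenterInstances

section Center

/-- The element `q` of the center. -/
def qC (W : Type*) [Ring W] [Algebra Kq W] : Subring.center W :=
  ⟨algebraMap Kq W (qp 1), Subring.mem_center_iff.2 fun b => (Algebra.commutes _ b).symm⟩

/-- The element `q⁻¹` of the center. -/
def qC' (W : Type*) [Ring W] [Algebra Kq W] : Subring.center W :=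
  ⟨algebraMap Kq W (qp (-1)), Subring.mem_center_iff.2 fun b => (Algebra.commutes _ b).symm⟩

theorem qp_mul_qp (i j : ℤ) : qp i * qp j = qp (i + j) := (LaurentPolynomial.T_add i j).symm

theorem qp_zero : qp 0 = 1 := LaurentPolynomial.T_zero

section
variable (W : Type*) [Ring W] [Algebra Kq W]

theorem qC_mul_qC' : qC W * qC' W = 1 := by
  apply Subtype.ext
  change algebraMap Kq W _ * algebraMap Kq W _ = 1
  rw [← map_mul, qp_mul_qp, add_neg_cancel, qp_zero, map_one]

variable {W}
theorem qC_smul (b : W) : qC W • b = qp 1 • b := (Algebra.smul_def _ b).symm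

theorem qC'_smul (b : W) : qC' W • b = qp (-1) • b := (Algebra.smul_def _ b).symm

theorem qp_smul_qp_neg (i : ℤ) (b : W) : qp i • qp (-i) • b = b := by
  rw [smul_smul, qp_mul_qp, add_neg_cancel, qp_zero, one_smul]

theorem qp_neg_smul_qp (i : ℤ) (b : W) : qp (-i) • qp i • b = b := by
  rw [smul_smul, qp_mul_qp, neg_add_cancel, qp_zero, one_smul]

omit [Algebra Kq W] in
theorem center_smul_def (r : Subring.center W) (b : W) : r • b = r.1 * b := rfl
end

variable {A : Type*} [Ring A]

/-- The variable as an element of the center. -/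
def xC (A : Type*) [Ring A] : Subring.center A⟦X⟧ :=
  ⟨PowerSeries.X, Subring.mem_center_iff.2 fun b => (PowerSeries.commute_X b)⟩

/-- A central element of the coefficient ring as a central constant series. -/
def liftC (r : Subring.center A) : Subring.center A⟦X⟧ :=
  ⟨PowerSeries.C r.1, Subring.mem_center_iff.2 fun b => by
    ext i
    rw [PowerSeries.coeff_C_mul, PowerSeries.coeff_mul_C]
    exact Subring.mem_center_iff.1 r.2 _⟩

variable [Algebra Kq A]

theorem C_qC : PowerSeries.C (qC A).1 = (qC A⟦X⟧).1 := by
  ext i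
  simp [qC, PowerSeries.algebraMap_apply, PowerSeries.coeff_C]

theorem serSwap_qC : serSwap (qC A⟦X⟧⟦X⟧).1 = (qC A⟦X⟧⟦X⟧).1 := by
  rw [← C_qC, ← C_qC, serSwap_C, PowerSeries.map_C]

end Center

section Transport
variable {W V : Type*} [Ring W] [Algebra Kq W] [Ring V] [Algebra Kq V]

theorem map_qC_smul {φ : W →+* V} (hφ : φ (qC W).1 = (qC V).1) (b : W) :
    φ (qC W • b) = qC V • φ b := by
  rw [center_smul_def, center_smul_def, map_mul, hφ]

theorem FlowPoint.map {z : Subring.center W} {c n G G' v w : W}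
    (h : FlowPoint (qC W) z c n G G' v w) (φ : W →+* V) (hφ : φ (qC W).1 = (qC V).1)
    {z' : Subring.center V} (hz' : φ z.1 = z'.1) (hu : ∀ b, IsUnit (1 + z'.1 * b)) :
    FlowPoint (qC V) z' (φ c) (φ n) (φ G) (φ G') (φ v) (φ w) := by
  have hs : ∀ b, φ (z • b) = z' • φ b := fun b => by
    rw [center_smul_def, center_smul_def, map_mul, hz']
  constructor
  · rw [← map_mul, h.nc, map_qC_smul hφ, map_mul]
  · exact hu
  · simpa [hs] using congrArg φ h.mul_G
  · simpa [hs] using congrArg φ h.G_mul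
  · simpa [hs] using congrArg φ h.mul_G'
  · simpa [hs] using congrArg φ h.G'_mul
  · simpa [hs] using congrArg φ h.v_eq
  · simpa [hs] using congrArg φ h.v_eq'
  · simpa [hs] using congrArg φ h.w_eq
  · simpa [hs] using congrArg φ h.w_eq'

theorem IsULetter.map {c n p : W} (h : IsULetter (qC W) c n p) (φ : W →+* V)
    (hφ : φ (qC W).1 = (qC V).1) : IsULetter (qC V) (φ c) (φ n) (φ p) := by
  constructor
  · simpa [map_qC_smul hφ] using congrArg φ h.quad
  · simpa [map_qC_smul hφ] using congrArg φ h.comm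

theorem IsMLetter.map {c n p : W} (h : IsMLetter (qC W) c n p) (φ : W →+* V)
    (hφ : φ (qC W).1 = (qC V).1) : IsMLetter (qC V) (φ c) (φ n) (φ p) := by
  constructor
  · simpa [map_qC_smul hφ] using congrArg φ h.quad
  · simpa [map_qC_smul hφ] using congrArg φ h.comm

end Transport

section Scalars
variable {A : Type*} [Ring A] [Algebra Kq A]

theorem map_C_qC : PowerSeries.map (PowerSeries.C (R := A)) (qC A⟦X⟧).1 = (qC A⟦X⟧⟦X⟧).1 := by
  rw [← C_qC, PowerSeries.map_C, C_qC, C_qC]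

theorem C_qC_smul (b : A) : PowerSeries.C (qC A • b) = qC A⟦X⟧ • PowerSeries.C b :=
  map_qC_smul (φ := PowerSeries.C (R := A)) C_qC b

theorem map_C_qC_smul (b : A⟦X⟧) : PowerSeries.map PowerSeries.C (qC A⟦X⟧ • b) =
    qC A⟦X⟧⟦X⟧ • PowerSeries.map PowerSeries.C b :=
  map_qC_smul (φ := PowerSeries.map (PowerSeries.C (R := A))) map_C_qC b

theorem map_map_C_qC_smul (b : A⟦X⟧⟦X⟧) :
    PowerSeries.map (PowerSeries.map PowerSeries.C) (qC A⟦X⟧⟦X⟧ • b) =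
      qC A⟦X⟧⟦X⟧⟦X⟧ • PowerSeries.map (PowerSeries.map PowerSeries.C) b :=
  map_qC_smul (φ := PowerSeries.map (PowerSeries.map (PowerSeries.C (R := A))))
    (by rw [← C_qC, PowerSeries.map_C, map_C_qC, C_qC]) b

theorem serSwap_qC_smul (b : A⟦X⟧⟦X⟧) :
    serSwap (qC A⟦X⟧⟦X⟧ • b) = qC A⟦X⟧⟦X⟧ • serSwap b :=
  map_qC_smul (φ := serSwap (A := A)) serSwap_qC b

end Scalars

open PowerSeries (C X coeff constantCoeff)

/-! ### The flow as a power series -/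

section

variable {A : Type} [Ring A]

/-- The relations of `ℂ[H₋\B₋]_q` for two series with coefficients in an algebra `A`. -/
structure QRel [Algebra Kq A] (U M : A⟦X⟧) : Prop where
  uu : quadLeft U = qp 1 • quadRight U
  mm : quadLeft M = qp (-1) • quadRight M
  um : inLam U * inMu M = qp (-1) • (inMu M * inLam U)

/-- The letter `(λ⁻¹s(λ) - μ⁻¹s(μ)) / (λ⁻¹ - μ⁻¹)`. In contrast to `inLam` and `inMu`, the outer
variable is `λ⁻¹` and the inner variable is `μ⁻¹`, in this definition and in `flowU`, `flowM`. -/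
def letter (s : A⟦X⟧) : A⟦X⟧⟦X⟧ :=
  PowerSeries.map C s + C X * divDiff s

/-- The series `H(μ)(u(λ))`. -/
def flowU (U M : A⟦X⟧) : A⟦X⟧⟦X⟧ :=
  letter U * C (negInvAdd U M) * PowerSeries.map C U
    - C X *
      (divDiff U * (1 + C (negInvAdd U M) * C U))

/-- The series `H(μ)(m(λ))`. -/
def flowM (U M : A⟦X⟧) : A⟦X⟧⟦X⟧ :=
  -(PowerSeries.map C M * C (negInvAdd M U) * letter M
    - C X *
      ((1 + C M * C (negInvAdd M U)) * divDiff M))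

/-- The inverse of `1 + X s t`. -/
def resolv (s t : A⟦X⟧) : A⟦X⟧ := PowerSeries.invOfUnit (1 + X * s * t) 1

theorem mul_resolv (s t : A⟦X⟧) : (1 + X * (s * t)) * resolv s t = 1 := by
  rw [resolv, ← mul_assoc]
  exact PowerSeries.mul_invOfUnit _ _ (by simp)

theorem resolv_mul (s t : A⟦X⟧) : resolv s t * (1 + X * (s * t)) = 1 := by
  rw [resolv, ← mul_assoc]
  exact PowerSeries.invOfUnit_mul _ _ (by simp)

theorem resolv_mul_comm (s t : A⟦X⟧) : resolv s t * s = s * resolv t s := by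
  have h : s * (1 + X * (t * s)) = (1 + X * (s * t)) * s := by
    rw [mul_add, add_mul, mul_one, one_mul, ← mul_assoc, PowerSeries.commute_X s]
    simp only [mul_assoc]
  calc _ = resolv s t * s * ((1 + X * (t * s)) * resolv t s) := by
        rw [mul_resolv, mul_one]
    _ = resolv s t * (s * (1 + X * (t * s))) * resolv t s := by
        simp only [mul_assoc]
    _ = _ := by rw [h, ← mul_assoc, resolv_mul, one_mul]

theorem negInvAdd_eq (s t : A⟦X⟧) : negInvAdd s t = -(X * (t * resolv s t)) := by
  rw [negInvAdd, resolv, mul_assoc]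

namespace QRel
variable [Algebra Kq A]
variable {U M : A⟦X⟧} (h : QRel U M)
include h

theorem mu_swap : inMu M * inLam U = qp 1 • (inLam U * inMu M) := by
  rw [h.um, qp_smul_qp_neg 1 (inMu M * inLam U)]

theorem nc : M * U = qp 1 • (U * M) := by
  ext i
  have e : ∀ i j, coeff j M * coeff i U =
      qp 1 • (coeff i U * coeff j M) := fun i j => by
    have := congrArg (coeffLM i j) h.mu_swap
    simpa [coeffLM, inLam, inMu, PowerSeries.coeff_C_mul, PowerSeries.coeff_mul_C] using this
  rw [PowerSeries.coeff_smul, PowerSeries.coeff_mul, PowerSeries.coeff_mul, Finset.smul_sum,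
    ← Finset.Nat.sum_antidiagonal_swap]
  exact Finset.sum_congr rfl fun p _ => e _ _

/-- The relations make `u(μ)`, `m(μ)` the data of a flow at `μ`. In `point₂` and `point₃` the same
data are seen in series in one and two further variables `λ`. -/
theorem point : FlowPoint (qC A⟦X⟧) (xC A) U M (resolv M U) (resolv U M) (negInvAdd U M)
    (negInvAdd M U) where
  nc := by rw [h.nc, qC_smul]
  hz b := isUnit_one_add_X_mul b
  mul_G := mul_resolv M U
  G_mul := resolv_mul M U
  mul_G' := mul_resolv U M
  G'_mul := resolv_mul U M
  v_eq := by rw [negInvAdd_eq, ← resolv_mul_comm]; rfl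
  v_eq' := negInvAdd_eq _ _
  w_eq := negInvAdd_eq _ _
  w_eq' := by rw [negInvAdd_eq, ← resolv_mul_comm]; rfl

theorem point₂ : FlowPoint (qC A⟦X⟧⟦X⟧) (liftC (xC A)) (C U) (C M)
    (C (resolv M U)) (C (resolv U M)) (C (negInvAdd U M))
    (C (negInvAdd M U)) :=
  h.point.map C C_qC rfl (isUnit_one_add_C_mul isUnit_one_add_X_mul)

theorem point₃ : FlowPoint (qC A⟦X⟧⟦X⟧⟦X⟧) (liftC (liftC (xC A)))
    (C (C U)) (C (C M))
    (C (C (resolv M U))) (C (C (resolv U M)))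
    (C (C (negInvAdd U M)))
    (C (C (negInvAdd M U))) :=
  h.point₂.map C C_qC rfl
    (isUnit_one_add_C_mul (isUnit_one_add_C_mul isUnit_one_add_X_mul))

omit h in
theorem reg_X_sub : ∀ b : A⟦X⟧⟦X⟧, (xC A⟦X⟧ - liftC (xC A)) • b = 0 → b = 0 :=
  reg_X.X_sub_C

omit h in
theorem divDiff_smul (s : A⟦X⟧) : (xC A⟦X⟧ - liftC (xC A)) • divDiff s =
    PowerSeries.map C s - C s := mul_divDiff s

theorem mu_swap' : C M * PowerSeries.map C U =
    qC A⟦X⟧⟦X⟧ • (PowerSeries.map C U * C M) := by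
  have e := congrArg serSwap h.mu_swap
  rw [← qC_smul, serSwap_qC_smul, map_mul, map_mul] at e
  simpa [inLam, inMu] using e

theorem isULetter : IsULetter (qC A⟦X⟧⟦X⟧) (C U) (C M) (letter U) := by
  refine isULetter_of_rel (x := xC A⟦X⟧) (z := liftC (xC A)) reg_X_sub (divDiff_smul U) ?_
    h.mu_swap' h.point₂.nc
  rw [qC_smul]
  have e := h.uu
  simp only [quadLeft, quadRight, xLam, xMu, inLam, inMu] at e
  rw [← neg_sub, ← neg_sub (C U), neg_mul_neg, neg_mul_neg]
  exact e

theorem mm' : quadRight M = qp 1 • quadLeft M := by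
  rw [h.mm, qp_smul_qp_neg]

theorem isMLetter : IsMLetter (qC A⟦X⟧⟦X⟧) (C U) (C M) (letter M) := by
  refine isMLetter_of_rel (x := xC A⟦X⟧) (z := liftC (xC A)) reg_X_sub (divDiff_smul M) ?_
    ?_ h.point₂.nc
  · rw [qC_smul]
    have e := h.mm'
    simp only [quadLeft, quadRight, xLam, xMu, inLam, inMu] at e
    rw [← neg_sub, ← neg_sub ((liftC (xC A)) • C M), neg_mul_neg, neg_mul_neg]
    exact e
  · rw [qC_smul]
    exact h.mu_swap

omit h in
theorem X_smul_letter (s : A⟦X⟧) : xC A⟦X⟧ • PowerSeries.map C s =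
    (xC A⟦X⟧ - liftC (xC A)) • letter s + liftC (xC A) • C s :=
  smul_eq_letter (divDiff_smul s)

omit h in
theorem X_smul_flowU (U M : A⟦X⟧) : xC A⟦X⟧ • flowU U M = (xC A⟦X⟧ - liftC (xC A)) •
    (letter U * C (negInvAdd U M) * letter U) + liftC (xC A) •
    (C U * C (negInvAdd U M) * C U)
      - liftC (xC A) • (letter U - C U) :=
  smul_flow_u (divDiff_smul U) rfl

omit h in
theorem X_smul_flowM (U M : A⟦X⟧) : xC A⟦X⟧ • flowM U M = -((xC A⟦X⟧ - liftC (xC A)) •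
    (letter M * C (negInvAdd M U) * letter M) + liftC (xC A) •
    (C M * C (negInvAdd M U) * C M)
      - liftC (xC A) • (letter M - C M)) :=
  smul_flow_m (divDiff_smul M) rfl

end QRel

section Relations
variable {F : Type} [Ring F] [Algebra Kq F] [Algebra Kq A] {f : F →ₐ[Kq] A} {D : F →+ A⟦X⟧}
  {UF MF : F⟦X⟧} {U M : A⟦X⟧}

/-- `D` is a derivation along the algebra map `f : F → A`, with values in `A⟦μ⁻¹⟧`, that takes
series `UF`, `MF` over `U`, `M` to the prescribed values of `H(μ)`. It is applied with `F` the
free algebra. -/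
structure IsFlowLift (f : F →ₐ[Kq] A) (D : F →+ A⟦X⟧) (UF MF : F⟦X⟧) (U M : A⟦X⟧) : Prop where
  skew : IsSkew ((C (R := A)).comp (f : F →+* A))
    ((C (R := A)).comp (f : F →+* A)) D
  map_u : PowerSeries.map (f : F →+* A) UF = U
  map_m : PowerSeries.map (f : F →+* A) MF = M
  on_u : serMap D UF = flowU U M
  on_m : serMap D MF = flowM U M

namespace IsFlowLift
variable (hD : IsFlowLift f D UF MF U M)
include hD

theorem map_C_u : PowerSeries.map ((C (R := A)).comp (f : F →+* A)) UF =
    PowerSeries.map C U := by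
  rw [← hD.map_u, ← RingHom.comp_apply, ← PowerSeries.map_comp]

theorem map_C_m : PowerSeries.map ((C (R := A)).comp (f : F →+* A)) MF =
    PowerSeries.map C M := by
  rw [← hD.map_m, ← RingHom.comp_apply, ← PowerSeries.map_comp]

end IsFlowLift

theorem serMap_serMap_inMu (D : F →+ A⟦X⟧) (s : F⟦X⟧) :
    serMap (serMap D) (inMu s) = PowerSeries.map C (serMap D s) := by
  ext i
  simp [inMu]

end Relations

end

/-! ### Compatibility of the flow with the relations -/

section

@[simp] theorem coe_liftC {A : Type*} [Ring A] (r : Subring.center A) :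
    (liftC r).1 = C r.1 := rfl

@[simp] theorem coe_xC {A : Type*} [Ring A] : (xC A).1 = X := rfl

variable {A : Type} [Ring A] [Algebra Kq A]

section
variable {U M : A⟦X⟧}

theorem reg₃ : (∀ b : A⟦X⟧⟦X⟧⟦X⟧, liftC (xC A⟦X⟧) • b = 0 → b = 0) ∧
    (∀ b : A⟦X⟧⟦X⟧⟦X⟧, xC A⟦X⟧⟦X⟧ • b = 0 → b = 0) ∧
    (∀ b : A⟦X⟧⟦X⟧⟦X⟧, (liftC (xC A⟦X⟧) - liftC (liftC (xC A))) • b = 0 → b = 0) ∧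
    (∀ b : A⟦X⟧⟦X⟧⟦X⟧, (xC A⟦X⟧⟦X⟧ - liftC (liftC (xC A))) • b = 0 → b = 0) ∧
    (∀ b : A⟦X⟧⟦X⟧⟦X⟧, (liftC (xC A⟦X⟧) - xC A⟦X⟧⟦X⟧) • b = 0 → b = 0) := by
  refine ⟨reg_X.C, reg_X, ?_, reg_X.C.X_sub_C, (reg_X.X_sub_C).sub_comm⟩
  have : Reg (C (X - C X : A⟦X⟧⟦X⟧)) :=
    (reg_X.X_sub_C).C
  rw [map_sub] at this
  exact this

@[simp] theorem map_map_C_map_C {A : Type*} [Ring A] (s : A⟦X⟧) :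
    PowerSeries.map (PowerSeries.map C) (PowerSeries.map C s) =
      PowerSeries.map C (PowerSeries.map (C (R := A)) s) := by
  ext i; simp

theorem C_sub_map_C {A : Type*} [Ring A] (s : A⟦X⟧⟦X⟧) : C s - PowerSeries.map C s =
    (liftC (xC A⟦X⟧) - xC A⟦X⟧⟦X⟧) • divDiff s := by
  rw [← neg_sub, ← mul_divDiff, ← neg_mul, neg_sub]
  rfl

/-- The three theorems `flowU_uu`, `flowM_mm` and `flow_um` are the identities of the same topic
for `FlowPoint`, now with `λ₁`, `λ₂`, `μ` as variables of a power series ring. -/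
theorem flowU_uu (h : QRel U M) :
    (xLam _ * C (flowU U M) - xMu _ * PowerSeries.map C (flowU U M)) *
        (inLam (PowerSeries.map C U) - inMu (PowerSeries.map C U))
      + (xLam _ * inLam (PowerSeries.map C U)
          - xMu _ * inMu (PowerSeries.map C U)) *
        (C (flowU U M) - PowerSeries.map C (flowU U M))
      = qp 1 • ((C (flowU U M) - PowerSeries.map C (flowU U M)) *
        (xLam _ * inLam (PowerSeries.map C U)
          - xMu _ * inMu (PowerSeries.map C U))
      + (inLam (PowerSeries.map C U) - inMu (PowerSeries.map C U)) *
        (xLam _ * C (flowU U M)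
          - xMu _ * PowerSeries.map C (flowU U M))) := by
  obtain ⟨r1, r2, r3, r4, r5⟩ := reg₃ (A := A)
  rw [← qC_smul]
  refine h.point₃.flow_uu h.point₃.isUnit_one_add_mul_v (x₁ := liftC (xC A⟦X⟧))
    (x₂ := xC A⟦X⟧⟦X⟧) r1 r2 r3 r4 r5 (s₁ := C (letter U))
    (s₂ := PowerSeries.map C (letter U)) (τ := divDiff (letter U))
    (h.isULetter.map C C_qC) ?_ ?_ ?_ ?_ ?_ ?_ ?_
  · simpa using h.isULetter.map (PowerSeries.map C) map_C_qC
  · simpa [center_smul_def, inLam] using congrArg C (QRel.X_smul_letter U)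
  · simpa [center_smul_def, inMu] using
      congrArg (PowerSeries.map C) (QRel.X_smul_letter U)
  · exact C_sub_map_C _
  · simpa [center_smul_def] using congrArg C (QRel.X_smul_flowU U M)
  · simpa [center_smul_def] using
      congrArg (PowerSeries.map C) (QRel.X_smul_flowU U M)
  · rw [qC_smul]
    have := congrArg (PowerSeries.map (PowerSeries.map C)) h.uu
    rw [← qC_smul, map_map_C_qC_smul] at this
    rw [qC_smul] at this
    simpa [quadLeft, quadRight, center_smul_def, inLam, inMu, xLam, xMu] using this

theorem flowM_mm (h : QRel U M) :
    (C (flowM U M) - PowerSeries.map C (flowM U M)) *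
        (xLam _ * inLam (PowerSeries.map C M)
          - xMu _ * inMu (PowerSeries.map C M))
      + (inLam (PowerSeries.map C M) - inMu (PowerSeries.map C M)) *
        (xLam _ * C (flowM U M)
          - xMu _ * PowerSeries.map C (flowM U M))
      = qp 1 • ((xLam _ * C (flowM U M)
          - xMu _ * PowerSeries.map C (flowM U M)) *
        (inLam (PowerSeries.map C M) - inMu (PowerSeries.map C M))
      + (xLam _ * inLam (PowerSeries.map C M)
          - xMu _ * inMu (PowerSeries.map C M)) *
        (C (flowM U M) - PowerSeries.map C (flowM U M))) := by
  obtain ⟨r1, r2, r3, r4, r5⟩ := reg₃ (A := A)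
  rw [← qC_smul]
  refine h.point₃.flow_mm (x₁ := liftC (xC A⟦X⟧))
    (x₂ := xC A⟦X⟧⟦X⟧) r1 r2 r3 r4 r5 (s₁ := C (letter M))
    (s₂ := PowerSeries.map C (letter M)) (τ := divDiff (letter M))
    (h.isMLetter.map C C_qC) ?_ ?_ ?_ ?_ ?_ ?_ ?_
  · simpa using h.isMLetter.map (PowerSeries.map C) map_C_qC
  · simpa [center_smul_def, inLam] using congrArg C (QRel.X_smul_letter M)
  · simpa [center_smul_def, inMu] using
      congrArg (PowerSeries.map C) (QRel.X_smul_letter M)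
  · exact C_sub_map_C _
  · simpa [center_smul_def] using congrArg C (QRel.X_smul_flowM U M)
  · simpa [center_smul_def] using
      congrArg (PowerSeries.map C) (QRel.X_smul_flowM U M)
  · rw [qC_smul]
    have := congrArg (PowerSeries.map (PowerSeries.map C)) h.mm'
    rw [← qC_smul, map_map_C_qC_smul] at this
    rw [qC_smul] at this
    simpa [quadLeft, quadRight, center_smul_def, inLam, inMu, xLam, xMu] using this

theorem letters_qcomm {R W : Type*} [CommRing R] [Ring W] [Algebra R W] {q x₁ x₂ z : R}
    {a b c n s y : W} (r₁ : ∀ b : W, (x₁ - z) • b = 0 → b = 0)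
    (r₂ : ∀ b : W, (x₂ - z) • b = 0 → b = 0) (hs : x₁ • a = (x₁ - z) • s + z • c)
    (hy : x₂ • b = (x₂ - z) • y + z • n) (hba : b * a = q • (a * b)) (hbc : b * c = q • (c * b))
    (hna : n * a = q • (a * n)) (hnc : n * c = q • (c * n)) : y * s = q • (s * y) := by
  rw [← sub_eq_zero]
  apply r₁; apply r₂
  have e : ((x₂ - z) • y) * ((x₁ - z) • s) = q • (((x₁ - z) • s) * ((x₂ - z) • y)) := by
    rw [eq_sub_of_add_eq hs.symm, eq_sub_of_add_eq hy.symm]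
    linear_combination (norm := (
      simp only [mul_sub, sub_mul, smul_sub, smul_mul_assoc,
        mul_smul_comm]
      module)) (x₂ * x₁) • hba - (x₂ * z) • hbc - (z * x₁) • hna + (z * z) • hnc
  linear_combination (norm := (
      simp only [smul_sub, smul_mul_assoc,
        mul_smul_comm]
      module)) e

set_option maxHeartbeats 1000000 in
theorem flow_um (h : QRel U M) :
    PowerSeries.map C (flowM U M) * inLam (PowerSeries.map C U)
      + inMu (PowerSeries.map C M) * C (flowU U M)
      = qp 1 • (C (flowU U M) * inMu (PowerSeries.map C M)
        + inLam (PowerSeries.map C U) *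
          PowerSeries.map C (flowM U M)) := by
  obtain ⟨r1, r2, r3, r4, r5⟩ := reg₃ (A := A)
  rw [← qC_smul]
  have ha : liftC (xC A⟦X⟧) • inLam (PowerSeries.map C U) =
      (liftC (xC A⟦X⟧) - liftC (liftC (xC A))) • C (letter U)
        + liftC (liftC (xC A)) • C (C U) := by
    simpa [center_smul_def, inLam] using congrArg C (QRel.X_smul_letter U)
  have hb : xC A⟦X⟧⟦X⟧ • inMu (PowerSeries.map C M) =
      (xC A⟦X⟧⟦X⟧ - liftC (liftC (xC A))) • PowerSeries.map C (letter M)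
        + liftC (liftC (xC A)) • C (C M) := by
    simpa [center_smul_def, inMu] using
      congrArg (PowerSeries.map C) (QRel.X_smul_letter M)
  refine h.point₃.flow_um (qC_mul_qC' _) (x₁ := liftC (xC A⟦X⟧)) (x₂ := xC A⟦X⟧⟦X⟧) r1 r2
    (s := C (letter U)) (y := PowerSeries.map C (letter M))
    (h.isULetter.map C C_qC) ?_ ?_ ha hb ?_ ?_
  · simpa using h.isMLetter.map (PowerSeries.map C) map_C_qC
  · refine letters_qcomm r3 r4 ha hb ?_ ?_ ?_ h.point₃.nc
    · have := congrArg (PowerSeries.map (PowerSeries.map C)) h.mu_swap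
      rw [← qC_smul, map_map_C_qC_smul] at this
      simpa [inLam, inMu] using this
    · have := congrArg (PowerSeries.map C) h.mu_swap
      rw [← qC_smul, map_C_qC_smul] at this
      simpa [inLam, inMu] using this
    · have := congrArg C h.mu_swap'
      rw [C_qC_smul] at this
      simpa [inLam] using this
  · simpa [center_smul_def] using congrArg C (QRel.X_smul_flowU U M)
  · simpa [center_smul_def] using
      congrArg (PowerSeries.map C) (QRel.X_smul_flowM U M)

end

/-- The relations of `ℂ[H₋\B₋N₊]_q` for two series and two elements of an algebra `A`. -/
structure QRelN (U M : A⟦X⟧) (S : ℤˣ → A) : Prop extends QRel U M where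
  uS : ∀ ε : ℤˣ, U * C (S ε) = qp ε • (C (S ε) * U)
  mSp : M * C (S 1) - qp (-1) • (C (S 1) * M) = (1 - qp (-1)) • 1
  mSm : M * C (S (-1)) - qp 1 • (C (S (-1)) * M) =
    -(qp 1 - 1) • (X * M ^ 2)
  SS : ∀ ε : ℤˣ, serre (S ε) (S (-ε)) = 0

namespace QRelN
variable {U M : A⟦X⟧} {S : ℤˣ → A} (h : QRelN U M S)
include h

theorem uSp : U * C (S 1) = qC A⟦X⟧ • (C (S 1) * U) := by
  rw [qC_smul]; exact h.uS 1

theorem uSm : qC A⟦X⟧ • (U * C (S (-1))) = C (S (-1)) * U := by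
  rw [qC_smul, h.uS (-1)]
  exact qp_smul_qp_neg 1 _

theorem mSp' : qC A⟦X⟧ • (M * C (S 1)) =
    C (S 1) * M + (qC A⟦X⟧ - 1) • 1 := by
  have e := congrArg (fun b => qp 1 • b) h.mSp
  simp only [smul_sub, sub_smul, qp_smul_qp_neg, one_smul] at e
  rw [qC_smul, sub_smul, one_smul, qC_smul, ← e]
  abel

theorem mSm' : M * C (S (-1)) = qC A⟦X⟧ • (C (S (-1)) * M)
    - ((qC A⟦X⟧ - 1) * xC A) • (M * M) := by
  rw [mul_smul, sub_smul, one_smul, qC_smul, qC_smul, center_smul_def]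
  have e := h.mSm
  rw [neg_smul, sub_smul, one_smul, pow_two] at e
  rw [eq_add_of_sub_eq e, coe_xC]
  abel

theorem letter_uSp : letter U * C (C (S 1)) =
    qC A⟦X⟧⟦X⟧ • (C (C (S 1)) * letter U) := by
  rw [← sub_eq_zero]
  apply QRel.reg_X_sub
  have e := eq_sub_of_add_eq (QRel.X_smul_letter U).symm
  have e1 := congrArg C h.uSp
  have e2 := congrArg (PowerSeries.map C) h.uSp
  rw [C_qC_smul] at e1
  rw [map_C_qC_smul] at e2
  simp only [map_mul, PowerSeries.map_C] at e1 e2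
  linear_combination (norm := (
      simp only [mul_sub, sub_mul, smul_sub, smul_mul_assoc,
        mul_smul_comm]
      module)) e * C (C (S 1))
        - qC A⟦X⟧⟦X⟧ • (C (C (S 1)) * e)
        + xC A⟦X⟧ • e2 - liftC (xC A) • e1

theorem letter_uSm : qC A⟦X⟧⟦X⟧ • (letter U * C (C (S (-1)))) =
    C (C (S (-1))) * letter U := by
  rw [← sub_eq_zero]
  apply QRel.reg_X_sub
  have e := eq_sub_of_add_eq (QRel.X_smul_letter U).symm
  have e1 := congrArg C h.uSm
  have e2 := congrArg (PowerSeries.map C) h.uSm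
  rw [C_qC_smul] at e1
  rw [map_C_qC_smul] at e2
  simp only [map_mul, PowerSeries.map_C] at e1 e2
  linear_combination (norm := (
      simp only [mul_sub, sub_mul, smul_sub, smul_mul_assoc,
        mul_smul_comm]
      module)) qC A⟦X⟧⟦X⟧ • (e * C (C (S (-1))))
        - (C (C (S (-1))) * e)
        + xC A⟦X⟧ • e2 - liftC (xC A) • e1

theorem mSp_lam : qC A⟦X⟧⟦X⟧ • (C M * C (C (S 1))) =
    C (C (S 1)) * C M + (qC A⟦X⟧⟦X⟧ - 1) • 1 := by
  have e1 := congrArg C h.mSp'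
  rw [C_qC_smul, sub_smul, map_add, map_sub, C_qC_smul] at e1
  simpa [sub_smul] using e1

theorem mSp_mu : qC A⟦X⟧⟦X⟧ • (PowerSeries.map C M *
      C (C (S 1))) =
    C (C (S 1)) * PowerSeries.map C M
      + (qC A⟦X⟧⟦X⟧ - 1) • 1 := by
  have e1 := congrArg (PowerSeries.map C) h.mSp'
  rw [map_C_qC_smul, sub_smul, map_add, map_sub, map_C_qC_smul] at e1
  simpa [sub_smul] using e1

theorem mSm_lam : C M * C (C (S (-1))) =
    qC A⟦X⟧⟦X⟧ • (C (C (S (-1))) * C M)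
    - ((qC A⟦X⟧⟦X⟧ - 1) * liftC (xC A)) • (C M * C M) := by
  have e1 := congrArg C h.mSm'
  rw [map_sub, C_qC_smul, mul_smul, sub_smul, map_sub, C_qC_smul] at e1
  simpa [sub_smul, mul_smul, center_smul_def (xC _), center_smul_def (liftC _)] using e1

theorem mSm_mu : PowerSeries.map C M * C (C (S (-1))) =
    qC A⟦X⟧⟦X⟧ • (C (C (S (-1))) * PowerSeries.map C M)
    - ((qC A⟦X⟧⟦X⟧ - 1) * xC A⟦X⟧) •
      (PowerSeries.map C M * PowerSeries.map C M) := by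
  have e1 := congrArg (PowerSeries.map C) h.mSm'
  rw [map_sub, map_C_qC_smul, mul_smul, sub_smul, map_sub,
    map_C_qC_smul] at e1
  simpa [sub_smul, mul_smul, center_smul_def (xC _)] using e1

theorem letter_mSp : qC A⟦X⟧⟦X⟧ • (letter M * C (C (S 1))) =
    C (C (S 1)) * letter M + (qC A⟦X⟧⟦X⟧ - 1) • 1 := by
  rw [← sub_eq_zero]
  apply QRel.reg_X_sub
  have e := eq_sub_of_add_eq (QRel.X_smul_letter M).symm
  linear_combination (norm := (
      simp only [mul_sub, sub_mul, smul_add, smul_sub, smul_mul_assoc,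
        mul_smul_comm]
      module)) qC A⟦X⟧⟦X⟧ • (e * C (C (S 1)))
        - (C (C (S 1)) * e)
        + xC A⟦X⟧ • h.mSp_mu - liftC (xC A) • h.mSp_lam

theorem letter_mSm : letter M * C (C (S (-1))) =
    qC A⟦X⟧⟦X⟧ • (C (C (S (-1))) * letter M)
    - (qC A⟦X⟧⟦X⟧ - 1) • ((xC A⟦X⟧ - liftC (xC A)) • (letter M * letter M)
      + liftC (xC A) • (letter M * C M + C M * letter M)) := by
  rw [← sub_eq_zero]
  apply QRel.reg_X_sub
  have e0 := QRel.X_smul_letter M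
  have e := eq_sub_of_add_eq e0.symm
  linear_combination (norm := (
      simp only [mul_add, add_mul, mul_sub, sub_mul, smul_add, smul_sub, smul_mul_assoc,
        mul_smul_comm]
      module)) e * C (C (S (-1)))
        - qC A⟦X⟧⟦X⟧ • (C (C (S (-1))) * e)
        + xC A⟦X⟧ • h.mSm_mu - liftC (xC A) • h.mSm_lam
        - (qC A⟦X⟧⟦X⟧ - 1) • (e0 * (xC A⟦X⟧ • PowerSeries.map C M)
          + ((xC A⟦X⟧ - liftC (xC A)) • letter M + liftC (xC A) • C M) * e0)

end QRelN

end

/-! ### Skew derivations of algebras given by generators and relations -/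

section Extension
variable {X : Type} {Rel : FreeAlgebra Kq X → FreeAlgebra Kq X → Prop} {B : Type*} [Ring B]
  [Algebra Kq B]

/-- An entry of a matrix, as a linear function. -/
def entry (B : Type*) [Ring B] [Algebra Kq B] (i j : Fin 2) : Matrix (Fin 2) (Fin 2) B →ₗ[Kq] B where
  toFun m := m i j
  map_add' _ _ := rfl
  map_smul' _ _ := rfl

/-- A skew derivation on an algebra with given generators and relations is determined by arbitrary
values on the generators, provided that it respects the relations. It is the off-diagonal entry of
an algebra homomorphism to upper triangular matrices. -/
theorem exists_skew_of_rel (g f : RingQuot Rel →ₐ[Kq] B) (d : X → B)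
    (hrel : ∀ D : FreeAlgebra Kq X →ₗ[Kq] B,
      IsSkew ((g.comp (RingQuot.mkAlgHom Kq Rel) : FreeAlgebra Kq X →ₐ[Kq] B) : _ →+* B)
        ((f.comp (RingQuot.mkAlgHom Kq Rel) : FreeAlgebra Kq X →ₐ[Kq] B) : _ →+* B)
        (D : FreeAlgebra Kq X →+ B) →
      (∀ x, D (FreeAlgebra.ι Kq x) = d x) → ∀ r s, Rel r s → D r = D s) :
    ∃ D : RingQuot Rel →ₗ[Kq] B, IsSkew (g : _ →+* B) (f : _ →+* B) (D : RingQuot Rel →+ B) ∧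
      ∀ x, D (RingQuot.mkAlgHom Kq Rel (FreeAlgebra.ι Kq x)) = d x := by
  set π := RingQuot.mkAlgHom Kq Rel with hπ
  -- the matrices `(g a, D a; 0, f a)` multiply as the skew derivation property demands
  let Φ : FreeAlgebra Kq X →ₐ[Kq] Matrix (Fin 2) (Fin 2) B :=
    FreeAlgebra.lift Kq fun x =>
      !![g (π (FreeAlgebra.ι Kq x)), d x; 0, f (π (FreeAlgebra.ι Kq x))]
  have hι : ∀ x, Φ (FreeAlgebra.ι Kq x) =
      !![g (π (FreeAlgebra.ι Kq x)), d x; 0, f (π (FreeAlgebra.ι Kq x))] := fun x =>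
    FreeAlgebra.lift_ι_apply _ _
  have hΦ : ∀ a, Φ a 0 0 = g (π a) ∧ Φ a 1 0 = 0 ∧ Φ a 1 1 = f (π a) := by
    intro a
    induction a using FreeAlgebra.induction with
    | grade0 r =>
      simp only [AlgHom.commutes, Matrix.algebraMap_matrix_apply]
      simp
    | grade1 x => simp [hι]
    | mul a b ha hb =>
      obtain ⟨h1, h2, h3⟩ := ha
      obtain ⟨k1, k2, k3⟩ := hb
      simp [map_mul, Matrix.mul_apply, Fin.sum_univ_two, *]
    | add a b ha hb =>
      obtain ⟨h1, h2, h3⟩ := ha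
      obtain ⟨k1, k2, k3⟩ := hb
      simp [map_add, *]
  let D₀ : FreeAlgebra Kq X →ₗ[Kq] B := (entry B 0 1).comp Φ.toLinearMap
  have hD₀ : ∀ a, D₀ a = Φ a 0 1 := fun _ => rfl
  have hs : ∀ a b, D₀ (a * b) = D₀ a * f (π b) + g (π a) * D₀ b := by
    intro a b
    rw [hD₀, hD₀, hD₀, map_mul, Matrix.mul_apply, Fin.sum_univ_two, (hΦ a).1, (hΦ b).2.2, add_comm]
  have hr : ∀ ⦃r s⦄, Rel r s → Φ r = Φ s := by
    intro r s h
    have e : π r = π s := RingQuot.mkAlgHom_rel Kq h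
    have e01 : Φ r 0 1 = Φ s 0 1 := hrel D₀ hs (fun x => by rw [hD₀, hι]; simp) r s h
    ext i j
    fin_cases i <;> fin_cases j
    · simp [(hΦ r).1, (hΦ s).1, e]
    · exact e01
    · simp [(hΦ r).2.1, (hΦ s).2.1]
    · simp [(hΦ r).2.2, (hΦ s).2.2, e]
  let Ψ : RingQuot Rel →ₐ[Kq] Matrix (Fin 2) (Fin 2) B := RingQuot.liftAlgHom Kq ⟨Φ, hr⟩
  have hΨ : ∀ a, Ψ (π a) = Φ a := fun a => RingQuot.liftAlgHom_mkAlgHom_apply _ _ _ _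
  refine ⟨(entry B 0 1).comp Ψ.toLinearMap, ?_, ?_⟩
  · intro a b
    obtain ⟨a, rfl⟩ := RingQuot.mkAlgHom_surjective Kq Rel a
    obtain ⟨b, rfl⟩ := RingQuot.mkAlgHom_surjective Kq Rel b
    change Ψ (π a * π b) 0 1 = Ψ (π a) 0 1 * f (π b) + g (π a) * Ψ (π b) 0 1
    rw [← map_mul, hΨ, hΨ, hΨ]
    exact hs a b
  · intro x
    change Ψ (π _) 0 1 = _
    rw [hΨ, hι]
    simp

theorem quot_induction {p : RingQuot Rel → Prop}
    (halg : ∀ r, p (algebraMap Kq _ r))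
    (hgen : ∀ x, p (RingQuot.mkAlgHom Kq Rel (FreeAlgebra.ι Kq x)))
    (hmul : ∀ a b, p a → p b → p (a * b)) (hadd : ∀ a b, p a → p b → p (a + b)) (a) : p a := by
  obtain ⟨a, rfl⟩ := RingQuot.mkAlgHom_surjective Kq Rel a
  induction a using FreeAlgebra.induction with
  | grade0 r => rw [AlgHom.commutes]; exact halg r
  | grade1 x => exact hgen x
  | mul a b ha hb => rw [map_mul]; exact hmul _ _ ha hb
  | add a b ha hb => rw [map_add]; exact hadd _ _ ha hb

end Extension

theorem neg_one_pow_mul_self' {A : Type*} [Ring A] (i : ℕ) : ((-1) ^ i * (-1) ^ i : A) = 1 := by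
  rw [← pow_add, Even.neg_one_pow ⟨i, rfl⟩]

theorem map_neg_one_pow_mul {A B : Type*} [Ring A] [Ring B] (D : A →+ B) (i : ℕ) (a : A) :
    D ((-1) ^ i * a) = (-1) ^ i * D a := by
  rcases neg_one_pow_eq_or A i with h | h <;> rcases Nat.even_or_odd i with h' | h' <;>
    simp [h'.neg_one_pow]

theorem coeff_genSer {A : Type} [Ring A] (c : ℕ → A) (i : ℕ) :
    coeff i (genSer c) = (-1) ^ i * c i := PowerSeries.coeff_mk _ _

theorem serMap_genSer {A : Type} {B : Type*} [Ring A] [Ring B] (D : A →+ B) (c : ℕ → A)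
    (s : B⟦X⟧) : serMap D (genSer c) = s ↔ ∀ i, D (c i) = (-1) ^ i * coeff i s := by
  have key : ∀ (i : ℕ) (b b' : B), (-1) ^ i * b = b' ↔ b = (-1) ^ i * b' := fun i b b' => by
    have e : ((-1) ^ i * (-1) ^ i : B) = 1 := neg_one_pow_mul_self' i
    constructor
    · rintro rfl; rw [← mul_assoc, e, one_mul]
    · rintro rfl; rw [← mul_assoc, e, one_mul]
  rw [PowerSeries.ext_iff]
  refine forall_congr' fun i => ?_
  rw [coeff_serMap, coeff_genSer, map_neg_one_pow_mul, key]

section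
variable {A : Type} [Ring A] [Algebra Kq A]

/-- Constant series, as an algebra homomorphism. -/
def algC (A : Type*) [Ring A] [Algebra Kq A] : A →ₐ[Kq] A⟦X⟧ :=
  { C with
    commutes' := fun r => by
      change C (algebraMap Kq A r) = _
      rw [PowerSeries.algebraMap_apply] }

section Relations
variable {F : Type} [Ring F] [Algebra Kq F] {f : F →ₐ[Kq] A} {UF MF : F⟦X⟧} {U M : A⟦X⟧}

theorem map_coeffLM (f : F →+* A) (i j : ℕ) (s : F⟦X⟧⟦X⟧) :
    f (coeffLM i j s) = coeffLM i j (PowerSeries.map (PowerSeries.map f) s) := by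
  simp [coeffLM]

theorem map_quadLeft (f : F →+* A) (s : F⟦X⟧) :
    PowerSeries.map (PowerSeries.map f) (quadLeft s) = quadLeft (PowerSeries.map f s) := by
  have e : PowerSeries.map (PowerSeries.map f) (inMu s) = inMu (PowerSeries.map f s) := by
    ext i; simp [inMu]
  simp [quadLeft, xLam, xMu, inLam, e]

theorem map_quadRight (f : F →+* A) (s : F⟦X⟧) :
    PowerSeries.map (PowerSeries.map f) (quadRight s) = quadRight (PowerSeries.map f s) := by
  have e : PowerSeries.map (PowerSeries.map f) (inMu s) = inMu (PowerSeries.map f s) := by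
    ext i; simp [inMu]
  simp [quadRight, xLam, xMu, inLam, e]

theorem coeffLM_ext {s t : A⟦X⟧⟦X⟧} (h : ∀ i j, coeffLM i j s = coeffLM i j t) : s = t := by
  ext j i
  exact h i j

theorem coeffLM_smul (r : Kq) (i j : ℕ) (s : A⟦X⟧⟦X⟧) :
    coeffLM i j (r • s) = r • coeffLM i j s := by
  simp [coeffLM]

theorem qRel_of_rel (hU : PowerSeries.map (f : F →+* A) UF = U)
    (hM : PowerSeries.map (f : F →+* A) MF = M)
    (uu : ∀ i j, f (coeffLM i j (quadLeft UF)) = f (qp 1 • coeffLM i j (quadRight UF)))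
    (mm : ∀ i j, f (coeffLM i j (quadLeft MF)) = f (qp (-1) • coeffLM i j (quadRight MF)))
    (um : ∀ i j, f (coeffLM i j (inLam UF * inMu MF)) =
      f (qp (-1) • coeffLM i j (inMu MF * inLam UF))) : QRel U M := by
  have e := map_coeffLM (f : F →+* A)
  have eU : PowerSeries.map (PowerSeries.map (f : F →+* A)) (inLam UF) = inLam U := by
    rw [inLam, PowerSeries.map_C, hU, inLam]
  have eM : PowerSeries.map (PowerSeries.map (f : F →+* A)) (inMu MF) = inMu M := by
    rw [← hM]; ext i; simp [inMu]
  constructor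
  · refine coeffLM_ext fun i j => ?_
    have := uu i j
    rw [map_smul] at this
    simpa [coeffLM_smul, ← hU, ← map_quadLeft, ← map_quadRight, ← e] using this
  · refine coeffLM_ext fun i j => ?_
    have := mm i j
    rw [map_smul] at this
    simpa [coeffLM_smul, ← hM, ← map_quadLeft, ← map_quadRight, ← e] using this
  · refine coeffLM_ext fun i j => ?_
    have := um i j
    rw [map_smul] at this
    rw [coeffLM_smul, ← eU, ← eM, ← map_mul, ← map_mul, ← e, ← e]
    exact this

namespace IsFlowLift
variable {D : F →+ A⟦X⟧} (hD : IsFlowLift f D UF MF U M)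
include hD

theorem skew₃ : IsSkew
    (PowerSeries.map (PowerSeries.map ((C (R := A)).comp (f : F →+* A))))
    (PowerSeries.map (PowerSeries.map ((C (R := A)).comp (f : F →+* A))))
    (serMap (serMap D)) := hD.skew.serMap.serMap

theorem inLam_u : PowerSeries.map (PowerSeries.map ((C (R := A)).comp (f : F →+* A)))
    (inLam UF) = inLam (PowerSeries.map C U) := by
  rw [inLam, PowerSeries.map_C, hD.map_C_u, inLam]

theorem inLam_m : PowerSeries.map (PowerSeries.map ((C (R := A)).comp (f : F →+* A)))
    (inLam MF) = inLam (PowerSeries.map C M) := by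
  rw [inLam, PowerSeries.map_C, hD.map_C_m, inLam]

theorem inMu_u : PowerSeries.map (PowerSeries.map ((C (R := A)).comp (f : F →+* A)))
    (inMu UF) = inMu (PowerSeries.map C U) := by
  rw [← hD.map_C_u]; ext i; simp [inMu]

theorem inMu_m : PowerSeries.map (PowerSeries.map ((C (R := A)).comp (f : F →+* A)))
    (inMu MF) = inMu (PowerSeries.map C M) := by
  rw [← hD.map_C_m]; ext i; simp [inMu]

theorem on_inLam_u : serMap (serMap D) (inLam UF) = C (flowU U M) := by
  rw [inLam, serMap_C, hD.on_u]

theorem on_inLam_m : serMap (serMap D) (inLam MF) = C (flowM U M) := by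
  rw [inLam, serMap_C, hD.on_m]

theorem on_inMu_u : serMap (serMap D) (inMu UF) =
    PowerSeries.map C (flowU U M) := by
  rw [serMap_serMap_inMu, hD.on_u]

theorem on_inMu_m : serMap (serMap D) (inMu MF) =
    PowerSeries.map C (flowM U M) := by
  rw [serMap_serMap_inMu, hD.on_m]

theorem xLam_mul (s : F⟦X⟧⟦X⟧) :
    serMap (serMap D) (xLam F * s) = xLam _ * serMap (serMap D) s :=
  serMap_C_mul (serMap_X_mul D) s

theorem xMu_mul (s : F⟦X⟧⟦X⟧) :
    serMap (serMap D) (xMu F * s) = xMu _ * serMap (serMap D) s := serMap_X_mul _ s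

theorem rel_uu (h : QRel U M) (i j : ℕ) :
    D (coeffLM i j (quadLeft UF)) = qp 1 • D (coeffLM i j (quadRight UF)) := by
  have e := flowU_uu h
  have k : ∀ s, D (coeffLM i j s) = coeff i (coeff j
    (serMap (serMap D) s)) := fun s => by simp [coeffLM]
  rw [k, k, quadLeft, quadRight, hD.skew₃, hD.skew₃]
  simp only [map_sub, hD.xLam_mul, hD.xMu_mul, hD.on_inLam_u, hD.on_inMu_u]
  rw [← PowerSeries.coeff_smul, ← PowerSeries.coeff_smul]
  refine congrArg (fun s => coeff i (coeff j s)) ?_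
  simp only [map_mul, hD.inLam_u, hD.inMu_u]
  simpa [xLam, xMu] using e

theorem rel_mm (h : QRel U M) (i j : ℕ) :
    D (coeffLM i j (quadLeft MF)) = qp (-1) • D (coeffLM i j (quadRight MF)) := by
  have e := congrArg (fun b => qp (-1) • b) (flowM_mm h)
  simp only [qp_neg_smul_qp] at e
  have k : ∀ s, D (coeffLM i j s) = coeff i (coeff j
    (serMap (serMap D) s)) := fun s => by simp [coeffLM]
  rw [k, k, quadLeft, quadRight, hD.skew₃, hD.skew₃]
  simp only [map_sub, hD.xLam_mul, hD.xMu_mul, hD.on_inLam_m, hD.on_inMu_m]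
  rw [← PowerSeries.coeff_smul, ← PowerSeries.coeff_smul]
  refine congrArg (fun s => coeff i (coeff j s)) ?_
  simp only [map_mul, hD.inLam_m, hD.inMu_m]
  simpa [xLam, xMu] using e.symm

theorem rel_um (h : QRel U M) (i j : ℕ) :
    D (coeffLM i j (inLam UF * inMu MF)) = qp (-1) • D (coeffLM i j (inMu MF * inLam UF)) := by
  have e := congrArg (fun b => qp (-1) • b) (flow_um h)
  simp only [qp_neg_smul_qp] at e
  have k : ∀ s, D (coeffLM i j s) = coeff i (coeff j
    (serMap (serMap D) s)) := fun s => by simp [coeffLM]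
  rw [k, k, hD.skew₃, hD.skew₃, hD.on_inLam_u, hD.on_inMu_m, hD.inLam_u, hD.inMu_m,
    ← PowerSeries.coeff_smul, ← PowerSeries.coeff_smul]
  refine congrArg (fun s => coeff i (coeff j s)) ?_
  exact e.symm

end IsFlowLift

end Relations
end

/-! ### Existence of the flows -/

section
variable {A : Type} [Ring A] [Algebra Kq A] {F : Type} [Ring F] [Algebra Kq F] {f : F →ₐ[Kq] A}
  {UF MF : F⟦X⟧} {U M : A⟦X⟧} {SF : ℤˣ → F} {S : ℤˣ → A}

/-- The counterpart of `IsFlowLift` in the presence of the half screening charges. -/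
structure IsFlowLiftN (f : F →ₐ[Kq] A) (D : F →ₗ[Kq] A⟦X⟧) (UF MF : F⟦X⟧) (U M : A⟦X⟧)
    (SF : ℤˣ → F) (S : ℤˣ → A) : Prop extends IsFlowLift f (D : F →+ A⟦X⟧) UF MF U M where
  map_S : ∀ ε, f (SF ε) = S ε
  on_Sp : D (SF 1) = negInvAdd M U
  on_Sm : D (SF (-1)) = negInvAdd U M

namespace QRelN
variable (h : QRelN U M S)
include h

theorem flow_uSp : flowU U M * C (C (S 1))
    + PowerSeries.map C U * C (negInvAdd M U) =
    qp 1 • (C (negInvAdd M U) * PowerSeries.map C U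
      + C (C (S 1)) * flowU U M) := by
  rw [← qC_smul]
  refine h.point₂.flow_uSp (qC_mul_qC' _) ?_ h.mSp_lam (x := xC A⟦X⟧) reg_X h.isULetter
    h.letter_uSp (QRel.X_smul_letter U) (QRel.X_smul_flowU U M)
  have e1 := congrArg C h.uSp
  rw [C_qC_smul] at e1
  simpa using e1

theorem flow_uSm : flowU U M * C (C (S (-1)))
    + PowerSeries.map C U * C (negInvAdd U M) =
    qp (-1) • (C (negInvAdd U M) * PowerSeries.map C U
      + C (C (S (-1))) * flowU U M) := by
  rw [← qp_neg_smul_qp 1 (flowU U M * C (C (S (-1)))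
    + PowerSeries.map C U * C (negInvAdd U M))]
  refine congrArg (fun b => qp (-1) • b) ?_
  rw [← qC_smul]
  refine h.point₂.flow_uSm (qC_mul_qC' _) ?_ h.mSm_lam (x := xC A⟦X⟧) reg_X h.isULetter
    h.letter_uSm (QRel.X_smul_letter U) (QRel.X_smul_flowU U M)
  have e1 := congrArg C h.uSm
  rw [C_qC_smul] at e1
  simpa using e1

theorem flow_mSp : flowM U M * C (C (S 1))
    + PowerSeries.map C M * C (negInvAdd M U) =
    qp (-1) • (C (negInvAdd M U) * PowerSeries.map C M
      + C (C (S 1)) * flowM U M) := by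
  rw [← qp_neg_smul_qp 1 (flowM U M * C (C (S 1))
    + PowerSeries.map C M * C (negInvAdd M U))]
  refine congrArg (fun b => qp (-1) • b) ?_
  rw [← qC_smul]
  refine h.point₂.flow_mSp (qC_mul_qC' _) ?_ h.mSp_lam (x := xC A⟦X⟧) reg_X h.isMLetter
    h.letter_mSp (QRel.X_smul_letter M) (QRel.X_smul_flowM U M)
  have e1 := congrArg C h.uSp
  rw [C_qC_smul] at e1
  simpa using e1

theorem flow_mSm : flowM U M * C (C (S (-1)))
    + PowerSeries.map C M * C (negInvAdd U M) =
    qp 1 • (C (negInvAdd U M) * PowerSeries.map C M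
      + C (C (S (-1))) * flowM U M)
      - (qp 1 - 1) • (X * (flowM U M * PowerSeries.map C M
        + PowerSeries.map C M * flowM U M)) := by
  have e : ∀ b : A⟦X⟧⟦X⟧, (qp 1 - 1) • (X * b) =
      ((qC A⟦X⟧⟦X⟧ - 1) * xC A⟦X⟧) • b := fun b => by
    rw [mul_smul, sub_smul, sub_smul, qC_smul, one_smul, one_smul]; rfl
  rw [e, ← qC_smul]
  refine h.point₂.flow_mSm (qC_mul_qC' _) ?_ h.mSm_lam (x := xC A⟦X⟧) reg_X h.isMLetter
    h.letter_mSm (QRel.X_smul_letter M) (QRel.X_smul_flowM U M)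
  have e1 := congrArg C h.uSm
  rw [C_qC_smul] at e1
  simpa using e1

theorem flow_SS :
    serreVar (qp 1 + 1 + qp (-1)) (C (S 1)) (C (S (-1)))
      (negInvAdd M U) (negInvAdd U M) = 0 ∧
    serreVar (qp 1 + 1 + qp (-1)) (C (S (-1))) (C (S 1))
      (negInvAdd U M) (negInvAdd M U) = 0 := by
  have e : ∀ b : A⟦X⟧, (qp 1 + 1 + qp (-1)) • b = (qC A⟦X⟧ + 1 + qC' A⟦X⟧) • b := fun b => by
    simp only [add_smul, qC_smul, qC'_smul, one_smul]
  have := h.point.flow_serre (qC_mul_qC' _) h.uSp h.mSp' h.uSm h.mSm'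
  simpa only [serreVar, e] using this

end QRelN

namespace IsFlowLiftN
variable {D : F →ₗ[Kq] A⟦X⟧} (hD : IsFlowLiftN f D UF MF U M SF S) (h : QRelN U M S)
include hD

theorem skew' (a b : F) : D (a * b) = D a * C (f b) + C (f a) * D b :=
  hD.skew a b

theorem coeff_mul_C (s : F⟦X⟧) (t : F) (i : ℕ) : D (coeff i (s * C t)) =
    coeff i (serMap (D : F →+ A⟦X⟧) s * C (C (f t)) +
      PowerSeries.map C (PowerSeries.map (f : F →+* A) s) * C (D t)) := by
  simp [PowerSeries.coeff_mul_C, hD.skew']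

theorem coeff_C_mul (s : F⟦X⟧) (t : F) (i : ℕ) : D (coeff i (C t * s)) =
    coeff i (C (D t) * PowerSeries.map C
        (PowerSeries.map (f : F →+* A) s) +
      C (C (f t)) * serMap (D : F →+ A⟦X⟧) s) := by
  simp [PowerSeries.coeff_C_mul, hD.skew']

include h

theorem rel_uS (ε : ℤˣ) (i : ℕ) : D (coeff i (UF * C (SF ε))) =
    qp ε • D (coeff i (C (SF ε) * UF)) := by
  rw [hD.coeff_mul_C, hD.coeff_C_mul, hD.on_u, hD.map_u, hD.map_S, ← PowerSeries.coeff_smul]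
  refine congrArg (coeff i) ?_
  rcases Int.units_eq_one_or ε with rfl | rfl
  · rw [hD.on_Sp]; exact h.flow_uSp
  · rw [hD.on_Sm]; exact h.flow_uSm

theorem rel_mSp (i : ℕ) : D (coeff i
      (MF * C (SF 1) - qp (-1) • (C (SF 1) * MF))) =
    D (coeff i ((1 - qp (-1)) • (1 : F⟦X⟧))) := by
  have e1 : D (coeff i (1 : F⟦X⟧)) = 0 := by
    have := congrArg (coeff i) hD.skew.serMap.map_one
    rw [coeff_serMap] at this
    simpa using this
  rw [map_sub, map_sub, PowerSeries.coeff_smul, PowerSeries.coeff_smul, map_smul, map_smul, e1,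
    smul_zero, sub_eq_zero, hD.coeff_mul_C, hD.coeff_C_mul, hD.on_m, hD.map_m, hD.map_S,
    ← PowerSeries.coeff_smul, hD.on_Sp]
  exact congrArg (coeff i) h.flow_mSp

theorem rel_mSm (i : ℕ) : D (coeff i
      (MF * C (SF (-1)) - qp 1 • (C (SF (-1)) * MF))) =
    D (coeff i (-(qp 1 - 1) • (X * MF ^ 2))) := by
  have e1 : D (coeff i (X * MF ^ 2)) = coeff i
      (X * (flowM U M * PowerSeries.map C M
        + PowerSeries.map C M * flowM U M)) := by
    have := hD.skew.serMap MF MF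
    rw [hD.on_m, hD.map_C_m] at this
    rw [← this, ← serMap_X_mul, coeff_serMap, pow_two]
    rfl
  rw [map_sub, map_sub, PowerSeries.coeff_smul, PowerSeries.coeff_smul, map_smul, map_smul, e1,
    hD.coeff_mul_C, hD.coeff_C_mul, hD.on_m, hD.map_m, hD.map_S, hD.on_Sm,
    ← PowerSeries.coeff_smul, ← PowerSeries.coeff_smul, h.flow_mSm, ← map_sub, neg_smul]
  refine congrArg (coeff i) ?_
  abel

theorem rel_SS (ε : ℤˣ) : D (serre (SF ε) (SF (-ε))) = 0 := by
  have key : ∀ a b, D (serre a b) = serreVar (qp 1 + 1 + qp (-1)) (C (f a))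
      (C (f b)) (D a) (D b) := by
    intro a b
    simp only [serre, serreVar, pow_succ, pow_zero, one_mul, map_sub, map_smul, hD.skew', map_mul]
    noncomm_ring
  rw [key, hD.map_S, hD.map_S]
  rcases Int.units_eq_one_or ε with rfl | rfl
  · rw [hD.on_Sp, hD.on_Sm]; exact h.flow_SS.1
  · rw [neg_neg, hD.on_Sp, hD.on_Sm]; exact h.flow_SS.2

end IsFlowLiftN
end

theorem QB.map_U : PowerSeries.map (QB.proj : _ →+* QB) GenB.U = genSer QB.u := by
  ext i
  simp [GenB.U, coeff_genSer, QB.u]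

theorem QB.map_M : PowerSeries.map (QB.proj : _ →+* QB) GenB.M = genSer QB.m := by
  ext i
  simp [GenB.M, coeff_genSer, QB.m]

theorem QB.proj_rel {r s} (h : RelB r s) : QB.proj r = QB.proj s := RingQuot.mkAlgHom_rel Kq h

theorem QB.qRel : QRel (genSer QB.u) (genSer QB.m) :=
  qRel_of_rel QB.map_U QB.map_M (fun i j => QB.proj_rel (.uu i j))
    (fun i j => QB.proj_rel (.mm i j)) (fun i j => QB.proj_rel (.um i j))

theorem QBN.map_U : PowerSeries.map (QBN.proj : _ →+* QBN) GenBN.U = genSer QBN.u := by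
  ext i
  simp [GenBN.U, coeff_genSer, QBN.u]

theorem QBN.map_M : PowerSeries.map (QBN.proj : _ →+* QBN) GenBN.M = genSer QBN.m := by
  ext i
  simp [GenBN.M, coeff_genSer, QBN.m]

theorem QBN.proj_rel {r s} (h : RelBN r s) : QBN.proj r = QBN.proj s := RingQuot.mkAlgHom_rel Kq h

theorem QBN.qRelN : QRelN (genSer QBN.u) (genSer QBN.m) QBN.S := by
  have hS : ∀ ε, (QBN.proj : _ →+* QBN) (GenBN.Sg ε) = QBN.S ε := fun _ => rfl
  refine { qRel_of_rel QBN.map_U QBN.map_M (fun i j => QBN.proj_rel (.uu i j))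
    (fun i j => QBN.proj_rel (.mm i j)) (fun i j => QBN.proj_rel (.um i j)) with
    uS := ?_, mSp := ?_, mSm := ?_, SS := ?_ }
  · intro ε
    ext i
    have := QBN.proj_rel (.uS ε i)
    rw [map_smul] at this
    rw [PowerSeries.coeff_smul, ← QBN.map_U, ← hS, ← PowerSeries.map_C, ← map_mul, ← map_mul,
      PowerSeries.coeff_map, PowerSeries.coeff_map]
    exact this
  · ext i
    have := QBN.proj_rel (.mSp i)
    rw [map_sub, map_sub, PowerSeries.coeff_smul, PowerSeries.coeff_smul, map_smul, map_smul] at this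
    rw [map_sub, PowerSeries.coeff_smul, PowerSeries.coeff_smul, ← QBN.map_M, ← hS,
      ← PowerSeries.map_C, ← map_mul, ← map_mul,
      PowerSeries.coeff_map, PowerSeries.coeff_map, ← map_one (PowerSeries.map (QBN.proj : FreeAlgebra Kq GenBN →+* QBN)),
      PowerSeries.coeff_map]
    exact this
  · ext i
    have := QBN.proj_rel (.mSm i)
    rw [map_sub, map_sub, PowerSeries.coeff_smul, PowerSeries.coeff_smul, map_smul, map_smul] at this
    rw [map_sub, PowerSeries.coeff_smul, PowerSeries.coeff_smul, ← QBN.map_M, ← hS,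
      ← PowerSeries.map_C, ← map_mul, ← map_mul,
      PowerSeries.coeff_map, PowerSeries.coeff_map, ← map_pow,
      ← PowerSeries.map_X (QBN.proj : FreeAlgebra Kq GenBN →+* QBN), ← map_mul, PowerSeries.coeff_map]
    exact this
  · intro ε
    have := QBN.proj_rel (.SS ε)
    rw [map_zero] at this
    rw [← this]
    simp only [serre, map_sub, map_mul, map_pow, map_smul]
    rfl

theorem QB.exists_flow : ∃ D : QB →ₗ[Kq] QB⟦X⟧,
    IsSkew C C (D : QB →+ QB⟦X⟧) ∧
    serMap (D : QB →+ QB⟦X⟧) (genSer QB.u) = flowU (genSer QB.u) (genSer QB.m) ∧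
    serMap (D : QB →+ QB⟦X⟧) (genSer QB.m) = flowM (genSer QB.u) (genSer QB.m) := by
  obtain ⟨D, hD, hgen⟩ := exists_skew_of_rel (Rel := RelB) (algC QB) (algC QB)
    (fun x => match x with
      | .u i => (-1) ^ i * coeff i (flowU (genSer QB.u) (genSer QB.m))
      | .m i => (-1) ^ i * coeff i (flowM (genSer QB.u) (genSer QB.m))) (by
    intro D hD hgen r s hrs
    have hl : IsFlowLift QB.proj (D : _ →+ QB⟦X⟧) GenB.U GenB.M (genSer QB.u) (genSer QB.m) :=
      ⟨hD, QB.map_U, QB.map_M, (serMap_genSer _ _ _).2 fun i => hgen (.u i),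
        (serMap_genSer _ _ _).2 fun i => hgen (.m i)⟩
    cases hrs with
    | uu i j => rw [map_smul]; exact hl.rel_uu QB.qRel i j
    | mm i j => rw [map_smul]; exact hl.rel_mm QB.qRel i j
    | um i j => rw [map_smul]; exact hl.rel_um QB.qRel i j)
  refine ⟨D, hD, ?_, ?_⟩
  · rw [serMap_genSer]; exact fun i => hgen (.u i)
  · rw [serMap_genSer]; exact fun i => hgen (.m i)

theorem QBN.exists_flow : ∃ D : QBN →ₗ[Kq] QBN⟦X⟧,
    IsSkew C C (D : QBN →+ QBN⟦X⟧) ∧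
    serMap (D : QBN →+ QBN⟦X⟧) (genSer QBN.u) = flowU (genSer QBN.u) (genSer QBN.m) ∧
    serMap (D : QBN →+ QBN⟦X⟧) (genSer QBN.m) = flowM (genSer QBN.u) (genSer QBN.m) ∧
    D (QBN.S 1) = negInvAdd (genSer QBN.m) (genSer QBN.u) ∧
    D (QBN.S (-1)) = negInvAdd (genSer QBN.u) (genSer QBN.m) := by
  obtain ⟨D, hD, hgen⟩ := exists_skew_of_rel (Rel := RelBN) (algC QBN) (algC QBN)
    (fun x => match x with
      | .u i => (-1) ^ i * coeff i (flowU (genSer QBN.u) (genSer QBN.m))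
      | .m i => (-1) ^ i * coeff i (flowM (genSer QBN.u) (genSer QBN.m))
      | .S ε => if ε = 1 then negInvAdd (genSer QBN.m) (genSer QBN.u) else
          negInvAdd (genSer QBN.u) (genSer QBN.m)) (by
    intro D hD hgen r s hrs
    have hl : IsFlowLiftN QBN.proj D GenBN.U GenBN.M (genSer QBN.u) (genSer QBN.m)
        GenBN.Sg QBN.S :=
      { skew := hD, map_u := QBN.map_U, map_m := QBN.map_M
        on_u := (serMap_genSer _ _ _).2 fun i => hgen (.u i)
        on_m := (serMap_genSer _ _ _).2 fun i => hgen (.m i)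
        map_S := fun _ => rfl
        on_Sp := (hgen (.S 1)).trans (if_pos rfl)
        on_Sm := (hgen (.S (-1))).trans (if_neg (by decide)) }
    cases hrs with
    | uu i j => rw [map_smul]; exact hl.rel_uu QBN.qRelN.toQRel i j
    | mm i j => rw [map_smul]; exact hl.rel_mm QBN.qRelN.toQRel i j
    | um i j => rw [map_smul]; exact hl.rel_um QBN.qRelN.toQRel i j
    | uS ε i => rw [map_smul]; exact hl.rel_uS QBN.qRelN ε i
    | mSp i => exact hl.rel_mSp QBN.qRelN i
    | mSm i => exact hl.rel_mSm QBN.qRelN i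
    | SS ε => rw [map_zero]; exact hl.rel_SS QBN.qRelN ε)
  refine ⟨D, hD, ?_, ?_, ?_, ?_⟩
  · rw [serMap_genSer]; exact fun i => hgen (.u i)
  · rw [serMap_genSer]; exact fun i => hgen (.m i)
  · exact (hgen (.S 1)).trans (if_pos rfl)
  · exact (hgen (.S (-1))).trans (if_neg (by decide))

/-! ### Uniqueness of the flows -/

section
variable {A : Type} [Ring A] [Algebra Kq A]

theorem X_sub_mul_flowU (U M : A⟦X⟧) :
    (X - C X) * flowU U M =
      (X * PowerSeries.map C U
        - C X * C U) * C (negInvAdd U M) *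
          PowerSeries.map C U
      - C X * (PowerSeries.map C U - C U) *
        (1 + C (negInvAdd U M) * C U) := by
  have e := eq_sub_of_add_eq (QRel.X_smul_letter U).symm
  have e2 := QRel.divDiff_smul U
  change (xC A⟦X⟧ - liftC (xC A)) • flowU U M = (xC A⟦X⟧ • _ - liftC (xC A) • _) * _ * _ -
    (liftC (xC A) • _) * _
  have e3 : flowU U M = letter U * C (negInvAdd U M) * PowerSeries.map C U
    - liftC (xC A) • (divDiff U * (1 + C (negInvAdd U M) * C U)) := rfl
  rw [e3, ← e2, ← e]
  simp only [smul_mul_assoc, smul_sub]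
  rw [smul_comm (liftC (xC A))]

theorem X_sub_mul_flowM (U M : A⟦X⟧) :
    (X - C X) * flowM U M =
      C X * (1 + C M * C (negInvAdd M U)) *
        (PowerSeries.map C M - C M)
      - PowerSeries.map C M * C (negInvAdd M U) *
        (X * PowerSeries.map C M
          - C X * C M) := by
  have e := eq_sub_of_add_eq (QRel.X_smul_letter M).symm
  have e2 := QRel.divDiff_smul M
  change (xC A⟦X⟧ - liftC (xC A)) • flowM U M = (liftC (xC A) • _) * _ -
    _ * (xC A⟦X⟧ • _ - liftC (xC A) • _)
  have e3 : flowM U M = -(PowerSeries.map C M * C (negInvAdd M U) * letter M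
    - liftC (xC A) • ((1 + C M * C (negInvAdd M U)) * divDiff M)) := rfl
  rw [e3, ← e2, ← e]
  simp only [smul_mul_assoc, mul_smul_comm, smul_sub, neg_sub]

theorem flowSerLam_eq {H : ℕ+ → A →ₗ[Kq] A} {D : A →+ A⟦X⟧} (hD : ∀ a, flowSer H a = D a)
    (s : A⟦X⟧) : flowSerLam H s = serSwap (serMap D s) := by
  ext k i
  rw [coeff_coeff_serSwap, coeff_serMap, ← hD, flowSerLam, flowSer, PowerSeries.coeff_mk,
    PowerSeries.coeff_mk]
  split_ifs with h
  · have := map_neg_one_pow_mul ((coeff (R := A) i : A⟦X⟧ →ₗ[A] A) : A⟦X⟧ →+ A) k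
      (applySer (H ⟨k, h⟩) s)
    refine this.trans ?_
    simp [applySer]
  · simp

/-- The formulas of the definition, multiplied by `λ⁻¹ - μ⁻¹`, determine `H(μ)(u(λ))` and
`H(μ)(m(λ))`, because `λ⁻¹ - μ⁻¹` is regular. -/
theorem flowFormulas_iff {H : ℕ+ → A →ₗ[Kq] A} {D : A →+ A⟦X⟧} (hD : ∀ a, flowSer H a = D a)
    (U M : A⟦X⟧) :
    FlowFormulas U M H ↔ serMap D U = flowU U M ∧ serMap D M = flowM U M := by
  have inj : Function.Injective (serSwap (A := A)) :=
    Function.LeftInverse.injective serSwap_serSwap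
  have e : serSwap (xLam A - xMu A) = X - C X := by
    simp [xLam, xMu]
  have e1 : ((xLam A - xMu A) * flowSerLam H U =
    (xLam A * inLam U - xMu A * inMu U) * inMu (negInvAdd U M) * inLam U
      - xMu A * (inLam U - inMu U) * (1 + inMu (negInvAdd U M) * inMu U)) ↔
      serMap D U = flowU U M := by
    rw [← inj.eq_iff, flowSerLam_eq hD, map_mul, e, serSwap_serSwap]
    have : serSwap ((xLam A * inLam U - xMu A * inMu U) * inMu (negInvAdd U M) * inLam U
      - xMu A * (inLam U - inMu U) * (1 + inMu (negInvAdd U M) * inMu U)) =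
      (X - C X) * flowU U M := by
      rw [X_sub_mul_flowU]
      simp [xLam, xMu, inLam, inMu]
    rw [this]
    exact ⟨fun h => Reg.cancel reg_X.X_sub_C h, fun h => by rw [h]⟩
  have e2 : ((xLam A - xMu A) * flowSerLam H M =
    xMu A * (1 + inMu M * inMu (negInvAdd M U)) * (inLam M - inMu M)
      - inLam M * inMu (negInvAdd M U) * (xLam A * inLam M - xMu A * inMu M)) ↔
      serMap D M = flowM U M := by
    rw [← inj.eq_iff, flowSerLam_eq hD, map_mul, e, serSwap_serSwap]
    have : serSwap (xMu A * (1 + inMu M * inMu (negInvAdd M U)) * (inLam M - inMu M)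
      - inLam M * inMu (negInvAdd M U) * (xLam A * inLam M - xMu A * inMu M)) =
      (X - C X) * flowM U M := by
      rw [X_sub_mul_flowM]
      simp [xLam, xMu, inLam, inMu]
    rw [this]
    exact ⟨fun h => Reg.cancel reg_X.X_sub_C h, fun h => by rw [h]⟩
  rw [← e1, ← e2]
  exact ⟨fun h => ⟨h.on_u, h.on_m⟩, fun h => ⟨h.1, h.2⟩⟩

/-- The family `H` as a single linear map `H(μ)`. -/
def flowSerHom (H : ℕ+ → A →ₗ[Kq] A) : A →ₗ[Kq] A⟦X⟧ where
  toFun := flowSer H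
  map_add' a b := by
    ext k
    simp only [flowSer, PowerSeries.coeff_mk, map_add]
    split_ifs <;> simp [mul_add]
  map_smul' r a := by
    ext k
    simp only [flowSer, PowerSeries.coeff_mk, map_smul, PowerSeries.coeff_smul, RingHom.id_apply]
    split_ifs <;> simp

/-- The family with generating series `D`. -/
def flowOf (D : A →ₗ[Kq] A⟦X⟧) (n : ℕ+) : A →ₗ[Kq] A where
  toFun a := (-1) ^ (n : ℕ) * coeff n (D a)
  map_add' a b := by simp [mul_add]
  map_smul' r a := by simp

theorem flowOf_apply (D : A →ₗ[Kq] A⟦X⟧) (n : ℕ+) (a : A) :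
    flowOf D n a = (-1) ^ (n : ℕ) * coeff n (D a) := rfl

theorem flowOf_flowSerHom (H : ℕ+ → A →ₗ[Kq] A) : flowOf (flowSerHom H) = H := by
  funext n
  ext a
  have : coeff (n : ℕ) (flowSerHom H a) = (-1) ^ (n : ℕ) * H n a := by
    change coeff (n : ℕ) (flowSer H a) = _
    rw [flowSer, PowerSeries.coeff_mk, dif_pos n.pos]
    rfl
  rw [flowOf_apply, this, ← mul_assoc, neg_one_pow_mul_self', one_mul]

theorem flowSer_flowOf {D : A →ₗ[Kq] A⟦X⟧} (h0 : ∀ a, constantCoeff (D a) = 0) (a : A) :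
    flowSer (flowOf D) a = D a := by
  ext k
  rw [flowSer, PowerSeries.coeff_mk]
  split_ifs with h
  · change (-1) ^ k * ((-1) ^ k * coeff k (D a)) = _
    rw [← mul_assoc, neg_one_pow_mul_self', one_mul]
  · obtain rfl : k = 0 := by omega
    rw [PowerSeries.coeff_zero_eq_constantCoeff_apply, h0]

theorem isDeriv_flowOf {D : A →ₗ[Kq] A⟦X⟧}
    (hD : IsSkew C C (D : A →+ A⟦X⟧)) (n : ℕ+) : IsDeriv (flowOf D n) := by
  intro a b
  have e := congrArg (coeff (n : ℕ)) (hD a b)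
  simp only [map_add, PowerSeries.coeff_mul_C, PowerSeries.coeff_C_mul] at e
  have e' : coeff (n : ℕ) (D (a * b)) =
    coeff (n : ℕ) (D a) * b + a * coeff (n : ℕ) (D b) := e
  rw [flowOf_apply, flowOf_apply, flowOf_apply, e']
  rcases neg_one_pow_eq_or A (n : ℕ) with h | h <;> rw [h] <;> noncomm_ring

theorem skew_flowSerHom {H : ℕ+ → A →ₗ[Kq] A} (h : ∀ n, IsDeriv (H n)) :
    IsSkew C C (flowSerHom H : A →+ A⟦X⟧) := by
  intro a b
  change flowSer H (a * b) = flowSer H a * _ + _ * flowSer H b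
  ext k
  rw [map_add, PowerSeries.coeff_mul_C, PowerSeries.coeff_C_mul]
  simp only [flowSer, PowerSeries.coeff_mk]
  split_ifs with hk
  · rw [h ⟨k, hk⟩ a b]
    rcases neg_one_pow_eq_or A k with h | h <;> rw [h] <;> noncomm_ring
  · simp

theorem map_constantCoeff_flowU (U M : A⟦X⟧) :
    PowerSeries.map constantCoeff (flowU U M) = 0 := by
  simp [flowU, negInvAdd]

theorem map_constantCoeff_flowM (U M : A⟦X⟧) :
    PowerSeries.map constantCoeff (flowM U M) = 0 := by
  simp [flowM, negInvAdd]

/-- The value on `Σ̄₊` is `w(μ)`, just as the value on `Σ̄₋` is `v(μ)`. -/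
theorem negInvAdd_eq' {U M : A⟦X⟧} (h : QRel U M) : negInvAdd M U =
    -(X * (U + U * negInvAdd U M * U)) := by
  rw [h.point.w_eq, ← h.point.G_eq, mul_add, mul_one, ← mul_assoc]
  rfl

end

theorem QB.skew_ext {B : Type*} [Ring B] [Algebra Kq B] {g f : QB →+* B} {D D' : QB →ₗ[Kq] B}
    (h : IsSkew g f (D : QB →+ B)) (h' : IsSkew g f (D' : QB →+ B))
    (hu : serMap (D : QB →+ B) (genSer QB.u) = serMap (D' : QB →+ B) (genSer QB.u))
    (hm : serMap (D : QB →+ B) (genSer QB.m) = serMap (D' : QB →+ B) (genSer QB.m)) : D = D' := by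
  have one : ∀ {E : QB →ₗ[Kq] B}, IsSkew g f (E : QB →+ B) → ∀ r, E (algebraMap Kq QB r) = 0 :=
    fun hE r => by
      rw [Algebra.algebraMap_eq_smul_one, map_smul]
      have := hE.map_one
      exact (congrArg _ this).trans (smul_zero r)
  rw [serMap_genSer] at hu hm
  ext a
  refine quot_induction (Rel := RelB) (p := fun a => D a = D' a) ?_ ?_ ?_ ?_ a
  · exact fun r => (one h r).trans (one h' r).symm
  · rintro (i | i)
    · refine (hu i).trans ?_
      rw [coeff_serMap, coeff_genSer, map_neg_one_pow_mul, ← mul_assoc, neg_one_pow_mul_self',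
        one_mul]
      rfl
    · refine (hm i).trans ?_
      rw [coeff_serMap, coeff_genSer, map_neg_one_pow_mul, ← mul_assoc, neg_one_pow_mul_self',
        one_mul]
      rfl
  · intro a b ha hb
    refine (h a b).trans ((h' a b).trans ?_).symm
    congr 2
    · exact ha.symm
    · exact hb.symm
  · intro a b ha hb
    exact (D.map_add a b).trans ((congrArg₂ _ ha hb).trans (D'.map_add a b).symm)

theorem QBN.skew_ext {B : Type*} [Ring B] [Algebra Kq B] {g f : QBN →+* B} {D D' : QBN →ₗ[Kq] B}
    (h : IsSkew g f (D : QBN →+ B)) (h' : IsSkew g f (D' : QBN →+ B))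
    (hu : serMap (D : QBN →+ B) (genSer QBN.u) = serMap (D' : QBN →+ B) (genSer QBN.u))
    (hm : serMap (D : QBN →+ B) (genSer QBN.m) = serMap (D' : QBN →+ B) (genSer QBN.m))
    (hS : ∀ ε, D (QBN.S ε) = D' (QBN.S ε)) : D = D' := by
  have one : ∀ {E : QBN →ₗ[Kq] B}, IsSkew g f (E : QBN →+ B) → ∀ r, E (algebraMap Kq QBN r) = 0 :=
    fun hE r => by
      rw [Algebra.algebraMap_eq_smul_one, map_smul]
      have := hE.map_one
      exact (congrArg _ this).trans (smul_zero r)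
  rw [serMap_genSer] at hu hm
  ext a
  refine quot_induction (Rel := RelBN) (p := fun a => D a = D' a) ?_ ?_ ?_ ?_ a
  · exact fun r => (one h r).trans (one h' r).symm
  · rintro (i | i | ε)
    · refine (hu i).trans ?_
      rw [coeff_serMap, coeff_genSer, map_neg_one_pow_mul, ← mul_assoc, neg_one_pow_mul_self',
        one_mul]
      rfl
    · refine (hm i).trans ?_
      rw [coeff_serMap, coeff_genSer, map_neg_one_pow_mul, ← mul_assoc, neg_one_pow_mul_self',
        one_mul]
      rfl
    · exact hS ε
  · intro a b ha hb
    refine (h a b).trans ((h' a b).trans ?_).symm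
    congr 2
    · exact ha.symm
    · exact hb.symm
  · intro a b ha hb
    exact (D.map_add a b).trans ((congrArg₂ _ ha hb).trans (D'.map_add a b).symm)

/-- The constant coefficient, as a linear map. -/
def constLin (A : Type*) [Ring A] [Algebra Kq A] : A⟦X⟧ →ₗ[Kq] A where
  toFun := constantCoeff
  map_add' := map_add _
  map_smul' r s := by
    rw [← PowerSeries.coeff_zero_eq_constantCoeff_apply, PowerSeries.coeff_smul,
      PowerSeries.coeff_zero_eq_constantCoeff_apply, RingHom.id_apply]

theorem QB.constantCoeff_flow {D : QB →ₗ[Kq] QB⟦X⟧}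
    (hD : IsSkew C C (D : QB →+ QB⟦X⟧))
    (hu : serMap (D : QB →+ QB⟦X⟧) (genSer QB.u) = flowU (genSer QB.u) (genSer QB.m))
    (hm : serMap (D : QB →+ QB⟦X⟧) (genSer QB.m) = flowM (genSer QB.u) (genSer QB.m)) (a : QB) :
    constantCoeff (D a) = 0 := by
  have : (constLin QB).comp D = 0 := by
    refine QB.skew_ext (hD.comp_left constantCoeff) (fun a b => by simp) ?_ ?_
    · have e := congrArg (PowerSeries.map constantCoeff) hu
      rw [map_serMap, map_constantCoeff_flowU] at e
      refine e.trans ?_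
      ext; simp
    · have e := congrArg (PowerSeries.map constantCoeff) hm
      rw [map_serMap, map_constantCoeff_flowM] at e
      refine e.trans ?_
      ext; simp
  exact LinearMap.congr_fun this a

theorem QBN.constantCoeff_flow {D : QBN →ₗ[Kq] QBN⟦X⟧}
    (hD : IsSkew C C (D : QBN →+ QBN⟦X⟧))
    (hu : serMap (D : QBN →+ QBN⟦X⟧) (genSer QBN.u) = flowU (genSer QBN.u) (genSer QBN.m))
    (hm : serMap (D : QBN →+ QBN⟦X⟧) (genSer QBN.m) = flowM (genSer QBN.u) (genSer QBN.m))
    (hSp : D (QBN.S 1) = negInvAdd (genSer QBN.m) (genSer QBN.u))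
    (hSm : D (QBN.S (-1)) = negInvAdd (genSer QBN.u) (genSer QBN.m)) (a : QBN) :
    constantCoeff (D a) = 0 := by
  have : (constLin QBN).comp D = 0 := by
    refine QBN.skew_ext (hD.comp_left constantCoeff) (fun a b => by simp) ?_ ?_ ?_
    · have e := congrArg (PowerSeries.map constantCoeff) hu
      rw [map_serMap, map_constantCoeff_flowU] at e
      refine e.trans ?_
      ext; simp
    · have e := congrArg (PowerSeries.map constantCoeff) hm
      rw [map_serMap, map_constantCoeff_flowM] at e
      refine e.trans ?_
      ext; simp
    · intro ε
      change constantCoeff (D _) = 0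
      rcases Int.units_eq_one_or ε with rfl | rfl
      · rw [hSp, negInvAdd]; simp
      · rw [hSm, negInvAdd]; simp
  exact LinearMap.congr_fun this a

/-! ### Naturality, and the natural map between the two algebras -/

section Naturality
variable {A B : Type} [Ring A] [Ring B] (φ : A →+* B)

theorem map_resolv (s t : A⟦X⟧) : PowerSeries.map φ (resolv s t) =
    resolv (PowerSeries.map φ s) (PowerSeries.map φ t) := by
  have h := congrArg (PowerSeries.map φ) (mul_resolv s t)
  simp only [map_mul, map_add, map_one, PowerSeries.map_X] at h
  exact (left_inv_eq_right_inv (resolv_mul _ _) h).symm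

theorem map_negInvAdd (s t : A⟦X⟧) : PowerSeries.map φ (negInvAdd s t) =
    negInvAdd (PowerSeries.map φ s) (PowerSeries.map φ t) := by
  simp [negInvAdd_eq, map_resolv]

theorem map_divDiff (s : A⟦X⟧) : PowerSeries.map (PowerSeries.map φ) (divDiff s) =
    divDiff (PowerSeries.map φ s) := by
  ext i j
  simp [divDiff]

theorem map_map_map_C (s : A⟦X⟧) :
    PowerSeries.map (PowerSeries.map φ) (PowerSeries.map C s) =
      PowerSeries.map C (PowerSeries.map φ s) := by
  ext i
  simp

theorem map_letter (s : A⟦X⟧) : PowerSeries.map (PowerSeries.map φ) (letter s) =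
    letter (PowerSeries.map φ s) := by
  simp [letter, map_divDiff, map_map_map_C]

theorem map_flowU (U M : A⟦X⟧) : PowerSeries.map (PowerSeries.map φ) (flowU U M) =
    flowU (PowerSeries.map φ U) (PowerSeries.map φ M) := by
  simp [flowU, map_divDiff, map_map_map_C, map_letter, map_negInvAdd]

theorem map_flowM (U M : A⟦X⟧) : PowerSeries.map (PowerSeries.map φ) (flowM U M) =
    flowM (PowerSeries.map φ U) (PowerSeries.map φ M) := by
  simp [flowM, map_divDiff, map_map_map_C, map_letter, map_negInvAdd]

theorem map_genSer (c : ℕ → A) : PowerSeries.map φ (genSer c) = genSer fun i => φ (c i) := by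
  ext i
  simp [coeff_genSer]

theorem map_inMu (s : A⟦X⟧) : PowerSeries.map (PowerSeries.map φ) (inMu s) =
    inMu (PowerSeries.map φ s) := map_map_map_C φ s

theorem map_inLam (s : A⟦X⟧) : PowerSeries.map (PowerSeries.map φ) (inLam s) =
    inLam (PowerSeries.map φ s) := by
  simp [inLam]

end Naturality

section Lift
variable {A : Type} [Ring A] [Algebra Kq A]

/-- The algebra map out of `ℂ[H₋\B₋]_q` given by two series that satisfy the relations. -/
def QB.lift {c d : ℕ → A} (h : QRel (genSer c) (genSer d)) : QB →ₐ[Kq] A :=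
  RingQuot.liftAlgHom Kq ⟨FreeAlgebra.lift Kq fun
    | .u i => c i
    | .m i => d i, by
    set f : FreeAlgebra Kq GenB →ₐ[Kq] A := FreeAlgebra.lift Kq fun
      | .u i => c i
      | .m i => d i with hf
    have hU : PowerSeries.map (f : _ →+* A) GenB.U = genSer c := by
      rw [GenB.U, map_genSer]
      congr 1; funext i
      exact FreeAlgebra.lift_ι_apply _ _
    have hM : PowerSeries.map (f : _ →+* A) GenB.M = genSer d := by
      rw [GenB.M, map_genSer]
      congr 1; funext i
      exact FreeAlgebra.lift_ι_apply _ _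
    have e := map_coeffLM (f : FreeAlgebra Kq GenB →+* A)
    rintro r s (⟨i, j⟩ | ⟨i, j⟩ | ⟨i, j⟩)
    · rw [map_smul]
      refine (e _ _ _).trans (.trans ?_ (congrArg (fun b => qp 1 • b) (e _ _ _)).symm)
      rw [map_quadLeft, map_quadRight, hU, h.uu, coeffLM_smul]
    · rw [map_smul]
      refine (e _ _ _).trans (.trans ?_ (congrArg (fun b => qp (-1) • b) (e _ _ _)).symm)
      rw [map_quadLeft, map_quadRight, hM, h.mm, coeffLM_smul]
    · rw [map_smul]
      refine (e _ _ _).trans (.trans ?_ (congrArg (fun b => qp (-1) • b) (e _ _ _)).symm)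
      rw [map_mul, map_mul, map_inMu, map_inLam, hU, hM, h.um, coeffLM_smul]⟩

theorem QB.lift_u {c d : ℕ → A} (h : QRel (genSer c) (genSer d)) (i : ℕ) :
    QB.lift h (QB.u i) = c i :=
  (RingQuot.liftAlgHom_mkAlgHom_apply Kq _ _ _).trans (FreeAlgebra.lift_ι_apply _ _)

theorem QB.lift_m {c d : ℕ → A} (h : QRel (genSer c) (genSer d)) (i : ℕ) :
    QB.lift h (QB.m i) = d i :=
  (RingQuot.liftAlgHom_mkAlgHom_apply Kq _ _ _).trans (FreeAlgebra.lift_ι_apply _ _)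

/-- The algebra map out of `ℂ[H₋\B₋N₊]_q` given by two series and two elements that satisfy the
relations. -/
def QBN.lift {c d : ℕ → A} {S : ℤˣ → A} (h : QRelN (genSer c) (genSer d) S) : QBN →ₐ[Kq] A :=
  RingQuot.liftAlgHom Kq ⟨FreeAlgebra.lift Kq fun
    | .u i => c i
    | .m i => d i
    | .S ε => S ε, by
    set f : FreeAlgebra Kq GenBN →ₐ[Kq] A := FreeAlgebra.lift Kq fun
      | .u i => c i
      | .m i => d i
      | .S ε => S ε with hf
    have hU : PowerSeries.map (f : _ →+* A) GenBN.U = genSer c := by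
      rw [GenBN.U, map_genSer]
      congr 1; funext i
      exact FreeAlgebra.lift_ι_apply _ _
    have hM : PowerSeries.map (f : _ →+* A) GenBN.M = genSer d := by
      rw [GenBN.M, map_genSer]
      congr 1; funext i
      exact FreeAlgebra.lift_ι_apply _ _
    have hS : ∀ ε, f (GenBN.Sg ε) = S ε := fun ε => FreeAlgebra.lift_ι_apply _ _
    have hS' : ∀ ε, (f : _ →+* A) (GenBN.Sg ε) = S ε := hS
    have e := map_coeffLM (f : FreeAlgebra Kq GenBN →+* A)
    have e1 : ∀ i s, f (coeff i s) =
        coeff i (PowerSeries.map (f : _ →+* A) s) := fun i s => by simp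
    have hmul := (PowerSeries.map (f : FreeAlgebra Kq GenBN →+* A)).map_mul
    have hpow := (PowerSeries.map (f : FreeAlgebra Kq GenBN →+* A)).map_pow
    rintro r s (⟨i, j⟩ | ⟨i, j⟩ | ⟨i, j⟩ | ⟨ε, i⟩ | i | i | ε)
    · rw [map_smul]
      refine (e _ _ _).trans (.trans ?_ (congrArg (fun b => qp 1 • b) (e _ _ _)).symm)
      rw [map_quadLeft, map_quadRight, hU, h.uu, coeffLM_smul]
    · rw [map_smul]
      refine (e _ _ _).trans (.trans ?_ (congrArg (fun b => qp (-1) • b) (e _ _ _)).symm)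
      rw [map_quadLeft, map_quadRight, hM, h.mm, coeffLM_smul]
    · rw [map_smul]
      refine (e _ _ _).trans (.trans ?_ (congrArg (fun b => qp (-1) • b) (e _ _ _)).symm)
      rw [map_mul, map_mul, map_inMu, map_inLam, hU, hM, h.um, coeffLM_smul]
    · rw [map_smul, e1, e1, hmul, hmul, hU, PowerSeries.map_C, hS', h.uS,
        PowerSeries.coeff_smul]
    · have := congrArg (coeff i) h.mSp
      rw [map_sub, map_sub, PowerSeries.coeff_smul, map_smul, e1, e1, hmul, hmul, hM,
        PowerSeries.map_C, hS', PowerSeries.coeff_smul, map_smul, e1, map_one,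
        ← PowerSeries.coeff_smul, ← PowerSeries.coeff_smul, ← map_sub]
      exact this
    · have := congrArg (coeff i) h.mSm
      rw [map_sub, map_sub, PowerSeries.coeff_smul, map_smul, e1, e1, hmul, hmul, hM,
        PowerSeries.map_C, hS', PowerSeries.coeff_smul, map_smul, e1, hmul, hpow, hM,
        PowerSeries.map_X,
        ← PowerSeries.coeff_smul, ← PowerSeries.coeff_smul, ← map_sub]
      exact this
    · have := h.SS ε
      rw [serre] at this
      simp only [serre, map_sub, map_mul, map_pow, map_smul, hS, map_zero]
      exact this⟩

theorem QBN.lift_u {c d : ℕ → A} {S : ℤˣ → A} (h : QRelN (genSer c) (genSer d) S) (i : ℕ) :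
    QBN.lift h (QBN.u i) = c i :=
  (RingQuot.liftAlgHom_mkAlgHom_apply Kq _ _ _).trans (FreeAlgebra.lift_ι_apply _ _)

theorem QBN.lift_m {c d : ℕ → A} {S : ℤˣ → A} (h : QRelN (genSer c) (genSer d) S) (i : ℕ) :
    QBN.lift h (QBN.m i) = d i :=
  (RingQuot.liftAlgHom_mkAlgHom_apply Kq _ _ _).trans (FreeAlgebra.lift_ι_apply _ _)

theorem QBN.lift_S {c d : ℕ → A} {S : ℤˣ → A} (h : QRelN (genSer c) (genSer d) S) (ε : ℤˣ) :
    QBN.lift h (QBN.S ε) = S ε :=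
  (RingQuot.liftAlgHom_mkAlgHom_apply Kq _ _ _).trans (FreeAlgebra.lift_ι_apply _ _)

end Lift

/-- The derivation `H(μ)` of `ℂ[H₋\B₋]_q`. -/
def QB.flow : QB →ₗ[Kq] QB⟦X⟧ := QB.exists_flow.choose

theorem QB.flow_skew : IsSkew C C (QB.flow : QB →+ QB⟦X⟧) :=
  QB.exists_flow.choose_spec.1

theorem QB.flow_u : serMap (QB.flow : QB →+ QB⟦X⟧) (genSer QB.u) =
    flowU (genSer QB.u) (genSer QB.m) := QB.exists_flow.choose_spec.2.1

theorem QB.flow_m : serMap (QB.flow : QB →+ QB⟦X⟧) (genSer QB.m) =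
    flowM (genSer QB.u) (genSer QB.m) := QB.exists_flow.choose_spec.2.2

/-- The derivation `H(μ)` of `ℂ[H₋\B₋N₊]_q`. -/
def QBN.flow : QBN →ₗ[Kq] QBN⟦X⟧ := QBN.exists_flow.choose

theorem QBN.flow_skew : IsSkew C C (QBN.flow : QBN →+ QBN⟦X⟧) :=
  QBN.exists_flow.choose_spec.1

theorem QBN.flow_u : serMap (QBN.flow : QBN →+ QBN⟦X⟧) (genSer QBN.u) =
    flowU (genSer QBN.u) (genSer QBN.m) := QBN.exists_flow.choose_spec.2.1

theorem QBN.flow_m : serMap (QBN.flow : QBN →+ QBN⟦X⟧) (genSer QBN.m) =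
    flowM (genSer QBN.u) (genSer QBN.m) := QBN.exists_flow.choose_spec.2.2.1

theorem QBN.flow_Sp : QBN.flow (QBN.S 1) = negInvAdd (genSer QBN.m) (genSer QBN.u) :=
  QBN.exists_flow.choose_spec.2.2.2.1

theorem QBN.flow_Sm : QBN.flow (QBN.S (-1)) = negInvAdd (genSer QBN.u) (genSer QBN.m) :=
  QBN.exists_flow.choose_spec.2.2.2.2

theorem QB.flowSer_flow (a : QB) : flowSer (flowOf QB.flow) a = QB.flow a :=
  flowSer_flowOf (QB.constantCoeff_flow QB.flow_skew QB.flow_u QB.flow_m) a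

theorem QBN.flowSer_flow (a : QBN) : flowSer (flowOf QBN.flow) a = QBN.flow a :=
  flowSer_flowOf (QBN.constantCoeff_flow QBN.flow_skew QBN.flow_u QBN.flow_m QBN.flow_Sp
    QBN.flow_Sm) a

theorem QB.isFlow : IsFlowB (flowOf QB.flow) where
  deriv := isDeriv_flowOf QB.flow_skew
  formulas := (flowFormulas_iff (D := (QB.flow : QB →+ QB⟦X⟧)) QB.flowSer_flow _ _).2
    ⟨QB.flow_u, QB.flow_m⟩

theorem QBN.isFlow : IsFlowBN (flowOf QBN.flow) where
  deriv := isDeriv_flowOf QBN.flow_skew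
  formulas := (flowFormulas_iff (D := (QBN.flow : QBN →+ QBN⟦X⟧)) QBN.flowSer_flow _ _).2
    ⟨QBN.flow_u, QBN.flow_m⟩
  on_Sp := by rw [QBN.flowSer_flow, QBN.flow_Sp, negInvAdd_eq' QBN.qRelN.toQRel]
  on_Sm := by rw [QBN.flowSer_flow, QBN.flow_Sm]

theorem QB.flow_unique {H : ℕ+ → QB →ₗ[Kq] QB} (h : IsFlowB H) : H = flowOf QB.flow := by
  have e := (flowFormulas_iff (D := (flowSerHom H : QB →+ QB⟦X⟧)) (fun _ => rfl) _ _).1 h.formulas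
  rw [← flowOf_flowSerHom H]
  exact congrArg flowOf (QB.skew_ext (skew_flowSerHom h.deriv) QB.flow_skew
    (e.1.trans QB.flow_u.symm) (e.2.trans QB.flow_m.symm))

theorem QBN.flow_unique {H : ℕ+ → QBN →ₗ[Kq] QBN} (h : IsFlowBN H) : H = flowOf QBN.flow := by
  have e := (flowFormulas_iff (D := (flowSerHom H : QBN →+ QBN⟦X⟧)) (fun _ => rfl) _ _).1 h.formulas
  rw [← flowOf_flowSerHom H]
  refine congrArg flowOf (QBN.skew_ext (skew_flowSerHom h.deriv) QBN.flow_skew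
    (e.1.trans QBN.flow_u.symm) (e.2.trans QBN.flow_m.symm) fun ε => ?_)
  rcases Int.units_eq_one_or ε with rfl | rfl
  · exact h.on_Sp.trans ((negInvAdd_eq' QBN.qRelN.toQRel).symm.trans QBN.flow_Sp.symm)
  · exact h.on_Sm.trans QBN.flow_Sm.symm

/-- The natural algebra map. -/
def QB.toQBN : QB →ₐ[Kq] QBN := QB.lift QBN.qRelN.toQRel

/-- An algebra map applied to all coefficients, as a linear map. -/
def mapLin {A B : Type*} [Ring A] [Ring B] [Algebra Kq A] [Algebra Kq B] (φ : A →ₐ[Kq] B) :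
    A⟦X⟧ →ₗ[Kq] B⟦X⟧ where
  toFun := PowerSeries.map (φ : A →+* B)
  map_add' := map_add _
  map_smul' r s := by
    ext i
    simp

theorem QB.map_toQBN_u : PowerSeries.map (QB.toQBN : QB →+* QBN) (genSer QB.u) =
    genSer QBN.u := by
  rw [map_genSer]
  exact congrArg genSer (funext fun i => QB.lift_u _ i)

theorem QB.map_toQBN_m : PowerSeries.map (QB.toQBN : QB →+* QBN) (genSer QB.m) =
    genSer QBN.m := by
  rw [map_genSer]
  exact congrArg genSer (funext fun i => QB.lift_m _ i)

theorem QB.map_flow (a : QB) :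
    PowerSeries.map (QB.toQBN : QB →+* QBN) (QB.flow a) = QBN.flow (QB.toQBN a) := by
  have : (mapLin QB.toQBN).comp QB.flow = QBN.flow.comp QB.toQBN.toLinearMap := by
    refine QB.skew_ext (g := PowerSeries.C.comp (QB.toQBN : QB →+* QBN))
      (f := PowerSeries.C.comp (QB.toQBN : QB →+* QBN)) ?_ ?_ ?_ ?_
    · intro a b
      have := QB.flow_skew.comp_left (PowerSeries.map (QB.toQBN : QB →+* QBN)) a b
      simp only [RingHom.coe_comp, Function.comp_apply, PowerSeries.map_C] at this
      exact this
    · intro a b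
      exact QBN.flow_skew.comp_right (QB.toQBN : QB →+* QBN) a b
    · refine (map_serMap (PowerSeries.map (QB.toQBN : QB →+* QBN))
        (QB.flow : QB →+ QB⟦X⟧) _).symm.trans
        (.trans ?_ (serMap_map (QBN.flow : QBN →+ QBN⟦X⟧) (QB.toQBN : QB →+* QBN) _))
      rw [QB.flow_u, map_flowU, QB.map_toQBN_u, QB.map_toQBN_m, QBN.flow_u]
    · refine (map_serMap (PowerSeries.map (QB.toQBN : QB →+* QBN))
        (QB.flow : QB →+ QB⟦X⟧) _).symm.trans
        (.trans ?_ (serMap_map (QBN.flow : QBN →+ QBN⟦X⟧) (QB.toQBN : QB →+* QBN) _))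
      rw [QB.flow_m, map_flowM, QB.map_toQBN_u, QB.map_toQBN_m, QBN.flow_m]
  exact LinearMap.congr_fun this a

theorem QB.toQBN_flowOf (n : ℕ+) (a : QB) :
    QB.toQBN (flowOf QB.flow n a) = flowOf QBN.flow n (QB.toQBN a) := by
  rw [flowOf_apply, flowOf_apply, ← QB.map_flow, PowerSeries.coeff_map]
  exact map_neg_one_pow_mul (QB.toQBN : QB →+ QBN) _ _

/-! ### The Riccati identity for `m` -/

open MulOpposite in
/-- The second derivatives of `m(λ)` agree: the opposite-ring image of `flow_comm_u`. -/
theorem flow_comm_m {R A : Type*} [CommRing R] [Ring A] [Algebra R A]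
    {x z₁ z₂ : R} {b n₁ n₂ w₁ w₂ E₁ E₂ N₁₂ N₂₁ W₁₂ W₂₁ P₁₂ P₂₁ : A}
    (r₁ : ∀ b : A, (x - z₁) • b = 0 → b = 0) (r₂ : ∀ b : A, (x - z₂) • b = 0 → b = 0)
    (r₃ : ∀ b : A, (z₂ - z₁) • b = 0 → b = 0)
    (hE₁ : (x - z₁) • E₁ = z₁ • ((1 + n₁ * w₁) * (b - n₁)) - b * w₁ * (x • b - z₁ • n₁))
    (hE₂ : (x - z₂) • E₂ = z₂ • ((1 + n₂ * w₂) * (b - n₂)) - b * w₂ * (x • b - z₂ • n₂))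
    (hN₁₂ : (z₂ - z₁) • N₁₂ = z₁ • ((1 + n₁ * w₁) * (n₂ - n₁)) - n₂ * w₁ * (z₂ • n₂ - z₁ • n₁))
    (hN₂₁ : (z₁ - z₂) • N₂₁ = z₂ • ((1 + n₂ * w₂) * (n₁ - n₂)) - n₁ * w₂ * (z₁ • n₁ - z₂ • n₂))
    (hW₁₂ : -((z₂ - z₁) • W₁₂) = z₁ • w₂ - z₂ • w₁ - z₂ • (w₁ * n₂ * w₂ + w₂ * n₂ * w₁)
      + z₁ • (w₂ * n₁ * w₁ + w₁ * n₁ * w₂))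
    (hW₂₁ : -((z₁ - z₂) • W₂₁) = z₂ • w₁ - z₁ • w₂ - z₁ • (w₂ * n₁ * w₁ + w₁ * n₁ * w₂)
      + z₂ • (w₁ * n₂ * w₂ + w₂ * n₂ * w₁))
    (hP₁₂ : (x - z₂) • P₁₂ = z₂ • ((N₁₂ * w₂ + n₂ * W₁₂) * (b - n₂) + (1 + n₂ * w₂) * (E₁ - N₁₂))
      - (E₁ * w₂ * (x • b - z₂ • n₂) + b * W₁₂ * (x • b - z₂ • n₂)
        + b * w₂ * (x • E₁ - z₂ • N₁₂)))
    (hP₂₁ : (x - z₁) • P₂₁ = z₁ • ((N₂₁ * w₁ + n₁ * W₂₁) * (b - n₁) + (1 + n₁ * w₁) * (E₂ - N₂₁))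
      - (E₂ * w₁ * (x • b - z₁ • n₁) + b * W₂₁ * (x • b - z₁ • n₁)
        + b * w₁ * (x • E₂ - z₁ • N₂₁))) :
    P₁₂ = P₂₁ := by
  have op_reg : ∀ {r : R}, (∀ b : A, r • b = 0 → b = 0) → ∀ b : Aᵐᵒᵖ, r • b = 0 → b = 0 :=
    fun h b hb => unop_injective (h _ (congrArg unop hb))
  refine op_injective (flow_comm_u (a := op b) (c₁ := op n₁) (c₂ := op n₂) (v₁ := op w₁)
    (v₂ := op w₂) (E₁ := op (-E₁)) (E₂ := op (-E₂)) (C₁₂ := op (-N₁₂)) (C₂₁ := op (-N₂₁))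
    (V₁₂ := op (-W₁₂)) (V₂₁ := op (-W₂₁)) (P₁₂ := op P₁₂) (P₂₁ := op P₂₁) (op_reg r₁) (op_reg r₂)
    (op_reg r₃) (unop_injective ?_) (unop_injective ?_) (unop_injective ?_) (unop_injective ?_)
    (unop_injective ?_) (unop_injective ?_) (unop_injective ?_) (unop_injective ?_)) <;>
    simp only [unop_add, unop_mul, unop_sub, unop_smul, unop_op, smul_neg, unop_one]
  · linear_combination (norm := (
      simp only [add_mul, mul_sub, smul_add, smul_sub, mul_smul_comm, mul_assoc, one_mul]
      module)) -hE₁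
  · linear_combination (norm := (
      simp only [add_mul, mul_sub, smul_add, smul_sub, mul_smul_comm, mul_assoc, one_mul]
      module)) -hE₂
  · linear_combination (norm := (
      simp only [add_mul, mul_sub, smul_add, smul_sub, mul_smul_comm, mul_assoc, one_mul]
      module)) -hN₁₂
  · linear_combination (norm := (
      simp only [add_mul, mul_sub, smul_add, smul_sub, mul_smul_comm, mul_assoc, one_mul]
      module)) -hN₂₁
  · linear_combination (norm := (
      simp only [smul_add, mul_assoc]
      module)) hW₁₂
  · linear_combination (norm := (
      simp only [smul_add, mul_assoc]
      module)) hW₂₁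
  · linear_combination (norm := (
      simp only [add_mul, mul_sub, smul_add, smul_sub, mul_smul_comm, mul_assoc, neg_mul, mul_neg, smul_neg, one_mul]
      module)) hP₁₂
  · linear_combination (norm := (
      simp only [add_mul, mul_sub, smul_add, smul_sub, mul_smul_comm, mul_assoc, neg_mul, mul_neg, smul_neg, one_mul]
      module)) hP₂₁

/-! ### The derivatives of `v` and `w` as power series -/

section

variable {A : Type} [Ring A] [Algebra Kq A] {U M : A⟦X⟧} {D : A →+ A⟦X⟧}

/-- A derivation of an arbitrary algebra, taking series `U`, `M` that satisfy the relations to the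
values of `H(μ)`. Commutativity is proved in this generality, which also covers the classical
flows. -/
structure QFlow (U M : A⟦X⟧) (D : A →+ A⟦X⟧) : Prop extends QRel U M where
  skew : IsSkew C C D
  on_u : serMap D U = flowU U M
  on_m : serMap D M = flowM U M

theorem mul_negInvAdd (s t : A⟦X⟧) :
    -(PowerSeries.X * t) = negInvAdd s t + PowerSeries.X * (negInvAdd s t * s * t) := by
  have h := resolv_mul s t
  have e : negInvAdd s t = -(PowerSeries.X * (t * resolv s t)) := negInvAdd_eq s t
  have k : negInvAdd s t * (1 + PowerSeries.X * (s * t)) = -(PowerSeries.X * t) := by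
    rw [e, neg_mul, mul_assoc, mul_assoc, h, mul_one]
  rw [← k, mul_add, mul_one, ← mul_assoc, (PowerSeries.commute_X (negInvAdd s t)).eq]
  simp only [mul_assoc]

theorem negInvAdd_mul (s t : A⟦X⟧) :
    -(PowerSeries.X * t) = negInvAdd s t + PowerSeries.X * (t * s * negInvAdd s t) := by
  have h := mul_resolv t s
  have e : negInvAdd s t = -(PowerSeries.X * (resolv t s * t)) := by
    rw [negInvAdd_eq, resolv_mul_comm]
  have k : (1 + PowerSeries.X * (t * s)) * negInvAdd s t = -(PowerSeries.X * t) := by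
    rw [e, mul_neg, ← mul_assoc, (PowerSeries.commute_X (1 + _)).eq, mul_assoc,
      ← mul_assoc _ (resolv t s) t, h, one_mul]
  rw [← k, add_mul, one_mul, mul_assoc]

theorem QRel.pointMu (h : QRel U M) : FlowPoint (qC A⟦X⟧⟦X⟧) (xC A⟦X⟧)
    (PowerSeries.map C U) (PowerSeries.map C M)
    (PowerSeries.map C (resolv M U)) (PowerSeries.map C (resolv U M))
    (PowerSeries.map C (negInvAdd U M))
    (PowerSeries.map C (negInvAdd M U)) :=
  h.point.map (PowerSeries.map C) map_C_qC (PowerSeries.map_X _)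
    isUnit_one_add_X_mul

namespace QFlow
variable (h : QFlow U M D)
include h

theorem skewSer (s t : A⟦X⟧) : serMap D (s * t) =
    serMap D s * PowerSeries.map C t + PowerSeries.map C s * serMap D t :=
  h.skew.serMap s t

theorem skewSer₂ (s t : A⟦X⟧⟦X⟧) : serMap (serMap D) (s * t) =
    serMap (serMap D) s * PowerSeries.map (PowerSeries.map C) t
      + PowerSeries.map (PowerSeries.map C) s * serMap (serMap D) t :=
  h.skew.serMap.serMap s t

theorem serMap_v : (PowerSeries.X - C PowerSeries.X) * serMap D (negInvAdd U M) =
    C PowerSeries.X * PowerSeries.map C (negInvAdd U M)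
      - PowerSeries.X * C (negInvAdd U M)
      - PowerSeries.X * (PowerSeries.map C (negInvAdd U M)
        * PowerSeries.map C U * C (negInvAdd U M)
        + C (negInvAdd U M) * PowerSeries.map C U *
          PowerSeries.map C (negInvAdd U M))
      + C PowerSeries.X * (C (negInvAdd U M)
        * C U * PowerSeries.map C (negInvAdd U M)
        + PowerSeries.map C (negInvAdd U M) * C U *
          C (negInvAdd U M)) := by
  refine h.point₂.flow_v (z₁ := liftC (xC A)) (z₂ := xC A⟦X⟧) h.pointMu (X := flowU U M)
    (Y := flowM U M) ?_ ?_ ?_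
  · refine (X_sub_mul_flowU U M).trans ?_
    simp only [center_smul_def, coe_liftC, coe_xC, mul_assoc]
  · refine (X_sub_mul_flowM U M).trans ?_
    simp only [center_smul_def, coe_liftC, coe_xC, mul_assoc]
  · have e := congrArg (serMap D) (mul_negInvAdd U M)
    rw [map_neg, map_add, serMap_X_mul, serMap_X_mul, h.skewSer, h.skewSer, h.on_u, h.on_m,
      map_mul, add_mul] at e
    simpa only [center_smul_def, coe_xC, mul_assoc] using e

theorem serMap_w : -((PowerSeries.X - C PowerSeries.X) *
      serMap D (negInvAdd M U)) =
    C PowerSeries.X * PowerSeries.map C (negInvAdd M U)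
      - PowerSeries.X * C (negInvAdd M U)
      - PowerSeries.X * (C (negInvAdd M U) * PowerSeries.map C M *
          PowerSeries.map C (negInvAdd M U)
        + PowerSeries.map C (negInvAdd M U)
        * PowerSeries.map C M * C (negInvAdd M U))
      + C PowerSeries.X * (PowerSeries.map C (negInvAdd M U) *
          C M * C (negInvAdd M U)
        + C (negInvAdd M U)
        * C M * PowerSeries.map C (negInvAdd M U)) := by
  refine h.point₂.flow_w (z₁ := liftC (xC A)) (z₂ := xC A⟦X⟧) h.pointMu (X := flowU U M)
    (Y := flowM U M) ?_ ?_ ?_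
  · refine (X_sub_mul_flowU U M).trans ?_
    simp only [center_smul_def, coe_liftC, coe_xC, mul_assoc]
  · refine (X_sub_mul_flowM U M).trans ?_
    simp only [center_smul_def, coe_liftC, coe_xC, mul_assoc]
  · have e := congrArg (serMap D) (negInvAdd_mul M U)
    rw [map_neg, map_add, serMap_X_mul, serMap_X_mul, h.skewSer, h.skewSer, h.on_u, h.on_m,
      map_mul, add_mul] at e
    simpa only [center_smul_def, coe_xC, mul_assoc] using e

theorem serSwap_v : serSwap (serMap D (negInvAdd U M)) = serMap D (negInvAdd U M) := by
  have e := h.serMap_v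
  have e' := congrArg serSwap e
  simp only [map_mul, map_sub, map_add, serSwap_X, serSwap_C, serSwap_map_C,
    PowerSeries.map_X] at e'
  refine Reg.cancel reg_X.X_sub_C ?_
  linear_combination (norm := noncomm_ring) -e' - e

theorem serSwap_w : serSwap (serMap D (negInvAdd M U)) = serMap D (negInvAdd M U) := by
  have e := h.serMap_w
  have e' := congrArg serSwap e
  simp only [map_mul, map_sub, map_add, map_neg, serSwap_X, serSwap_C, serSwap_map_C,
    PowerSeries.map_X] at e'
  refine Reg.cancel reg_X.X_sub_C ?_
  linear_combination (norm := noncomm_ring) e' + e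

theorem mu₂ (s : A⟦X⟧) : serMap (serMap D) (PowerSeries.map C s) =
    PowerSeries.map C (serMap D s) := serMap_serMap_inMu D s

theorem serMap_flowU : (PowerSeries.X - C PowerSeries.X) * serMap (serMap D) (flowU U M) =
    (PowerSeries.X * PowerSeries.map C (flowU U M)
        - C PowerSeries.X * C (flowU U M))
        * C (PowerSeries.map C (negInvAdd U M))
        * PowerSeries.map C (PowerSeries.map C U)
      + (PowerSeries.X * PowerSeries.map C (PowerSeries.map C U)
        - C PowerSeries.X * C (PowerSeries.map C U))
        * C (serMap D (negInvAdd U M))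
        * PowerSeries.map C (PowerSeries.map C U)
      + (PowerSeries.X * PowerSeries.map C (PowerSeries.map C U)
        - C PowerSeries.X * C (PowerSeries.map C U))
        * C (PowerSeries.map C (negInvAdd U M))
        * PowerSeries.map C (flowU U M)
      - C PowerSeries.X * ((PowerSeries.map C (flowU U M)
          - C (flowU U M))
          * (1 + C (PowerSeries.map C (negInvAdd U M))
            * C (PowerSeries.map C U))
        + (PowerSeries.map C (PowerSeries.map C U)
          - C (PowerSeries.map C U))
          * (C (serMap D (negInvAdd U M))
              * C (PowerSeries.map C U)
            + C (PowerSeries.map C (negInvAdd U M))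
              * C (flowU U M))) := by
  have e := congrArg (serMap (serMap D)) (X_sub_mul_flowU U M)
  have one : serMap (serMap D) (1 : A⟦X⟧⟦X⟧) = 0 := h.skew.serMap.serMap.map_one
  have X₁ : serMap D PowerSeries.X = 0 := by
    rw [← mul_one PowerSeries.X, serMap_X_mul, h.skew.serMap.map_one, mul_zero]
  have X₂ : serMap (serMap D) PowerSeries.X = 0 := by
    rw [← mul_one PowerSeries.X, serMap_X_mul, one, mul_zero]
  simp only [sub_mul, mul_sub, mul_assoc, mul_add, mul_one, map_sub, map_add, h.skewSer₂,
    h.mu₂, h.on_u, serMap_C, map_mul, PowerSeries.map_X, PowerSeries.map_C, map_map_C_map_C, X₁, X₂, map_zero, zero_mul, zero_add]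
    at e ⊢
  linear_combination (norm := noncomm_ring) e

theorem serMap_flowM : (PowerSeries.X - C PowerSeries.X) * serMap (serMap D) (flowM U M) =
    C PowerSeries.X * ((C (flowM U M)
          * C (PowerSeries.map C (negInvAdd M U))
        + C (PowerSeries.map C M)
          * C (serMap D (negInvAdd M U)))
        * (PowerSeries.map C (PowerSeries.map C M)
          - C (PowerSeries.map C M))
      + (1 + C (PowerSeries.map C M)
          * C (PowerSeries.map C (negInvAdd M U)))
        * (PowerSeries.map C (flowM U M) - C (flowM U M)))
      - (PowerSeries.map C (flowM U M)
          * C (PowerSeries.map C (negInvAdd M U))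
          * (PowerSeries.X * PowerSeries.map C (PowerSeries.map C M)
            - C PowerSeries.X * C (PowerSeries.map C M))
        + PowerSeries.map C (PowerSeries.map C M)
          * C (serMap D (negInvAdd M U))
          * (PowerSeries.X * PowerSeries.map C (PowerSeries.map C M)
            - C PowerSeries.X * C (PowerSeries.map C M))
        + PowerSeries.map C (PowerSeries.map C M)
          * C (PowerSeries.map C (negInvAdd M U))
          * (PowerSeries.X * PowerSeries.map C (flowM U M)
            - C PowerSeries.X * C (flowM U M))) := by
  have e := congrArg (serMap (serMap D)) (X_sub_mul_flowM U M)
  have one : serMap (serMap D) (1 : A⟦X⟧⟦X⟧) = 0 := h.skew.serMap.serMap.map_one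
  have X₁ : serMap D PowerSeries.X = 0 := by
    rw [← mul_one PowerSeries.X, serMap_X_mul, h.skew.serMap.map_one, mul_zero]
  have X₂ : serMap (serMap D) PowerSeries.X = 0 := by
    rw [← mul_one PowerSeries.X, serMap_X_mul, one, mul_zero]
  have r1 : ∀ s t : A⟦X⟧⟦X⟧, s * (PowerSeries.X * t) = PowerSeries.X * (s * t) := fun s t => by
    rw [← mul_assoc, (PowerSeries.commute_X s).eq, mul_assoc]
  have r2 : ∀ s t : A⟦X⟧⟦X⟧, s * (C PowerSeries.X * t) =
      C PowerSeries.X * (s * t) := fun s t =>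
    (mul_smul_comm (liftC (xC A)) s t)
  have r1' : ∀ s t : A⟦X⟧⟦X⟧⟦X⟧, s * (PowerSeries.X * t) = PowerSeries.X * (s * t) :=
    fun s t => by rw [← mul_assoc, (PowerSeries.commute_X s).eq, mul_assoc]
  have r2' : ∀ s t : A⟦X⟧⟦X⟧⟦X⟧, s * (C PowerSeries.X * t) =
      C PowerSeries.X * (s * t) := fun s t =>
    (mul_smul_comm (liftC (xC A⟦X⟧)) s t)
  simp only [sub_mul, add_mul, mul_sub, mul_assoc, mul_add, mul_one, r1, r2, map_sub,
    map_add, h.skewSer₂, h.mu₂, h.on_m, serMap_C, map_mul, PowerSeries.map_X, PowerSeries.map_C, map_map_C_map_C, X₁, X₂, map_zero, zero_mul, zero_add]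
    at e
  simp only [sub_mul, add_mul, one_mul, mul_sub, mul_assoc, mul_add, r1', r2'] at e ⊢
  linear_combination (norm := abel) e

end QFlow

end

/-! ### Commutativity of the flows -/

section
variable {A : Type} [Ring A] [Algebra Kq A] {U M : A⟦X⟧} {D : A →+ A⟦X⟧}

theorem map_serSwap_map_C (s : A⟦X⟧⟦X⟧) :
    PowerSeries.map serSwap (PowerSeries.map C s) =
      PowerSeries.map (PowerSeries.map C) s := by
  ext i; simp

namespace QFlow
variable (h : QFlow U M D)
include h

theorem swap_serMap_flowU : PowerSeries.map serSwap (serMap (serMap D) (flowU U M)) =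
    serMap (serMap D) (flowU U M) := by
  obtain ⟨-, -, r₃, r₁, -⟩ := reg₃ (A := A)
  have r₂ : ∀ b : A⟦X⟧⟦X⟧⟦X⟧, (xC A⟦X⟧⟦X⟧ - liftC (xC A⟦X⟧)) • b = 0 → b = 0 := reg_X.X_sub_C
  have E := X_sub_mul_flowU U M
  have e2 := congrArg (PowerSeries.map C) E
  have e1 := congrArg (PowerSeries.map (PowerSeries.map C)) E
  have c1 := congrArg C E
  have c2 := congrArg (fun s => C (serSwap s)) E
  have v1 := congrArg C h.serMap_v
  have v2 := congrArg (fun s => C (serSwap s)) h.serMap_v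
  have p1 := h.serMap_flowU
  have p2 := congrArg (PowerSeries.map serSwap) h.serMap_flowU
  simp only [map_mul, map_sub, map_add, map_one, PowerSeries.map_X, PowerSeries.map_C,
    map_map_C_map_C, serSwap_X, serSwap_C, serSwap_map_C, map_serSwap_map_C,
    h.serSwap_v] at e1 e2 c1 c2 v1 v2 p1 p2
  refine (flow_comm_u (x := xC A⟦X⟧⟦X⟧) (z₁ := liftC (liftC (xC A))) (z₂ := liftC (xC A⟦X⟧))
    (a := PowerSeries.map C (PowerSeries.map C U))
    (c₁ := C (C U)) (c₂ := C (PowerSeries.map C U))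
    (v₁ := C (C (negInvAdd U M)))
    (v₂ := C (PowerSeries.map C (negInvAdd U M)))
    (E₁ := PowerSeries.map C (flowU U M))
    (E₂ := PowerSeries.map (PowerSeries.map C) (flowU U M))
    (C₁₂ := C (flowU U M)) (C₂₁ := C (serSwap (flowU U M)))
    (V₁₂ := C (serMap D (negInvAdd U M)))
    (V₂₁ := C (serMap D (negInvAdd U M)))
    r₁ r₂ r₃ ?_ ?_ ?_ ?_ ?_ ?_ ?_ ?_).symm
  all_goals simp only [center_smul_def, coe_liftC, coe_xC, AddSubgroupClass.coe_sub, mul_assoc]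
  · simpa only [mul_assoc] using e2
  · simpa only [mul_assoc] using e1
  · simpa only [mul_assoc] using c1
  · simpa only [mul_assoc] using c2
  · simpa only [mul_assoc] using v1
  · simpa only [mul_assoc] using v2
  · simpa only [mul_assoc] using p1
  · simpa only [mul_assoc] using p2

theorem swap_serMap_flowM : PowerSeries.map serSwap (serMap (serMap D) (flowM U M)) =
    serMap (serMap D) (flowM U M) := by
  obtain ⟨-, -, r₃, r₁, -⟩ := reg₃ (A := A)
  have r₂ : ∀ b : A⟦X⟧⟦X⟧⟦X⟧, (xC A⟦X⟧⟦X⟧ - liftC (xC A⟦X⟧)) • b = 0 → b = 0 := reg_X.X_sub_C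
  have E := X_sub_mul_flowM U M
  have e2 := congrArg (PowerSeries.map C) E
  have e1 := congrArg (PowerSeries.map (PowerSeries.map C)) E
  have c1 := congrArg C E
  have c2 := congrArg (fun s => C (serSwap s)) E
  have v1 := congrArg C h.serMap_w
  have v2 := congrArg (fun s => C (serSwap s)) h.serMap_w
  have p1 := h.serMap_flowM
  have p2 := congrArg (PowerSeries.map serSwap) h.serMap_flowM
  simp only [map_mul, map_sub, map_add, map_neg, map_one, PowerSeries.map_X, PowerSeries.map_C,
    map_map_C_map_C, serSwap_X, serSwap_C, serSwap_map_C, map_serSwap_map_C,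
    h.serSwap_w] at e1 e2 c1 c2 v1 v2 p1 p2
  refine (flow_comm_m (x := xC A⟦X⟧⟦X⟧) (z₁ := liftC (liftC (xC A))) (z₂ := liftC (xC A⟦X⟧))
    (b := PowerSeries.map C (PowerSeries.map C M))
    (n₁ := C (C M)) (n₂ := C (PowerSeries.map C M))
    (w₁ := C (C (negInvAdd M U)))
    (w₂ := C (PowerSeries.map C (negInvAdd M U)))
    (E₁ := PowerSeries.map C (flowM U M))
    (E₂ := PowerSeries.map (PowerSeries.map C) (flowM U M))
    (N₁₂ := C (flowM U M)) (N₂₁ := C (serSwap (flowM U M)))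
    (W₁₂ := C (serMap D (negInvAdd M U)))
    (W₂₁ := C (serMap D (negInvAdd M U)))
    r₁ r₂ r₃ ?_ ?_ ?_ ?_ ?_ ?_ ?_ ?_).symm
  all_goals simp only [center_smul_def, coe_liftC, coe_xC, AddSubgroupClass.coe_sub, mul_assoc]
  · simpa only [mul_assoc] using e2
  · simpa only [mul_assoc] using e1
  · simpa only [mul_assoc] using c1
  · simpa only [mul_assoc] using c2
  · simpa only [mul_assoc] using v1
  · simp only [mul_assoc] at v2
    rw [v2, sub_right_comm, sub_add_eq_add_sub]
  · simpa only [mul_assoc] using p1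
  · simpa only [mul_assoc] using p2

omit h
/-- The commutator of the derivations `H(μ)` and `H(ν)`. -/
def swapDefect (D : A →ₗ[Kq] A⟦X⟧) : A →ₗ[Kq] A⟦X⟧⟦X⟧ where
  toFun a := serSwap (serMap (D : A →+ A⟦X⟧) (D a)) - serMap (D : A →+ A⟦X⟧) (D a)
  map_add' a b := by
    simp only [map_add]
    abel
  map_smul' r a := by
    ext i j
    simp [smul_sub]

theorem swapDefect_apply (D : A →ₗ[Kq] A⟦X⟧) (a : A) : swapDefect D a =
    serSwap (serMap (D : A →+ A⟦X⟧) (D a)) - serMap (D : A →+ A⟦X⟧) (D a) := rfl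

variable {D : A →ₗ[Kq] A⟦X⟧}

/-- The commutator is again a derivation, so that it vanishes as soon as it does on generators. -/
theorem swapDefect_skew (hD : IsSkew C C (D : A →+ A⟦X⟧)) :
    IsSkew (PowerSeries.C.comp C) (PowerSeries.C.comp C)
      (swapDefect D : A →+ A⟦X⟧⟦X⟧) := by
  intro a b
  change swapDefect D (a * b) = swapDefect D a * _ + _ * swapDefect D b
  have e : ∀ a b, D (a * b) = D a * C b + C a * D b := hD
  have e' := hD.serMap
  simp only [swapDefect_apply, e, map_add, e' _ _, serMap_C, map_mul, serSwap_C, serSwap_map_C,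
    PowerSeries.map_C, RingHom.comp_apply, AddMonoidHom.coe_coe]
  noncomm_ring

theorem serMap_swapDefect (s : A⟦X⟧) : serMap (swapDefect D : A →+ A⟦X⟧⟦X⟧) s =
    PowerSeries.map serSwap (serMap (serMap (D : A →+ A⟦X⟧)) (serMap (D : A →+ A⟦X⟧) s))
      - serMap (serMap (D : A →+ A⟦X⟧)) (serMap (D : A →+ A⟦X⟧) s) := by
  ext i
  simp [swapDefect_apply]

theorem flowOf_comm (hD : swapDefect D = 0) (n k : ℕ+) (a : A) :
    flowOf D n (flowOf D k a) = flowOf D k (flowOf D n a) := by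
  have e : ∀ n k : ℕ+, flowOf D n (flowOf D k a) = (-1) ^ (n : ℕ) * ((-1) ^ (k : ℕ) *
      coeff (n : ℕ) (coeff (k : ℕ) (serMap (D : A →+ A⟦X⟧) (D a)))) := by
    intro n k
    rw [coeff_serMap, flowOf_apply, flowOf_apply]
    congr 1
    exact map_neg_one_pow_mul (((coeff (R := A) (n : ℕ) : A⟦X⟧ →ₗ[A] A) :
      A⟦X⟧ →+ A).comp (D : A →+ A⟦X⟧)) _ _
  have s : serSwap (serMap (D : A →+ A⟦X⟧) (D a)) = serMap (D : A →+ A⟦X⟧) (D a) :=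
    sub_eq_zero.1 (LinearMap.congr_fun hD a)
  rw [e, e, ← mul_assoc, ← mul_assoc, ← pow_add, ← pow_add, add_comm, ← coeff_coeff_serSwap, s]

end QFlow
end

theorem QB.qFlow : QFlow (genSer QB.u) (genSer QB.m) (QB.flow : QB →+ QB⟦X⟧) :=
  { QB.qRel with skew := QB.flow_skew, on_u := QB.flow_u, on_m := QB.flow_m }

theorem QBN.qFlow : QFlow (genSer QBN.u) (genSer QBN.m) (QBN.flow : QBN →+ QBN⟦X⟧) :=
  { QBN.qRelN.toQRel with skew := QBN.flow_skew, on_u := QBN.flow_u, on_m := QBN.flow_m }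

theorem zero_skew {A B : Type*} [Ring A] [Ring B] [Algebra Kq A] [Algebra Kq B] (g f : A →+* B) :
    IsSkew g f ((0 : A →ₗ[Kq] B) : A →+ B) := fun a b => by simp

theorem QB.flow_comm (n k : ℕ+) (a : QB) :
    flowOf QB.flow n (flowOf QB.flow k a) = flowOf QB.flow k (flowOf QB.flow n a) := by
  refine QFlow.flowOf_comm (QB.skew_ext (QFlow.swapDefect_skew QB.flow_skew) (zero_skew _ _) ?_ ?_)
    n k a
  · rw [QFlow.serMap_swapDefect, QB.flow_u, QB.qFlow.swap_serMap_flowU, sub_self]; ext; simp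
  · rw [QFlow.serMap_swapDefect, QB.flow_m, QB.qFlow.swap_serMap_flowM, sub_self]; ext; simp

theorem QBN.flow_comm (n k : ℕ+) (a : QBN) :
    flowOf QBN.flow n (flowOf QBN.flow k a) = flowOf QBN.flow k (flowOf QBN.flow n a) := by
  refine QFlow.flowOf_comm (QBN.skew_ext (QFlow.swapDefect_skew QBN.flow_skew) (zero_skew _ _)
    ?_ ?_ ?_) n k a
  · rw [QFlow.serMap_swapDefect, QBN.flow_u, QBN.qFlow.swap_serMap_flowU, sub_self]; ext; simp
  · rw [QFlow.serMap_swapDefect, QBN.flow_m, QBN.qFlow.swap_serMap_flowM, sub_self]; ext; simp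
  · intro ε
    rw [QFlow.swapDefect_apply, LinearMap.zero_apply, sub_eq_zero]
    rcases Int.units_eq_one_or ε with rfl | rfl
    · rw [QBN.flow_Sp]; exact QBN.qFlow.serSwap_w
    · rw [QBN.flow_Sm]; exact QBN.qFlow.serSwap_v

/-! ### The grading, and the outer part of `f_ε` on generators -/

section
variable {A : Type} [Ring A] [Algebra Kq A]

theorem genSer_smul (r : Kq) (c : ℕ → A) : genSer (fun i => r • c i) = r • genSer c := by
  ext i
  simp [coeff_genSer]

theorem inLam_smul (r : Kq) (s : A⟦X⟧) : inLam (r • s) = r • inLam s := by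
  ext i j
  simp only [inLam, PowerSeries.coeff_smul, PowerSeries.coeff_C]
  split_ifs <;> simp

theorem inMu_smul (r : Kq) (s : A⟦X⟧) : inMu (r • s) = r • inMu s := by
  ext i j
  simp only [inMu, PowerSeries.coeff_smul, PowerSeries.coeff_C, PowerSeries.coeff_map]
  split_ifs <;> simp

theorem C_smul (r : Kq) (a : A) : (C (r • a) : A⟦X⟧) = r • C a := by
  ext j
  simp only [PowerSeries.coeff_smul, PowerSeries.coeff_C]
  split_ifs <;> simp

theorem serre_smul (r s : Kq) (a b : A) : serre (r • a) (s • b) = (r ^ 3 * s) • serre a b := by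
  simp only [serre, pow_succ, pow_zero, one_mul, smul_mul_assoc, mul_smul_comm, smul_sub, smul_smul,
    mul_assoc]
  module

theorem QRelN.rescale {U M : A⟦X⟧} {S : ℤˣ → A} (h : QRelN U M S) (n : ℤ) :
    QRelN (qp n • U) (qp (-n) • M) (fun δ => qp (n * δ) • S δ) where
  uu := by
    have : ∀ r : Kq, quadLeft (r • U) = (r * r) • quadLeft U ∧
        quadRight (r • U) = (r * r) • quadRight U := fun r => by
      simp [quadLeft, quadRight, inLam_smul, inMu_smul, ← smul_sub, smul_smul]
    rw [(this _).1, (this _).2, h.uu, smul_comm]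
  mm := by
    have : ∀ r : Kq, quadLeft (r • M) = (r * r) • quadLeft M ∧
        quadRight (r • M) = (r * r) • quadRight M := fun r => by
      simp [quadLeft, quadRight, inLam_smul, inMu_smul, ← smul_sub, smul_smul]
    rw [(this _).1, (this _).2, h.mm, smul_comm]
  um := by
    simp only [inLam_smul, inMu_smul, smul_mul_assoc, mul_smul_comm, h.um, smul_smul]
    congr 1; ring
  uS δ := by
    simp only [C_smul, smul_mul_assoc, mul_smul_comm, h.uS, smul_smul]
    congr 1; ring
  mSp := by
    simp only [C_smul, smul_mul_assoc, mul_smul_comm, smul_smul, ← h.mSp, qp_mul_qp]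
    have e : (-n : ℤ) + n * ((1 : ℤˣ) : ℤ) = 0 := by simp
    have e2 : (n * ((1 : ℤˣ) : ℤ) + -n : ℤ) = 0 := by simp
    simp [qp_zero]
  mSm := by
    have h := h.mSm
    have e : (n * (((-1 : ℤˣ) : ℤˣ) : ℤ) : ℤ) = -n := by simp
    simp only [e, C_smul, smul_mul_assoc, mul_smul_comm, smul_smul, pow_two] at h ⊢
    rw [eq_add_of_sub_eq h]
    module
  SS δ := by
    rw [serre_smul, h.SS, smul_zero]

end

/-- The grading automorphisms, by which `k_ε` acts: `u`, `m`, `S δ` have degrees `1`, `-1`, `δ`. -/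
def QBN.wt (n : ℤ) : QBN →ₐ[Kq] QBN :=
  QBN.lift (c := fun i => qp n • QBN.u i) (d := fun i => qp (-n) • QBN.m i)
    (S := fun δ => qp (n * δ) • QBN.S δ)
    (by rw [genSer_smul, genSer_smul]; exact QBN.qRelN.rescale n)

namespace QBN

theorem wt_u (n : ℤ) (i : ℕ) : wt n (u i) = qp n • u i := lift_u _ i
theorem wt_m (n : ℤ) (i : ℕ) : wt n (m i) = qp (-n) • m i := lift_m _ i
theorem wt_S (n : ℤ) (δ : ℤˣ) : wt n (S δ) = qp (n * δ) • S δ := lift_S _ δ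

theorem map_wt_u (n : ℤ) : PowerSeries.map (wt n : QBN →+* QBN) (genSer u) = qp n • genSer u := by
  rw [map_genSer, ← genSer_smul]
  exact congrArg genSer (funext (wt_u n))

theorem map_wt_m (n : ℤ) : PowerSeries.map (wt n : QBN →+* QBN) (genSer m) =
    qp (-n) • genSer m := by
  rw [map_genSer, ← genSer_smul]
  exact congrArg genSer (funext (wt_m n))

theorem algHom_ext {B : Type*} [Ring B] [Algebra Kq B] {f g : QBN →ₐ[Kq] B}
    (hu : ∀ i, f (u i) = g (u i)) (hm : ∀ i, f (m i) = g (m i)) (hS : ∀ δ, f (S δ) = g (S δ)) :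
    f = g := by
  refine RingQuot.ringQuot_ext' Kq f g (FreeAlgebra.hom_ext (funext ?_))
  rintro (i | i | δ)
  · exact hu i
  · exact hm i
  · exact hS δ

theorem wt_wt (n k : ℤ) : (wt n).comp (wt k) = wt (n + k) := by
  refine algHom_ext (fun i => ?_) (fun i => ?_) fun δ => ?_
  · rw [AlgHom.comp_apply, wt_u, map_smul, wt_u, wt_u, smul_smul, qp_mul_qp, add_comm]
  · rw [AlgHom.comp_apply, wt_m, map_smul, wt_m, wt_m, smul_smul, qp_mul_qp]
    congr 2; ring
  · rw [AlgHom.comp_apply, wt_S, map_smul, wt_S, wt_S, smul_smul, qp_mul_qp]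
    congr 2; ring

theorem wt_zero : wt 0 = AlgHom.id Kq QBN := by
  refine algHom_ext (fun i => ?_) (fun i => ?_) fun δ => ?_
  · rw [wt_u, qp_zero, one_smul]; rfl
  · rw [wt_m, neg_zero, qp_zero, one_smul]; rfl
  · rw [wt_S, zero_mul, qp_zero, one_smul]; rfl

end QBN

/-- The map `u(λ) ↦ λ⁻¹ u(λ)²` preserves the quadratic relation of `u`, as a skew derivation. -/
theorem shift_uu {R A : Type*} [CommRing R] [Ring A] [Algebra R A] {q x y : R} {a c : A}
    (r : ∀ b : A, (x - y) • b = 0 → b = 0)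
    (h : (x • a - y • c) * (a - c) = q • ((a - c) * (x • a - y • c))) :
    (x • x • (a * a) - y • y • (c * c)) * (a - c)
        + q • ((x • a - y • c) * (x • (a * a) - y • (c * c))) =
      q • ((x • (a * a) - y • (c * c)) * (x • a - y • c)
        + q • ((a - c) * (x • x • (a * a) - y • y • (c * c)))) := by
  rw [← sub_eq_zero]
  apply r
  linear_combination (norm := (
      simp only [mul_add, mul_sub, sub_mul, smul_add, smul_sub, smul_mul_assoc,
        mul_smul_comm, mul_assoc]
      module)) (x + y) • ((x • a - y • c) * h + q • (h * (x • a - y • c)))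
        - (x * y * (1 + q)) • (h * (a - c) + (a - c) * h)

section
variable {A : Type} [Ring A] [Algebra Kq A]

/-- The value on `u(λ)` of the outer part of `f_ε`, see `QBN.shift`. -/
def shiftU (ε : ℤˣ) (U : A⟦X⟧) : A⟦X⟧ :=
  if ε = 1 then -(qp 1 - 1) • (X * U ^ 2) else (1 - qp (-1)) • 1

variable {U M : A⟦X⟧} {S : ℤˣ → A}

theorem QRel.shift_uu (h : QRel U M) (ε : ℤˣ) :
    (xLam A * inLam (shiftU ε U) - xMu A * inMu (shiftU ε U)) * (inLam U - inMu U)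
      + qp ε • ((xLam A * inLam U - xMu A * inMu U) *
        (inLam (shiftU ε U) - inMu (shiftU ε U))) =
    qp 1 • ((inLam (shiftU ε U) - inMu (shiftU ε U)) * (xLam A * inLam U - xMu A * inMu U)
      + qp ε • ((inLam U - inMu U) *
        (xLam A * inLam (shiftU ε U) - xMu A * inMu (shiftU ε U)))) := by
  rcases Int.units_eq_one_or ε with rfl | rfl
  · have e := h.uu
    have r : ∀ b : A⟦X⟧⟦X⟧, (liftC (xC A) - xC A⟦X⟧) • b = 0 → b = 0 := (reg_X.X_sub_C).sub_comm
    have k := QDS.shift_uu (q := qC A⟦X⟧⟦X⟧) r (a := inLam U) (c := inMu U)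
      (by rw [qC_smul]; exact e)
    have qm : ∀ b : A⟦X⟧⟦X⟧, (qC A⟦X⟧⟦X⟧).1 * b = qp 1 • b := fun b => (Algebra.smul_def _ b).symm
    simp only [center_smul_def, coe_liftC, coe_xC] at k
    simp only [qm] at k
    have k2 := congrArg (fun b => -(qp 1 - 1) • b) k
    simp only [shiftU, if_true, inLam_smul, inMu_smul, Units.val_one]
    have e1 : inLam (X * U ^ 2) = xLam A * (inLam U * inLam U) := by
      simp [inLam, xLam, pow_two]
    have e2 : inMu (X * U ^ 2) = xMu A * (inMu U * inMu U) := by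
      simp [inMu, xMu, pow_two]
    rw [e1, e2]
    simp only [mul_smul_comm, smul_mul_assoc, ← smul_sub, ← smul_add, smul_comm _ (-(qp 1 - 1))]
    exact k2
  · have hs : ∀ (s : A⟦X⟧), shiftU (-1) s = (1 - qp (-1)) • 1 := fun s => if_neg (by decide)
    have e := congrArg (fun b => qp (-1) • b) h.uu
    simp only [quadLeft, quadRight, qp_neg_smul_qp] at e
    have cl : ∀ b : A⟦X⟧⟦X⟧, b * (xLam A - xMu A) = (xLam A - xMu A) * b := fun b => by
      have h1 := Subring.mem_center_iff.1 (liftC (xC A)).2 b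
      have h2 := Subring.mem_center_iff.1 (xC A⟦X⟧).2 b
      rw [mul_sub, sub_mul]
      exact congrArg₂ _ h1 h2
    simp only [hs, inLam_smul, inMu_smul]
    have e1 : inLam (1 : A⟦X⟧) = 1 := by simp [inLam]
    have e2 : inMu (1 : A⟦X⟧) = 1 := by simp [inMu]
    simp only [e1, e2, sub_self, mul_zero, zero_mul, smul_zero, add_zero, zero_add, mul_one,
      mul_smul_comm, smul_mul_assoc, ← smul_sub, cl]
    exact (qp_smul_qp_neg 1 _).symm

theorem QRel.shift_um (h : QRel U M) (ε : ℤˣ) : inLam (shiftU ε U) * inMu M =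
    qp (-1) • (qp (-ε) • (inMu M * inLam (shiftU ε U))) := by
  rcases Int.units_eq_one_or ε with rfl | rfl
  · have e1 : inLam (X * U ^ 2) = xLam A * (inLam U * inLam U) := by
      simp [inLam, xLam, pow_two]
    have c : inMu M * (xLam A * (inLam U * inLam U)) = xLam A * (inMu M * (inLam U * inLam U)) :=
      mul_smul_comm (liftC (xC A)) _ _
    simp only [shiftU, if_true, inLam_smul]
    rw [e1, smul_mul_assoc, mul_smul_comm, c, mul_assoc, mul_assoc, h.um, mul_smul_comm,
      ← mul_assoc (inLam U) (inMu M), h.um]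
    simp only [smul_mul_assoc, mul_smul_comm, mul_assoc, Units.val_one]
    rw [smul_comm (qp (-1)) (-(qp 1 - 1)), smul_comm (qp (-1)) (-(qp 1 - 1))]
  · have hs : ∀ (s : A⟦X⟧), shiftU (-1) s = (1 - qp (-1)) • 1 := fun s => if_neg (by decide)
    have e1 : inLam (1 : A⟦X⟧) = 1 := by simp [inLam]
    rw [hs, inLam_smul, e1, smul_mul_assoc, mul_smul_comm, one_mul, mul_one]
    exact (qp_neg_smul_qp 1 _).symm

theorem QRelN.shift_uS (h : QRelN U M S) (ε δ : ℤˣ) : shiftU ε U * C (S δ) =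
    qp δ • (qp (ε * δ) • (C (S δ) * shiftU ε U)) := by
  rcases Int.units_eq_one_or ε with rfl | rfl
  · simp only [shiftU, if_true, pow_two, Units.val_one, one_mul]
    have e : C (S δ) * (X * (U * U)) =
      X * (C (S δ) * (U * U)) := mul_smul_comm (xC A) _ _
    rw [smul_mul_assoc, mul_smul_comm, e, mul_assoc, mul_assoc, h.uS, mul_smul_comm,
      ← mul_assoc U, h.uS]
    simp only [smul_mul_assoc, mul_smul_comm, mul_assoc]
    rw [smul_comm (qp δ) (-(qp 1 - 1)), smul_comm (qp δ) (-(qp 1 - 1))]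
  · have hs : ∀ (s : A⟦X⟧), shiftU (-1) s = (1 - qp (-1)) • 1 := fun s => if_neg (by decide)
    rw [hs, smul_mul_assoc, mul_smul_comm, one_mul, mul_one]
    have : (((-1 : ℤˣ) : ℤ) * δ) = -(δ : ℤ) := by simp
    rw [this, qp_smul_qp_neg]

end

/-! ### The outer part of `f_ε` -/

section
variable {A : Type} [Ring A] [Algebra Kq A] {F : Type} [Ring F] [Algebra Kq F]
  {g f : F →ₐ[Kq] A} {UF MF : F⟦X⟧} {U M : A⟦X⟧} {SF : ℤˣ → F} {S : ℤˣ → A} {ε : ℤˣ}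

/-- The counterpart of `IsFlowLift` for the outer part of `f_ε`: `D` is a skew derivation along
algebra maps `g` and `f`, where `g` differs from `f` by a grading automorphism. -/
structure IsShiftLift (g f : F →ₐ[Kq] A) (ε : ℤˣ) (D : F →ₗ[Kq] A) (UF MF : F⟦X⟧) (U M : A⟦X⟧)
    (SF : ℤˣ → F) (S : ℤˣ → A) : Prop where
  skew : IsSkew (g : F →+* A) (f : F →+* A) (D : F →+ A)
  map_u : PowerSeries.map (f : F →+* A) UF = U
  map_m : PowerSeries.map (f : F →+* A) MF = M
  map_S : ∀ δ, f (SF δ) = S δ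
  map_u' : PowerSeries.map (g : F →+* A) UF = qp ε • U
  map_m' : PowerSeries.map (g : F →+* A) MF = qp (-ε) • M
  map_S' : ∀ δ, g (SF δ) = qp (ε * δ) • S δ
  on_u : serMap (D : F →+ A) UF = shiftU ε U
  on_m : serMap (D : F →+ A) MF = 0
  on_S : ∀ δ, D (SF δ) = 0

namespace IsShiftLift
variable {D : F →ₗ[Kq] A} (hD : IsShiftLift g f ε D UF MF U M SF S)
include hD

theorem skew₂ (s t : F⟦X⟧⟦X⟧) : serMap (serMap (D : F →+ A)) (s * t) =
    serMap (serMap (D : F →+ A)) s * PowerSeries.map (PowerSeries.map (f : F →+* A)) t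
      + PowerSeries.map (PowerSeries.map (g : F →+* A)) s * serMap (serMap (D : F →+ A)) t :=
  hD.skew.serMap.serMap s t

theorem coeffLM_D (i j : ℕ) (s : F⟦X⟧⟦X⟧) : D (coeffLM i j s) =
    coeffLM i j (serMap (serMap (D : F →+ A)) s) := by
  simp [coeffLM]

theorem inLam_D (s : F⟦X⟧) : serMap (serMap (D : F →+ A)) (inLam s) =
    inLam (serMap (D : F →+ A) s) := serMap_C _ _

theorem inMu_D (s : F⟦X⟧) : serMap (serMap (D : F →+ A)) (inMu s) =
    inMu (serMap (D : F →+ A) s) := by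
  ext i; simp [inMu]

theorem xLam_D (s : F⟦X⟧⟦X⟧) : serMap (serMap (D : F →+ A)) (xLam F * s) =
    xLam A * serMap (serMap (D : F →+ A)) s := serMap_C_mul (serMap_X_mul _) s

theorem xMu_D (s : F⟦X⟧⟦X⟧) : serMap (serMap (D : F →+ A)) (xMu F * s) =
    xMu A * serMap (serMap (D : F →+ A)) s := serMap_X_mul _ s

omit hD in
theorem map_xLam (φ : F →+* A) : PowerSeries.map (PowerSeries.map φ) (xLam F) = xLam A := by
  simp [xLam]

omit hD in
theorem map_xMu (φ : F →+* A) : PowerSeries.map (PowerSeries.map φ) (xMu F) = xMu A := by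
  simp [xMu]

theorem rel_uu (h : QRel U M) (i j : ℕ) :
    D (coeffLM i j (quadLeft UF)) = qp 1 • D (coeffLM i j (quadRight UF)) := by
  rw [hD.coeffLM_D, hD.coeffLM_D, ← coeffLM_smul]
  refine congrArg (coeffLM i j) ?_
  rw [quadLeft, quadRight, hD.skew₂, hD.skew₂]
  simp only [map_sub, map_mul, hD.inLam_D, hD.inMu_D, hD.xLam_D, hD.xMu_D, map_inLam, map_inMu,
    map_xLam, map_xMu, hD.map_u, hD.map_u', hD.on_u, inLam_smul, inMu_smul, mul_smul_comm,
    ← smul_sub, smul_mul_assoc]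
  exact h.shift_uu ε

theorem rel_mm (i j : ℕ) :
    D (coeffLM i j (quadLeft MF)) = qp (-1) • D (coeffLM i j (quadRight MF)) := by
  rw [hD.coeffLM_D, hD.coeffLM_D, ← coeffLM_smul]
  refine congrArg (coeffLM i j) ?_
  have z1 : inLam (0 : A⟦X⟧) = 0 := map_zero _
  have z2 : inMu (0 : A⟦X⟧) = 0 := map_zero _
  rw [quadLeft, quadRight, hD.skew₂, hD.skew₂]
  simp only [map_sub, hD.inLam_D, hD.inMu_D, hD.xLam_D, hD.xMu_D, hD.on_m, z1, z2, mul_zero,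
    sub_zero, zero_mul, add_zero, smul_zero]

theorem rel_um (h : QRel U M) (i j : ℕ) :
    D (coeffLM i j (inLam UF * inMu MF)) = qp (-1) • D (coeffLM i j (inMu MF * inLam UF)) := by
  rw [hD.coeffLM_D, hD.coeffLM_D, ← coeffLM_smul]
  refine congrArg (coeffLM i j) ?_
  have z2 : inMu (0 : A⟦X⟧) = 0 := map_zero _
  rw [hD.skew₂, hD.skew₂, hD.inLam_D, hD.inMu_D, hD.on_m, hD.on_u, z2, mul_zero, zero_mul,
    add_zero, zero_add, map_inMu, map_inMu, hD.map_m, hD.map_m', inMu_smul, smul_mul_assoc]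
  exact h.shift_um ε

theorem skewSer (s t : F⟦X⟧) : serMap (D : F →+ A) (s * t) =
    serMap (D : F →+ A) s * PowerSeries.map (f : F →+* A) t
      + PowerSeries.map (g : F →+* A) s * serMap (D : F →+ A) t := hD.skew.serMap s t

theorem D_coeff (i : ℕ) (s : F⟦X⟧) : D (coeff i s) =
    coeff i (serMap (D : F →+ A) s) := by
  rw [coeff_serMap]; rfl

theorem C_S (δ : ℤˣ) : serMap (D : F →+ A) (C (SF δ)) = 0 := by
  rw [serMap_C]
  exact (congrArg C (hD.on_S δ)).trans (map_zero _)

theorem rel_uS (h : QRelN U M S) (δ : ℤˣ) (i : ℕ) :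
    D (coeff i (UF * C (SF δ))) =
      qp δ • D (coeff i (C (SF δ) * UF)) := by
  have e1 : (f : F →+* A) (SF δ) = S δ := hD.map_S δ
  have e2 : (g : F →+* A) (SF δ) = qp (ε * δ) • S δ := hD.map_S' δ
  rw [hD.D_coeff, hD.D_coeff, hD.skewSer, hD.skewSer, hD.C_S, hD.on_u, mul_zero, zero_mul,
    add_zero, zero_add, PowerSeries.map_C, PowerSeries.map_C, e1, e2, ← PowerSeries.coeff_smul,
    C_smul, smul_mul_assoc, h.shift_uS ε δ]

theorem D_mS (δ : ℤˣ) (i : ℕ) : D (coeff i (MF * C (SF δ))) = 0 ∧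
    D (coeff i (C (SF δ) * MF)) = 0 := by
  constructor
  · rw [hD.D_coeff, hD.skewSer, hD.C_S, hD.on_m, mul_zero, zero_mul, add_zero, map_zero]
  · rw [hD.D_coeff, hD.skewSer, hD.C_S, hD.on_m, mul_zero, zero_mul, add_zero, map_zero]

theorem rel_mSp (i : ℕ) : D (coeff i
      (MF * C (SF 1) - qp (-1) • (C (SF 1) * MF))) =
    D (coeff i ((1 - qp (-1)) • (1 : F⟦X⟧))) := by
  have e1 : D (coeff i (1 : F⟦X⟧)) = 0 := by
    rw [hD.D_coeff, hD.skew.serMap.map_one, map_zero]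
  rw [map_sub, map_sub, PowerSeries.coeff_smul, PowerSeries.coeff_smul, map_smul, map_smul, e1,
    (hD.D_mS 1 i).1, (hD.D_mS 1 i).2, smul_zero, smul_zero, sub_zero]

theorem rel_mSm (i : ℕ) : D (coeff i
      (MF * C (SF (-1)) - qp 1 • (C (SF (-1)) * MF))) =
    D (coeff i (-(qp 1 - 1) • (X * MF ^ 2))) := by
  have e1 : D (coeff i (X * MF ^ 2)) = 0 := by
    rw [hD.D_coeff, serMap_X_mul, pow_two, hD.skewSer, hD.on_m, zero_mul, mul_zero, add_zero,
      mul_zero, map_zero]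
  rw [map_sub, map_sub, PowerSeries.coeff_smul, PowerSeries.coeff_smul, map_smul, map_smul, e1,
    (hD.D_mS _ i).1, (hD.D_mS _ i).2, smul_zero, smul_zero, sub_zero]

theorem rel_SS (δ : ℤˣ) : D (serre (SF δ) (SF (-δ))) = 0 := by
  have e : ∀ a b, D (a * b) = D a * f b + g a * D b := hD.skew
  simp only [serre, pow_succ, pow_zero, one_mul, map_sub, map_smul, e, hD.on_S, zero_mul, mul_zero,
    add_zero, smul_zero, sub_zero]

end IsShiftLift
end

/-- The properties that characterize the outer part of `f_ε`. -/
structure IsShift (ε : ℤˣ) (F : QBN →ₗ[Kq] QBN) : Prop where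
  skew : IsSkew (QBN.wt ε : QBN →+* QBN) (RingHom.id QBN) (F : QBN →+ QBN)
  on_u : serMap (F : QBN →+ QBN) (genSer QBN.u) = shiftU ε (genSer QBN.u)
  on_m : serMap (F : QBN →+ QBN) (genSer QBN.m) = 0
  on_S : ∀ δ, F (QBN.S δ) = 0

theorem QBN.exists_shift (ε : ℤˣ) : ∃ F, IsShift ε F := by
  obtain ⟨D, hD, hgen⟩ := exists_skew_of_rel (Rel := RelBN) (QBN.wt ε) (AlgHom.id Kq QBN)
    (fun x => match x with
      | .u i => (-1) ^ i * coeff i (shiftU ε (genSer QBN.u))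
      | .m _ => 0
      | .S _ => 0) (by
    intro D hD hgen r s hrs
    have hl : IsShiftLift ((QBN.wt ε).comp QBN.proj) ((AlgHom.id Kq QBN).comp QBN.proj) ε D
        GenBN.U GenBN.M (genSer QBN.u) (genSer QBN.m) GenBN.Sg QBN.S :=
      { skew := hD
        map_u := QBN.map_U
        map_m := QBN.map_M
        map_S := fun _ => rfl
        map_u' := by
          rw [← QBN.map_wt_u, ← QBN.map_U]; ext i; simp
        map_m' := by
          rw [← QBN.map_wt_m, ← QBN.map_M]; ext i; simp
        map_S' := QBN.wt_S ε
        on_u := (serMap_genSer _ _ _).2 fun i => hgen (.u i)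
        on_m := (serMap_genSer _ _ _).2 fun i => (hgen (.m i)).trans (by simp)
        on_S := fun δ => hgen (.S δ) }
    cases hrs with
    | uu i j => rw [map_smul]; exact hl.rel_uu QBN.qRelN.toQRel i j
    | mm i j => rw [map_smul]; exact hl.rel_mm i j
    | um i j => rw [map_smul]; exact hl.rel_um QBN.qRelN.toQRel i j
    | uS ε i => rw [map_smul]; exact hl.rel_uS QBN.qRelN ε i
    | mSp i => exact hl.rel_mSp i
    | mSm i => exact hl.rel_mSm i
    | SS ε => rw [map_zero]; exact hl.rel_SS ε)
  refine ⟨D, hD, ?_, ?_, ?_⟩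
  · rw [serMap_genSer]; exact fun i => hgen (.u i)
  · rw [serMap_genSer]; exact fun i => (hgen (.m i)).trans (by simp)
  · exact fun δ => hgen (.S δ)

/-- The outer part of the action of `f_ε`: the action is the sum of the inner skew derivation `a ↦
S_ε a - k_ε(a) S_ε` and of this skew derivation, which annihilates `m` and the charges. -/
def QBN.shift (ε : ℤˣ) : QBN →ₗ[Kq] QBN := (QBN.exists_shift ε).choose

theorem QBN.isShift (ε : ℤˣ) : IsShift ε (QBN.shift ε) := (QBN.exists_shift ε).choose_spec

/-! ### The operators of the action -/

section Serre
variable {A : Type} [Ring A] [Algebra Kq A]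

theorem serre_neg (a b : A) : serre (-a) (-b) = serre a b := by
  simp [serre, pow_succ]

theorem map_serre {B : Type} [Ring B] [Algebra Kq B] (φ : A →ₐ[Kq] B) (a b : A) :
    φ (serre a b) = serre (φ a) (φ b) := by
  simp only [serre, map_sub, map_mul, map_pow, map_smul]

/-- The Serre expression is additive on pairs that `q`-commute in the appropriate way. -/
theorem serre_add_aux {a b c d : A} (ca : c * a = qp 1 • (a * c)) (cb : c * b = qp (-1) • (b * c))
    (da : d * a = qp (-1) • (a * d)) (db : d * b = qp 1 • (b * d)) :
    serre (a + c) (b + d) = serre a b + serre c d := by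
  have ca' : ∀ t, c * (a * t) = qp 1 • (a * (c * t)) := fun t => by
    rw [← mul_assoc, ca, smul_mul_assoc, mul_assoc]
  have cb' : ∀ t, c * (b * t) = qp (-1) • (b * (c * t)) := fun t => by
    rw [← mul_assoc, cb, smul_mul_assoc, mul_assoc]
  have da' : ∀ t, d * (a * t) = qp (-1) • (a * (d * t)) := fun t => by
    rw [← mul_assoc, da, smul_mul_assoc, mul_assoc]
  have db' : ∀ t, d * (b * t) = qp 1 • (b * (d * t)) := fun t => by
    rw [← mul_assoc, db, smul_mul_assoc, mul_assoc]
  simp only [serre, pow_succ, pow_zero, one_mul, mul_add, add_mul, mul_assoc, ca, cb, da, ca',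
    cb', da', mul_smul_comm, smul_mul_assoc, smul_smul, qp_mul_qp, smul_add, smul_sub,
    add_smul, one_smul]
  norm_num only
  simp only [qp_zero, one_smul]
  module

theorem serre_add {a c : ℤˣ → A} (h : ∀ δ ε, c δ * a ε = qp (ε * δ) • (a ε * c δ)) (ε : ℤˣ) :
    serre (a ε + c ε) (a (-ε) + c (-ε)) = serre (a ε) (a (-ε)) + serre (c ε) (c (-ε)) := by
  rcases Int.units_eq_one_or ε with rfl | rfl
  · exact serre_add_aux (h _ _) (h _ _) (h _ _) (h _ _)
  · exact serre_add_aux (h _ _) (h _ _) (h _ _) (h _ _)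

end Serre

namespace QBN

/-- Left multiplication by a half screening charge. -/
def opL (ε : ℤˣ) : Module.End Kq QBN := LinearMap.mulLeft Kq (S ε)

/-- The action of `k_ε`, for `n = ε`. -/
def opK (n : ℤ) : Module.End Kq QBN := (wt n).toLinearMap

/-- Right multiplication by a half screening charge, twisted by the grading. -/
def opR (ε : ℤˣ) : Module.End Kq QBN := LinearMap.mulRight Kq (S ε) * opK ε

/-- The action of `f_ε`: left multiplication, outer part and twisted right multiplication pairwise
satisfy the hypothesis of `serre_add`. -/
def opF (ε : ℤˣ) : Module.End Kq QBN := opL ε + (shift ε + -opR ε)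

theorem opK_apply (n : ℤ) (a : QBN) : opK n a = wt n a := rfl
theorem opR_apply (ε : ℤˣ) (a : QBN) : opR ε a = wt ε a * S ε := rfl
theorem opF_apply (ε : ℤˣ) (a : QBN) : opF ε a = S ε * a + (shift ε a - wt ε a * S ε) := by
  rw [sub_eq_add_neg]; rfl

theorem wt_wt_apply (n k : ℤ) (a : QBN) : wt n (wt k a) = wt (n + k) a := by
  rw [← wt_wt]; rfl

theorem shift_mul (ε : ℤˣ) (a b : QBN) :
    shift ε (a * b) = shift ε a * b + wt ε a * shift ε b := (isShift ε).skew a b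

theorem map_wt_shiftU (n : ℤ) (ε : ℤˣ) : PowerSeries.map (wt n : QBN →+* QBN)
    (shiftU ε (genSer u)) = qp (n * ε) • qp n • shiftU ε (genSer u) := by
  have e : ∀ (r : Kq) (s : QBN⟦X⟧), PowerSeries.map (wt n : QBN →+* QBN) (r • s) =
      r • PowerSeries.map (wt n : QBN →+* QBN) s := fun r s => by ext i; simp
  rcases Int.units_eq_one_or ε with rfl | rfl
  · simp only [shiftU, if_true, e, map_mul, PowerSeries.map_X, map_wt_u, pow_two,
      smul_mul_assoc, mul_smul_comm, Units.val_one, mul_one]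
    rw [smul_comm (qp n) (-(qp 1 - 1)), smul_comm (qp n) (-(qp 1 - 1))]
  · have hs : ∀ (s : QBN⟦X⟧), shiftU (-1) s = (1 - qp (-1)) • 1 := fun s => if_neg (by decide)
    have : (n * ((-1 : ℤˣ) : ℤ)) = -n := by simp
    rw [hs, e, map_one, this, qp_neg_smul_qp]

theorem wt_shift (n : ℤ) (ε : ℤˣ) (a : QBN) :
    wt n (shift ε a) = qp (n * ε) • shift ε (wt n a) := by
  have : opK n * shift ε = qp (n * ε) • (shift ε * opK n) := by
    have e : ∀ s : QBN⟦X⟧,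
        serMap (((opK n * shift ε : Module.End Kq QBN) : QBN →ₗ[Kq] QBN) : QBN →+ QBN) s =
        PowerSeries.map (wt n : QBN →+* QBN) (serMap (shift ε : QBN →+ QBN) s) := fun s => by
      ext i; simp [opK_apply]
    have e' : ∀ s : QBN⟦X⟧, serMap (((qp (n * ε) • (shift ε * opK n) : Module.End Kq QBN) :
        QBN →ₗ[Kq] QBN) : QBN →+ QBN) s =
        qp (n * ε) • serMap (shift ε : QBN →+ QBN) (PowerSeries.map (wt n : QBN →+* QBN) s) :=
      fun s => by ext i; simp [opK_apply]
    have e2 : ∀ (r : Kq) (s : QBN⟦X⟧), serMap (shift ε : QBN →+ QBN) (r • s) =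
        r • serMap (shift ε : QBN →+ QBN) s := fun r s => by ext i; simp
    refine skew_ext (g := (wt (n + ε) : QBN →+* QBN)) (f := (wt n : QBN →+* QBN)) ?_ ?_ ?_ ?_ ?_
    · intro a b
      change wt n (shift ε (a * b)) = wt n (shift ε a) * wt n b
        + wt (n + ε) a * wt n (shift ε b)
      rw [shift_mul, map_add, map_mul, map_mul, wt_wt_apply]
    · intro a b
      change qp (n * ε) • shift ε (wt n (a * b)) = (qp (n * ε) • shift ε (wt n a)) * wt n b
        + wt (n + ε) a * (qp (n * ε) • shift ε (wt n b))
      rw [map_mul, shift_mul, wt_wt_apply, add_comm (ε : ℤ), smul_add, smul_mul_assoc,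
        mul_smul_comm]
    · refine (e _).trans (.trans ?_ (e' _).symm)
      rw [map_wt_u, e2, (isShift ε).on_u, map_wt_shiftU]
    · refine (e _).trans (.trans ?_ (e' _).symm)
      rw [map_wt_m, e2, (isShift ε).on_m, map_zero, smul_zero, smul_zero]
    · intro δ
      change wt n (shift ε (S δ)) = qp (n * ε) • shift ε (wt n (S δ))
      rw [wt_S, map_smul, (isShift ε).on_S, map_zero, smul_zero, smul_zero]
  exact LinearMap.congr_fun this a

theorem wt_opF (n : ℤ) (ε : ℤˣ) (a : QBN) : wt n (opF ε a) = qp (n * ε) • opF ε (wt n a) := by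
  simp only [opF_apply, map_add, map_sub, map_mul, wt_S, wt_shift, wt_wt_apply, smul_add,
    smul_sub, smul_mul_assoc, mul_smul_comm, add_comm n]

theorem opF_mul (ε : ℤˣ) (a b : QBN) : opF ε (a * b) = opF ε a * b + wt ε a * opF ε b := by
  simp only [opF_apply, map_mul, shift_mul]
  noncomm_ring

theorem serre_opL (ε : ℤˣ) : serre (opL ε) (opL (-ε)) = 0 := by
  have := map_serre (Algebra.lmul Kq QBN) (S ε) (S (-ε))
  rw [qRelN.SS, map_zero] at this
  exact this.symm

theorem serre_opR (ε : ℤˣ) : serre (opR ε) (opR (-ε)) = 0 := by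
  have h := qRelN.SS ε
  ext a
  have key : serre (opR ε) (opR (-ε)) a = -(wt (2 * ε) a * serre (S ε) (S (-ε))) := by
    simp only [serre, pow_succ, pow_zero, one_mul, LinearMap.sub_apply, LinearMap.smul_apply,
      Module.End.mul_apply, opR_apply, map_mul, wt_S, map_smul, wt_wt_apply]
    have s1 : (ε : ℤ) * ε = 1 := by rcases Int.units_eq_one_or ε with rfl | rfl <;> rfl
    simp only [Units.val_neg, mul_neg, neg_mul, s1, smul_mul_assoc, mul_smul_comm, smul_smul,
      qp_mul_qp, mul_sub, mul_add, smul_sub, add_smul, one_smul, mul_assoc]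
    norm_num only
    have w : ∀ n, n = 2 * (ε : ℤ) → wt n a = wt (2 * ε) a := by rintro _ rfl; rfl
    rw [w (ε + (ε + (ε + -ε))) (by ring), w (ε + (ε + (-ε + ε))) (by ring),
      w (ε + (-ε + (ε + ε))) (by ring), w (-ε + (ε + (ε + ε))) (by ring)]
    simp only [qp_zero, one_smul]
    module
  rw [key, h, mul_zero, neg_zero]
  rfl

end QBN

/-! ### The Serre relations for the operators of the action -/

/-- The Serre relations for two skew derivations `P`, `N`, evaluated at an element `u` with `P u =
α x u²` and `N u = κ`: on powers of `u` they act like `q`-difference operators. -/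
theorem serre_shift_aux {A : Type} [Ring A] [Algebra Kq A] {P N : Module.End Kq A}
    {k l : A →ₐ[Kq] A} {u x : A} {α κ : Kq} (hP : ∀ a b, P (a * b) = P a * b + k a * P b)
    (hN : ∀ a b, N (a * b) = N a * b + l a * N b) (ku : k u = qp 1 • u) (lu : l u = qp (-1) • u)
    (lx : l x = x) (kx : k x = x) (Px : P x = 0) (Nx : N x = 0)
    (hx : ∀ a, a * x = x * a) (Pu : P u = α • (x * (u * u)))
    (Nu : N u = κ • 1) : serre P N u = 0 ∧ serre N P u = 0 := by
  have hx' : ∀ a b, a * (x * b) = x * (a * b) := fun a b => by rw [← mul_assoc, hx, mul_assoc]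
  have P1 : P 1 = 0 := by simpa using hP 1 1
  have N1 : N 1 = 0 := by simpa using hN 1 1
  have Pmul : ∀ a, P (x * a) = x * P a := fun a => by rw [hP, Px, kx, zero_mul, zero_add]
  have Nmul : ∀ a, N (x * a) = x * N a := fun a => by rw [hN, Nx, lx, zero_mul, zero_add]
  have P2 : P (u * u) = (α * (1 + qp 1)) • (x * (u * (u * u))) := by
    rw [hP, ku, Pu]
    simp only [smul_mul_assoc, mul_smul_comm, mul_assoc, hx']
    module
  have P3 : P (u * (u * u)) = (α * (1 + qp 1 + qp 2)) • (x * (u * (u * (u * u)))) := by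
    have e : qp 1 * qp 1 = qp 2 := qp_mul_qp 1 1
    rw [hP, ku, Pu, P2]
    simp only [smul_mul_assoc, mul_smul_comm, mul_assoc, hx', ← e]
    module
  have N2 : N (u * u) = (κ * (1 + qp (-1))) • u := by
    rw [hN, lu, Nu]
    simp only [smul_mul_assoc, mul_smul_comm, one_mul, mul_one]
    module
  have N3 : N (u * (u * u)) = (κ * (1 + qp (-1) + qp (-2))) • (u * u) := by
    have e : qp (-1) * qp (-1) = qp (-2) := qp_mul_qp (-1) (-1)
    rw [hN, lu, Nu, N2]
    simp only [smul_mul_assoc, mul_smul_comm, one_mul, ← e]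
    module
  have N4 : N (u * (u * (u * u))) =
      (κ * (1 + qp (-1) + qp (-2) + qp (-3))) • (u * (u * u)) := by
    have e : qp (-1) * qp (-1) = qp (-2) := qp_mul_qp (-1) (-1)
    have e' : qp (-1) * qp (-2) = qp (-3) := qp_mul_qp (-1) (-2)
    rw [hN, lu, Nu, N3]
    simp only [smul_mul_assoc, mul_smul_comm, one_mul, ← e', ← e]
    module
  constructor
  · simp only [serre, pow_succ, pow_zero, one_mul, LinearMap.sub_apply, LinearMap.smul_apply,
      Module.End.mul_apply, Pmul, Nmul, Pu, Nu, P2, P3, N2, N3, N4, map_smul, P1, map_zero, smul_zero,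
      zero_sub, mul_smul_comm, smul_smul]
    rw [← sub_smul, smul_smul, ← neg_smul, ← sub_smul]
    refine (congrArg (fun r => r • _) ?_).trans (zero_smul _ _)
    have e : qp 1 * qp (-1) = 1 := by rw [qp_mul_qp, add_neg_cancel, qp_zero]
    have e2 : qp 2 = qp 1 * qp 1 := (qp_mul_qp 1 1).symm
    have e3 : qp (-2) = qp (-1) * qp (-1) := by rw [qp_mul_qp]; rfl
    have e4 : qp (-3) = qp (-1) * (qp (-1) * qp (-1)) := by
      rw [qp_mul_qp, qp_mul_qp]; rfl
    rw [e2, e3, e4]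
    generalize qp 1 = r at e ⊢
    generalize qp (-1) = t at e ⊢
    linear_combination (α ^ 3 * κ * (1 + r) * (1 + t + t ^ 2 + t ^ 3 - (1 + r + t) * t ^ 2)) * e
  · simp only [serre, pow_succ, pow_zero, one_mul, LinearMap.sub_apply, LinearMap.smul_apply,
      Module.End.mul_apply, Pu, Nu, N2, map_smul, P1, N1, map_zero, smul_zero, sub_zero,
      Nmul, mul_zero]

/-- The map `serMap`, as a linear map. -/
def serLin {A B : Type*} [Ring A] [Ring B] [Algebra Kq A] [Algebra Kq B] (D : A →ₗ[Kq] B) :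
    A⟦X⟧ →ₗ[Kq] B⟦X⟧ where
  toFun := serMap (D : A →+ B)
  map_add' := map_add _
  map_smul' r s := by ext i; simp

theorem serre_serLin {A : Type} [Ring A] [Algebra Kq A] (P N : Module.End Kq A) (s : A⟦X⟧) :
    serMap ((serre P N : A →ₗ[Kq] A) : A →+ A) s =
      serre (A := Module.End Kq A⟦X⟧) (serLin P) (serLin N) s := by
  have c : ∀ (D : A →ₗ[Kq] A) i s, coeff i (serLin D s) = D (coeff i s) :=
    fun D i s => coeff_serMap (D : A →+ A) i s
  ext i
  rw [coeff_serMap]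
  change serre P N (coeff i s) = _
  simp only [serre, pow_succ, pow_zero, one_mul, LinearMap.sub_apply, LinearMap.smul_apply,
      Module.End.mul_apply, map_sub, PowerSeries.coeff_smul, c]

/-- An algebra map applied to all coefficients, as an algebra map. -/
def serAlg {A B : Type*} [Ring A] [Ring B] [Algebra Kq A] [Algebra Kq B] (φ : A →ₐ[Kq] B) :
    A⟦X⟧ →ₐ[Kq] B⟦X⟧ :=
  { PowerSeries.map (φ : A →+* B) with
    commutes' := fun r => by
      change PowerSeries.map (φ : A →+* B) (algebraMap Kq A⟦X⟧ r) = _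
      rw [PowerSeries.algebraMap_apply, PowerSeries.algebraMap_apply, PowerSeries.map_C]
      exact congrArg C (φ.commutes r) }

namespace QBN

theorem serre_shift_mul (ε : ℤˣ) (a b : QBN) :
    serre (shift ε) (shift (-ε)) (a * b) =
      serre (shift ε) (shift (-ε)) a * b + wt (ε + ε) a * serre (shift ε) (shift (-ε)) b := by
  simp only [serre, pow_succ, pow_zero, one_mul, LinearMap.sub_apply, LinearMap.smul_apply,
      Module.End.mul_apply, shift_mul, map_add, wt_shift, map_smul, wt_wt_apply]
  have s1 : (ε : ℤ) * ε = 1 := by rcases Int.units_eq_one_or ε with rfl | rfl <;> rfl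
  simp only [Units.val_neg, mul_neg, neg_mul, s1, smul_mul_assoc, mul_smul_comm, smul_smul,
      qp_mul_qp, mul_sub, mul_add, smul_add, smul_sub, add_smul, one_smul, add_neg_cancel, neg_add_cancel, add_neg_cancel_left, neg_add_cancel_left, sub_mul, add_mul, add_zero, one_mul]
  norm_num only
  simp only [qp_zero, one_smul]
  module

theorem serre_shift (ε : ℤˣ) : serre (shift ε) (shift (-ε)) = 0 := by
  refine skew_ext (g := (wt (ε + ε) : QBN →+* QBN)) (f := RingHom.id _)
    (serre_shift_mul ε) (zero_skew _ _) ?_ ?_ ?_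
  · have zero : serMap ((0 : QBN →ₗ[Kq] QBN) : QBN →+ QBN) (genSer u) = 0 := by ext; simp
    rw [zero]
    refine (serre_serLin _ _ _).trans ?_
    have h := fun δ => (isShift δ).skew.serMap
    have hX : ∀ δ, serMap (shift δ : QBN →+ QBN) X = 0 := fun δ => by
      rw [← mul_one X, serMap_X_mul, (h δ).map_one, mul_zero]
    have id : ∀ s : QBN⟦X⟧, PowerSeries.map (RingHom.id QBN) s = s := fun s => by ext; simp
    have h' : ∀ (δ : ℤˣ) (a b : QBN⟦X⟧), serLin (shift δ) (a * b) =
        serLin (shift δ) a * b + serAlg (wt δ) a * serLin (shift δ) b := fun δ a b => by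
      refine (h δ a b).trans ?_
      rw [id]; rfl
    have := serre_shift_aux (P := serLin (shift 1)) (N := serLin (shift (-1)))
      (k := serAlg (wt (1 : ℤˣ))) (l := serAlg (wt (-1 : ℤˣ))) (x := X) (u := genSer u)
      (h' _) (h' _) (map_wt_u _) (map_wt_u _) (PowerSeries.map_X _) (PowerSeries.map_X _)
      (hX _) (hX _) (fun a => PowerSeries.commute_X a)
      ((isShift 1).on_u.trans (by rw [shiftU, if_pos rfl, pow_two]))
      ((isShift (-1)).on_u.trans (if_neg (by decide)))
    rcases Int.units_eq_one_or ε with rfl | rfl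
    · exact this.1
    · exact this.2
  · refine (serre_serLin _ _ _).trans ?_
    have : ∀ δ, serLin (shift δ) (genSer m) = 0 := fun δ => (isShift δ).on_m
    simp only [serre, pow_succ, pow_zero, one_mul, LinearMap.sub_apply, LinearMap.smul_apply,
      Module.End.mul_apply, this, map_zero, smul_zero, sub_zero]
    ext; simp
  · intro δ
    simp only [serre, pow_succ, pow_zero, one_mul, LinearMap.sub_apply, LinearMap.smul_apply,
      Module.End.mul_apply, (isShift _).on_S, map_zero, smul_zero, sub_zero]
    rfl

theorem serre_opF (ε : ℤˣ) : serre (opF ε) (opF (-ε)) = 0 := by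
  have h1 := serre_add (a := opL) (c := fun ε => shift ε + -opR ε) (fun δ ε => by
    ext a
    change shift δ (S ε * a) + -(wt δ (S ε * a) * S δ) =
      qp (ε * δ) • (S ε * (shift δ a + -(wt δ a * S δ)))
    rw [shift_mul, (isShift δ).on_S, map_mul, wt_S, zero_mul, zero_add, smul_mul_assoc,
      smul_mul_assoc, smul_mul_assoc, mul_add, smul_add, mul_neg, smul_neg, mul_assoc,
      mul_comm (ε : ℤ)]) ε
  have h2 := serre_add (a := shift) (c := fun ε => -opR ε) (fun δ ε => by
    ext a
    change -(wt δ (shift ε a) * S δ) = qp (ε * δ) • shift ε (-(wt δ a * S δ))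
    rw [wt_shift, map_neg, shift_mul, (isShift _).on_S, mul_zero, add_zero, smul_neg,
      smul_mul_assoc, mul_comm (ε : ℤ)]) ε
  rw [serre_opL, zero_add] at h1
  rw [serre_shift, zero_add, serre_neg, serre_opR] at h2
  exact h1.trans h2

end QBN

/-! ### The action of the quantum group -/

namespace QBN

/-- The action of `U_q(b̂₋)`. -/
def act : Uq →ₐ[Kq] Module.End Kq QBN :=
  RingQuot.liftAlgHom Kq ⟨FreeAlgebra.lift Kq fun
    | .k ε => opK ε
    | .kinv ε => opK (-ε)
    | .f ε => opF ε, by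
    have kk : ∀ n k : ℤ, opK n * opK k = opK (n + k) := fun n k => by
      ext a; exact wt_wt_apply n k a
    have k0 : opK 0 = 1 := by
      ext a; rw [opK_apply, wt_zero]; rfl
    rintro r s (ε | ε | ⟨ε, δ⟩ | ⟨ε, δ⟩ | ε)
    · simp only [map_mul, FreeAlgebra.lift_ι_apply, map_one, kk, add_neg_cancel, k0]
    · simp only [map_mul, FreeAlgebra.lift_ι_apply, map_one, kk, neg_add_cancel, k0]
    · simp only [map_mul, FreeAlgebra.lift_ι_apply, kk, add_comm]
    · simp only [map_mul, FreeAlgebra.lift_ι_apply, map_smul]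
      ext a
      change wt ε (opF δ (wt (-ε) a)) = qp _ • opF δ a
      rw [wt_opF, wt_wt_apply, add_neg_cancel, wt_zero, Units.val_mul]
      rfl
    · rw [map_serre, FreeAlgebra.lift_ι_apply, FreeAlgebra.lift_ι_apply, map_zero]
      exact serre_opF ε⟩

theorem act_k (ε : ℤˣ) : act (Uq.k ε) = opK ε :=
  (RingQuot.liftAlgHom_mkAlgHom_apply Kq _ _ _).trans (FreeAlgebra.lift_ι_apply _ _)

theorem act_kinv (ε : ℤˣ) : act (Uq.proj (FreeAlgebra.ι Kq (.kinv ε))) = opK (-ε) :=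
  (RingQuot.liftAlgHom_mkAlgHom_apply Kq _ _ _).trans (FreeAlgebra.lift_ι_apply _ _)

theorem act_f (ε : ℤˣ) : act (Uq.f ε) = opF ε :=
  (RingQuot.liftAlgHom_mkAlgHom_apply Kq _ _ _).trans (FreeAlgebra.lift_ι_apply _ _)

theorem applySer_opF (ε : ℤˣ) (s : QBN⟦X⟧) : applySer (opF ε) s =
    C (S ε) * s + (serMap (shift ε : QBN →+ QBN) s
      - PowerSeries.map (wt ε : QBN →+* QBN) s * C (S ε)) := by
  ext i
  simp [applySer, opF_apply]

theorem isUqAction : IsUqAction act where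
  k_mul ε a b := by rw [act_k]; exact map_mul (wt ε) a b
  f_mul ε a b := by rw [act_k, act_f]; exact opF_mul ε a b
  k_one ε := by rw [act_k]; exact map_one (wt ε)
  f_one ε := by
    rw [act_f]
    have := opF_mul ε 1 1
    simpa using this
  k_u ε i := by rw [act_k]; exact wt_u ε i
  k_m ε i := by rw [act_k]; exact wt_m ε i
  k_S ε δ := by rw [act_k, Units.val_mul]; exact wt_S ε δ
  fp_u := by
    rw [act_f, applySer_opF, (isShift 1).on_u, map_wt_u, shiftU, if_pos rfl, qRelN.uS 1,
      smul_mul_assoc, qRelN.uS 1]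
    simp only [smul_smul, sub_mul, qp_mul_qp, Units.val_one, sub_smul]
    norm_num only
    rw [qp_zero, one_smul]
    abel
  fm_u := by
    rw [act_f, applySer_opF, (isShift (-1)).on_u, map_wt_u, shiftU, if_neg (by decide),
      smul_mul_assoc, qRelN.uS (-1)]
    simp only [Units.val_neg, Units.val_one, smul_smul, sub_mul, qp_mul_qp, sub_smul]
    norm_num only
    rw [qp_zero, one_smul]
    module
  fp_m := by
    have h := congrArg (fun s => qp 1 • s) (eq_add_of_sub_eq qRelN.mSp)
    simp only [smul_add, smul_smul, qp_mul_qp, sub_smul, one_smul, smul_sub] at h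
    norm_num only at h
    rw [qp_zero, one_smul] at h
    rw [act_f, applySer_opF, (isShift 1).on_m, map_wt_m, zero_sub, smul_mul_assoc, Units.val_one]
    linear_combination (norm := module) -h
  fm_m := by
    have h := congrArg (fun s => qp (-1) • s) (eq_add_of_sub_eq qRelN.mSm)
    simp only [smul_add, smul_smul, qp_mul_qp, sub_smul, one_smul, smul_sub,
      neg_smul, smul_neg] at h
    norm_num only at h
    simp only [qp_zero, one_smul] at h
    rw [act_f, applySer_opF, (isShift (-1)).on_m, map_wt_m, zero_sub, smul_mul_assoc,
      Units.val_neg, Units.val_one, neg_neg]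
    linear_combination (norm := module) -h
  f_S ε δ := by
    rw [act_f, opF_apply, (isShift ε).on_S, wt_S, smul_mul_assoc, Units.val_mul, zero_sub,
      sub_eq_add_neg]

theorem act_unique {φ : Uq →ₐ[Kq] Module.End Kq QBN} (h : IsUqAction φ) : φ = act := by
  have hK : ∀ ε, φ (Uq.k ε) = act (Uq.k ε) := by
    intro ε
    let g : QBN →ₐ[Kq] QBN := AlgHom.ofLinearMap (φ (Uq.k ε)) (h.k_one ε) (h.k_mul ε)
    have : g = wt ε := algHom_ext (fun i => (h.k_u ε i).trans (wt_u _ _).symm)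
      (fun i => (h.k_m ε i).trans (wt_m _ _).symm)
      (fun δ => (h.k_S ε δ).trans (by rw [wt_S, Units.val_mul]))
    rw [act_k]
    exact congrArg AlgHom.toLinearMap this
  have hinv : ∀ (ψ : Uq →ₐ[Kq] Module.End Kq QBN) ε,
      ψ (Uq.k ε) * ψ (Uq.proj (FreeAlgebra.ι Kq (.kinv ε))) = 1 ∧
      ψ (Uq.proj (FreeAlgebra.ι Kq (.kinv ε))) * ψ (Uq.k ε) = 1 := fun ψ ε => by
    have e1 : Uq.proj (FreeAlgebra.ι Kq (.k ε) * FreeAlgebra.ι Kq (.kinv ε)) = Uq.proj 1 :=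
      RingQuot.mkAlgHom_rel Kq (RelUq.k_kinv ε)
    have e2 : Uq.proj (FreeAlgebra.ι Kq (.kinv ε) * FreeAlgebra.ι Kq (.k ε)) = Uq.proj 1 :=
      RingQuot.mkAlgHom_rel Kq (RelUq.kinv_k ε)
    rw [map_mul, map_one] at e1 e2
    constructor
    · rw [← map_mul]; exact (congrArg ψ e1).trans (map_one ψ)
    · rw [← map_mul]; exact (congrArg ψ e2).trans (map_one ψ)
  have hF : ∀ ε, φ (Uq.f ε) = act (Uq.f ε) := by
    intro ε
    have a := isUqAction
    refine skew_ext (g := (wt ε : QBN →+* QBN)) (f := RingHom.id QBN) ?_ ?_ ?_ ?_ ?_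
    · intro x y
      have := h.f_mul ε x y
      rw [hK, act_k] at this
      exact this
    · intro x y
      have := a.f_mul ε x y
      rw [act_k] at this
      exact this
    · rcases Int.units_eq_one_or ε with rfl | rfl
      · exact h.fp_u.trans a.fp_u.symm
      · exact h.fm_u.trans a.fm_u.symm
    · rcases Int.units_eq_one_or ε with rfl | rfl
      · exact h.fp_m.trans a.fp_m.symm
      · exact h.fm_m.trans a.fm_m.symm
    · exact fun δ => (h.f_S ε δ).trans (a.f_S ε δ).symm
  refine RingQuot.ringQuot_ext' Kq φ act (FreeAlgebra.hom_ext (funext ?_))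
  rintro (ε | ε | ε)
  · exact hK ε
  · refine left_inv_eq_right_inv (hinv φ ε).2 ?_
    rw [hK]
    exact (hinv act ε).1
  · exact hF ε

end QBN

/-! ### The action on `v` and `w` -/

section Scale
variable {A : Type} [Ring A] [Algebra Kq A] {r r' : Kq}

theorem resolv_smul (h : r * r' = 1) (s t : A⟦X⟧) : resolv (r • s) (r' • t) = resolv s t := by
  have h' : r' * r = 1 := by rw [mul_comm, h]
  simp only [resolv, mul_smul_comm, smul_mul_assoc, smul_smul, h', one_smul]

theorem negInvAdd_smul (h : r * r' = 1) (s t : A⟦X⟧) :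
    negInvAdd (r • s) (r' • t) = r' • negInvAdd s t := by
  rw [negInvAdd_eq, negInvAdd_eq, resolv_smul h, smul_mul_assoc, mul_smul_comm, smul_neg]

theorem map_C_smul (r : Kq) (s : A⟦X⟧) : PowerSeries.map C (r • s) =
    r • PowerSeries.map (C (R := A)) s := inMu_smul r s

theorem divDiff_kq_smul (r : Kq) (s : A⟦X⟧) : divDiff (r • s) = r • divDiff s := by
  ext i j; simp [divDiff]

theorem letter_kq_smul (r : Kq) (s : A⟦X⟧) : letter (r • s) = r • letter s := by
  simp only [letter, divDiff_kq_smul, map_C_smul, mul_smul_comm, smul_add]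

theorem flowU_smul (h : r * r' = 1) (U M : A⟦X⟧) :
    flowU (r • U) (r' • M) = r • flowU U M := by
  have h' : r' * r = 1 := by rw [mul_comm, h]
  simp only [flowU, letter_kq_smul, divDiff_kq_smul, map_C_smul, negInvAdd_smul h, C_smul,
    h, h', one_smul, mul_smul_comm, smul_mul_assoc, smul_sub, smul_smul, mul_assoc]

theorem flowM_smul (h : r * r' = 1) (U M : A⟦X⟧) :
    flowM (r • U) (r' • M) = r' • flowM U M := by
  have h' : r' * r = 1 := by rw [mul_comm, h]
  simp only [flowM, letter_kq_smul, divDiff_kq_smul, map_C_smul, negInvAdd_smul h', C_smul,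
    h, one_smul, mul_smul_comm, smul_mul_assoc, smul_sub, smul_neg, smul_smul,
    mul_assoc]

end Scale

theorem qp_mul_neg (n : ℤ) : qp n * qp (-n) = 1 := by rw [qp_mul_qp, add_neg_cancel, qp_zero]
theorem qp_neg_mul (n : ℤ) : qp (-n) * qp n = 1 := by rw [qp_mul_qp, neg_add_cancel, qp_zero]

namespace QBN

/-- The series `v(μ)`. -/
def v : QBN⟦X⟧ := negInvAdd (genSer u) (genSer m)
/-- The series `w(μ)`. -/
def w : QBN⟦X⟧ := negInvAdd (genSer m) (genSer u)

theorem map_wt_v (n : ℤ) : PowerSeries.map (wt n : QBN →+* QBN) v = qp (-n) • v := by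
  rw [v, map_negInvAdd, map_wt_u, map_wt_m, negInvAdd_smul (qp_mul_neg n)]

theorem map_wt_w (n : ℤ) : PowerSeries.map (wt n : QBN →+* QBN) w = qp n • w := by
  rw [w, map_negInvAdd, map_wt_u, map_wt_m, negInvAdd_smul (qp_neg_mul n)]

theorem map_wt_flow (n : ℤ) (a : QBN) :
    PowerSeries.map (wt n : QBN →+* QBN) (flow a) = flow (wt n a) := by
  have : (mapLin (wt n)).comp flow = flow.comp (wt n).toLinearMap := by
    refine skew_ext (g := PowerSeries.C.comp (wt n : QBN →+* QBN))
      (f := PowerSeries.C.comp (wt n : QBN →+* QBN)) ?_ ?_ ?_ ?_ ?_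
    · intro a b
      have := flow_skew.comp_left (PowerSeries.map (wt n : QBN →+* QBN)) a b
      simp only [RingHom.coe_comp, Function.comp_apply, PowerSeries.map_C] at this
      exact this
    · intro a b
      exact flow_skew.comp_right (wt n : QBN →+* QBN) a b
    · refine (map_serMap (PowerSeries.map (wt n : QBN →+* QBN)) (flow : QBN →+ QBN⟦X⟧) _).symm.trans
        (.trans ?_ (serMap_map (flow : QBN →+ QBN⟦X⟧) (wt n : QBN →+* QBN) _))
      rw [flow_u, map_flowU, map_wt_u, map_wt_m, flowU_smul (qp_mul_neg n), ← flow_u]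
      ext; simp
    · refine (map_serMap (PowerSeries.map (wt n : QBN →+* QBN)) (flow : QBN →+ QBN⟦X⟧) _).symm.trans
        (.trans ?_ (serMap_map (flow : QBN →+ QBN⟦X⟧) (wt n : QBN →+* QBN) _))
      rw [flow_m, map_flowM, map_wt_u, map_wt_m, flowM_smul (qp_mul_neg n), ← flow_m]
      ext; simp
    · intro δ
      change PowerSeries.map (wt n : QBN →+* QBN) (flow (S δ)) = flow (wt n (S δ))
      rw [wt_S, map_smul]
      rcases Int.units_eq_one_or δ with rfl | rfl
      · rw [flow_Sp, Units.val_one, mul_one]; exact map_wt_w n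
      · rw [flow_Sm, Units.val_neg, Units.val_one, mul_neg, mul_one]; exact map_wt_v n
  exact LinearMap.congr_fun this a

/-- The outer part of `f_ε`, on series. -/
def shiftSer (ε : ℤˣ) : QBN⟦X⟧ →+ QBN⟦X⟧ := serMap (shift ε : QBN →+ QBN)

/-- The outer part of `f_ε`, on bivariate series. -/
def shiftSer₂ (ε : ℤˣ) : QBN⟦X⟧⟦X⟧ →+ QBN⟦X⟧⟦X⟧ := serMap (shiftSer ε)

/-- The grading automorphism, on bivariate series. -/
def wt₂ (n : ℤ) : QBN⟦X⟧⟦X⟧ →+* QBN⟦X⟧⟦X⟧ :=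
  PowerSeries.map (PowerSeries.map (wt n : QBN →+* QBN))

variable (ε : ℤˣ)

theorem shiftSer_mul (s t : QBN⟦X⟧) : shiftSer ε (s * t) = shiftSer ε s * t +
    PowerSeries.map (wt ε : QBN →+* QBN) s * shiftSer ε t := by
  have id : ∀ s : QBN⟦X⟧, PowerSeries.map (RingHom.id QBN) s = s := fun s => by ext; simp
  exact ((isShift ε).skew.serMap s t).trans (by rw [id]; rfl)

theorem shiftSer_X_mul (s : QBN⟦X⟧) : shiftSer ε (X * s) =
    X * shiftSer ε s := serMap_X_mul _ _

theorem shiftSer_u : shiftSer ε (genSer u) = shiftU ε (genSer u) := (isShift ε).on_u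
theorem shiftSer_m : shiftSer ε (genSer m) = 0 := (isShift ε).on_m

theorem shiftSer_v : shiftSer ε v = qp (-ε) • (v * shiftU ε (genSer u) * v) := by
  have e := congrArg (shiftSer ε) (mul_negInvAdd (genSer u) (genSer m))
  have h := qRelN.point
  rw [← v] at e h
  rw [map_neg, map_add, shiftSer_X_mul, shiftSer_X_mul, shiftSer_mul, shiftSer_mul, shiftSer_m,
    shiftSer_u, map_wt_v, mul_zero, mul_zero, add_zero, neg_zero] at e
  have g := h.mul_G'
  have hv := h.v_eq'
  have e2 := congrArg (fun b => b * resolv (genSer u) (genSer m)) e.symm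
  simp only [center_smul_def, coe_xC, zero_mul] at g hv e2
  have c : X * (shiftSer ε v * genSer u * genSer m) =
      shiftSer ε v * (X * (genSer u * genSer m)) := by
    rw [mul_assoc]; exact (mul_smul_comm (xC QBN) _ _).symm
  have c2 : X * (qp (-ε) • v * shiftU ε (genSer u) * genSer m) *
      resolv (genSer u) (genSer m) = -(qp (-ε) • (v * shiftU ε (genSer u) * v)) := by
    nth_rewrite 3 [hv]
    rw [mul_neg, smul_neg, neg_neg, smul_mul_assoc, smul_mul_assoc, mul_smul_comm, smul_mul_assoc]
    refine congrArg _ ?_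
    rw [mul_assoc, mul_assoc _ (genSer m)]
    exact (mul_smul_comm (xC QBN) _ _).symm
  rw [add_mul (shiftSer ε v * genSer u), mul_add, c, ← add_assoc, add_mul, c2] at e2
  have c3 : (shiftSer ε v + shiftSer ε v * (X * (genSer u * genSer m))) *
      resolv (genSer u) (genSer m) = shiftSer ε v := by
    rw [← mul_one_add, mul_assoc, g, mul_one]
  rw [c3] at e2
  exact eq_of_sub_eq_zero (by rw [sub_eq_add_neg]; exact e2)

theorem shiftSer_w : shiftSer ε w = -(X * (resolv (genSer u) (genSer m) *
    shiftU ε (genSer u) * resolv (genSer m) (genSer u))) := by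
  have e := congrArg (shiftSer ε) (mul_negInvAdd (genSer m) (genSer u))
  have h := qRelN.point
  rw [← w] at e h
  rw [map_neg, map_add, shiftSer_X_mul, shiftSer_X_mul, shiftSer_mul, shiftSer_mul, shiftSer_m,
    shiftSer_u, map_mul, map_wt_w, map_wt_m, mul_zero, add_zero, smul_mul_smul_comm, qp_mul_neg,
    one_smul] at e
  have g := h.mul_G
  have hG := h.G'_eq'
  have e2 := congrArg (fun b => b * resolv (genSer m) (genSer u)) e.symm
  simp only [center_smul_def, coe_xC] at g
  have c : X * (shiftSer ε w * genSer m * genSer u) =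
      shiftSer ε w * (X * (genSer m * genSer u)) := by
    rw [mul_assoc]; exact (mul_smul_comm (xC QBN) _ _).symm
  have c3 : (shiftSer ε w + shiftSer ε w * (X * (genSer m * genSer u))) *
      resolv (genSer m) (genSer u) = shiftSer ε w := by
    rw [← mul_one_add, mul_assoc, g, mul_one]
  rw [mul_add, c, ← add_assoc, add_mul, c3] at e2
  rw [eq_sub_of_add_eq e2, ← hG]
  noncomm_ring

theorem shiftSer_v_one : shiftSer 1 v =
    -(1 - qp (-1)) • (X * (v * (genSer u * genSer u) * v)) := by
  have c : ∀ s t : QBN⟦X⟧, s * (X * t) = X * (s * t) :=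
    fun s t => mul_smul_comm (xC QBN) s t
  rw [shiftSer_v, shiftU, if_pos rfl, mul_smul_comm, smul_mul_assoc, c, smul_smul, pow_two]
  have e : qp (-((1 : ℤˣ) : ℤ)) * -(qp 1 - 1) = -(1 - qp (-1)) := by
    rw [mul_neg, mul_sub, qp_mul_qp]; norm_num [qp_zero]
  rw [e, mul_assoc X]

theorem shiftSer_w_one : shiftSer 1 w = (qp 1 - 1) • (w * w) := by
  have h := qRelN.point
  rw [← w] at h
  have c : ∀ s t : QBN⟦X⟧, s * (X * t) = X * (s * t) :=
    fun s t => mul_smul_comm (xC QBN) s t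
  have e : w * w = X * (resolv (genSer u) (genSer m) *
      (X * (genSer u * genSer u)) * resolv (genSer m) (genSer u)) := by
    have h1 := h.w_eq
    have h2 := h.w_eq'
    simp only [center_smul_def, coe_xC] at h1 h2
    nth_rewrite 1 [h2]
    nth_rewrite 1 [h1]
    simp only [neg_mul_neg, mul_assoc, c]
  rw [shiftSer_w, shiftU, if_pos rfl, mul_smul_comm, smul_mul_assoc, mul_smul_comm, neg_smul,
    neg_neg, e, pow_two]

theorem shiftSer_v_neg : shiftSer (-1) v = (qp 1 - 1) • (v * v) := by
  rw [shiftSer_v, shiftU, if_neg (by decide), mul_smul_comm, mul_one, smul_mul_assoc, smul_smul]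
  congr 1
  rw [mul_sub, mul_one, Units.val_neg, Units.val_one, neg_neg, qp_mul_neg]

theorem shiftSer_w_neg : shiftSer (-1) w = -(1 - qp (-1)) •
    (X * (resolv (genSer u) (genSer m) * resolv (genSer m) (genSer u))) := by
  rw [shiftSer_w, shiftU, if_neg (by decide), mul_smul_comm, mul_one, smul_mul_assoc,
    mul_smul_comm, neg_smul]

end QBN

/-! ### Equivariance of the flows -/

namespace QBN
variable (ε : ℤˣ)

theorem shiftSer₂_mul (s t : QBN⟦X⟧⟦X⟧) : shiftSer₂ ε (s * t) = shiftSer₂ ε s * t +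
    wt₂ ε s * shiftSer₂ ε t := by
  have h : IsSkew (PowerSeries.map (wt ε : QBN →+* QBN)) (RingHom.id _) (shiftSer ε) :=
    fun s t => shiftSer_mul ε s t
  have id : ∀ s : QBN⟦X⟧⟦X⟧, PowerSeries.map (RingHom.id _) s = s := fun s => by ext; simp
  exact (h.serMap s t).trans (by rw [id]; rfl)

theorem shiftSer₂_C (s : QBN⟦X⟧) : shiftSer₂ ε (C s) = C (shiftSer ε s) :=
  serMap_C _ _

theorem shiftSer₂_map_C (s : QBN⟦X⟧) : shiftSer₂ ε (PowerSeries.map C s) =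
    PowerSeries.map C (shiftSer ε s) := by
  ext i; simp [shiftSer₂, shiftSer]

theorem shiftSer₂_x (s : QBN⟦X⟧⟦X⟧) : shiftSer₂ ε (xC QBN⟦X⟧ • s) = xC QBN⟦X⟧ • shiftSer₂ ε s :=
  serMap_X_mul _ _

theorem shiftSer₂_z (s : QBN⟦X⟧⟦X⟧) : shiftSer₂ ε (liftC (xC QBN) • s) =
    liftC (xC QBN) • shiftSer₂ ε s :=
  serMap_C_mul (shiftSer_X_mul ε) s

theorem shiftSer₂_b (s : QBN⟦X⟧⟦X⟧) : shiftSer₂ ε ((xC QBN⟦X⟧ - liftC (xC QBN)) • s) =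
    (xC QBN⟦X⟧ - liftC (xC QBN)) • shiftSer₂ ε s := by
  rw [sub_smul, sub_smul, map_sub, shiftSer₂_x, shiftSer₂_z]

theorem wt₂_C (n : ℤ) (s : QBN⟦X⟧) : wt₂ n (C s) =
    C (PowerSeries.map (wt n : QBN →+* QBN) s) := PowerSeries.map_C _ _

theorem wt₂_u (n : ℤ) : wt₂ n (C (genSer u)) = qp n • C (genSer u) := by
  rw [wt₂_C, map_wt_u, C_smul]
theorem wt₂_m (n : ℤ) : wt₂ n (C (genSer m)) = qp (-n) • C (genSer m) := by
  rw [wt₂_C, map_wt_m, C_smul]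
theorem wt₂_v (n : ℤ) : wt₂ n (C v) = qp (-n) • C v := by
  rw [wt₂_C, map_wt_v, C_smul]

theorem wt₂_letter_u (n : ℤ) : wt₂ n (letter (genSer u)) = qp n • letter (genSer u) := by
  rw [wt₂, map_letter, map_wt_u, letter_kq_smul]
theorem wt₂_letter_m (n : ℤ) : wt₂ n (letter (genSer m)) = qp (-n) • letter (genSer m) := by
  rw [wt₂, map_letter, map_wt_m, letter_kq_smul]

theorem cancel_b {s t : QBN⟦X⟧⟦X⟧} (h : (xC QBN⟦X⟧ - liftC (xC QBN)) • s =
    (xC QBN⟦X⟧ - liftC (xC QBN)) • t) : s = t :=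
  sub_eq_zero.1 (QRel.reg_X_sub (A := QBN) _ (by rw [smul_sub, h, sub_self]))

theorem shiftSer₂_letter (s : QBN⟦X⟧) : (xC QBN⟦X⟧ - liftC (xC QBN)) • shiftSer₂ ε (letter s) =
    xC QBN⟦X⟧ • PowerSeries.map C (shiftSer ε s)
      - liftC (xC QBN) • C (shiftSer ε s) := by
  have e := congrArg (shiftSer₂ ε) (QRel.X_smul_letter s)
  rw [map_add, shiftSer₂_b, shiftSer₂_x, shiftSer₂_z, shiftSer₂_C, shiftSer₂_map_C] at e
  rw [e, add_sub_cancel_right]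

theorem shiftSer₂_letter_m : shiftSer₂ ε (letter (genSer m)) = 0 := by
  refine cancel_b ?_
  rw [shiftSer₂_letter, shiftSer_m, map_zero, map_zero, smul_zero, smul_zero, smul_zero, sub_zero]

theorem C_X_smul (s : QBN⟦X⟧) : C (X * s) =
    liftC (xC QBN) • C s := map_mul _ _ _

theorem map_C_X_smul (s : QBN⟦X⟧) : PowerSeries.map C (X * s) =
    xC QBN⟦X⟧ • PowerSeries.map C s := by
  rw [(PowerSeries.map (C (R := QBN))).map_mul, PowerSeries.map_X]; rfl

theorem qSub (b : QBN⟦X⟧⟦X⟧) : (qp 1 - 1) • b = (qC QBN⟦X⟧⟦X⟧ - 1) • b := by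
  rw [sub_smul, sub_smul, qC_smul, one_smul, one_smul]
theorem subQ' (b : QBN⟦X⟧⟦X⟧) : (1 - qp (-1)) • b = (1 - qC' QBN⟦X⟧⟦X⟧) • b := by
  rw [sub_smul, sub_smul, qC'_smul, one_smul, one_smul]

theorem shiftSer₂_letter_u_one : shiftSer₂ 1 (letter (genSer u)) =
    -((qC QBN⟦X⟧⟦X⟧ - 1) • ((xC QBN⟦X⟧ - liftC (xC QBN)) • (letter (genSer u) * letter (genSer u))
      + liftC (xC QBN) • (letter (genSer u) * C (genSer u) +
        C (genSer u) * letter (genSer u)))) := by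
  refine cancel_b ?_
  have e := QRel.X_smul_letter (genSer u)
  have e2 : xC QBN⟦X⟧ • xC QBN⟦X⟧ •
      (PowerSeries.map C (genSer u) * PowerSeries.map C (genSer u)) =
      (xC QBN⟦X⟧ • PowerSeries.map C (genSer u)) *
      (xC QBN⟦X⟧ • PowerSeries.map C (genSer u)) := by
    rw [smul_mul_smul_comm, smul_smul]
  rw [e] at e2
  rw [shiftSer₂_letter, shiftSer_u, shiftU, if_pos rfl, map_C_smul, C_smul, map_C_X_smul, C_X_smul,
    pow_two, map_mul, (C (R := QBN⟦X⟧)).map_mul, neg_smul, neg_smul, qSub, qSub]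
  have e3 := congrArg (fun b => (qC QBN⟦X⟧⟦X⟧ - 1) • b) e2
  linear_combination (norm := (
      simp only [mul_add, add_mul, smul_add, smul_mul_assoc,
        mul_smul_comm, smul_neg]
      module)) -e3

theorem shiftSer₂_letter_u_neg : shiftSer₂ (-1) (letter (genSer u)) = (1 - qC' QBN⟦X⟧⟦X⟧) • 1 := by
  refine cancel_b ?_
  rw [shiftSer₂_letter, shiftSer_u, shiftU, if_neg (by decide), map_C_smul, C_smul, map_one,
    map_one, subQ', ← sub_smul]

/-- The commutator of the outer part of `f_ε` with the flow. -/
def shiftFlow : QBN →ₗ[Kq] QBN⟦X⟧ :=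
  (serLin (shift ε)).comp flow - flow.comp (shift ε)

/-- The inner skew derivation given by the derivative of the half screening charge. That it equals
`shiftFlow` says that the flow commutes with `f_ε`. -/
def chargeFlow : QBN →ₗ[Kq] QBN⟦X⟧ where
  toFun a := flow (S ε) * C a - C (wt ε a) * flow (S ε)
  map_add' a b := by simp only [map_add, mul_add, add_mul]; abel
  map_smul' r a := by
    have e : wt ε (r • a) = r • wt ε a := map_smul _ _ _
    rw [RingHom.id_apply, e, C_smul, C_smul, smul_sub, smul_mul_assoc, mul_smul_comm]

theorem shiftFlow_apply (a : QBN) : shiftFlow ε a = shiftSer ε (flow a) - flow (shift ε a) := rfl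
theorem chargeFlow_apply (a : QBN) : chargeFlow ε a =
    flow (S ε) * C a - C (wt ε a) * flow (S ε) := rfl

theorem flow_mul (a b : QBN) : flow (a * b) = flow a * C b + C a * flow b :=
  flow_skew a b

theorem shiftFlow_skew : IsSkew (PowerSeries.C.comp (wt ε : QBN →+* QBN)) C
    (shiftFlow ε : QBN →+ QBN⟦X⟧) := by
  intro a b
  change shiftFlow ε (a * b) = shiftFlow ε a * _ + C (wt ε a) * shiftFlow ε b
  have hC : ∀ a : QBN, shiftSer ε (C a) = C (shift ε a) :=
    fun a => serMap_C _ _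
  simp only [shiftFlow_apply, shift_mul, flow_mul, map_add, shiftSer_mul, hC, map_wt_flow,
    PowerSeries.map_C]
  change _ + (_ + C (wt ε a) * _) - _ = _
  noncomm_ring

theorem chargeFlow_skew : IsSkew (PowerSeries.C.comp (wt ε : QBN →+* QBN)) C
    (chargeFlow ε : QBN →+ QBN⟦X⟧) := by
  intro a b
  change chargeFlow ε (a * b) = chargeFlow ε a * _ + C (wt ε a) * chargeFlow ε b
  simp only [chargeFlow_apply, map_mul]
  noncomm_ring

theorem shiftFlow_S (δ : ℤˣ) : shiftFlow ε (S δ) = shiftSer ε (flow (S δ)) := by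
  rw [shiftFlow_apply, (isShift ε).on_S, map_zero, sub_zero]

theorem chargeFlow_S (δ : ℤˣ) : chargeFlow ε (S δ) =
    flow (S ε) * C (S δ) - qp (ε * δ) • (C (S δ) * flow (S ε)) := by
  rw [chargeFlow_apply, wt_S, C_smul, smul_mul_assoc]

theorem shiftFlow_S_eq (δ : ℤˣ) : shiftFlow ε (S δ) = chargeFlow ε (S δ) := by
  rw [shiftFlow_S, chargeFlow_S]
  have h := qRelN.point
  have s1 := qRelN.uSp
  have s2 := qRelN.uSm
  have s3 := qRelN.mSp'
  have s4 := qRelN.mSm'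
  have hq : qC QBN⟦X⟧ * qC' QBN⟦X⟧ = 1 := qC_mul_qC' _
  have sub : ∀ b : QBN⟦X⟧, (qp 1 - 1) • b = (qC QBN⟦X⟧ - 1) • b := fun b => by
    rw [sub_smul, sub_smul, qC_smul, one_smul, one_smul]
  have sub' : ∀ b : QBN⟦X⟧, (1 - qp (-1)) • b = (1 - qC' QBN⟦X⟧) • b := fun b => by
    rw [sub_smul, sub_smul, qC'_smul, one_smul, one_smul]
  have Xs : ∀ b : QBN⟦X⟧, X * b = xC QBN • b := fun b => rfl
  rcases Int.units_eq_one_or ε with rfl | rfl <;> rcases Int.units_eq_one_or δ with rfl | rfl <;>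
    simp only [Units.val_one, Units.val_neg, mul_one, mul_neg, neg_neg]
  · rw [flow_Sp]
    have e := h.w_mul_Sp s1 s3
    change shiftSer 1 w = _
    rw [shiftSer_w_one, e, ← qC_smul, sub, add_sub_cancel_left]
    rfl
  · rw [flow_Sp, flow_Sm]
    have e := h.w_mul_Sm s2 s4
    have e2 := h.v_c_c_v hq
    change shiftSer 1 v = _
    rw [shiftSer_v_one, neg_smul, sub', Xs]
    rw [← qC'_smul]
    have e3 := congrArg (fun b => qC' QBN⟦X⟧ • b) e
    simp only [smul_smul, smul_sub] at e3
    change -((1 - qC' QBN⟦X⟧) • xC _ • (negInvAdd _ _ * _ * negInvAdd _ _)) = _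
    rw [e2]
    linear_combination (norm := (match_scalars <;> grind)) -e3
  · rw [flow_Sp, flow_Sm]
    have e := h.v_mul_Sp s1 s3
    have e2 := h.G_comm
    change shiftSer (-1) w = _
    rw [shiftSer_w_neg, neg_smul, sub', Xs]
    rw [← qC'_smul]
    have e3 := congrArg (fun b => qC' QBN⟦X⟧ • b) e
    simp only [smul_smul, smul_sub] at e3
    rw [← e2]
    linear_combination (norm := (match_scalars <;> grind)) -e3
  · rw [flow_Sm]
    have e := h.v_mul_Sm s2 s4
    change shiftSer (-1) v = _
    rw [shiftSer_v_neg, e, ← qC_smul, sub, add_sub_cancel_left]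
    rfl

theorem serMap_shiftFlow (s : QBN⟦X⟧) : serMap (shiftFlow ε : QBN →+ QBN⟦X⟧) s =
    shiftSer₂ ε (serMap (flow : QBN →+ QBN⟦X⟧) s)
      - serMap (flow : QBN →+ QBN⟦X⟧) (shiftSer ε s) := by
  ext i : 1
  rw [coeff_serMap, map_sub, shiftSer₂, coeff_serMap, coeff_serMap, coeff_serMap, shiftSer,
    coeff_serMap]
  rfl

theorem serMap_chargeFlow (s : QBN⟦X⟧) : serMap (chargeFlow ε : QBN →+ QBN⟦X⟧) s =
    C (flow (S ε)) * PowerSeries.map C s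
      - PowerSeries.map C (PowerSeries.map (wt ε : QBN →+* QBN) s) *
        C (flow (S ε)) := by
  ext i : 1
  rw [coeff_serMap, map_sub, PowerSeries.coeff_C_mul, PowerSeries.coeff_mul_C,
    PowerSeries.coeff_map, PowerSeries.coeff_map, PowerSeries.coeff_map]
  rfl

theorem serMap_flow_shiftU : xC QBN⟦X⟧ • serMap (flow : QBN →+ QBN⟦X⟧) (shiftU 1 (genSer u)) =
    -((qC QBN⟦X⟧⟦X⟧ - 1) • ((xC QBN⟦X⟧ • flowU (genSer u) (genSer m)) *
        (xC QBN⟦X⟧ • PowerSeries.map C (genSer u))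
      + (xC QBN⟦X⟧ • PowerSeries.map C (genSer u)) *
        (xC QBN⟦X⟧ • flowU (genSer u) (genSer m)))) := by
  have e : ∀ (r : Kq) (s : QBN⟦X⟧), serMap (flow : QBN →+ QBN⟦X⟧) (r • s) =
      r • serMap (flow : QBN →+ QBN⟦X⟧) s := fun r s => (serLin flow).map_smul r s
  have e2 : serMap (flow : QBN →+ QBN⟦X⟧) (genSer u * genSer u) = _ :=
    flow_skew.serMap (genSer u) (genSer u)
  rw [shiftU, if_pos rfl, e, serMap_X_mul, pow_two, e2, flow_u, neg_smul, qSub]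
  change xC QBN⟦X⟧ • -((qC QBN⟦X⟧⟦X⟧ - 1) • xC QBN⟦X⟧ • (flowU (genSer u) (genSer m) *
    PowerSeries.map C (genSer u) + PowerSeries.map C (genSer u) *
      flowU (genSer u) (genSer m))) = _
  simp only [smul_mul_assoc, mul_smul_comm, smul_add, smul_smul]
  module

theorem serMap_flow_shiftU_neg : serMap (flow : QBN →+ QBN⟦X⟧) (shiftU (-1) (genSer u)) = 0 := by
  have e : ∀ (r : Kq) (s : QBN⟦X⟧), serMap (flow : QBN →+ QBN⟦X⟧) (r • s) =
      r • serMap (flow : QBN →+ QBN⟦X⟧) s := fun r s => (serLin flow).map_smul r s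
  rw [shiftU, if_neg (by decide), e, flow_skew.serMap.map_one, smul_zero]

theorem cancel_x {s t : QBN⟦X⟧⟦X⟧} (h : xC QBN⟦X⟧ • s = xC QBN⟦X⟧ • t) : s = t :=
  Reg.cancel reg_X h

theorem qp_one_smul (b : QBN⟦X⟧⟦X⟧) : qp 1 • b = qC QBN⟦X⟧⟦X⟧ • b := (qC_smul b).symm
theorem qp_neg_one_smul (b : QBN⟦X⟧⟦X⟧) : qp (-1) • b = qC' QBN⟦X⟧⟦X⟧ • b := (qC'_smul b).symm

theorem X_smul_flowU' : xC QBN⟦X⟧ • flowU (genSer u) (genSer m) = (xC QBN⟦X⟧ - liftC (xC QBN)) •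
    (letter (genSer u) * C v * letter (genSer u)) + liftC (xC QBN) •
    (C (genSer u) * C v * C (genSer u))
      - liftC (xC QBN) • (letter (genSer u) - C (genSer u)) :=
  QRel.X_smul_flowU _ _

theorem X_smul_flowM' : xC QBN⟦X⟧ • flowM (genSer u) (genSer m) = -((xC QBN⟦X⟧ - liftC (xC QBN)) •
    (letter (genSer m) * C w * letter (genSer m)) + liftC (xC QBN) •
    (C (genSer m) * C w * C (genSer m))
      - liftC (xC QBN) • (letter (genSer m) - C (genSer m))) :=
  QRel.X_smul_flowM _ _

theorem shiftFlow_m_one : serMap (shiftFlow 1 : QBN →+ QBN⟦X⟧) (genSer m) =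
    serMap (chargeFlow 1 : QBN →+ QBN⟦X⟧) (genSer m) := by
  refine cancel_x ?_
  have hq := qC_mul_qC' QBN⟦X⟧⟦X⟧
  have h := qRelN.point₂.equiv_plus_m hq (xC QBN⟦X⟧ - liftC (xC QBN)) qRelN.isMLetter
  have e := QRel.X_smul_letter (genSer m)
  rw [serMap_shiftFlow, serMap_chargeFlow, shiftSer_m, map_zero, sub_zero, flow_m, ← shiftSer₂_x,
    X_smul_flowM', flow_Sp, map_wt_m, map_C_smul, ← w]
  rw [← w, ← e] at h
  simp only [map_neg, map_sub, map_add, shiftSer₂_b, shiftSer₂_z, shiftSer₂_mul, shiftSer₂_C,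
    shiftSer_m, map_zero, shiftSer₂_letter_m, shiftSer_w_one, zero_mul, mul_zero, add_zero,
    zero_add, wt₂_letter_m, wt₂_m, map_mul, C_smul, smul_zero, sub_zero, qSub, Units.val_one,
    qp_neg_one_smul, smul_mul_assoc, mul_smul_comm] at h ⊢
  have h' := congrArg (fun b => qC' QBN⟦X⟧⟦X⟧ • b) h
  simp only [mul_assoc] at h' ⊢
  linear_combination (norm := (match_scalars <;> grind)) h'

theorem shiftFlow_m_neg : serMap (shiftFlow (-1) : QBN →+ QBN⟦X⟧) (genSer m) =
    serMap (chargeFlow (-1) : QBN →+ QBN⟦X⟧) (genSer m) := by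
  refine cancel_x ?_
  have hq := qC_mul_qC' QBN⟦X⟧⟦X⟧
  have h := qRelN.point₂.equiv_minus_m hq (xC QBN⟦X⟧ - liftC (xC QBN)) qRelN.isMLetter
  have e := QRel.X_smul_letter (genSer m)
  rw [serMap_shiftFlow, serMap_chargeFlow, shiftSer_m, map_zero, sub_zero, flow_m, ← shiftSer₂_x,
    X_smul_flowM', flow_Sm, map_wt_m, map_C_smul, ← v]
  rw [← v, ← e] at h
  simp only [map_neg, map_sub, map_add, shiftSer₂_b, shiftSer₂_z, shiftSer₂_mul, shiftSer₂_C,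
    shiftSer_m, map_zero, shiftSer₂_letter_m, shiftSer_w_neg, zero_mul, mul_zero, add_zero,
    zero_add, wt₂_letter_m, wt₂_m, C_smul, smul_zero, sub_zero, Units.val_neg, neg_neg,
    Units.val_one, C_X_smul, neg_smul, subQ',
    qp_one_smul, smul_mul_assoc, mul_smul_comm] at h ⊢
  simp only [map_mul]
  linear_combination (norm := (
      simp only [sub_mul, smul_add, smul_sub, smul_mul_assoc,
        mul_smul_comm, mul_assoc, neg_mul, mul_neg, smul_neg, one_mul]
      match_scalars <;> grind)) h

set_option maxHeartbeats 1000000 in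
theorem shiftFlow_u_one : serMap (shiftFlow 1 : QBN →+ QBN⟦X⟧) (genSer u) =
    serMap (chargeFlow 1 : QBN →+ QBN⟦X⟧) (genSer u) := by
  refine cancel_x ?_
  have hq := qC_mul_qC' QBN⟦X⟧⟦X⟧
  have h := qRelN.point₂.star_identity hq (xC QBN⟦X⟧ - liftC (xC QBN)) qRelN.isULetter
  have e := QRel.X_smul_letter (genSer u)
  have r1 : ∀ t, xC QBN⟦X⟧ • (t * PowerSeries.map C (genSer u)) =
      t * (xC QBN⟦X⟧ • PowerSeries.map C (genSer u)) := fun t =>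
    (mul_smul_comm _ _ _).symm
  have r2 : ∀ (r : Kq) t, xC QBN⟦X⟧ • (r • PowerSeries.map C (genSer u) * t) =
      r • ((xC QBN⟦X⟧ • PowerSeries.map C (genSer u)) * t) := fun r t => by
    rw [smul_mul_assoc, smul_comm _ r, smul_mul_assoc]
  rw [serMap_shiftFlow, serMap_chargeFlow, smul_sub, shiftSer_u, flow_u, ← shiftSer₂_x,
    serMap_flow_shiftU, X_smul_flowU', flow_Sp, map_wt_u, map_C_smul, ← w,
    smul_sub _ (C w * _), r1, r2, e]
  rw [← w, ← v] at h
  simp only [map_neg, map_sub, map_add, shiftSer₂_b, shiftSer₂_z, shiftSer₂_mul, shiftSer₂_C,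
    shiftSer_u, shiftU, if_true, shiftSer₂_letter_u_one, shiftSer_v_one, wt₂_letter_u, wt₂_u, C_smul, Units.val_one, C_X_smul, neg_smul, subQ', qSub, pow_two,
    qp_one_smul, smul_mul_assoc]
  simp only [map_mul, wt₂_letter_u, wt₂_u, wt₂_v, qp_one_smul, qp_neg_one_smul,
    smul_mul_assoc, mul_smul_comm]
  clear e r1 r2
  generalize qC QBN⟦X⟧⟦X⟧ = Q at *
  generalize qC' QBN⟦X⟧⟦X⟧ = Q' at *
  generalize liftC (xC QBN) = z at *
  generalize xC QBN⟦X⟧ - z = B at *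
  generalize letter (genSer u) = s at *
  generalize C (genSer u) = c at *
  generalize C v = v at *
  generalize C w = w at *
  linear_combination (norm := (
      simp only [mul_add, add_mul, mul_sub, sub_mul, smul_add, smul_sub, smul_mul_assoc,
        mul_smul_comm, mul_assoc, neg_mul, mul_neg, smul_neg]
      match_scalars <;> grind)) -h

theorem shiftFlow_u_neg : serMap (shiftFlow (-1) : QBN →+ QBN⟦X⟧) (genSer u) =
    serMap (chargeFlow (-1) : QBN →+ QBN⟦X⟧) (genSer u) := by
  refine cancel_x ?_
  have hq := qC_mul_qC' QBN⟦X⟧⟦X⟧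
  have h := qRelN.point₂.equiv_minus_u hq (xC QBN⟦X⟧ - liftC (xC QBN)) qRelN.isULetter
  have e := QRel.X_smul_letter (genSer u)
  have r1 : ∀ t, xC QBN⟦X⟧ • (t * PowerSeries.map C (genSer u)) =
      t * (xC QBN⟦X⟧ • PowerSeries.map C (genSer u)) := fun t =>
    (mul_smul_comm _ _ _).symm
  have r2 : ∀ (r : Kq) t, xC QBN⟦X⟧ • (r • PowerSeries.map C (genSer u) * t) =
      r • ((xC QBN⟦X⟧ • PowerSeries.map C (genSer u)) * t) := fun r t => by
    rw [smul_mul_assoc, smul_comm _ r, smul_mul_assoc]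
  rw [serMap_shiftFlow, serMap_chargeFlow, smul_sub, shiftSer_u, flow_u, ← shiftSer₂_x,
    serMap_flow_shiftU_neg, X_smul_flowU', flow_Sm, map_wt_u, map_C_smul, ← v,
    smul_sub _ (C v * _), r1, r2, e]
  rw [← v] at h
  have h' := congrArg (fun b => qC' QBN⟦X⟧⟦X⟧ • b) h
  have ne : ¬ (-1 : ℤˣ) = 1 := by decide
  simp only [map_sub, map_add, shiftSer₂_b, shiftSer₂_z, shiftSer₂_mul, shiftSer₂_C,
    shiftSer_u, shiftU, if_neg ne, shiftSer₂_letter_u_neg, shiftSer_v_neg, wt₂_letter_u, wt₂_u, wt₂_v,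
    map_mul, C_smul, Units.val_one, Units.val_neg, neg_smul, subQ', qSub, neg_neg, map_one,
    qp_one_smul, qp_neg_one_smul, smul_mul_assoc, mul_smul_comm]
  linear_combination (norm := (
      simp only [mul_add, add_mul, smul_add, smul_sub, smul_mul_assoc,
        mul_smul_comm, mul_assoc, one_mul, mul_one, smul_zero]
      match_scalars <;> grind)) h'

theorem shiftFlow_eq : shiftFlow ε = chargeFlow ε := by
  refine skew_ext (shiftFlow_skew ε) (chargeFlow_skew ε) ?_ ?_ (shiftFlow_S_eq ε)
  · rcases Int.units_eq_one_or ε with rfl | rfl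
    exacts [shiftFlow_u_one, shiftFlow_u_neg]
  · rcases Int.units_eq_one_or ε with rfl | rfl
    exacts [shiftFlow_m_one, shiftFlow_m_neg]

theorem serMap_opF_flow (a : QBN) : serMap (opF ε : QBN →+ QBN) (flow a) = flow (opF ε a) := by
  have e := LinearMap.congr_fun (shiftFlow_eq ε) a
  rw [shiftFlow_apply, chargeFlow_apply] at e
  have e2 : serMap (opF ε : QBN →+ QBN) (flow a) = C (S ε) * flow a +
      (shiftSer ε (flow a) - PowerSeries.map (wt ε : QBN →+* QBN) (flow a) *
        C (S ε)) := applySer_opF ε (flow a)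
  rw [e2, map_wt_flow, opF_apply, map_add, map_sub, flow_mul, flow_mul,
    eq_add_of_sub_eq e]
  noncomm_ring

theorem act_flow (h : Uq) (n : ℕ+) (a : QBN) :
    act h (flowOf flow n a) = flowOf flow n (act h a) := by
  have key : ∀ (L : Module.End Kq QBN), (∀ a, serMap (L : QBN →+ QBN) (flow a) = flow (L a)) →
      ∀ a, L (flowOf flow n a) = flowOf flow n (L a) := fun L hL a => by
    rw [flowOf_apply, flowOf_apply, ← hL, coeff_serMap]
    exact map_neg_one_pow_mul (L : QBN →+ QBN) n _
  have hk : ∀ (n : ℤ) (a : QBN), serMap (opK n : QBN →+ QBN) (flow a) = flow (opK n a) :=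
    fun n a => (show _ = PowerSeries.map (wt n : QBN →+* QBN) (flow a) by ext; simp [opK_apply]).trans
      (map_wt_flow n a)
  revert a
  refine quot_induction (Rel := RelUq)
    (p := fun h => ∀ a, act h (flowOf flow n a) = flowOf flow n (act h a)) ?_ ?_ ?_ ?_ h
  · intro r a
    have e : act (algebraMap Kq Uq r) = r • 1 := by
      rw [AlgHom.commutes, Algebra.algebraMap_eq_smul_one]
    refine (LinearMap.congr_fun e _).trans (.trans ?_ (congrArg (flowOf flow n)
      (LinearMap.congr_fun e a)).symm)
    exact ((flowOf flow n).map_smul r a).symm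
  · rintro (ε | ε | ε) a
    · refine (LinearMap.congr_fun (act_k ε) _).trans (.trans ?_ (congrArg (flowOf flow n)
        (LinearMap.congr_fun (act_k ε) a)).symm)
      exact key _ (hk ε) a
    · refine (LinearMap.congr_fun (act_kinv ε) _).trans (.trans ?_ (congrArg (flowOf flow n)
        (LinearMap.congr_fun (act_kinv ε) a)).symm)
      exact key _ (hk (-ε)) a
    · refine (LinearMap.congr_fun (act_f ε) _).trans (.trans ?_ (congrArg (flowOf flow n)
        (LinearMap.congr_fun (act_f ε) a)).symm)
      exact key _ (serMap_opF_flow ε) a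
  · intro x y hx hy a
    have e : act (x * y) = act x * act y := map_mul act x y
    refine (LinearMap.congr_fun e _).trans (.trans ?_ (congrArg (flowOf flow n)
      (LinearMap.congr_fun e a)).symm)
    exact (congrArg (act x) (hy a)).trans (hx _)
  · intro x y hx hy a
    have e : act (x + y) = act x + act y := map_add act x y
    refine (LinearMap.congr_fun e _).trans (.trans ?_ (congrArg (flowOf flow n)
      (LinearMap.congr_fun e a)).symm)
    exact (congrArg₂ (· + ·) (hx a) (hy a)).trans ((flowOf flow n).map_add _ _).symm

end QBN

/-! ### The kernel of the specialization at `q = 1` -/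

/-- The evaluation `q = 1`. -/
def evalOne : Kq →+* ℂ := LaurentPolynomial.eval₂ (RingHom.id ℂ) 1

theorem evalOne_qp (n : ℤ) : evalOne (qp n) = 1 := by
  rw [evalOne, qp, LaurentPolynomial.eval₂_T, one_zpow, Units.val_one]

theorem evalOne_C (c : ℂ) : evalOne (LaurentPolynomial.C c) = c := by
  rw [evalOne, LaurentPolynomial.eval₂_C, RingHom.id_apply]

section Commutative
variable {A : Type} [CommRing A] [Algebra Kq A]

theorem qp_smul_ser {A : Type} [Ring A] [Algebra Kq A] (h : ∀ (n : ℤ) (a : A), qp n • a = a)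
    (n : ℤ) (s : A⟦X⟧) : qp n • s = s := by
  ext i
  rw [PowerSeries.coeff_smul, h]

theorem QRel.of_comm (h : ∀ (n : ℤ) (a : A), qp n • a = a) (U M : A⟦X⟧) : QRel U M where
  uu := by rw [qp_smul_ser (qp_smul_ser h), quadLeft, quadRight, mul_comm]
  mm := by rw [qp_smul_ser (qp_smul_ser h), quadLeft, quadRight, mul_comm]
  um := by rw [qp_smul_ser (qp_smul_ser h), mul_comm]

theorem QRelN.of_comm (h : ∀ (n : ℤ) (a : A), qp n • a = a) (U M : A⟦X⟧) (S : ℤˣ → A) :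
    QRelN U M S where
  toQRel := QRel.of_comm h U M
  uS ε := by rw [qp_smul_ser h, mul_comm]
  mSp := by rw [qp_smul_ser h, sub_smul, qp_smul_ser h, one_smul, mul_comm, sub_self, sub_self]
  mSm := by
    rw [qp_smul_ser h, neg_smul, sub_smul, qp_smul_ser h, one_smul, mul_comm, sub_self, sub_self,
      neg_zero]
  SS ε := by
    have e : (S ε) ^ 2 * S (-ε) * S ε - S ε * S (-ε) * (S ε) ^ 2 = 0 := by ring
    rw [serre, e, smul_zero]
    ring

end Commutative

section Trivial
variable {A : Type} [Ring A] [Algebra Kq A]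

theorem commute_coeff_of_quad {U : A⟦X⟧} (h : quadLeft U = quadRight U) (i j : ℕ) :
    coeff i U * coeff j U = coeff j U * coeff i U := by
  have e : (X - C X : A⟦X⟧⟦X⟧) *
      (inLam U * inMu U - inMu U * inLam U) = 0 := by
    have c : ∀ s t : A⟦X⟧⟦X⟧, s * (X * t) = X * (s * t) :=
      fun s t => mul_smul_comm (xC A⟦X⟧) s t
    have c' : ∀ s t : A⟦X⟧⟦X⟧, s * (C X * t) =
        C X * (s * t) := fun s t => mul_smul_comm (liftC (xC A)) s t
    have := sub_eq_zero.2 h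
    simp only [quadLeft, quadRight, xLam, xMu, mul_sub, sub_mul, mul_assoc, c, c'] at this ⊢
    rw [← this]
    abel
  have e2 := QRel.reg_X_sub (A := A) _ e
  have e3 := congrArg (coeffLM i j) (sub_eq_zero.1 e2)
  simpa [coeffLM, inLam, inMu] using e3

theorem QRel.commute {U M : A⟦X⟧} (h : QRel U M) (hq : ∀ (n : ℤ) (a : A), qp n • a = a) (i j : ℕ) :
    (coeff i U * coeff j U = coeff j U * coeff i U) ∧
    (coeff i M * coeff j M = coeff j M * coeff i M) ∧
    coeff i U * coeff j M =
      coeff j M * coeff i U := by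
  have h1 := h.uu
  have h2 := h.mm
  have h3 := congrArg (coeffLM i j) h.um
  rw [qp_smul_ser (qp_smul_ser hq)] at h1 h2 h3
  exact ⟨commute_coeff_of_quad h1 i j, commute_coeff_of_quad h2 i j,
    by simpa [coeffLM, inLam, inMu] using h3⟩

theorem QRelN.commute {U M : A⟦X⟧} {S : ℤˣ → A} (h : QRelN U M S)
    (hq : ∀ (n : ℤ) (a : A), qp n • a = a) (ε : ℤˣ) (i : ℕ) :
    (coeff i U * S ε = S ε * coeff i U) ∧
    coeff i M * S ε = S ε * coeff i M := by
  have h1 := h.uS ε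
  have h2 := h.mSp
  have h3 := h.mSm
  rw [qp_smul_ser hq] at h1
  rw [qp_smul_ser hq, sub_smul, qp_smul_ser hq, one_smul, sub_self, sub_eq_zero] at h2
  rw [qp_smul_ser hq, neg_smul, sub_smul, qp_smul_ser hq, one_smul, sub_self, neg_zero,
    sub_eq_zero] at h3
  refine ⟨by simpa using congrArg (coeff i) h1, ?_⟩
  rcases Int.units_eq_one_or ε with rfl | rfl
  · simpa using congrArg (coeff i) h2
  · simpa using congrArg (coeff i) h3

variable {B : Type} [Ring B] [Algebra Kq B]

theorem map_map_smul (φ : A →ₐ[Kq] B) (r : Kq) (s : A⟦X⟧⟦X⟧) :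
    PowerSeries.map (PowerSeries.map (φ : A →+* B)) (r • s) =
      r • PowerSeries.map (PowerSeries.map (φ : A →+* B)) s := by
  ext i j; simp

theorem QRel.map {U M : A⟦X⟧} (h : QRel U M) (φ : A →ₐ[Kq] B) :
    QRel (PowerSeries.map (φ : A →+* B) U) (PowerSeries.map (φ : A →+* B) M) where
  uu := by rw [← map_quadLeft, h.uu, map_map_smul, map_quadRight]
  mm := by rw [← map_quadLeft, h.mm, map_map_smul, map_quadRight]
  um := by rw [← map_inLam, ← map_inMu, ← map_mul, h.um, map_map_smul, map_mul]

theorem QRelN.map {U M : A⟦X⟧} {S : ℤˣ → A} (h : QRelN U M S) (φ : A →ₐ[Kq] B) :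
    QRelN (PowerSeries.map (φ : A →+* B) U) (PowerSeries.map (φ : A →+* B) M) (fun ε => φ (S ε)) := by
  have sm : ∀ (r : Kq) (s : A⟦X⟧), PowerSeries.map (φ : A →+* B) (r • s) =
      r • PowerSeries.map (φ : A →+* B) s := fun r s => by ext i; simp
  have hC : ∀ ε, C (φ (S ε)) = PowerSeries.map (φ : A →+* B) (C (S ε)) :=
    fun ε => (PowerSeries.map_C _ _).symm
  have hX : (X : B⟦X⟧) = PowerSeries.map (φ : A →+* B) X :=
    (PowerSeries.map_X _).symm
  have mul := (PowerSeries.map (φ : A →+* B)).map_mul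
  have pow := (PowerSeries.map (φ : A →+* B)).map_pow
  refine { h.toQRel.map φ with uS := fun ε => ?_, mSp := ?_, mSm := ?_, SS := fun ε => ?_ }
  · rw [hC, ← mul, ← mul, h.uS, sm]
  · rw [hC, ← mul, ← mul, ← sm, ← map_sub, h.mSp, sm, map_one]
  · rw [hC, hX, ← pow, ← mul, ← mul, ← mul, ← sm, ← map_sub, h.mSm, sm]
  · have := congrArg φ (h.SS ε)
    simpa only [serre, map_sub, map_mul, map_pow, map_smul, map_zero] using this

end Trivial

theorem eq_evalOne {Q : Type*} [Ring Q] {f : Kq →+* Q} (h : f (qp 1) = 1) (r : Kq) :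
    f r = f (LaurentPolynomial.C (evalOne r)) := by
  have e : f (qp (-1)) = 1 := by
    have := congrArg f (qp_mul_neg 1)
    rwa [map_mul, h, one_mul, map_one] at this
  have e1 : ∀ n : ℕ, f (qp n) = 1 ∧ f (qp (-n)) = 1 := by
    intro n
    induction n with
    | zero => simp [qp_zero]
    | succ n ih =>
      have a1 : qp ((n + 1 : ℕ) : ℤ) = qp n * qp 1 := by rw [qp_mul_qp]; push_cast; rfl
      have a2 : qp (-((n + 1 : ℕ) : ℤ)) = qp (-n) * qp (-1) := by
        rw [qp_mul_qp]; push_cast; congr 1; ring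
      rw [a1, a2, map_mul, map_mul, ih.1, ih.2, h, e, one_mul]
      exact ⟨rfl, rfl⟩
  have e2 : ∀ n : ℤ, f (qp n) = 1 := fun n => by
    obtain ⟨m, rfl | rfl⟩ := n.eq_nat_or_neg
    exacts [(e1 m).1, (e1 m).2]
  induction r using LaurentPolynomial.induction_on' with
  | add p q hp hq => rw [map_add, map_add, map_add, map_add, ← hp, ← hq]
  | C_mul_T n a =>
    have := e2 n
    rw [qp] at this
    have t := evalOne_qp n
    rw [qp] at t
    rw [map_mul, map_mul, this, t, evalOne_C, mul_one, mul_one]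

theorem qp_smul_of_one {Q : Type*} [Ring Q] [Algebra Kq Q] (h : algebraMap Kq Q (qp 1) = 1)
    (n : ℤ) (a : Q) : qp n • a = a := by
  rw [Algebra.smul_def, eq_evalOne h, evalOne_qp, map_one, map_one, one_mul]

/-- Let `σ` be a specialization at `q = 1` under which the images of the generators are
algebraically independent. Then the kernel of `σ` is contained in the kernel of every quotient in
which `q = 1` and the generators commute, since that quotient is a quotient of a polynomial ring
in the generators. -/
theorem eq_zero_of_specialization {A Q F ι : Type} [Ring A] [Algebra Kq A] [Ring Q] [CommRing F]
    [Algebra ℂ F] {g : ι → A}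
    (hind : ∀ p : A → Prop, (∀ r, p (algebraMap Kq A r)) → (∀ i, p (g i)) →
      (∀ a b, p a → p b → p (a * b)) → (∀ a b, p a → p b → p (a + b)) → ∀ x, p x)
    {π : A →+* Q} (hπ : Function.Surjective π) (hq : π (algebraMap Kq A (qp 1)) = 1)
    (hc : ∀ i j, π (g i) * π (g j) = π (g j) * π (g i)) {σ : A →+* F} (hσ : SpecializesAtOne σ)
    (halg : AlgebraicIndependent ℂ fun i => σ (g i)) {x : A} (hx : σ x = 0) : π x = 0 := by
  -- the quotient is commutative, since the images of the generators commute
  have hc1 : ∀ i x, π (g i) * π x = π x * π (g i) := fun i => by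
    refine hind _ ?_ (hc i) ?_ ?_
    · intro r
      rw [← map_mul, ← map_mul, Algebra.commutes]
    · intro a b ha hb
      rw [map_mul, ← mul_assoc, ha, mul_assoc, hb, mul_assoc]
    · intro a b ha hb
      rw [map_add, mul_add, ha, hb, add_mul]
  have hc2 : ∀ x y, π x * π y = π y * π x := by
    refine hind _ ?_ hc1 ?_ ?_
    · intro r y
      rw [← map_mul, ← map_mul, Algebra.commutes]
    · intro a b ha hb y
      rw [map_mul, mul_assoc, hb, ← mul_assoc, ha, mul_assoc]
    · intro a b ha hb y
      rw [map_add, add_mul, ha, hb, mul_add]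
  let _ : CommRing Q := { (inferInstance : Ring Q) with
    mul_comm := fun a b => by
      obtain ⟨a, rfl⟩ := hπ a
      obtain ⟨b, rfl⟩ := hπ b
      exact hc2 a b }
  let φ : MvPolynomial ι ℂ →+* Q := MvPolynomial.eval₂Hom
    ((π.comp (algebraMap Kq A)).comp LaurentPolynomial.C) (fun i => π (g i))
  have key : ∀ x, ∃ p : MvPolynomial ι ℂ, π x = φ p ∧
      σ x = MvPolynomial.aeval (fun i => σ (g i)) p := by
    refine hind _ ?_ ?_ ?_ ?_
    · intro r
      refine ⟨MvPolynomial.C (evalOne r), ?_, ?_⟩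
      · rw [MvPolynomial.coe_eval₂Hom, MvPolynomial.eval₂_C]
        exact eq_evalOne (f := π.comp (algebraMap Kq A)) hq r
      · rw [MvPolynomial.aeval_C, ← hσ.map_const]
        exact eq_evalOne (f := σ.comp (algebraMap Kq A)) hσ.map_q r
    · intro i
      exact ⟨MvPolynomial.X i, by simp [φ], by simp⟩
    · rintro a b ⟨p, hp, hp'⟩ ⟨p2, hp2, hp2'⟩
      exact ⟨p * p2, by rw [map_mul, map_mul, hp, hp2], by rw [map_mul, map_mul, hp', hp2']⟩
    · rintro a b ⟨p, hp, hp'⟩ ⟨p2, hp2, hp2'⟩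
      exact ⟨p + p2, by rw [map_add, map_add, hp, hp2], by rw [map_add, map_add, hp', hp2']⟩
  obtain ⟨p, h1, h2⟩ := key x
  rw [hx] at h2
  rw [h1, (injective_iff_map_eq_zero _).1 halg p h2.symm, map_zero]

theorem coeff_map_genSer {A B : Type} [Ring A] [Ring B] (φ : A →+* B) (c : ℕ → A) (i : ℕ) :
    coeff i (PowerSeries.map φ (genSer c)) = (-1) ^ i * φ (c i) := by
  simp [genSer]

theorem neg_one_pow_mul_comm {B : Type*} [Ring B] {i j : ℕ} {a b : B}
    (h : (-1) ^ i * a * ((-1) ^ j * b) = (-1) ^ j * b * ((-1) ^ i * a)) : a * b = b * a := by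
  rcases neg_one_pow_eq_or B i with hi | hi <;> rcases neg_one_pow_eq_or B j with hj | hj <;>
    simpa [hi, hj] using h

theorem neg_one_pow_mul_comm' {B : Type*} [Ring B] {i : ℕ} {a b : B}
    (h : (-1) ^ i * a * b = b * ((-1) ^ i * a)) : a * b = b * a := by
  rcases neg_one_pow_eq_or B i with hi | hi <;> simpa [hi] using h

theorem QB.commute_gen {Q : Type} [Ring Q] [Algebra Kq Q] (h : algebraMap Kq Q (qp 1) = 1)
    (π : QB →ₐ[Kq] Q) (x y : GenB) : π (QB.proj (FreeAlgebra.ι Kq x)) * π (QB.proj (FreeAlgebra.ι Kq y))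
      = π (QB.proj (FreeAlgebra.ι Kq y)) * π (QB.proj (FreeAlgebra.ι Kq x)) := by
  have H := (QB.qRel.map π).commute (qp_smul_of_one h)
  simp only [coeff_map_genSer] at H
  rcases x with i | i <;> rcases y with j | j
  exacts [neg_one_pow_mul_comm (H i j).1, neg_one_pow_mul_comm (H i j).2.2,
    (neg_one_pow_mul_comm (H j i).2.2).symm, neg_one_pow_mul_comm (H i j).2.1]

theorem QBN.commute_gen {Q : Type} [Ring Q] [Algebra Kq Q] (h : algebraMap Kq Q (qp 1) = 1)
    (π : QBN →ₐ[Kq] Q) (hS : π (QBN.S 1) * π (QBN.S (-1)) = π (QBN.S (-1)) * π (QBN.S 1))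
    (x y : GenBN) : π (QBN.proj (FreeAlgebra.ι Kq x)) * π (QBN.proj (FreeAlgebra.ι Kq y))
      = π (QBN.proj (FreeAlgebra.ι Kq y)) * π (QBN.proj (FreeAlgebra.ι Kq x)) := by
  have H := (QBN.qRelN.map π).commute (qp_smul_of_one h)
  have H2 := (QBN.qRelN.map π).toQRel.commute (qp_smul_of_one h)
  simp only [coeff_map_genSer] at H H2
  rcases x with i | i | ε <;> rcases y with j | j | δ
  · exact neg_one_pow_mul_comm (H2 i j).1
  · exact neg_one_pow_mul_comm (H2 i j).2.2
  · exact neg_one_pow_mul_comm' (H δ i).1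
  · exact (neg_one_pow_mul_comm (H2 j i).2.2).symm
  · exact neg_one_pow_mul_comm (H2 i j).2.1
  · exact neg_one_pow_mul_comm' (H δ i).2
  · exact (neg_one_pow_mul_comm' (H ε j).1).symm
  · exact (neg_one_pow_mul_comm' (H ε j).2).symm
  · rcases Int.units_eq_one_or ε with rfl | rfl <;> rcases Int.units_eq_one_or δ with rfl | rfl
    exacts [rfl, hS, hS.symm, rfl]

theorem QB.mem_ker {F : Type} [CommRing F] [Algebra ℂ F] {σ : QB →+* F} (hσ : SpecializesAtOne σ)
    (halg : AlgebraicIndependent ℂ fun x => σ (QB.proj (FreeAlgebra.ι Kq x))) (x : QB) :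
    σ x = 0 ↔ ∃ y, x = (qp 1 - 1) • y := by
  constructor
  · intro hx
    let J : TwoSidedIdeal QB := TwoSidedIdeal.mk' {x | ∃ y, x = (qp 1 - 1) • y} ⟨0, by simp⟩
      (by rintro _ _ ⟨a, rfl⟩ ⟨b, rfl⟩; exact ⟨a + b, by rw [smul_add]⟩)
      (by rintro _ ⟨a, rfl⟩; exact ⟨-a, by rw [smul_neg]⟩)
      (by rintro b _ ⟨a, rfl⟩; exact ⟨b * a, by rw [mul_smul_comm]⟩)
      (by rintro _ b ⟨a, rfl⟩; exact ⟨a * b, by rw [smul_mul_assoc]⟩)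
    have hJ : ∀ x, x ∈ J ↔ ∃ y, x = (qp 1 - 1) • y := fun x => by
      rw [TwoSidedIdeal.mem_mk']; rfl
    have hπ : ∀ x, J.ringCon.mkₐ Kq x = 0 ↔ x ∈ J := fun x => by
      rw [TwoSidedIdeal.mem_iff]; exact J.ringCon.eq
    have h1 : algebraMap Kq J.ringCon.Quotient (qp 1) = 1 := by
      have e : J.ringCon.mkₐ Kq ((qp 1 - 1) • (1 : QB)) = 0 := (hπ _).2 ((hJ _).2 ⟨1, rfl⟩)
      rw [map_smul, map_one, sub_smul, one_smul, sub_eq_zero, ← Algebra.algebraMap_eq_smul_one] at e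
      exact e
    rw [← hJ, ← hπ]
    exact eq_zero_of_specialization (g := fun x => QB.proj (FreeAlgebra.ι Kq x))
      (fun p h1 h2 h3 h4 => quot_induction (Rel := RelB) h1 h2 h3 h4)
      (Q := J.ringCon.Quotient) (π := J.ringCon.mk') J.ringCon.mk'_surjective
      (((J.ringCon.mkₐ Kq).commutes _).trans h1)
      (QB.commute_gen h1 (J.ringCon.mkₐ Kq)) hσ halg hx
  · rintro ⟨y, rfl⟩
    rw [Algebra.smul_def, map_mul, map_sub, map_one, map_sub, hσ.map_q, map_one, sub_self, zero_mul]

theorem QBN.mem_ker {F : Type} [CommRing F] [Algebra ℂ F] {σ : QBN →+* F} (hσ : SpecializesAtOne σ)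
    (halg : AlgebraicIndependent ℂ fun x => σ (QBN.proj (FreeAlgebra.ι Kq x))) (x : QBN) :
    σ x = 0 ↔ x ∈ TwoSidedIdeal.span
      {algebraMap Kq QBN (qp 1 - 1), QBN.S 1 * QBN.S (-1) - QBN.S (-1) * QBN.S 1} := by
  set J := TwoSidedIdeal.span
      {algebraMap Kq QBN (qp 1 - 1), QBN.S 1 * QBN.S (-1) - QBN.S (-1) * QBN.S 1}
  constructor
  · intro hx
    have hπ : ∀ x, J.ringCon.mkₐ Kq x = 0 ↔ x ∈ J := fun x => by
      rw [TwoSidedIdeal.mem_iff]; exact J.ringCon.eq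
    have h1 : algebraMap Kq J.ringCon.Quotient (qp 1) = 1 := by
      have e := (hπ _).2 (TwoSidedIdeal.subset_span (Set.mem_insert (algebraMap Kq QBN (qp 1 - 1)) _))
      rw [AlgHom.commutes, map_sub, map_one, sub_eq_zero] at e
      exact e
    have hS : J.ringCon.mkₐ Kq (QBN.S 1) * J.ringCon.mkₐ Kq (QBN.S (-1)) =
        J.ringCon.mkₐ Kq (QBN.S (-1)) * J.ringCon.mkₐ Kq (QBN.S 1) := by
      have e := (hπ _).2 (TwoSidedIdeal.subset_span (Set.mem_insert_of_mem
        (algebraMap Kq QBN (qp 1 - 1)) (Set.mem_singleton _)))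
      rwa [map_sub, map_mul, map_mul, sub_eq_zero] at e
    rw [← hπ]
    exact eq_zero_of_specialization (g := fun x => QBN.proj (FreeAlgebra.ι Kq x))
      (fun p h1 h2 h3 h4 => quot_induction (Rel := RelBN) h1 h2 h3 h4)
      (Q := J.ringCon.Quotient) (π := J.ringCon.mk') J.ringCon.mk'_surjective
      (((J.ringCon.mkₐ Kq).commutes _).trans h1)
      (QBN.commute_gen h1 (J.ringCon.mkₐ Kq) hS) hσ halg hx
  · intro hx
    have : J ≤ TwoSidedIdeal.ker σ := TwoSidedIdeal.span_le.2 (by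
      rintro y (rfl | rfl)
      · rw [SetLike.mem_coe, TwoSidedIdeal.mem_ker, map_sub, map_sub, hσ.map_q, map_one, map_one, sub_self]
      · rw [SetLike.mem_coe, TwoSidedIdeal.mem_ker, map_sub, map_mul, map_mul, mul_comm, sub_self])
    exact (TwoSidedIdeal.mem_ker σ).1 (this hx)

/-! ### Points with given coordinates, and the specialization maps -/

section Coordinates
variable {R : Type} [CommRing R]

theorem genSer_coord (s : R⟦X⟧) : genSer (fun i => (-1) ^ i * coeff i s) = s := by
  ext i
  rw [coeff_genSer, ← mul_assoc, neg_one_pow_mul_self', one_mul]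

theorem genSer_uCoord (g : Matrix.SpecialLinearGroup (Fin 2) R⟦X⟧) : genSer (uCoord g) = uCl g :=
  genSer_coord _

theorem genSer_mCoord (g : Matrix.SpecialLinearGroup (Fin 2) R⟦X⟧) : genSer (mCoord g) = mCl g :=
  genSer_coord _

theorem isUnit_one_add_mul {s t : R⟦X⟧} (h : constantCoeff t = 0) :
    IsUnit (1 + s * t) := isUnit_one_add_of_constantCoeff (by simp [h])

theorem constantCoeff_vCl {g : Matrix.SpecialLinearGroup (Fin 2) R⟦X⟧} (h : g ∈ Bminus R) :
    constantCoeff (vCl g) = 0 := by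
  have h1 : constantCoeff (g 0 1) = 0 := h
  rw [vCl, map_mul, h1, zero_mul]

theorem X_mul_mCl {g : Matrix.SpecialLinearGroup (Fin 2) R⟦X⟧} (h : g ∈ Bminus R) :
    X * mCl g * (1 + uCl g * vCl g) = -vCl g := by
  have h0 := constantCoeff_vCl h
  have hu := Ring.mul_inverse_cancel _ (isUnit_one_add_mul (s := uCl g) h0)
  have e : X * mCl g = -(vCl g * Ring.inverse (1 + uCl g * vCl g)) := by
    ext i
    cases i with
    | zero => simp [h0]
    | succ i => rw [PowerSeries.coeff_succ_X_mul, mCl, PowerSeries.coeff_mk, map_neg]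
  rw [e]
  linear_combination -vCl g * hu

theorem negInvAdd_mul_comm (u m : R⟦X⟧) :
    negInvAdd u m * (1 + X * (u * m)) = -(X * m) := by
  have h := PowerSeries.mul_invOfUnit (1 + X * u * m) 1 (by simp)
  rw [negInvAdd]
  linear_combination -(X * m) * h

theorem eq_negInvAdd {u m v : R⟦X⟧} (h : X * m * (1 + u * v) = -v) :
    v = negInvAdd u m := by
  have e := negInvAdd_mul_comm u m
  refine (isUnit_one_add_X_mul (u * m)).mul_left_cancel ?_
  linear_combination h - e

theorem vCl_eq {g : Matrix.SpecialLinearGroup (Fin 2) R⟦X⟧} (h : g ∈ Bminus R) :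
    vCl g = negInvAdd (uCl g) (mCl g) := eq_negInvAdd (X_mul_mCl h)

end Coordinates

/-- The point of `B₋` with given coordinates `u` and `m`. -/
def pointB (u m : ℂ⟦X⟧) : Bminus ℂ :=
  ⟨⟨!![1 + u * negInvAdd u m, negInvAdd u m; u, 1], by rw [Matrix.det_fin_two_of]; ring⟩, by
    change constantCoeff (negInvAdd u m) = 0
    simp [negInvAdd]⟩

theorem uCl_pointB (u m : ℂ⟦X⟧) : uCl (pointB u m).1 = u := by
  change u * Ring.inverse 1 = u
  rw [Ring.inverse_one, mul_one]

theorem mCl_pointB (u m : ℂ⟦X⟧) : mCl (pointB u m).1 = m := by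
  have h := X_mul_mCl (pointB u m).2
  have hv : vCl (pointB u m).1 = negInvAdd u m := mul_one _
  rw [uCl_pointB, hv] at h
  have e := negInvAdd_mul_comm u m
  have h0 : constantCoeff (negInvAdd u m) = 0 := by simp [negInvAdd]
  refine Reg.cancel reg_X ((isUnit_one_add_mul (s := u) h0).mul_right_cancel ?_)
  linear_combination h - e

theorem uFun_pointB (u m : ℂ⟦X⟧) (i : ℕ) :
    uFun i (HB.mk (pointB u m)) = (-1) ^ i * coeff i u := by
  change (-1) ^ i * coeff i (uCl (pointB u m).1) = _
  rw [uCl_pointB]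

theorem mFun_pointB (u m : ℂ⟦X⟧) (i : ℕ) :
    mFun i (HB.mk (pointB u m)) = (-1) ^ i * coeff i m := by
  change (-1) ^ i * coeff i (mCl (pointB u m).1) = _
  rw [mCl_pointB]

/-- The element `(1 + s t λ, t; s λ, 1)` of `N₊`. -/
def pointN (s t : ℂ) : Nplus ℂ :=
  ⟨⟨!![1 + Polynomial.C (s * t) * Polynomial.X, Polynomial.C t; Polynomial.C s * Polynomial.X, 1],
    by rw [Matrix.det_fin_two_of, map_mul]; ring⟩, by
    refine ⟨?_, ?_, ?_⟩
    · change Polynomial.constantCoeff (1 + Polynomial.C (s * t) * Polynomial.X) = 1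
      simp
    · change Polynomial.constantCoeff (Polynomial.C s * Polynomial.X) = 0
      simp
    · exact map_one (Polynomial.constantCoeff (R := ℂ))⟩

section Functions

/-- Functions that take independently all values are algebraically independent. -/
theorem algebraicIndependent_of_points {Y ι : Type} {O : Subalgebra ℂ (Y → ℂ)} (g : ι → O)
    (h : ∀ x : ι → ℂ, ∃ p, ∀ i, (g i).1 p = x i) : AlgebraicIndependent ℂ g := by
  refine (injective_iff_map_eq_zero _).2 fun p hp => MvPolynomial.funext fun x => ?_
  obtain ⟨y, hy⟩ := h x
  have e := congrArg ((Pi.evalAlgHom ℂ (fun _ : Y => ℂ) y).comp O.val) hp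
  rw [MvPolynomial.comp_aeval_apply, map_zero] at e
  rw [map_zero, ← e, MvPolynomial.aeval_def, MvPolynomial.eval₂_eq_eval_map]
  have : (fun i => ((Pi.evalAlgHom ℂ (fun _ : Y => ℂ) y).comp O.val) (g i)) = x := funext hy
  rw [this]
  simp

/-- The structure of an algebra over `ℂ[q, q⁻¹]` in which `q` acts as `1`. -/
abbrev algebraAtOne (F : Type) [CommRing F] [Algebra ℂ F] : Algebra Kq F :=
  ((algebraMap ℂ F).comp evalOne).toAlgebra

instance : Algebra Kq OB := algebraAtOne OB

instance : Algebra Kq OBN := algebraAtOne OBN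

theorem OB.kq_smul (r : Kq) (f : OB) : r • f = evalOne r • f :=
  (Algebra.smul_def (R := ℂ) (evalOne r) f).symm

theorem OBN.kq_smul (r : Kq) (f : OBN) : r • f = evalOne r • f :=
  (Algebra.smul_def (R := ℂ) (evalOne r) f).symm

theorem OB.qp_smul (n : ℤ) (f : OB) : qp n • f = f := by
  rw [OB.kq_smul, evalOne_qp, one_smul]

theorem OBN.qp_smul (n : ℤ) (f : OBN) : qp n • f = f := by
  rw [OBN.kq_smul, evalOne_qp, one_smul]

/-- The images of the half screening charges. -/
def OBN.S (ε : ℤˣ) : OBN := if ε = 1 then OBN.a 1 0 1 else OBN.a 0 1 0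

/-- The classical limit of `ℂ[H₋\B₋]_q`. -/
def limitB : QB →ₐ[Kq] OB := QB.lift (QRel.of_comm OB.qp_smul (genSer OB.u) (genSer OB.m))

/-- The classical limit of `ℂ[H₋\B₋N₊]_q`. -/
def limitBN : QBN →ₐ[Kq] OBN :=
  QBN.lift (QRelN.of_comm OBN.qp_smul (genSer OBN.u) (genSer OBN.m) OBN.S)

theorem limitB_u (i : ℕ) : limitB (QB.u i) = OB.u i := QB.lift_u _ i
theorem limitB_m (i : ℕ) : limitB (QB.m i) = OB.m i := QB.lift_m _ i
theorem limitBN_u (i : ℕ) : limitBN (QBN.u i) = OBN.u i := QBN.lift_u _ i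
theorem limitBN_m (i : ℕ) : limitBN (QBN.m i) = OBN.m i := QBN.lift_m _ i
theorem limitBN_S (ε : ℤˣ) : limitBN (QBN.S ε) = OBN.S ε := QBN.lift_S _ ε

theorem specializes_limitB : SpecializesAtOne (limitB : QB →+* OB) where
  map_q := (limitB.commutes _).trans (by
    change algebraMap ℂ OB (evalOne (qp 1)) = 1
    rw [evalOne_qp, map_one])
  map_const c := (limitB.commutes _).trans (by
    change algebraMap ℂ OB (evalOne _) = _
    rw [evalOne_C])

theorem specializes_limitBN : SpecializesAtOne (limitBN : QBN →+* OBN) where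
  map_q := (limitBN.commutes _).trans (by
    change algebraMap ℂ OBN (evalOne (qp 1)) = 1
    rw [evalOne_qp, map_one])
  map_const c := (limitBN.commutes _).trans (by
    change algebraMap ℂ OBN (evalOne _) = _
    rw [evalOne_C])

theorem isLimitB : IsLimitB (limitB : QB →+* OB) where
  toSpecializesAtOne := specializes_limitB
  map_u := limitB_u
  map_m := limitB_m
  surj := by
    rintro ⟨f, hf⟩
    have : ∃ x, (limitB x).1 = f := by
      induction hf using Algebra.adjoin_induction with
      | mem f hf =>
        rcases hf with ⟨i, rfl⟩ | ⟨i, rfl⟩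
        exacts [⟨QB.u i, congrArg Subtype.val (limitB_u i)⟩,
          ⟨QB.m i, congrArg Subtype.val (limitB_m i)⟩]
      | algebraMap c =>
        exact ⟨algebraMap Kq QB (LaurentPolynomial.C c),
          congrArg Subtype.val (specializes_limitB.map_const c)⟩
      | add f g _ _ hf hg =>
        obtain ⟨x, rfl⟩ := hf
        obtain ⟨y, rfl⟩ := hg
        exact ⟨x + y, congrArg Subtype.val (map_add limitB x y)⟩
      | mul f g _ _ hf hg =>
        obtain ⟨x, rfl⟩ := hf
        obtain ⟨y, rfl⟩ := hg
        exact ⟨x * y, congrArg Subtype.val (map_mul limitB x y)⟩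
    obtain ⟨x, hx⟩ := this
    exact ⟨x, Subtype.ext hx⟩
  ker := QB.mem_ker specializes_limitB (algebraicIndependent_of_points _ fun x => by
    refine ⟨HB.mk (pointB (genSer fun i => x (.u i)) (genSer fun i => x (.m i))), ?_⟩
    rintro (i | i)
    · refine (congrArg (fun f : OB => f.1 _) (limitB_u i)).trans ((uFun_pointB _ _ i).trans ?_)
      rw [coeff_genSer, ← mul_assoc, neg_one_pow_mul_self', one_mul]
    · refine (congrArg (fun f : OB => f.1 _) (limitB_m i)).trans ((mFun_pointB _ _ i).trans ?_)
      rw [coeff_genSer, ← mul_assoc, neg_one_pow_mul_self', one_mul])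

theorem isLimitBN : IsLimitBN (limitBN : QBN →+* OBN) where
  toSpecializesAtOne := specializes_limitBN
  map_u := limitBN_u
  map_m := limitBN_m
  map_Sp := (limitBN_S 1).trans (if_pos rfl)
  map_Sm := (limitBN_S (-1)).trans (if_neg (by decide))
  ker := QBN.mem_ker specializes_limitBN (algebraicIndependent_of_points _ fun x => by
    refine ⟨(HB.mk (pointB (genSer fun i => x (.u i)) (genSer fun i => x (.m i))),
      pointN (x (.S 1)) (x (.S (-1)))), ?_⟩
    rintro (i | i | ε)
    · refine (congrArg (fun f : OBN => f.1 _) (limitBN_u i)).trans ((uFun_pointB _ _ i).trans ?_)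
      rw [coeff_genSer, ← mul_assoc, neg_one_pow_mul_self', one_mul]
    · refine (congrArg (fun f : OBN => f.1 _) (limitBN_m i)).trans ((mFun_pointB _ _ i).trans ?_)
      rw [coeff_genSer, ← mul_assoc, neg_one_pow_mul_self', one_mul]
    · refine (congrArg (fun f : OBN => f.1 _) (limitBN_S ε)).trans ?_
      rcases Int.units_eq_one_or ε with rfl | rfl
      · rw [OBN.S, if_pos rfl]
        change (Polynomial.C (x (.S 1)) * Polynomial.X).coeff 1 = _
        simp
      · rw [OBN.S, if_neg (by decide)]
        change (Polynomial.C (x (.S (-1)))).coeff 0 = _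
        simp)

end Functions

/-! ### Derivations of function algebras from curves -/

/-- A family of curves through the points of a set `Y` differentiates an algebra of functions on
`Y`, as soon as the derivatives of the generators at time `0` belong to the algebra. -/
theorem exists_derivation_of_curves {Y : Type} {S : Set (Y → ℂ)} (γ : Y → ℂ → Y)
    (h : ∀ s ∈ S, ∃ s' ∈ Algebra.adjoin ℂ S, ∀ p,
      s (γ p 0) = s p ∧ HasDerivAt (fun t => s (γ p t)) (s' p) 0) :
    ∃ D : Derivation ℂ (Algebra.adjoin ℂ S) (Algebra.adjoin ℂ S),
      ∀ (f f' : Algebra.adjoin ℂ S), (∀ p, HasDerivAt (fun t => f.1 (γ p t)) (f'.1 p) 0) →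
        D f = f' := by
  have key : ∀ f : Algebra.adjoin ℂ S, ∃ f' : Algebra.adjoin ℂ S, ∀ p,
      f.1 (γ p 0) = f.1 p ∧ HasDerivAt (fun t => f.1 (γ p t)) (f'.1 p) 0 := by
    rintro ⟨f, hf⟩
    induction hf using Algebra.adjoin_induction with
    | mem s hs =>
      obtain ⟨s', h1, h2⟩ := h s hs
      exact ⟨⟨s', h1⟩, h2⟩
    | algebraMap c => exact ⟨0, fun p => ⟨rfl, hasDerivAt_const 0 c⟩⟩
    | add f g _ _ hf hg =>
      obtain ⟨f', hf⟩ := hf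
      obtain ⟨g', hg⟩ := hg
      exact ⟨f' + g', fun p => ⟨congrArg₂ (· + ·) (hf p).1 (hg p).1, (hf p).2.add (hg p).2⟩⟩
    | mul f g hf' hg' hf hg =>
      obtain ⟨f', hf⟩ := hf
      obtain ⟨g', hg⟩ := hg
      refine ⟨f' * ⟨g, hg'⟩ + ⟨f, hf'⟩ * g', fun p =>
        ⟨congrArg₂ (· * ·) (hf p).1 (hg p).1, ((hf p).2.mul (hg p).2).congr_deriv ?_⟩⟩
      rw [(hf p).1, (hg p).1]
      rfl
  choose d hd using key
  have uniq : ∀ f f' : Algebra.adjoin ℂ S,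
      (∀ p, HasDerivAt (fun t => f.1 (γ p t)) (f'.1 p) 0) → d f = f' := fun f f' h' =>
    Subtype.ext (funext fun p => (hd f p).2.unique (h' p))
  refine ⟨Derivation.mk' ⟨⟨d, fun f g => uniq _ _ fun p => (hd f p).2.add (hd g p).2⟩,
    fun c f => uniq _ _ fun p => (hd f p).2.const_mul c⟩ fun f g => uniq _ _ fun p => ?_, uniq⟩
  refine ((hd f p).2.mul (hd g p).2).congr_deriv ?_
  rw [(hd f p).1, (hd g p).1]
  change _ = f.1 p * (d g).1 p + g.1 p * (d f).1 p
  ring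

theorem hasDerivAt_cubic (a b c d : ℂ) :
    HasDerivAt (fun t : ℂ => a + t * b + t ^ 2 * c + t ^ 3 * d) b 0 := by
  have h := hasDerivAt_id (0 : ℂ)
  exact ((((h.mul_const b).const_add a).add ((h.pow 2).mul_const c)).add
    ((h.pow 3).mul_const d)).congr_deriv (by simp)

theorem hasDerivAt_affine (a b : ℂ) : HasDerivAt (fun t : ℂ => a + t * b) b 0 := by
  exact ((hasDerivAt_id (0 : ℂ)).mul_const b |>.const_add a).congr_deriv (one_mul b)

theorem uFun_genSer (c d : ℕ → ℂ) (i : ℕ) :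
    uFun i (HB.mk (pointB (genSer c) (genSer d))) = c i := by
  rw [uFun_pointB, coeff_genSer, ← mul_assoc, neg_one_pow_mul_self', one_mul]

theorem mFun_genSer (c d : ℕ → ℂ) (i : ℕ) :
    mFun i (HB.mk (pointB (genSer c) (genSer d))) = d i := by
  rw [mFun_pointB, coeff_genSer, ← mul_assoc, neg_one_pow_mul_self', one_mul]

/-- As `u`, `m` are free coordinates, a vector field may be prescribed arbitrarily on them; it
differentiates along straight lines in these coordinates. -/
theorem OB.exists_derivation (u' m' : ℕ → OB) : ∃ D : Derivation ℂ OB OB,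
    (∀ i, D (OB.u i) = u' i) ∧ ∀ i, D (OB.m i) = m' i := by
  have hu : ∀ i (p : HB), HasDerivAt (fun t => uFun i (HB.mk (pointB
      (genSer fun i => uFun i p + t * (u' i).1 p) (genSer fun i => mFun i p + t * (m' i).1 p))))
      ((u' i).1 p) 0 := fun i p => by
    simp only [uFun_genSer]
    exact hasDerivAt_affine _ _
  have hm : ∀ i (p : HB), HasDerivAt (fun t => mFun i (HB.mk (pointB
      (genSer fun i => uFun i p + t * (u' i).1 p) (genSer fun i => mFun i p + t * (m' i).1 p))))
      ((m' i).1 p) 0 := fun i p => by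
    simp only [mFun_genSer]
    exact hasDerivAt_affine _ _
  obtain ⟨D, hD⟩ := exists_derivation_of_curves (S := Set.range uFun ∪ Set.range mFun)
    (fun p t => HB.mk (pointB (genSer fun i => uFun i p + t * (u' i).1 p)
      (genSer fun i => mFun i p + t * (m' i).1 p))) (by
    rintro _ (⟨i, rfl⟩ | ⟨i, rfl⟩)
    · exact ⟨_, (u' i).2, fun p => ⟨by rw [uFun_genSer, zero_mul, add_zero], hu i p⟩⟩
    · exact ⟨_, (m' i).2, fun p => ⟨by rw [mFun_genSer, zero_mul, add_zero], hm i p⟩⟩)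
  exact ⟨D, fun i => hD _ _ (hu i), fun i => hD _ _ (hm i)⟩

/-- The curve `(1 + t A (1, -1; 1, -1)) (1 + t (B + A) E) (1 + t (C - A) F)` in `SL₂`, whose
velocity at `t = 0` is `(A, B; C, -A)`. -/
def slCurve {R : Type} [CommRing R] (A B C t : R) : Matrix.SpecialLinearGroup (Fin 2) R :=
  ⟨!![1 + t * A + t ^ 2 * (B * (C - A)) + t ^ 3 * (A * (B + A) * (C - A)),
      t * B + t ^ 2 * (A * (B + A));
      t * C - t ^ 2 * (A * (C - A)) + t ^ 3 * (A * (B + A) * (C - A)),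
      1 - t * A + t ^ 2 * (A * (B + A))], by rw [Matrix.det_fin_two_of]; ring⟩

/-- The curve in `N₊` through `n` with velocity `(A, B; C, -A) n`. -/
def nCurve {A B C : ℂ[X]} (hA : A.coeff 0 = 0) (hC : C.coeff 0 = 0) (n : Nplus ℂ) (t : ℂ) :
    Nplus ℂ :=
  ⟨slCurve A B C (Polynomial.C t), by
    have hA : Polynomial.constantCoeff A = 0 := hA
    have hC : Polynomial.constantCoeff C = 0 := hC
    refine ⟨?_, ?_, ?_⟩
    · change Polynomial.constantCoeff (1 + _ * A + _ * (B * (C - A)) + _ * (A * _ * _)) = 1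
      simp only [map_add, map_mul, map_sub, map_one, hA, hC]
      ring
    · change Polynomial.constantCoeff (_ * C - _ * (A * _) + _ * (A * _ * _)) = 0
      simp only [map_add, map_mul, map_sub, hA, hC]
      ring
    · change Polynomial.constantCoeff (1 - _ * A + _ * (A * _)) = 1
      simp only [map_add, map_mul, map_sub, map_one, hA]
      ring⟩ * n

section
variable {A B C : ℂ[X]} (hA : A.coeff 0 = 0) (hC : C.coeff 0 = 0) (n : Nplus ℂ) (j : Fin 2)

theorem coeff_cubic (a b c d : ℂ[X]) (t : ℂ) (r : ℕ) :
    (a + Polynomial.C t * b + Polynomial.C t ^ 2 * c + Polynomial.C t ^ 3 * d).coeff r =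
      a.coeff r + t * b.coeff r + t ^ 2 * c.coeff r + t ^ 3 * d.coeff r := by
  simp only [Polynomial.coeff_add, ← map_pow, Polynomial.coeff_C_mul]

theorem nCurve_apply_zero (t : ℂ) : (nCurve (B := B) hA hC n t).1 0 j =
    n.1 0 j + Polynomial.C t * (A * n.1 0 j + B * n.1 1 j)
      + Polynomial.C t ^ 2 * (B * (C - A) * n.1 0 j + A * (B + A) * n.1 1 j)
      + Polynomial.C t ^ 3 * (A * (B + A) * (C - A) * n.1 0 j) := by
  change ((slCurve A B C (Polynomial.C t)).1 * n.1.1) 0 j = _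
  rw [Matrix.mul_apply, Fin.sum_univ_two]
  generalize Polynomial.C t = τ
  change (1 + τ * A + τ ^ 2 * (B * (C - A)) + τ ^ 3 * (A * (B + A) * (C - A))) * n.1 0 j +
    (τ * B + τ ^ 2 * (A * (B + A))) * n.1 1 j = _
  ring

theorem nCurve_apply_one (t : ℂ) : (nCurve (B := B) hA hC n t).1 1 j =
    n.1 1 j + Polynomial.C t * (C * n.1 0 j - A * n.1 1 j)
      + Polynomial.C t ^ 2 * (-(A * (C - A)) * n.1 0 j + A * (B + A) * n.1 1 j)
      + Polynomial.C t ^ 3 * (A * (B + A) * (C - A) * n.1 0 j) := by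
  change ((slCurve A B C (Polynomial.C t)).1 * n.1.1) 1 j = _
  rw [Matrix.mul_apply, Fin.sum_univ_two]
  generalize Polynomial.C t = τ
  change (τ * C - τ ^ 2 * (A * (C - A)) + τ ^ 3 * (A * (B + A) * (C - A))) * n.1 0 j +
    (1 - τ * A + τ ^ 2 * (A * (B + A))) * n.1 1 j = _
  ring

theorem hasDerivAt_nCurve_zero (r : ℕ) :
    HasDerivAt (fun t => ((nCurve (B := B) hA hC n t).1 0 j).coeff r)
      ((A * n.1 0 j + B * n.1 1 j).coeff r) 0 := by
  simp only [nCurve_apply_zero, coeff_cubic]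
  exact hasDerivAt_cubic _ _ _ _

theorem hasDerivAt_nCurve_one (r : ℕ) :
    HasDerivAt (fun t => ((nCurve (B := B) hA hC n t).1 1 j).coeff r)
      ((C * n.1 0 j - A * n.1 1 j).coeff r) 0 := by
  simp only [nCurve_apply_one, coeff_cubic]
  exact hasDerivAt_cubic _ _ _ _

end

/-- The generating series of the coordinate functions on an entry of the `N₊`-component. -/
def OBN.aSer (s j : Fin 2) : OBN⟦X⟧ := PowerSeries.mk (OBN.a s j)

/-- The value of a function at a point. -/
def OBN.ev (p : HBN) : OBN →+* ℂ :=
  (Pi.evalRingHom (fun _ : HBN => ℂ) p).comp OBN.val.toRingHom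

theorem OBN.ev_apply (p : HBN) (f : OBN) : OBN.ev p f = f.1 p := rfl

theorem OBN.map_ev_aSer (p : HBN) (s j : Fin 2) :
    PowerSeries.map (OBN.ev p) (OBN.aSer s j) = (p.2.1 s j : ℂ[X]) := by
  ext r
  rw [PowerSeries.coeff_map, OBN.aSer, PowerSeries.coeff_mk, Polynomial.coeff_coe]
  rfl

theorem map_coe_polynomial {R R' : Type} [CommRing R] [CommRing R'] (φ : R →+* R') (f : R[X]) :
    PowerSeries.map φ (f : R⟦X⟧) = (f.map φ : R'[X]) := by
  ext; simp

/-- On the `N₊`-component the vector field is an infinitesimal left translation by `(A, B; C,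
-A)`, which may depend on the point. -/
theorem OBN.exists_derivation (u' m' : ℕ → OBN) {A B C : OBN[X]} (hA : A.coeff 0 = 0)
    (hC : C.coeff 0 = 0) : ∃ D : Derivation ℂ OBN OBN,
    (∀ i, D (OBN.u i) = u' i) ∧ (∀ i, D (OBN.m i) = m' i) ∧
    (∀ j r, D (OBN.a 0 j r) = coeff r ((A : OBN⟦X⟧) * OBN.aSer 0 j + (B : OBN⟦X⟧) * OBN.aSer 1 j)) ∧
    ∀ j r, D (OBN.a 1 j r) = coeff r ((C : OBN⟦X⟧) * OBN.aSer 0 j - (A : OBN⟦X⟧) * OBN.aSer 1 j) := by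
  have hA' : ∀ p : HBN, (A.map (OBN.ev p)).coeff 0 = 0 := fun p => by
    rw [Polynomial.coeff_map, hA, map_zero]
  have hC' : ∀ p : HBN, (C.map (OBN.ev p)).coeff 0 = 0 := fun p => by
    rw [Polynomial.coeff_map, hC, map_zero]
  let γ : HBN → ℂ → HBN := fun p t => (HB.mk (pointB (genSer fun i => uFun i p.1 + t * (u' i).1 p)
    (genSer fun i => mFun i p.1 + t * (m' i).1 p)),
      nCurve (B := B.map (OBN.ev p)) (hA' p) (hC' p) p.2 t)
  have hu : ∀ i (p : HBN), HasDerivAt (fun t => uFunN i (γ p t)) ((u' i).1 p) 0 := fun i p => by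
    simp only [uFunN, γ, uFun_genSer]
    exact hasDerivAt_affine _ _
  have hm : ∀ i (p : HBN), HasDerivAt (fun t => mFunN i (γ p t)) ((m' i).1 p) 0 := fun i p => by
    simp only [mFunN, γ, mFun_genSer]
    exact hasDerivAt_affine _ _
  have h0 : ∀ j r p, HasDerivAt (fun t => aFunN (0, j, r) (γ p t))
      ((coeff r ((A : OBN⟦X⟧) * OBN.aSer 0 j + (B : OBN⟦X⟧) * OBN.aSer 1 j)).1 p) 0 :=
    fun j r p => by
      refine (hasDerivAt_nCurve_zero (B := B.map (OBN.ev p)) (hA' p) (hC' p) p.2 j r).congr_deriv ?_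
      rw [← OBN.ev_apply, ← PowerSeries.coeff_map, ← Polynomial.coeff_coe]
      simp only [map_add, map_mul, map_coe_polynomial, OBN.map_ev_aSer, Polynomial.coe_add,
        Polynomial.coe_mul]
  have h1 : ∀ j r p, HasDerivAt (fun t => aFunN (1, j, r) (γ p t))
      ((coeff r ((C : OBN⟦X⟧) * OBN.aSer 0 j - (A : OBN⟦X⟧) * OBN.aSer 1 j)).1 p) 0 :=
    fun j r p => by
      refine (hasDerivAt_nCurve_one (B := B.map (OBN.ev p)) (hA' p) (hC' p) p.2 j r).congr_deriv ?_
      rw [← OBN.ev_apply, ← PowerSeries.coeff_map, ← Polynomial.coeff_coe]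
      simp only [map_sub, map_mul, map_coe_polynomial, OBN.map_ev_aSer, Polynomial.coe_sub,
        Polynomial.coe_mul]
  obtain ⟨D, hD⟩ := exists_derivation_of_curves
    (S := Set.range uFunN ∪ Set.range mFunN ∪ Set.range aFunN) γ (by
    rintro _ ((⟨i, rfl⟩ | ⟨i, rfl⟩) | ⟨⟨s, j, r⟩, rfl⟩)
    · exact ⟨_, (u' i).2, fun p => ⟨by simp only [uFunN, γ, uFun_genSer, zero_mul, add_zero], hu i p⟩⟩
    · exact ⟨_, (m' i).2, fun p => ⟨by simp only [mFunN, γ, mFun_genSer, zero_mul, add_zero], hm i p⟩⟩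
    · fin_cases s
      · exact ⟨_, Subtype.property _, fun p => ⟨by
          change ((nCurve (B := B.map (OBN.ev p)) (hA' p) (hC' p) p.2 0).1 0 j).coeff r = _
          rw [nCurve_apply_zero, coeff_cubic]
          change _ = (p.2.1 0 j).coeff r
          ring, h0 j r p⟩⟩
      · exact ⟨_, Subtype.property _, fun p => ⟨by
          change ((nCurve (B := B.map (OBN.ev p)) (hA' p) (hC' p) p.2 0).1 1 j).coeff r = _
          rw [nCurve_apply_one, coeff_cubic]
          change _ = (p.2.1 1 j).coeff r
          ring, h1 j r p⟩⟩)
  exact ⟨D, fun i => hD _ _ (hu i), fun i => hD _ _ (hm i), fun j r => hD _ _ (h0 j r),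
    fun j r => hD _ _ (h1 j r)⟩

/-! ### The classical flows on the smaller space -/

/-- Algebras over `ℂ[q, q⁻¹]` in which `q` acts as `1`. -/
class QActsAsOne (O : Type) [CommRing O] [Algebra ℂ O] [Algebra Kq O] : Prop where
  smul_eq : ∀ (r : Kq) (f : O), r • f = evalOne r • f

instance : QActsAsOne OB := ⟨OB.kq_smul⟩
instance : QActsAsOne OBN := ⟨OBN.kq_smul⟩

section FlowDer
variable {O : Type} [CommRing O] [Algebra ℂ O] [Algebra Kq O] [QActsAsOne O]

/-- The generating series `∑ μ^{-k-1} d_k` of a family of derivations. -/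
def flowDer (d : ℕ → Derivation ℂ O O) : O →ₗ[Kq] O⟦X⟧ where
  toFun f := X * PowerSeries.mk fun k => d k f
  map_add' f g := by
    rw [← mul_add]
    congr 1
    ext; simp
  map_smul' r f := by
    rw [RingHom.id_apply, ← mul_smul_comm]
    congr 1
    ext
    simp [QActsAsOne.smul_eq]

variable {d : ℕ → Derivation ℂ O O}

theorem coeff_succ_flowDer (k : ℕ) (f : O) :
    coeff (k + 1) (flowDer d f) = d k f :=
  (PowerSeries.coeff_succ_X_mul k _).trans (PowerSeries.coeff_mk k fun k => d k f)

theorem coeff_zero_flowDer (f : O) : coeff 0 (flowDer d f) = 0 :=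
  PowerSeries.coeff_zero_X_mul _

theorem flowDer_eq {f : O} {s : O⟦X⟧} (h0 : constantCoeff s = 0)
    (h : ∀ k, d k f = coeff (k + 1) s) : flowDer d f = s := by
  ext n
  cases n with
  | zero =>
    rw [coeff_zero_flowDer, PowerSeries.coeff_zero_eq_constantCoeff_apply, h0]
  | succ k => exact (coeff_succ_flowDer k f).trans (h k)

theorem flowDer_skew : IsSkew C C (flowDer d : O →+ O⟦X⟧) := fun a b =>
  flowDer_eq (s := flowDer d a * C b + C a * flowDer d b)
    (by
      simp only [map_add, map_mul, ← PowerSeries.coeff_zero_eq_constantCoeff_apply,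
        coeff_zero_flowDer]
      ring) fun k => by
    rw [map_add, PowerSeries.coeff_mul_C, PowerSeries.coeff_C_mul, coeff_succ_flowDer,
      coeff_succ_flowDer, Derivation.leibniz, smul_eq_mul, smul_eq_mul]
    ring

theorem serMap_flowDer {c : ℕ → O} {F : O⟦X⟧⟦X⟧}
    (h0 : PowerSeries.map constantCoeff F = 0)
    (h : ∀ k i, d k (c i) = (-1) ^ i * coeff (k + 1) (coeff i F)) :
    serMap (flowDer d : O →+ O⟦X⟧) (genSer c) = F := by
  ext1 i
  rw [coeff_serMap, coeff_genSer]
  refine flowDer_eq (by simpa using congrArg (coeff i) h0) fun k => ?_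
  have e := map_neg_one_pow_mul (d k : O →+ O) i (c i)
  refine e.trans ?_
  change (-1) ^ i * d k (c i) = _
  rw [h, ← mul_assoc, neg_one_pow_mul_self', one_mul]

theorem comm_of_swapDefect {f : O} (h : QFlow.swapDefect (flowDer d) f = 0) (k l : ℕ) :
    ⁅d k, d l⁆ f = 0 := by
  have e := congrArg (fun s => coeff (k + 1) (coeff (l + 1) s)) h
  simp only [QFlow.swapDefect_apply, map_sub, coeff_coeff_serSwap, coeff_serMap, map_zero] at e
  simp only [AddMonoidHom.coe_coe, coeff_succ_flowDer] at e
  rw [Derivation.commutator_apply, ← neg_sub, neg_eq_zero]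
  exact e

theorem swapDefect_of_coeff {c : ℕ → O} {s : O⟦X⟧} (i : ℕ)
    (hs : coeff i s = (-1) ^ i * c i)
    (h : serMap (QFlow.swapDefect (flowDer d) : O →+ O⟦X⟧⟦X⟧) s = 0) :
    QFlow.swapDefect (flowDer d) (c i) = 0 := by
  have e := congrArg (coeff i) h
  rw [coeff_serMap, hs, map_zero] at e
  have e' := (map_neg_one_pow_mul (QFlow.swapDefect (flowDer d) : O →+ O⟦X⟧⟦X⟧) i (c i)).symm.trans e
  rcases neg_one_pow_eq_or (O⟦X⟧⟦X⟧) i with h | h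
  · rwa [h, one_mul] at e'
  · rwa [h, neg_one_mul, neg_eq_zero] at e'

theorem QFlow.comm_u {c b : ℕ → O}
    (h : QFlow (genSer c) (genSer b) (flowDer d : O →+ O⟦X⟧)) (k l i : ℕ) :
    ⁅d k, d l⁆ (c i) = 0 :=
  comm_of_swapDefect (swapDefect_of_coeff i (coeff_genSer c i) (by
    rw [QFlow.serMap_swapDefect, h.on_u, h.swap_serMap_flowU, sub_self])) k l

theorem QFlow.comm_m {c b : ℕ → O}
    (h : QFlow (genSer c) (genSer b) (flowDer d : O →+ O⟦X⟧)) (k l i : ℕ) :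
    ⁅d k, d l⁆ (b i) = 0 :=
  comm_of_swapDefect (swapDefect_of_coeff i (coeff_genSer b i) (by
    rw [QFlow.serMap_swapDefect, h.on_m, h.swap_serMap_flowM, sub_self])) k l

end FlowDer

theorem derivation_eq_zero {Y : Type} {S : Set (Y → ℂ)}
    (D : Derivation ℂ (Algebra.adjoin ℂ S) (Algebra.adjoin ℂ S))
    (h : ∀ s (hs : s ∈ S), D ⟨s, Algebra.subset_adjoin hs⟩ = 0) : D = 0 :=
  Derivation.ext_of_adjoin_eq_top _ Algebra.adjoin_adjoin_coe_preimage fun f hf => h f.1 hf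

theorem OB.exists_flow : ∃ d : ℕ → Derivation ℂ OB OB,
    QFlow (genSer OB.u) (genSer OB.m) (flowDer d : OB →+ OB⟦X⟧) := by
  choose d hu hm using fun k => OB.exists_derivation
    (fun i => (-1) ^ i *
      coeff (k + 1) (coeff i (flowU (genSer OB.u) (genSer OB.m))))
    (fun i => (-1) ^ i *
      coeff (k + 1) (coeff i (flowM (genSer OB.u) (genSer OB.m))))
  exact ⟨d, { QRel.of_comm OB.qp_smul _ _ with
    skew := flowDer_skew
    on_u := serMap_flowDer (map_constantCoeff_flowU _ _) hu
    on_m := serMap_flowDer (map_constantCoeff_flowM _ _) hm }⟩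

/-- The classical flows on `ℂ[H₋\B₋]`; `OB.der k` corresponds to `diag(λ^{k+1}, -λ^{k+1}) / 2`. -/
def OB.der : ℕ → Derivation ℂ OB OB := OB.exists_flow.choose

theorem OB.qFlow : QFlow (genSer OB.u) (genSer OB.m) (flowDer OB.der : OB →+ OB⟦X⟧) :=
  OB.exists_flow.choose_spec

theorem OB.der_comm (k l : ℕ) : ⁅OB.der k, OB.der l⁆ = 0 := by
  refine derivation_eq_zero _ ?_
  rintro _ (⟨i, rfl⟩ | ⟨i, rfl⟩)
  exacts [OB.qFlow.comm_u k l i, OB.qFlow.comm_m k l i]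

theorem map_limitB_u : PowerSeries.map (limitB : QB →+* OB) (genSer QB.u) = genSer OB.u :=
  (map_genSer _ _).trans (congrArg genSer (funext limitB_u))

theorem map_limitB_m : PowerSeries.map (limitB : QB →+* OB) (genSer QB.m) = genSer OB.m :=
  (map_genSer _ _).trans (congrArg genSer (funext limitB_m))

theorem map_limitB_flow (x : QB) :
    PowerSeries.map (limitB : QB →+* OB) (QB.flow x) = flowDer OB.der (limitB x) := by
  have : (mapLin limitB).comp QB.flow = (flowDer OB.der).comp limitB.toLinearMap := by
    refine QB.skew_ext (g := PowerSeries.C.comp (limitB : QB →+* OB))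
      (f := PowerSeries.C.comp (limitB : QB →+* OB)) ?_ ?_ ?_ ?_
    · intro a b
      have := QB.flow_skew.comp_left (PowerSeries.map (limitB : QB →+* OB)) a b
      simp only [RingHom.coe_comp, Function.comp_apply, PowerSeries.map_C] at this
      exact this
    · intro a b
      exact OB.qFlow.skew.comp_right (limitB : QB →+* OB) a b
    · refine (map_serMap (PowerSeries.map (limitB : QB →+* OB))
        (QB.flow : QB →+ QB⟦X⟧) _).symm.trans
        (.trans ?_ (serMap_map (flowDer OB.der : OB →+ OB⟦X⟧) (limitB : QB →+* OB) _))
      rw [QB.flow_u, map_flowU, map_limitB_u, map_limitB_m, OB.qFlow.on_u]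
    · refine (map_serMap (PowerSeries.map (limitB : QB →+* OB))
        (QB.flow : QB →+ QB⟦X⟧) _).symm.trans
        (.trans ?_ (serMap_map (flowDer OB.der : OB →+ OB⟦X⟧) (limitB : QB →+* OB) _))
      rw [QB.flow_m, map_flowM, map_limitB_u, map_limitB_m, OB.qFlow.on_m]
  exact LinearMap.congr_fun this x

/-! ### The classical flows on the larger space -/

section PolyPart
variable {R : Type} [CommRing R]

/-- For `f = ∑ f_i λ^{-i}`, the generating series in `μ⁻¹` of the parts of the `λ^n f` with positive
powers of `λ`. The outer variable is `λ` and the inner one is `μ⁻¹`. -/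
def polyPart (f : R⟦X⟧) : R⟦X⟧⟦X⟧ :=
  PowerSeries.mk fun j => PowerSeries.mk fun n =>
    if 1 ≤ j ∧ j ≤ n then coeff (n - j) f else 0

theorem coeff_polyPart (f : R⟦X⟧) (j n : ℕ) :
    coeff n (coeff j (polyPart f)) =
      if 1 ≤ j ∧ j ≤ n then coeff (n - j) f else 0 := by
  simp [polyPart]

theorem mul_polyPart (f : R⟦X⟧) :
    (1 - X * PowerSeries.C X) * polyPart f =
      X * PowerSeries.C X * PowerSeries.C f := by
  rw [sub_mul, one_mul, mul_assoc, mul_assoc, ← map_mul]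
  ext j n
  rcases j with _ | j
  · simpa [PowerSeries.coeff_zero_X_mul] using (coeff_polyPart f 0 n).trans (if_neg (by simp))
  rw [map_sub, map_sub, PowerSeries.coeff_succ_X_mul, PowerSeries.coeff_succ_X_mul,
    PowerSeries.coeff_C_mul, PowerSeries.coeff_C, coeff_polyPart]
  rcases n with _ | n
  · simp [PowerSeries.coeff_zero_X_mul]
    split_ifs <;> simp
  · rw [PowerSeries.coeff_succ_X_mul, coeff_polyPart]
    rcases j with _ | j
    · simp [PowerSeries.coeff_succ_X_mul]
    · simp

/-- The part of `λ^n f` with positive powers of `λ`. -/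
def posPart (n : ℕ) (f : R⟦X⟧) : R[X] :=
  ∑ i ∈ Finset.range n, Polynomial.monomial (n - i) (coeff i f)

theorem coeff_posPart (n : ℕ) (f : R⟦X⟧) (j : ℕ) : (posPart n f).coeff j =
    if 1 ≤ j ∧ j ≤ n then coeff (n - j) f else 0 := by
  rw [posPart, Polynomial.finsetSum_coeff]
  simp only [Polynomial.coeff_monomial]
  split_ifs with h
  · rw [Finset.sum_eq_single (n - j)]
    · rw [if_pos (by omega)]
    · intro i hi hij
      rw [Finset.mem_range] at hi
      rw [if_neg (by omega)]
    · intro h'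
      exact absurd (Finset.mem_range.2 (by omega)) h'
  · refine Finset.sum_eq_zero fun i hi => ?_
    rw [Finset.mem_range] at hi
    rw [if_neg (by omega)]

theorem coeff_polyPart_mul (f s : R⟦X⟧) (n r : ℕ) :
    coeff n (coeff r (polyPart f * PowerSeries.map PowerSeries.C s)) =
      coeff r ((posPart n f : R⟦X⟧) * s) := by
  rw [PowerSeries.coeff_mul, map_sum, PowerSeries.coeff_mul]
  refine Finset.sum_congr rfl fun p _ => ?_
  rw [PowerSeries.coeff_map, PowerSeries.coeff_mul_C, coeff_polyPart, Polynomial.coeff_coe,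
    coeff_posPart]

end PolyPart

theorem coeff_C_mul_map_C {R : Type} [CommRing R] (f s : R⟦X⟧) (n r : ℕ) :
    coeff n (coeff r (PowerSeries.C f * PowerSeries.map PowerSeries.C s)) =
      coeff n f * coeff r s := by
  rw [PowerSeries.coeff_C_mul, PowerSeries.coeff_map, PowerSeries.coeff_mul_C]

/-- The series `v` over the function algebra. -/
def OBN.V : OBN⟦X⟧ := negInvAdd (genSer OBN.u) (genSer OBN.m)

/-- The series `1 / 2 + u v` over the function algebra. -/
def OBN.W : OBN⟦X⟧ :=
  PowerSeries.C (algebraMap ℂ OBN (1 / 2)) + genSer OBN.u * OBN.V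

theorem OBN.constantCoeff_V : constantCoeff OBN.V = 0 := by
  simp [OBN.V, negInvAdd]

/-- The classical flows on the larger space: on `u`, `m` they are the classical limit of `H(μ)`,
and on `N₊` the left translation by the component of `b⁻¹ diag(λ^n, -λ^n) b / 2` in the Lie
algebra of `N₊`. The generating series of these components are geometric series, summed here by
the factor `1 - λ μ⁻¹`. -/
theorem OBN.exists_flow : ∃ d : ℕ → Derivation ℂ OBN OBN,
    QFlow (genSer OBN.u) (genSer OBN.m) (flowDer d : OBN →+ OBN⟦X⟧) ∧
    (∀ j, (1 - X * PowerSeries.C X) *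
        serMap (flowDer d : OBN →+ OBN⟦X⟧) (OBN.aSer 0 j) =
      X * PowerSeries.C X *
          (PowerSeries.C OBN.W * PowerSeries.map PowerSeries.C (OBN.aSer 0 j))
        + PowerSeries.C OBN.V * PowerSeries.map PowerSeries.C (OBN.aSer 1 j)) ∧
    (∀ j, (1 - X * PowerSeries.C X) *
        serMap (flowDer d : OBN →+ OBN⟦X⟧) (OBN.aSer 1 j) =
      -(X * PowerSeries.C X *
          (PowerSeries.C (genSer OBN.u * (1 + genSer OBN.u * OBN.V)) *
            PowerSeries.map PowerSeries.C (OBN.aSer 0 j)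
        + PowerSeries.C OBN.W * PowerSeries.map PowerSeries.C (OBN.aSer 1 j)))) ∧
    (∀ k j r, d k (OBN.a 0 j r) =
      coeff r ((posPart (k + 1) OBN.W : OBN⟦X⟧) * OBN.aSer 0 j +
        ((posPart (k + 1) OBN.V + Polynomial.C (coeff (k + 1) OBN.V) :) : OBN⟦X⟧) *
          OBN.aSer 1 j)) ∧
    ∀ k j r, d k (OBN.a 1 j r) =
      coeff r
        ((posPart (k + 1) (-(genSer OBN.u * (1 + genSer OBN.u * OBN.V))) : OBN⟦X⟧) *
          OBN.aSer 0 j - (posPart (k + 1) OBN.W : OBN⟦X⟧) * OBN.aSer 1 j) := by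
  choose d hu hm h0 h1 using fun k => OBN.exists_derivation
    (fun i => (-1) ^ i *
      coeff (k + 1) (coeff i (flowU (genSer OBN.u) (genSer OBN.m))))
    (fun i => (-1) ^ i *
      coeff (k + 1) (coeff i (flowM (genSer OBN.u) (genSer OBN.m))))
    (A := posPart (k + 1) OBN.W)
    (B := posPart (k + 1) OBN.V + Polynomial.C (coeff (k + 1) OBN.V))
    (C := posPart (k + 1) (-(genSer OBN.u * (1 + genSer OBN.u * OBN.V))))
    (by rw [coeff_posPart, if_neg (by simp)])
    (by rw [coeff_posPart, if_neg (by simp)])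
  have z : ∀ (f s : OBN⟦X⟧) (r : ℕ), constantCoeff (coeff r
      (polyPart f * PowerSeries.map PowerSeries.C s)) = 0 := fun f s r => by
    rw [← PowerSeries.coeff_zero_eq_constantCoeff_apply, coeff_polyPart_mul, posPart]
    simp
  have e0 : ∀ j, serMap (flowDer d : OBN →+ OBN⟦X⟧) (OBN.aSer 0 j) =
      polyPart OBN.W * PowerSeries.map PowerSeries.C (OBN.aSer 0 j) +
        (polyPart OBN.V * PowerSeries.map PowerSeries.C (OBN.aSer 1 j) +
        PowerSeries.C OBN.V * PowerSeries.map PowerSeries.C (OBN.aSer 1 j)) := fun j => by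
    ext1 r
    rw [coeff_serMap, OBN.aSer, PowerSeries.coeff_mk]
    refine flowDer_eq ?_ fun k => ?_
    · rw [map_add, map_add, map_add, map_add, z, z, PowerSeries.coeff_C_mul, map_mul,
        OBN.constantCoeff_V]
      ring
    · rw [h0, map_add, map_add, map_add, map_add, map_add, coeff_polyPart_mul,
        coeff_polyPart_mul, coeff_C_mul_map_C, Polynomial.coe_add, add_mul, map_add,
        Polynomial.coe_C, PowerSeries.coeff_C_mul]
      rfl
  have e1 : ∀ j, serMap (flowDer d : OBN →+ OBN⟦X⟧) (OBN.aSer 1 j) =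
      polyPart (-(genSer OBN.u * (1 + genSer OBN.u * OBN.V))) *
          PowerSeries.map PowerSeries.C (OBN.aSer 0 j) -
        polyPart OBN.W * PowerSeries.map PowerSeries.C (OBN.aSer 1 j) := fun j => by
    ext1 r
    rw [coeff_serMap, OBN.aSer, PowerSeries.coeff_mk]
    refine flowDer_eq ?_ fun k => ?_
    · rw [map_sub, map_sub, z, z, sub_zero]
    · rw [h1, map_sub, map_sub, map_sub, coeff_polyPart_mul, coeff_polyPart_mul]
      rfl
  refine ⟨d, { QRel.of_comm OBN.qp_smul _ _ with
    skew := flowDer_skew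
    on_u := serMap_flowDer (map_constantCoeff_flowU _ _) hu
    on_m := serMap_flowDer (map_constantCoeff_flowM _ _) hm }, fun j => ?_, fun j => ?_, h0, h1⟩
  · rw [e0]
    linear_combination mul_polyPart OBN.W * PowerSeries.map PowerSeries.C (OBN.aSer 0 j) +
      mul_polyPart OBN.V * PowerSeries.map PowerSeries.C (OBN.aSer 1 j)
  · rw [e1]
    have e := mul_polyPart (-(genSer OBN.u * (1 + genSer OBN.u * OBN.V)))
    rw [map_neg] at e
    linear_combination e *
        PowerSeries.map PowerSeries.C (OBN.aSer 0 j) -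
      mul_polyPart OBN.W * PowerSeries.map PowerSeries.C (OBN.aSer 1 j)

/-- The classical flows on `ℂ[H₋\B₋N₊]`; `OBN.der k` corresponds to
`diag(λ^{k+1}, -λ^{k+1}) / 2`. -/
def OBN.der : ℕ → Derivation ℂ OBN OBN := OBN.exists_flow.choose

theorem OBN.qFlow : QFlow (genSer OBN.u) (genSer OBN.m) (flowDer OBN.der : OBN →+ OBN⟦X⟧) :=
  OBN.exists_flow.choose_spec.1

theorem OBN.flow_a_zero (j : Fin 2) : (1 - X * PowerSeries.C X) *
        serMap (flowDer OBN.der : OBN →+ OBN⟦X⟧) (OBN.aSer 0 j) =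
      X * PowerSeries.C X *
          (PowerSeries.C OBN.W * PowerSeries.map PowerSeries.C (OBN.aSer 0 j))
        + PowerSeries.C OBN.V * PowerSeries.map PowerSeries.C (OBN.aSer 1 j) :=
  OBN.exists_flow.choose_spec.2.1 j

theorem OBN.flow_a_one (j : Fin 2) : (1 - X * PowerSeries.C X) *
        serMap (flowDer OBN.der : OBN →+ OBN⟦X⟧) (OBN.aSer 1 j) =
      -(X * PowerSeries.C X *
          (PowerSeries.C (genSer OBN.u * (1 + genSer OBN.u * OBN.V)) *
            PowerSeries.map PowerSeries.C (OBN.aSer 0 j)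
        + PowerSeries.C OBN.W * PowerSeries.map PowerSeries.C (OBN.aSer 1 j))) :=
  OBN.exists_flow.choose_spec.2.2.1 j

theorem OBN.der_a_zero (k : ℕ) (j : Fin 2) (r : ℕ) : OBN.der k (OBN.a 0 j r) =
      coeff r ((posPart (k + 1) OBN.W : OBN⟦X⟧) * OBN.aSer 0 j +
        ((posPart (k + 1) OBN.V + Polynomial.C (coeff (k + 1) OBN.V) :) : OBN⟦X⟧) *
          OBN.aSer 1 j) :=
  OBN.exists_flow.choose_spec.2.2.2.1 k j r

theorem OBN.der_a_one (k : ℕ) (j : Fin 2) (r : ℕ) : OBN.der k (OBN.a 1 j r) =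
      coeff r
        ((posPart (k + 1) (-(genSer OBN.u * (1 + genSer OBN.u * OBN.V))) : OBN⟦X⟧) *
          OBN.aSer 0 j - (posPart (k + 1) OBN.W : OBN⟦X⟧) * OBN.aSer 1 j) :=
  OBN.exists_flow.choose_spec.2.2.2.2 k j r

theorem OBN.a_const_zero_zero : OBN.a 0 0 0 = 1 := Subtype.ext (funext fun p => p.2.2.1)
theorem OBN.a_const_one_zero : OBN.a 1 0 0 = 0 := Subtype.ext (funext fun p => p.2.2.2.1)
theorem OBN.a_const_one_one : OBN.a 1 1 0 = 1 := Subtype.ext (funext fun p => p.2.2.2.2)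

theorem OBN.flow_Sm : flowDer OBN.der (OBN.S (-1)) = negInvAdd (genSer OBN.u) (genSer OBN.m) := by
  have e := congrArg (coeff 0) (OBN.flow_a_zero 1)
  rw [sub_mul, one_mul, mul_assoc, mul_assoc, map_sub, map_add, PowerSeries.coeff_zero_X_mul,
    PowerSeries.coeff_zero_X_mul, coeff_serMap, PowerSeries.coeff_C_mul, PowerSeries.coeff_map,
    OBN.aSer, OBN.aSer, PowerSeries.coeff_mk, PowerSeries.coeff_mk, OBN.a_const_one_one, map_one,
    sub_zero, zero_add, mul_one] at e
  rw [OBN.S, if_neg (by decide)]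
  exact e

theorem OBN.flow_Sp : flowDer OBN.der (OBN.S 1) = negInvAdd (genSer OBN.m) (genSer OBN.u) := by
  have e := congrArg (coeff 1) (OBN.flow_a_one 0)
  rw [sub_mul, one_mul, mul_assoc, mul_assoc, map_sub, map_neg, PowerSeries.coeff_succ_X_mul,
    PowerSeries.coeff_succ_X_mul, PowerSeries.coeff_C_mul, PowerSeries.coeff_C_mul, map_add,
    PowerSeries.coeff_C_mul, PowerSeries.coeff_C_mul, coeff_serMap, coeff_serMap,
    PowerSeries.coeff_map, PowerSeries.coeff_map,
    OBN.aSer, OBN.aSer, PowerSeries.coeff_mk, PowerSeries.coeff_mk, PowerSeries.coeff_mk,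
    OBN.a_const_zero_zero, OBN.a_const_one_zero, map_zero, map_zero, map_one,
    mul_zero, mul_zero, sub_zero, add_zero, mul_one] at e
  rw [OBN.S, if_pos rfl, negInvAdd_eq' OBN.qFlow.toQRel]
  refine e.trans ?_
  rw [OBN.V]
  ring

theorem map_limitBN_u : PowerSeries.map (limitBN : QBN →+* OBN) (genSer QBN.u) = genSer OBN.u :=
  (map_genSer _ _).trans (congrArg genSer (funext limitBN_u))

theorem map_limitBN_m : PowerSeries.map (limitBN : QBN →+* OBN) (genSer QBN.m) = genSer OBN.m :=
  (map_genSer _ _).trans (congrArg genSer (funext limitBN_m))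

theorem map_limitBN_flow (x : QBN) :
    PowerSeries.map (limitBN : QBN →+* OBN) (QBN.flow x) = flowDer OBN.der (limitBN x) := by
  have : (mapLin limitBN).comp QBN.flow = (flowDer OBN.der).comp limitBN.toLinearMap := by
    refine QBN.skew_ext (g := PowerSeries.C.comp (limitBN : QBN →+* OBN))
      (f := PowerSeries.C.comp (limitBN : QBN →+* OBN)) ?_ ?_ ?_ ?_ ?_
    · intro a b
      have := QBN.flow_skew.comp_left (PowerSeries.map (limitBN : QBN →+* OBN)) a b
      simp only [RingHom.coe_comp, Function.comp_apply, PowerSeries.map_C] at this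
      exact this
    · intro a b
      exact OBN.qFlow.skew.comp_right (limitBN : QBN →+* OBN) a b
    · refine (map_serMap (PowerSeries.map (limitBN : QBN →+* OBN))
        (QBN.flow : QBN →+ QBN⟦X⟧) _).symm.trans
        (.trans ?_ (serMap_map (flowDer OBN.der : OBN →+ OBN⟦X⟧) (limitBN : QBN →+* OBN) _))
      rw [QBN.flow_u, map_flowU, map_limitBN_u, map_limitBN_m, OBN.qFlow.on_u]
    · refine (map_serMap (PowerSeries.map (limitBN : QBN →+* OBN))
        (QBN.flow : QBN →+ QBN⟦X⟧) _).symm.trans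
        (.trans ?_ (serMap_map (flowDer OBN.der : OBN →+ OBN⟦X⟧) (limitBN : QBN →+* OBN) _))
      rw [QBN.flow_m, map_flowM, map_limitBN_u, map_limitBN_m, OBN.qFlow.on_m]
    · intro ε
      change PowerSeries.map (limitBN : QBN →+* OBN) (QBN.flow (QBN.S ε)) =
        flowDer OBN.der (limitBN (QBN.S ε))
      rw [limitBN_S]
      rcases Int.units_eq_one_or ε with rfl | rfl
      · rw [QBN.flow_Sp, map_negInvAdd, map_limitBN_u, map_limitBN_m, OBN.flow_Sp]
      · rw [QBN.flow_Sm, map_negInvAdd, map_limitBN_u, map_limitBN_m, OBN.flow_Sm]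
  exact LinearMap.congr_fun this x

/-! ### Zero curvature and commutativity of the classical flows -/

section ZeroCurvature
variable {T : Type*} [CommRing T] {l x y k ux vx uy vy dx dy dv a b a₁ b₁ a₂ b₂ p p' : T}

/-- The commutativity of two flows on the upper entry `a` of a column `(a, b)` of a matrix in
`N₊`, with denominators cleared: the zero curvature equation. Here `x`, `y` are `μ₁⁻¹`, `μ₂⁻¹`,
`l` is the polynomial variable, `k` is `1 / 2`, and `p`, `p'` are the two mixed second
derivatives. -/
theorem zero_curvature_top (hk : 2 * k = 1)
    (hdy : (y - x) * dy = (y * uy - x * ux) * vx * uy - x * (uy - ux) * (1 + vx * ux))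
    (hdx : (x - y) * dx = (x * ux - y * uy) * vy * ux - y * (ux - uy) * (1 + vy * uy))
    (hdv : (y - x) * dv = x * vy - y * vx - y * (vy * uy * vx + vx * uy * vy)
      + x * (vx * ux * vy + vy * ux * vx))
    (ha₁ : (1 - l * x) * a₁ = l * x * ((k + ux * vx) * a) + vx * b)
    (hb₁ : (1 - l * x) * b₁ = -(l * x * (ux * (1 + ux * vx) * a + (k + ux * vx) * b)))
    (ha₂ : (1 - l * y) * a₂ = l * y * ((k + uy * vy) * a) + vy * b)
    (hb₂ : (1 - l * y) * b₂ = -(l * y * (uy * (1 + uy * vy) * a + (k + uy * vy) * b)))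
    (hp : p - l * (y * p) = l * (y * ((dy * vy + uy * dv) * a + (k + uy * vy) * a₁))
      + (dv * b + vy * b₁))
    (hp' : p' - l * (x * p') = l * (x * ((dx * vx + ux * dv) * a + (k + ux * vx) * a₂))
      + (dv * b + vx * b₂)) :
    (y - x) * ((1 - l * x) * ((1 - l * y) * p)) = (y - x) * ((1 - l * x) * ((1 - l * y) * p')) := by
  linear_combination (y - x) * (1 - l * x) * hp - (y - x) * (1 - l * y) * hp'
    + (1 - l * x) * (l * y * a * (vy * hdy + uy * hdv) + b * hdv)
    - (1 - l * y) * (l * x * a * (-vx * hdx + ux * hdv) + b * hdv)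
    + (y - x) * (l * y * (k + uy * vy) * ha₁ + vy * hb₁)
    - (y - x) * (l * x * (k + ux * vx) * ha₂ + vx * hb₂)
    - hk * l * b * (y - x) * (x * vy - y * vx)

theorem zero_curvature_bottom (hk : 2 * k = 1)
    (hdy : (y - x) * dy = (y * uy - x * ux) * vx * uy - x * (uy - ux) * (1 + vx * ux))
    (hdx : (x - y) * dx = (x * ux - y * uy) * vy * ux - y * (ux - uy) * (1 + vy * uy))
    (hdv : (y - x) * dv = x * vy - y * vx - y * (vy * uy * vx + vx * uy * vy)
      + x * (vx * ux * vy + vy * ux * vx))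
    (ha₁ : (1 - l * x) * a₁ = l * x * ((k + ux * vx) * a) + vx * b)
    (hb₁ : (1 - l * x) * b₁ = -(l * x * (ux * (1 + ux * vx) * a + (k + ux * vx) * b)))
    (ha₂ : (1 - l * y) * a₂ = l * y * ((k + uy * vy) * a) + vy * b)
    (hb₂ : (1 - l * y) * b₂ = -(l * y * (uy * (1 + uy * vy) * a + (k + uy * vy) * b)))
    (hp : p - l * (y * p) = -(l * (y * (dy * ((1 + uy * vy) * a)
      + uy * ((dy * vy + uy * dv) * a + (1 + uy * vy) * a₁)
      + ((dy * vy + uy * dv) * b + (k + uy * vy) * b₁)))))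
    (hp' : p' - l * (x * p') = -(l * (x * (dx * ((1 + ux * vx) * a)
      + ux * ((dx * vx + ux * dv) * a + (1 + ux * vx) * a₂)
      + ((dx * vx + ux * dv) * b + (k + ux * vx) * b₂))))) :
    (y - x) * ((1 - l * x) * ((1 - l * y) * p)) = (y - x) * ((1 - l * x) * ((1 - l * y) * p')) := by
  linear_combination (y - x) * (1 - l * x) * hp - (y - x) * (1 - l * y) * hp'
    - l * y * (1 - l * x) * (a * ((1 + 2 * uy * vy) * hdy + uy ^ 2 * hdv)
      + b * (vy * hdy + uy * hdv))
    + l * x * (1 - l * y) * (a * (-(1 + 2 * ux * vx) * hdx + ux ^ 2 * hdv)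
      + b * (-vx * hdx + ux * hdv))
    - (y - x) * (l * y * (uy * (1 + uy * vy) * ha₁ + (k + uy * vy) * hb₁))
    + (y - x) * (l * x * (ux * (1 + ux * vx) * ha₂ + (k + ux * vx) * hb₂))
    + hk * l ^ 2 * a * y * x * (x - y) * (uy * (1 + uy * vy) - ux * (1 + ux * vx))

end ZeroCurvature

theorem cancel_zero_curvature {A : Type*} [CommRing A] {p p' : A⟦X⟧⟦X⟧⟦X⟧}
    (h : (C X - C (C X)) *
        ((1 - X * C (C X)) *
          ((1 - X * C X) * p)) =
      (C X - C (C X)) *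
        ((1 - X * C (C X)) *
          ((1 - X * C X) * p'))) : p = p' := by
  have r : Reg (C X - C (C X) :
      A⟦X⟧⟦X⟧⟦X⟧) := by
    rw [← map_sub]
    exact reg_X.X_sub_C.C
  have u : ∀ c : A⟦X⟧⟦X⟧, IsUnit (1 - X * C c) := fun c => by
    rw [sub_eq_add_neg, ← mul_neg]
    exact isUnit_one_add_X_mul _
  exact (u _).mul_left_cancel ((u _).mul_left_cancel (r.cancel h))

set_option maxHeartbeats 2000000 in
theorem OBN.swap_a (j : Fin 2) :
    PowerSeries.map serSwap (serMap (serMap (flowDer OBN.der : OBN →+ OBN⟦X⟧))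
      (serMap (flowDer OBN.der : OBN →+ OBN⟦X⟧) (OBN.aSer 0 j))) =
    serMap (serMap (flowDer OBN.der : OBN →+ OBN⟦X⟧))
      (serMap (flowDer OBN.der : OBN →+ OBN⟦X⟧) (OBN.aSer 0 j)) ∧
    PowerSeries.map serSwap (serMap (serMap (flowDer OBN.der : OBN →+ OBN⟦X⟧))
      (serMap (flowDer OBN.der : OBN →+ OBN⟦X⟧) (OBN.aSer 1 j))) =
    serMap (serMap (flowDer OBN.der : OBN →+ OBN⟦X⟧))
      (serMap (flowDer OBN.der : OBN →+ OBN⟦X⟧) (OBN.aSer 1 j)) := by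
  have h := OBN.qFlow
  have X₁ : serMap (flowDer OBN.der : OBN →+ OBN⟦X⟧) X = 0 := by
    rw [← mul_one X, serMap_X_mul, h.skew.serMap.map_one, mul_zero]
  have X₂ : serMap (serMap (flowDer OBN.der : OBN →+ OBN⟦X⟧)) X = 0 := by
    rw [← mul_one X, serMap_X_mul, h.skew.serMap.serMap.map_one, mul_zero]
  have one : serMap (serMap (flowDer OBN.der : OBN →+ OBN⟦X⟧)) 1 = 0 := h.skew.serMap.serMap.map_one
  have k0 : (flowDer OBN.der : OBN →+ OBN⟦X⟧) (algebraMap ℂ OBN (1 / 2)) = 0 := by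
    refine flowDer_eq (by simp) fun k => ?_
    rw [Derivation.map_algebraMap, map_zero]
  have dW : serMap (flowDer OBN.der : OBN →+ OBN⟦X⟧) OBN.W =
      flowU (genSer OBN.u) (genSer OBN.m) * PowerSeries.map C OBN.V +
        PowerSeries.map C (genSer OBN.u) *
          serMap (flowDer OBN.der : OBN →+ OBN⟦X⟧) OBN.V := by
    rw [OBN.W, map_add, serMap_C, k0, map_zero, zero_add, h.skewSer, h.on_u]
  have sV : serSwap (serMap (flowDer OBN.der : OBN →+ OBN⟦X⟧) OBN.V) =
      serMap (flowDer OBN.der : OBN →+ OBN⟦X⟧) OBN.V := h.serSwap_v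
  have hV : negInvAdd (genSer OBN.u) (genSer OBN.m) = OBN.V := rfl
  have hk : (2 : OBN⟦X⟧⟦X⟧⟦X⟧) * C (C (C
      (algebraMap ℂ OBN (1 / 2)))) = 1 := by
    have : (2 : OBN) * algebraMap ℂ OBN (1 / 2) = 1 := by
      rw [← map_ofNat (algebraMap ℂ OBN) 2, ← map_mul]
      norm_num
    have e := congrArg (fun s => C (C (C s)) :
      OBN → OBN⟦X⟧⟦X⟧⟦X⟧) this
    simpa only [map_mul, map_one, map_ofNat] using e
  have hdy := congrArg C (X_sub_mul_flowU (genSer OBN.u) (genSer OBN.m))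
  have hdx := congrArg (fun s => C (serSwap s))
    (X_sub_mul_flowU (genSer OBN.u) (genSer OBN.m))
  have hdv := congrArg C h.serMap_v
  simp only [hV, map_mul, map_sub, map_add, map_one, PowerSeries.map_X, serSwap_X, serSwap_C, serSwap_map_C]
    at hdy hdx hdv
  obtain ⟨ha₁, hb₁, ha₂, hb₂⟩ := And.intro
    (congrArg (PowerSeries.map C) (OBN.flow_a_zero j))
    (And.intro (congrArg (PowerSeries.map C) (OBN.flow_a_one j))
    (And.intro (congrArg (PowerSeries.map (PowerSeries.map C)) (OBN.flow_a_zero j))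
    (congrArg (PowerSeries.map (PowerSeries.map C)) (OBN.flow_a_one j))))
  have e₀ := congrArg (serMap (serMap (flowDer OBN.der : OBN →+ OBN⟦X⟧))) (OBN.flow_a_zero j)
  have e₁ := congrArg (serMap (serMap (flowDer OBN.der : OBN →+ OBN⟦X⟧))) (OBN.flow_a_one j)
  simp only [sub_mul, one_mul, mul_assoc, map_sub, map_add, map_neg, h.skewSer₂, h.mu₂, serMap_C, map_mul, PowerSeries.map_X, PowerSeries.map_C, map_map_C_map_C,
    dW, X₁, X₂, map_zero, zero_mul, zero_add, h.on_u, one, map_one] at e₀ e₁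
  have e₀' := congrArg (PowerSeries.map serSwap) e₀
  have e₁' := congrArg (PowerSeries.map serSwap) e₁
  have hW : ∀ f : OBN⟦X⟧ →+* OBN⟦X⟧⟦X⟧, f OBN.W = f (C (algebraMap ℂ OBN (1 / 2))) +
      f (genSer OBN.u) * f OBN.V := fun f => by rw [OBN.W, map_add, map_mul]
  have hW₁ := hW C
  have hW₂ := hW (PowerSeries.map C)
  rw [PowerSeries.map_C] at hW₂
  simp only [map_sub, map_add, map_mul, map_neg, map_one, PowerSeries.map_X, PowerSeries.map_C,
    serSwap_X, serSwap_C, serSwap_map_C, map_serSwap_map_C, sV,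
    map_map_C_map_C, hW₁, hW₂] at e₀ e₁ e₀' e₁' ha₁ hb₁ ha₂ hb₂
  refine ⟨(cancel_zero_curvature (zero_curvature_top hk hdy hdx hdv
    ha₁ hb₁ ha₂ hb₂ e₀ e₀')).symm,
    (cancel_zero_curvature (zero_curvature_bottom hk hdy hdx hdv
    ha₁ hb₁ ha₂ hb₂ e₁ e₁')).symm⟩

theorem OBN.der_comm (k l : ℕ) : ⁅OBN.der k, OBN.der l⁆ = 0 := by
  refine derivation_eq_zero _ ?_
  rintro _ ((⟨i, rfl⟩ | ⟨i, rfl⟩) | ⟨⟨s, j, r⟩, rfl⟩)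
  · exact OBN.qFlow.comm_u k l i
  · exact OBN.qFlow.comm_m k l i
  · refine comm_of_swapDefect (f := OBN.a s j r) ?_ k l
    have : serMap (QFlow.swapDefect (flowDer OBN.der) : OBN →+ OBN⟦X⟧⟦X⟧) (OBN.aSer s j) = 0 := by
      rw [QFlow.serMap_swapDefect, sub_eq_zero]
      fin_cases s
      exacts [(OBN.swap_a j).1, (OBN.swap_a j).2]
    have e := congrArg (coeff r) this
    rwa [coeff_serMap, OBN.aSer, PowerSeries.coeff_mk, map_zero] at e

/-! ### Separation of powers of `λ`, and the velocities of `u` and `m` -/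

section Split
variable {R : Type} [CommRing R]

/-- The part of `λ^n f` without positive powers of `λ`. -/
def shiftSer (n : ℕ) (f : R⟦X⟧) : R⟦X⟧ := PowerSeries.mk fun i => coeff (i + n) f

theorem coeff_shiftSer (n i : ℕ) (f : R⟦X⟧) :
    coeff i (shiftSer n f) = coeff (i + n) f := by simp [shiftSer]

theorem shiftSer_eq (n : ℕ) (f : R⟦X⟧) : shiftSer n f =
    PowerSeries.C (coeff n f) + X * shiftSer (n + 1) f := by
  ext i
  cases i with
  | zero => simp [shiftSer]
  | succ i =>
    rw [coeff_shiftSer, map_add, PowerSeries.coeff_succ_X_mul, coeff_shiftSer, PowerSeries.coeff_C,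
      if_neg (Nat.succ_ne_zero i), zero_add, add_right_comm, add_assoc]

theorem posPart_succ (n : ℕ) (f : R⟦X⟧) : posPart (n + 1) f =
    Polynomial.X * (posPart n f + Polynomial.C (coeff n f)) := by
  ext j
  cases j with
  | zero => simp [coeff_posPart]
  | succ j =>
    rw [Polynomial.coeff_X_mul, Polynomial.coeff_add, Polynomial.coeff_C, coeff_posPart,
      coeff_posPart]
    rcases j with _ | j
    · simp
    · simp

theorem polyToLaurent_X_mul :
    polyToLaurent R Polynomial.X * HahnSeries.ofPowerSeries ℤ R X = 1 := by
  rw [polyToLaurent, Polynomial.coe_eval₂RingHom, Polynomial.eval₂_X, HahnSeries.ofPowerSeries_X,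
    HahnSeries.single_mul_single]
  simp

theorem polyToLaurent_C (r : R) : polyToLaurent R (Polynomial.C r) = HahnSeries.C r := by
  rw [polyToLaurent, Polynomial.coe_eval₂RingHom, Polynomial.eval₂_C]

theorem X_pow_mul_eq (n : ℕ) (f : R⟦X⟧) :
    polyToLaurent R (Polynomial.X ^ n) * HahnSeries.ofPowerSeries ℤ R f =
      HahnSeries.ofPowerSeries ℤ R (shiftSer n f) + polyToLaurent R (posPart n f) := by
  induction n with
  | zero =>
    have : shiftSer 0 f = f := by ext; simp [shiftSer]
    rw [this, posPart]
    simp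
  | succ n ih =>
    rw [shiftSer_eq, map_add, map_mul, HahnSeries.ofPowerSeries_C] at ih
    rw [posPart_succ, map_mul, map_add, polyToLaurent_C, pow_succ', map_mul]
    linear_combination polyToLaurent R Polynomial.X * ih +
      HahnSeries.ofPowerSeries ℤ R (shiftSer (n + 1) f) * polyToLaurent_X_mul (R := R)

theorem map_shiftSer {R' : Type} [CommRing R'] (φ : R →+* R') (n : ℕ) (f : R⟦X⟧) :
    PowerSeries.map φ (shiftSer n f) = shiftSer n (PowerSeries.map φ f) := by
  ext; simp [shiftSer]

theorem map_posPart {R' : Type} [CommRing R'] (φ : R →+* R') (n : ℕ) (f : R⟦X⟧) :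
    (posPart n f).map φ = posPart n (PowerSeries.map φ f) := by
  simp [posPart, Polynomial.map_sum]

/-- The coefficient of `μ^{-n}` in a bivariate series. -/
def muCoeff (n : ℕ) : R⟦X⟧⟦X⟧ →+ R⟦X⟧ := serMap (coeff (R := R) n : R⟦X⟧ →+ R)

theorem coeff_muCoeff (n i : ℕ) (F : R⟦X⟧⟦X⟧) : coeff i (muCoeff n F) =
    coeff n (coeff i F) := coeff_serMap _ i F

theorem muCoeff_mul (n : ℕ) (s : R⟦X⟧) (F : R⟦X⟧⟦X⟧) :
    muCoeff n (PowerSeries.map PowerSeries.C s * F) = s * muCoeff n F := by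
  ext i
  simp only [coeff_muCoeff, PowerSeries.coeff_mul, map_sum, PowerSeries.coeff_map]
  refine Finset.sum_congr rfl fun p _ => ?_
  rw [← PowerSeries.coeff_mul, PowerSeries.coeff_C_mul]

theorem muCoeff_divDiff (k : ℕ) (s : R⟦X⟧) :
    muCoeff (k + 1) (PowerSeries.C X * divDiff s) = shiftSer (k + 1) s := by
  ext i
  rw [coeff_muCoeff, PowerSeries.coeff_C_mul, PowerSeries.coeff_succ_X_mul, coeff_shiftSer]
  simp [divDiff, add_assoc]

theorem muCoeff_divDiff_sub (k : ℕ) (s : R⟦X⟧) :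
    muCoeff (k + 1) (PowerSeries.C X * divDiff s - PowerSeries.C s) =
      X * shiftSer (k + 2) s := by
  rw [map_sub, muCoeff_divDiff, shiftSer_eq, muCoeff, serMap_C]
  exact add_sub_cancel_left _ _

end Split

section Velocity
variable {R : Type} [CommRing R] [Algebra Kq R]

/-- The velocity of `u` has the form `C + 2 u A - u² B` of an infinitesimal Möbius transformation,
with `(A, B; C, -A)` the component of `b⁻¹ diag(λ^n, -λ^n) b / 2` in the Lie algebra of `B₋`. -/
theorem flowU_eq (u m : R⟦X⟧) : flowU u m =
    -(PowerSeries.C X * divDiff (u * (1 + u * negInvAdd u m)))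
      + PowerSeries.map PowerSeries.C (2 * u) *
        (PowerSeries.C X * divDiff (u * negInvAdd u m))
      - PowerSeries.map PowerSeries.C (u ^ 2) *
        (PowerSeries.C X * divDiff (negInvAdd u m) - PowerSeries.C (negInvAdd u m)) := by
  refine Reg.cancel reg_X.X_sub_C ?_
  have h₁ := mul_divDiff (u * (1 + u * negInvAdd u m))
  have h₂ := mul_divDiff (u * negInvAdd u m)
  have h₃ := mul_divDiff (negInvAdd u m)
  rw [X_sub_mul_flowU]
  simp only [map_mul, map_add, map_one, map_pow, map_ofNat] at h₁ h₂ ⊢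
  linear_combination PowerSeries.C X * h₁
    - 2 * PowerSeries.map PowerSeries.C u * PowerSeries.C X * h₂
    + PowerSeries.map PowerSeries.C u ^ 2 * PowerSeries.C X * h₃

theorem X_mul_flowM_eq (hq : ∀ (n : ℤ) (a : R), qp n • a = a) (u m : R⟦X⟧) :
    X * flowM u m =
    -(PowerSeries.C X * divDiff (negInvAdd u m) - PowerSeries.C (negInvAdd u m))
      - PowerSeries.map PowerSeries.C (2 * X * m) *
        (PowerSeries.C X * divDiff (u * negInvAdd u m))
      - PowerSeries.map PowerSeries.C (X ^ 2 * m ^ 2) *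
        (PowerSeries.C X * divDiff (u * (1 + u * negInvAdd u m))) := by
  refine Reg.cancel reg_X.X_sub_C ?_
  have h₁ := mul_divDiff (u * (1 + u * negInvAdd u m))
  have h₂ := mul_divDiff (u * negInvAdd u m)
  have h₃ := mul_divDiff (negInvAdd u m)
  have hv : X * m * (1 + u * negInvAdd u m) = -negInvAdd u m := by
    linear_combination negInvAdd_mul_comm u m
  have hx := congrArg (PowerSeries.map (PowerSeries.C (R := R))) hv
  have hy := congrArg (PowerSeries.C (R := R⟦X⟧)) hv
  have hw := congrArg (PowerSeries.C (R := R⟦X⟧)) (negInvAdd_eq' (QRel.of_comm hq u m))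
  have e := X_sub_mul_flowM u m
  rw [hw] at e
  simp only [map_mul, map_add, map_neg, map_one, map_pow, map_ofNat, PowerSeries.map_X]
    at h₁ h₂ hx hy e ⊢
  generalize PowerSeries.map PowerSeries.C m = mx at *
  generalize PowerSeries.C m = my at *
  generalize PowerSeries.map PowerSeries.C u = ux at *
  generalize PowerSeries.C u = uy at *
  generalize PowerSeries.map PowerSeries.C (negInvAdd u m) = vx at *
  generalize PowerSeries.C (negInvAdd u m) = vy at *
  generalize (PowerSeries.C X : R⟦X⟧⟦X⟧) = y at *
  generalize (X : R⟦X⟧⟦X⟧) = x at *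
  linear_combination x * e + y * h₃ + 2 * x * mx * y * h₂ + x ^ 2 * mx ^ 2 * y * h₁
    - x * y * uy * (2 * mx - my) * hy - x * hy + (x * mx * y * ux + y) * hx

end Velocity

/-! ### The action of `h₊` and infinitesimal factorization -/

section Rho
variable {O : Type} [CommRing O] [Algebra ℂ O]

/-- The linear extension of `diag(λ^{k+1}, -λ^{k+1}) ↦ 2 d_k` to `h₊`. -/
def rhoOf (d : ℕ → Derivation ℂ O O) : hPlus →ₗ[ℂ] Derivation ℂ O O :=
  ((Polynomial.basisMonomials ℂ).constr ℂ fun k => (2 : ℂ) • d k) ∘ₗ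
    ({ Polynomial.divX_hom with map_smul' := fun c p => by ext; simp } : ℂ[X] →ₗ[ℂ] ℂ[X]) ∘ₗ
      hPlus.subtype

theorem rhoOf_apply (d : ℕ → Derivation ℂ O O) (a : hPlus) : rhoOf d a =
    (Polynomial.basisMonomials ℂ).constr ℂ (fun k => (2 : ℂ) • d k) a.1.divX := rfl

theorem constr_monomial (d : ℕ → Derivation ℂ O O) (k : ℕ) (c : ℂ) :
    (Polynomial.basisMonomials ℂ).constr ℂ (fun k => (2 : ℂ) • d k) (Polynomial.monomial k c) =
      c • (2 : ℂ) • d k := by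
  have : Polynomial.monomial k c = c • Polynomial.basisMonomials ℂ k := by
    rw [Polynomial.coe_basisMonomials, Polynomial.smul_monomial, smul_eq_mul, mul_one]
  rw [this, map_smul, Module.Basis.constr_basis]

theorem rhoOf_hGen (d : ℕ → Derivation ℂ O O) (k : ℕ) :
    rhoOf d (hGen ⟨k + 1, k.succ_pos⟩) = (2 : ℂ) • d k := by
  have : (Polynomial.X ^ (k + 1) : ℂ[X]).divX = Polynomial.monomial k 1 := by
    rw [Polynomial.divX_X_pow, if_neg k.succ_ne_zero, Nat.add_sub_cancel,
      Polynomial.X_pow_eq_monomial]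
  rw [rhoOf_apply]
  change (Polynomial.basisMonomials ℂ).constr ℂ (fun k => (2 : ℂ) • d k)
    (Polynomial.X ^ (k + 1) : ℂ[X]).divX = _
  rw [this, constr_monomial, one_smul]

theorem rhoOf_induction (d : ℕ → Derivation ℂ O O) {P : ℂ[X] → Derivation ℂ O O → Prop}
    (add : ∀ a b D E, P a D → P b E → P (a + b) (D + E))
    (smul : ∀ (c : ℂ) a D, P a D → P (Polynomial.C c * a) (c • D))
    (mono : ∀ k, P (Polynomial.X ^ (k + 1)) ((2 : ℂ) • d k)) (a : hPlus) : P a.1 (rhoOf d a) := by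
  have key : ∀ g : ℂ[X], P (Polynomial.X * g)
      ((Polynomial.basisMonomials ℂ).constr ℂ (fun k => (2 : ℂ) • d k) g) := by
    intro g
    induction g using Polynomial.induction_on' with
    | add p q hp hq =>
      rw [mul_add, map_add]
      exact add _ _ _ _ hp hq
    | monomial k c =>
      rw [constr_monomial, ← Polynomial.C_mul_X_pow_eq_monomial, mul_left_comm, ← pow_succ']
      exact smul _ _ _ (mono k)
  have h0 : a.1.coeff 0 = 0 := a.2
  have e := Polynomial.X_mul_divX_add a.1
  rw [h0, map_zero, add_zero] at e
  have := key a.1.divX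
  rwa [e] at this

theorem rhoOf_comm {d : ℕ → Derivation ℂ O O} (h : ∀ k l, ⁅d k, d l⁆ = 0) (a b : hPlus) :
    ⁅rhoOf d a, rhoOf d b⁆ = 0 := by
  refine rhoOf_induction d (P := fun _ D => ⁅D, rhoOf d b⁆ = 0) (fun _ _ D E hD hE => ?_)
    (fun c _ D hD => ?_) (fun k => ?_) a
  · rw [add_lie, hD, hE, add_zero]
  · rw [smul_lie, hD, smul_zero]
  refine rhoOf_induction d (P := fun _ D => ⁅(2 : ℂ) • d k, D⁆ = 0) (fun _ _ D E hD hE => ?_)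
    (fun c _ D hD => ?_) (fun l => ?_) b
  · rw [lie_add, hD, hE, add_zero]
  · rw [lie_smul, hD, smul_zero]
  · rw [smul_lie, lie_smul, h, smul_zero, smul_zero]

end Rho

section Infinitesimal

/-- The inclusion of the complex numbers into the dual numbers. -/
abbrev dualC : ℂ →+* DualNumber ℂ := algebraMap ℂ (DualNumber ℂ)

/-- A power series over `ℂ` as a Laurent series over the dual numbers. -/
def serL : ℂ⟦X⟧ →+* LaurentSeries (DualNumber ℂ) :=
  (HahnSeries.ofPowerSeries ℤ (DualNumber ℂ)).comp (PowerSeries.map dualC)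

/-- A polynomial in `λ` over `ℂ` as a Laurent series over the dual numbers. -/
def polyL : ℂ[X] →+* LaurentSeries (DualNumber ℂ) :=
  (polyToLaurent (DualNumber ℂ)).comp (Polynomial.mapRingHom dualC)

/-- Let `b` be a point of `B₋` with coordinates `u`, `v`, `m`, and `h = diag(1, -1)`. The matrices
`X₋ = (A, B; C, -A)` and `X₊ = (A', B'; C', -A')` are the components of `b⁻¹ a h b` in the Lie
algebras of `B₋` and `N₊`, and `du`, `dm` are the derivatives of `u`, `m` along `b ↦ b X₋`. -/
structure InfFactor (a : ℂ[X]) (u v m du dm A B C : ℂ⟦X⟧) (A' B' C' : ℂ[X]) : Prop where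
  hA : polyL a * serL (1 + 2 * (u * v)) = serL A + polyL A'
  hB : polyL a * serL (2 * v) = serL B + polyL B'
  hC : polyL a * serL (-(2 * (u * (1 + u * v)))) = serL C + polyL C'
  B_zero : constantCoeff B = 0
  A_zero : Polynomial.constantCoeff A' = 0
  C_zero : Polynomial.constantCoeff C' = 0
  on_u : du = C + 2 * u * A - u ^ 2 * B
  on_m : PowerSeries.X * dm = -B - 2 * PowerSeries.X * m * A + PowerSeries.X ^ 2 * m ^ 2 * C

variable {a a₂ : ℂ[X]} {u v m du dm A B C du₂ dm₂ A₂ B₂ C₂ : ℂ⟦X⟧} {A' B' C' A₂' B₂' C₂' : ℂ[X]}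

theorem InfFactor.add (h : InfFactor a u v m du dm A B C A' B' C')
    (h₂ : InfFactor a₂ u v m du₂ dm₂ A₂ B₂ C₂ A₂' B₂' C₂') :
    InfFactor (a + a₂) u v m (du + du₂) (dm + dm₂) (A + A₂) (B + B₂) (C + C₂)
      (A' + A₂') (B' + B₂') (C' + C₂') where
  hA := by rw [map_add polyL, map_add serL A, map_add polyL]; linear_combination h.hA + h₂.hA
  hB := by rw [map_add polyL, map_add serL B, map_add polyL]; linear_combination h.hB + h₂.hB
  hC := by rw [map_add polyL, map_add serL C, map_add polyL]; linear_combination h.hC + h₂.hC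
  B_zero := by rw [map_add, h.B_zero, h₂.B_zero, add_zero]
  A_zero := by rw [map_add, h.A_zero, h₂.A_zero, add_zero]
  C_zero := by rw [map_add, h.C_zero, h₂.C_zero, add_zero]
  on_u := by linear_combination h.on_u + h₂.on_u
  on_m := by linear_combination h.on_m + h₂.on_m

theorem polyL_C (c : ℂ) : polyL (Polynomial.C c) = serL (PowerSeries.C c) := by
  simp only [polyL, serL, RingHom.comp_apply, Polynomial.coe_mapRingHom, Polynomial.map_C,
    polyToLaurent_C, PowerSeries.map_C, HahnSeries.ofPowerSeries_C]

theorem InfFactor.smul (c : ℂ) (h : InfFactor a u v m du dm A B C A' B' C') :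
    InfFactor (Polynomial.C c * a) u v m (PowerSeries.C c * du) (PowerSeries.C c * dm)
      (PowerSeries.C c * A) (PowerSeries.C c * B) (PowerSeries.C c * C)
      (Polynomial.C c * A') (Polynomial.C c * B') (Polynomial.C c * C') where
  hA := by simp only [map_mul polyL, map_mul serL (PowerSeries.C c), polyL_C]; linear_combination serL (PowerSeries.C c) * h.hA
  hB := by simp only [map_mul polyL, map_mul serL (PowerSeries.C c), polyL_C]; linear_combination serL (PowerSeries.C c) * h.hB
  hC := by simp only [map_mul polyL, map_mul serL (PowerSeries.C c), polyL_C]; linear_combination serL (PowerSeries.C c) * h.hC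
  B_zero := by rw [map_mul, h.B_zero, mul_zero]
  A_zero := by rw [map_mul, h.A_zero, mul_zero]
  C_zero := by rw [map_mul, h.C_zero, mul_zero]
  on_u := by linear_combination PowerSeries.C c * h.on_u
  on_m := by linear_combination PowerSeries.C c * h.on_m

theorem polyL_X_pow_mul (n : ℕ) (f : ℂ⟦X⟧) :
    polyL (Polynomial.X ^ n) * serL f = serL (shiftSer n f) + polyL (posPart n f) := by
  simp only [polyL, serL, RingHom.comp_apply, Polynomial.coe_mapRingHom, Polynomial.map_pow,
    Polynomial.map_X, map_shiftSer, map_posPart]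
  exact X_pow_mul_eq n _

theorem shiftSer_C (k : ℕ) (c : ℂ) : shiftSer (k + 1) (PowerSeries.C c) = 0 := by
  ext i
  rw [coeff_shiftSer, PowerSeries.coeff_C, if_neg (by omega), map_zero]

theorem shiftSer_add (k : ℕ) (f g : ℂ⟦X⟧) : shiftSer k (f + g) = shiftSer k f + shiftSer k g := by
  ext i
  simp only [coeff_shiftSer, map_add]

theorem shiftSer_neg (k : ℕ) (f : ℂ⟦X⟧) : shiftSer k (-f) = -shiftSer k f := by
  ext i
  simp only [coeff_shiftSer, map_neg]

/-- The infinitesimal factorization for `a = λ^{k+1}`. -/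
theorem infFactor_X_pow (k : ℕ) (u m : ℂ⟦X⟧) :
    InfFactor (Polynomial.X ^ (k + 1)) u (negInvAdd u m) m
      (2 * muCoeff (k + 1) (flowU u m)) (2 * muCoeff (k + 1) (flowM u m))
      (2 * shiftSer (k + 1) (u * negInvAdd u m))
      (2 * (PowerSeries.X * shiftSer (k + 2) (negInvAdd u m)))
      (2 * shiftSer (k + 1) (-(u * (1 + u * negInvAdd u m))))
      (2 * posPart (k + 1) (PowerSeries.C (1 / 2) + u * negInvAdd u m))
      (2 * (posPart (k + 1) (negInvAdd u m) +
        Polynomial.C (coeff (k + 1) (negInvAdd u m))))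
      (2 * posPart (k + 1) (-(u * (1 + u * negInvAdd u m)))) where
  hA := by
    have e := polyL_X_pow_mul (k + 1) (PowerSeries.C (1 / 2) + u * negInvAdd u m)
    have h2 : (1 : ℂ⟦X⟧) = 2 * PowerSeries.C (1 / 2) := by
      rw [← map_ofNat (PowerSeries.C (R := ℂ)) 2, ← map_mul]
      norm_num
    rw [shiftSer_add, shiftSer_C, zero_add] at e
    rw [h2, ← mul_add, map_mul, map_mul, map_mul, map_ofNat, map_ofNat]
    linear_combination 2 * e
  hB := by
    have e := polyL_X_pow_mul (k + 1) (negInvAdd u m)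
    rw [shiftSer_eq, map_add serL] at e
    rw [map_mul, map_mul, map_mul polyL, map_add, polyL_C, map_ofNat, map_ofNat]
    linear_combination 2 * e
  hC := by
    rw [← mul_neg, map_mul, map_mul, map_mul polyL, map_ofNat, map_ofNat]
    linear_combination 2 * polyL_X_pow_mul (k + 1) (-(u * (1 + u * negInvAdd u m)))
  B_zero := by simp
  A_zero := by
    rw [map_mul]
    refine mul_eq_zero_of_right _ ((coeff_posPart _ _ 0).trans (if_neg (by simp)))
  C_zero := by
    rw [map_mul]
    refine mul_eq_zero_of_right _ ((coeff_posPart _ _ 0).trans (if_neg (by simp)))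
  on_u := by
    let _ : Algebra Kq ℂ := algebraAtOne ℂ
    rw [flowU_eq, map_sub, map_add, map_neg, muCoeff_mul, muCoeff_mul, muCoeff_divDiff,
      muCoeff_divDiff, muCoeff_divDiff_sub, shiftSer_neg]
    ring
  on_m := by
    let _ : Algebra Kq ℂ := algebraAtOne ℂ
    have hq : ∀ (n : ℤ) (a : ℂ), qp n • a = a := fun n a => by
      rw [Algebra.smul_def]
      change evalOne (qp n) * a = a
      rw [evalOne_qp, one_mul]
    have e : PowerSeries.X * muCoeff (k + 1) (flowM u m) =
        muCoeff (k + 1) (PowerSeries.X * flowM u m) := (serMap_X_mul _ _).symm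
    rw [mul_left_comm, e, X_mul_flowM_eq hq, map_sub, map_sub, map_neg, muCoeff_mul, muCoeff_mul,
      muCoeff_divDiff, muCoeff_divDiff, muCoeff_divDiff_sub, shiftSer_neg]
    ring

end Infinitesimal

/-! ### The factorization over the dual numbers -/

section

open Matrix

section Factor

theorem matrix_two_eq {T : Type*} {a b c d a' b' c' d' : T} (ha : a = a') (hb : b = b')
    (hc : c = c') (hd : d = d') : !![a, b; c, d] = !![a', b'; c', d'] := by
  rw [ha, hb, hc, hd]

/-- The Gauss factorization of `(1 + ε a h) b` over the dual numbers: if `b⁻¹ a h b = X₋ + X₊`,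
then `(1 + ε a h) b = b (1 + ε X₋) (1 + ε X₊)`. -/
theorem infinitesimal_factorization {T : Type*} [CommRing T] {α β γ δ l E A B C A' B' C' : T}
    (hE : E * E = 0) (hdet : α * δ - β * γ = 1) (hA : l * (1 + 2 * (β * γ)) = A + A')
    (hB : l * (2 * (β * δ)) = B + B') (hC : l * (-(2 * (α * γ))) = C + C') :
    !![1 + E * l, 0; 0, 1 - E * l] * !![α, β; γ, δ] =
      !![α, β; γ, δ] * !![1 + E * A, E * B; E * C, 1 - E * A] *
        !![1 + E * A', E * B'; E * C', 1 - E * A'] := by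
  rw [Matrix.mul_fin_two, Matrix.mul_fin_two, Matrix.mul_fin_two]
  refine matrix_two_eq ?_ ?_ ?_ ?_
  · linear_combination E * α * hA + E * β * hC
      - (α * A * A' + β * C * A' + α * B * C' - β * A * C') * hE
  · linear_combination E * α * hB - E * β * hA - 2 * E * l * β * hdet
      - (α * A * B' + β * C * B' - α * B * A' + β * A * A') * hE
  · linear_combination E * γ * hA + E * δ * hC + 2 * E * l * γ * hdet
      - (γ * A * A' + δ * C * A' + γ * B * C' - δ * A * C') * hE
  · linear_combination E * γ * hB - E * δ * hA
      - (γ * A * B' + δ * C * B' - γ * B * A' + δ * A * A') * hE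

variable {R : Type} [CommRing R]

theorem det_entries (g : SpecialLinearGroup (Fin 2) R) : g 0 0 * g 1 1 - g 0 1 * g 1 0 = 1 := by
  have h := g.det_coe
  rwa [Matrix.det_fin_two] at h

theorem isUnit_of_mem_Bminus {g : SpecialLinearGroup (Fin 2) R⟦X⟧} (h : g ∈ Bminus R) :
    IsUnit (g 1 1) := by
  have h0 : constantCoeff (g 0 1) = 0 := h
  have e := congrArg constantCoeff (det_entries g)
  rw [map_sub, map_mul, map_mul, h0, zero_mul, sub_zero, map_one] at e
  rw [PowerSeries.isUnit_iff_constantCoeff]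
  exact IsUnit.of_mul_eq_one_right _ e

theorem uCl_mul {g : SpecialLinearGroup (Fin 2) R⟦X⟧} (h : g ∈ Bminus R) :
    uCl g * g 1 1 = g 1 0 := by
  rw [uCl, mul_assoc, Ring.inverse_mul_cancel _ (isUnit_of_mem_Bminus h), mul_one]

end Factor

/-- The dual number `ε` as a constant power series. -/
def epsS : (DualNumber ℂ)⟦X⟧ := PowerSeries.C DualNumber.eps

/-- The dual number `ε` as a constant polynomial. -/
def epsP : (DualNumber ℂ)[X] := Polynomial.C DualNumber.eps

theorem epsS_mul_self : epsS * epsS = 0 := by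
  rw [epsS, ← map_mul, DualNumber.eps_mul_eps, map_zero]

theorem epsP_mul_self : epsP * epsP = 0 := by
  rw [epsP, ← map_mul, DualNumber.eps_mul_eps, map_zero]

/-- The matrix `1 + ε (A, B; C, -A)`. -/
def infElem {T : Type} [CommRing T] (e : T) (he : e * e = 0) (A B C : T) :
    SpecialLinearGroup (Fin 2) T :=
  ⟨!![1 + e * A, e * B; e * C, 1 - e * A], by
    rw [Matrix.det_fin_two_of]
    linear_combination -(A * A + B * C) * he⟩

theorem map_infElem {T T' : Type} [CommRing T] [CommRing T'] (φ : T →+* T') (e : T)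
    (he : e * e = 0) (A B C : T) : (SpecialLinearGroup.map φ (infElem e he A B C)).1 =
      !![1 + φ e * φ A, φ e * φ B; φ e * φ C, 1 - φ e * φ A] := by
  ext i j
  fin_cases i <;> fin_cases j
  · exact (map_add φ _ _).trans (by rw [map_one, map_mul]; rfl)
  · exact map_mul φ _ _
  · exact map_mul φ _ _
  · exact (map_sub φ _ _).trans (by rw [map_one, map_mul]; rfl)

/-- A point of `B₋` seen over the dual numbers. -/
def dualB (b : Bminus ℂ) : SpecialLinearGroup (Fin 2) (DualNumber ℂ)⟦X⟧ :=
  SpecialLinearGroup.map (PowerSeries.map dualC) b.1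

/-- A point of `N₊` seen over the dual numbers. -/
def dualN (n : Nplus ℂ) : SpecialLinearGroup (Fin 2) (DualNumber ℂ)[X] :=
  SpecialLinearGroup.map (Polynomial.mapRingHom dualC) n.1

/-- The point `b (1 + ε (A, B; C, -A))`. -/
def movedB (b : Bminus ℂ) (A B C : ℂ⟦X⟧) : SpecialLinearGroup (Fin 2) (DualNumber ℂ)⟦X⟧ :=
  dualB b * infElem epsS epsS_mul_self (PowerSeries.map dualC A) (PowerSeries.map dualC B)
    (PowerSeries.map dualC C)

/-- The point `1 + ε (A, B; C, -A)` of `N₊`. -/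
def movedN (A B C : ℂ[X]) : SpecialLinearGroup (Fin 2) (DualNumber ℂ)[X] :=
  infElem epsP epsP_mul_self (A.map dualC) (B.map dualC) (C.map dualC)

section
variable {a : ℂ[X]} {b : Bminus ℂ} {du dm A B C : ℂ⟦X⟧} {A' B' C' : ℂ[X]}

theorem infTrans_mul_liftB (h : InfFactor a (uCl b.1) (vCl b.1) (mCl b.1) du dm A B C A' B' C') :
    infTrans a * liftB b =
      loopB (DualNumber ℂ) (movedB b A B C) * loopN (DualNumber ℂ) (movedN A' B' C') := by
  have hu := uCl_mul b.2
  have hv : vCl b.1 = b.1 0 1 * b.1 1 1 := rfl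
  have hdet := det_entries b.1
  have e1 : uCl b.1 * vCl b.1 = b.1 0 1 * b.1 1 0 := by
    rw [hv]; linear_combination b.1 0 1 * hu
  have e2 : uCl b.1 * (1 + uCl b.1 * vCl b.1) = b.1 0 0 * b.1 1 0 := by
    rw [e1]; linear_combination b.1 0 0 * hu - uCl b.1 * hdet
  have hA := h.hA
  have hB := h.hB
  have hC := h.hC
  rw [e1, map_add, map_mul, map_mul, map_one, map_ofNat] at hA
  rw [hv, map_mul, map_mul, map_ofNat] at hB
  rw [e2, map_neg, map_mul, map_mul, map_ofNat] at hC
  have hd := congrArg serL hdet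
  rw [map_sub, map_mul, map_mul, map_one] at hd
  have hE : (HahnSeries.C (DualNumber.eps : DualNumber ℂ) : LaurentSeries (DualNumber ℂ)) *
      HahnSeries.C (DualNumber.eps : DualNumber ℂ) = 0 := by
    rw [← map_mul, DualNumber.eps_mul_eps, map_zero]
  have hL : (liftB b).1 = !![serL (b.1 0 0), serL (b.1 0 1); serL (b.1 1 0), serL (b.1 1 1)] := by
    refine Matrix.ext fun i j => ?_
    fin_cases i <;> fin_cases j <;> rfl
  have key := infinitesimal_factorization (T := LaurentSeries (DualNumber ℂ)) hE hd hA hB hC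
  rw [← hL] at key
  refine Subtype.ext (key.trans ?_)
  have s1 : HahnSeries.ofPowerSeries ℤ (DualNumber ℂ) epsS = HahnSeries.C DualNumber.eps :=
    HahnSeries.ofPowerSeries_C _
  have s2 : polyToLaurent (DualNumber ℂ) epsP = HahnSeries.C DualNumber.eps := polyToLaurent_C _
  have m1 := map_infElem (T' := LaurentSeries (DualNumber ℂ)) (HahnSeries.ofPowerSeries ℤ (DualNumber ℂ)) epsS epsS_mul_self
    (PowerSeries.map dualC A) (PowerSeries.map dualC B) (PowerSeries.map dualC C)
  have m2 := map_infElem (T' := LaurentSeries (DualNumber ℂ)) (polyToLaurent (DualNumber ℂ)) epsP epsP_mul_self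
    (A'.map dualC) (B'.map dualC) (C'.map dualC)
  rw [s1] at m1
  rw [s2] at m2
  rw [movedB, map_mul]
  exact (congrArg₂ (fun x y => (liftB b).1 * x * y) m1 m2).symm

theorem movedB_apply (i : Fin 2) :
    movedB b A B C i 0 = PowerSeries.map dualC (b.1 i 0) * (1 + epsS * PowerSeries.map dualC A)
      + PowerSeries.map dualC (b.1 i 1) * (epsS * PowerSeries.map dualC C) ∧
    movedB b A B C i 1 = PowerSeries.map dualC (b.1 i 0) * (epsS * PowerSeries.map dualC B)
      + PowerSeries.map dualC (b.1 i 1) * (1 - epsS * PowerSeries.map dualC A) := by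
  constructor
  all_goals
    change ((dualB b).1 * (infElem epsS epsS_mul_self (PowerSeries.map dualC A)
      (PowerSeries.map dualC B) (PowerSeries.map dualC C)).1 :
        Matrix (Fin 2) (Fin 2) (DualNumber ℂ)⟦X⟧) i _ = _
    rw [Matrix.mul_apply, Fin.sum_univ_two]
    rfl

theorem movedB_mem (hB : constantCoeff B = 0) :
    movedB b A B C ∈ Bminus (DualNumber ℂ) := by
  have h0 : constantCoeff (b.1 0 1) = 0 := b.2
  have hB' : constantCoeff (PowerSeries.map dualC B) = 0 := by
    rw [← PowerSeries.coeff_zero_eq_constantCoeff_apply, PowerSeries.coeff_map,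
      PowerSeries.coeff_zero_eq_constantCoeff_apply, hB, map_zero]
  have h0' : constantCoeff (PowerSeries.map dualC (b.1 0 1)) = 0 := by
    rw [← PowerSeries.coeff_zero_eq_constantCoeff_apply, PowerSeries.coeff_map,
      PowerSeries.coeff_zero_eq_constantCoeff_apply, h0, map_zero]
  change constantCoeff (movedB b A B C 0 1) = 0
  rw [(movedB_apply 0).2, map_add, map_mul, map_mul, map_mul, hB', h0', mul_zero, mul_zero,
    zero_mul, add_zero]

theorem uCl_movedB (hB : constantCoeff B = 0)
    (hu : du = C + 2 * uCl b.1 * A - uCl b.1 ^ 2 * B) :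
    uCl (movedB b A B C) = PowerSeries.map dualC (uCl b.1) + epsS * PowerSeries.map dualC du := by
  have hm := movedB_mem (b := b) (A := A) (C := C) hB
  refine (isUnit_of_mem_Bminus hm).mul_right_cancel ?_
  rw [uCl_mul hm, (movedB_apply 1).1, (movedB_apply 1).2, ← uCl_mul b.2, hu]
  simp only [map_mul, map_add, map_sub, map_pow, map_ofNat]
  generalize PowerSeries.map dualC (uCl b.1) = u
  generalize PowerSeries.map dualC (b.1 1 1) = d
  generalize PowerSeries.map dualC A = A
  generalize PowerSeries.map dualC B = B
  generalize PowerSeries.map dualC C = C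
  linear_combination -(C + 2 * u * A - u ^ 2 * B) * d * (u * B - A) * epsS_mul_self

theorem mCl_movedB (hB : constantCoeff B = 0)
    (hu : du = C + 2 * uCl b.1 * A - uCl b.1 ^ 2 * B)
    (hm : PowerSeries.X * dm = -B - 2 * PowerSeries.X * mCl b.1 * A
      + PowerSeries.X ^ 2 * mCl b.1 ^ 2 * C) :
    mCl (movedB b A B C) = PowerSeries.map dualC (mCl b.1) + epsS * PowerSeries.map dualC dm := by
  have hmem := movedB_mem (b := b) (A := A) (C := C) hB
  refine Reg.cancel reg_X ((isUnit_one_add_mul (s := uCl (movedB b A B C))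
    (constantCoeff_vCl hmem)).mul_right_cancel ?_)
  rw [X_mul_mCl hmem, uCl_movedB hB hu, vCl, (movedB_apply 0).2, (movedB_apply 1).2, hu]
  have h1 := congrArg (PowerSeries.map dualC) (X_mul_mCl b.2)
  have h2 := congrArg (PowerSeries.map dualC) hm
  have h3 := congrArg (PowerSeries.map dualC) (det_entries b.1)
  have h4 := congrArg (PowerSeries.map dualC) (uCl_mul b.2)
  rw [vCl] at h1
  simp only [map_mul, map_add, map_sub, map_pow, map_ofNat, map_neg, map_one,
    PowerSeries.map_X] at h1 h2 h3 h4 ⊢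
  rw [← h4] at h3 ⊢
  generalize PowerSeries.map dualC (uCl b.1) = u at *
  generalize PowerSeries.map dualC (mCl b.1) = m at *
  generalize PowerSeries.map dualC (b.1 0 0) = α at *
  generalize PowerSeries.map dualC (b.1 0 1) = β at *
  generalize PowerSeries.map dualC (b.1 1 1) = δ at *
  generalize PowerSeries.map dualC A = A at *
  generalize PowerSeries.map dualC B = B at *
  generalize PowerSeries.map dualC C = C at *
  generalize PowerSeries.map dualC dm = dm at *
  generalize (PowerSeries.X : (DualNumber ℂ)⟦X⟧) = x at *
  have hE := epsS_mul_self
  generalize epsS = e at *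
  have hv : (α * (e * B) + β * (1 - e * A)) * (u * δ * (e * B) + δ * (1 - e * A)) =
      β * δ + e * ((1 + 2 * u * (β * δ)) * B - 2 * (β * δ) * A) := by
    linear_combination e * B * h3 + (α * u * δ * B ^ 2 - α * δ * A * B - β * u * δ * A * B
      + β * δ * A ^ 2) * hE
  rw [hv]
  generalize β * δ = v at *
  linear_combination (-1 + e * (2 * A - C * x * m - u * B)) * h1 - e * (1 + u * v) * h2
    - (x * m * (C + 2 * u * A - u ^ 2 * B) * ((1 + 2 * u * v) * B - 2 * v * A)
      + x * dm * (u * ((1 + 2 * u * v) * B - 2 * v * A) + (C + 2 * u * A - u ^ 2 * B) * v)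
      + e * x * dm * (C + 2 * u * A - u ^ 2 * B) * ((1 + 2 * u * v) * B - 2 * v * A)) * hE

theorem movedN_mem (hA : Polynomial.constantCoeff A' = 0) (hC : Polynomial.constantCoeff C' = 0) :
    movedN A' B' C' ∈ Nplus (DualNumber ℂ) := by
  have h : ∀ {f : ℂ[X]}, Polynomial.constantCoeff f = 0 →
      Polynomial.constantCoeff (f.map dualC) = 0 := fun {f} hf => by
    rw [Polynomial.constantCoeff_apply, Polynomial.coeff_map, ← Polynomial.constantCoeff_apply, hf,
      map_zero]
  refine ⟨?_, ?_, ?_⟩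
  · change Polynomial.constantCoeff (1 + epsP * A'.map dualC) = 1
    rw [map_add, map_mul, h hA, mul_zero, add_zero, map_one]
  · change Polynomial.constantCoeff (epsP * C'.map dualC) = 0
    rw [map_mul, h hC, mul_zero]
  · change Polynomial.constantCoeff (1 - epsP * A'.map dualC) = 1
    rw [map_sub, map_mul, h hA, mul_zero, sub_zero, map_one]

theorem dualN_mem (n : Nplus ℂ) : dualN n ∈ Nplus (DualNumber ℂ) := by
  have h : ∀ f : ℂ[X], Polynomial.constantCoeff (f.map dualC) =
      dualC (Polynomial.constantCoeff f) := fun f => by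
    rw [Polynomial.constantCoeff_apply, Polynomial.coeff_map, ← Polynomial.constantCoeff_apply]
  obtain ⟨h1, h2, h3⟩ := n.2
  refine ⟨(h _).trans ?_, (h _).trans ?_, (h _).trans ?_⟩
  · exact (congrArg dualC h1).trans (map_one _)
  · exact (congrArg dualC h2).trans (map_zero _)
  · exact (congrArg dualC h3).trans (map_one _)

theorem movedN_mul_apply (n : Nplus ℂ) (j : Fin 2) :
    (movedN A' B' C' * dualN n) 0 j = (n.1 0 j).map dualC
      + epsP * (A' * n.1 0 j + B' * n.1 1 j).map dualC ∧
    (movedN A' B' C' * dualN n) 1 j = (n.1 1 j).map dualC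
      + epsP * (C' * n.1 0 j - A' * n.1 1 j).map dualC := by
  constructor
  all_goals
    change ((movedN A' B' C').1 * (dualN n).1 : Matrix (Fin 2) (Fin 2) (DualNumber ℂ)[X]) _ j = _
    rw [Matrix.mul_apply, Fin.sum_univ_two]
  · change (1 + epsP * A'.map dualC) * (n.1 0 j).map dualC
      + (epsP * B'.map dualC) * (n.1 1 j).map dualC = _
    rw [Polynomial.map_add, Polynomial.map_mul, Polynomial.map_mul]
    ring
  · change (epsP * C'.map dualC) * (n.1 0 j).map dualC
      + (1 - epsP * A'.map dualC) * (n.1 1 j).map dualC = _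
    rw [Polynomial.map_sub, Polynomial.map_mul, Polynomial.map_mul]
    ring

end

theorem isFirstOrder_add (x y : ℂ) :
    IsFirstOrder (dualC x + DualNumber.eps * dualC y) x y := by
  change TrivSqZeroExt.inl x + TrivSqZeroExt.inr 1 * TrivSqZeroExt.inl y = _
  rw [TrivSqZeroExt.inr_mul_inl, op_smul_eq_mul, one_mul]

theorem isFirstOrder_coord {s : (DualNumber ℂ)⟦X⟧} {f : ℂ⟦X⟧} {c : ℕ → ℂ}
    (h : s = PowerSeries.map dualC f + epsS * PowerSeries.map dualC (genSer c)) (i : ℕ) :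
    IsFirstOrder ((-1) ^ i * coeff i s) ((-1) ^ i * coeff i f) (c i) := by
  have e : (-1) ^ i * coeff i s =
      dualC ((-1) ^ i * coeff i f) + DualNumber.eps * dualC (c i) := by
    rw [h, map_add, epsS, PowerSeries.coeff_C_mul, PowerSeries.coeff_map, PowerSeries.coeff_map,
      coeff_genSer, map_mul, map_mul, map_pow, map_neg, map_one]
    linear_combination DualNumber.eps * dualC (c i) * neg_one_pow_mul_self' (A := DualNumber ℂ) i
  rw [e]
  exact isFirstOrder_add _ _

end

/-! ### The classical flows are infinitesimal left translations -/

section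

open Matrix

theorem genSer_add (c d : ℕ → ℂ) : genSer c + genSer d = genSer fun i => c i + d i := by
  ext i
  simp only [map_add, coeff_genSer, mul_add]

theorem genSer_mul (r : ℂ) (c : ℕ → ℂ) : PowerSeries.C r * genSer c = genSer fun i => r * c i := by
  ext i
  simp only [PowerSeries.coeff_C_mul, coeff_genSer, mul_left_comm]

/-- The vector field `D` is given at every point by the infinitesimal factorization. -/
def IsInfB (a : ℂ[X]) (D : Derivation ℂ OB OB) : Prop :=
  ∀ b : Bminus ℂ, ∃ A B C A' B' C', InfFactor a (uCl b.1) (vCl b.1) (mCl b.1)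
    (genSer fun i => (D (OB.u i)).1 (HB.mk b)) (genSer fun i => (D (OB.m i)).1 (HB.mk b))
    A B C A' B' C'

/-- The vector field `D` is given at every point by the infinitesimal factorization. -/
def IsInfBN (a : ℂ[X]) (D : Derivation ℂ OBN OBN) : Prop :=
  ∀ (b : Bminus ℂ) (n : Nplus ℂ), ∃ A B C A' B' C', InfFactor a (uCl b.1) (vCl b.1) (mCl b.1)
    (genSer fun i => (D (OBN.u i)).1 (HB.mk b, n)) (genSer fun i => (D (OBN.m i)).1 (HB.mk b, n))
    A B C A' B' C' ∧
    (∀ j r, (D (OBN.a 0 j r)).1 (HB.mk b, n) = (A' * n.1 0 j + B' * n.1 1 j).coeff r) ∧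
    ∀ j r, (D (OBN.a 1 j r)).1 (HB.mk b, n) = (C' * n.1 0 j - A' * n.1 1 j).coeff r

theorem IsInfB.isVectorField {a : ℂ[X]} {D : Derivation ℂ OB OB} (h : IsInfB a D) :
    IsVectorFieldB a D := fun b => by
  obtain ⟨A, B, C, A', B', C', h⟩ := h b
  refine ⟨1, one_mem _, movedB b A B C, movedB_mem h.B_zero, movedN A' B' C',
    movedN_mem h.A_zero h.C_zero, ?_, isFirstOrder_coord (uCl_movedB h.B_zero h.on_u),
    isFirstOrder_coord (mCl_movedB h.B_zero h.on_u h.on_m)⟩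
  rw [map_one, one_mul]
  exact infTrans_mul_liftB h

theorem IsInfBN.isVectorField {a : ℂ[X]} {D : Derivation ℂ OBN OBN} (h : IsInfBN a D) :
    IsVectorFieldBN a D := fun b n => by
  obtain ⟨A, B, C, A', B', C', h, h0, h1⟩ := h b n
  refine ⟨1, one_mem _, movedB b A B C, movedB_mem h.B_zero, movedN A' B' C' * dualN n,
    mul_mem (movedN_mem h.A_zero h.C_zero) (dualN_mem n), ?_,
    isFirstOrder_coord (uCl_movedB h.B_zero h.on_u),
    isFirstOrder_coord (mCl_movedB h.B_zero h.on_u h.on_m), fun s j r => ?_⟩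
  · rw [map_one, one_mul, map_mul, ← mul_assoc, ← mul_assoc, infTrans_mul_liftB h]
    rfl
  · fin_cases s
    · change IsFirstOrder (((movedN A' B' C' * dualN n) 0 j).coeff r) ((n.1 0 j).coeff r)
        ((D (OBN.a 0 j r)).1 (HB.mk b, n))
      rw [(movedN_mul_apply n j).1, h0, Polynomial.coeff_add, epsP, Polynomial.coeff_C_mul,
        Polynomial.coeff_map, Polynomial.coeff_map]
      exact isFirstOrder_add _ _
    · change IsFirstOrder (((movedN A' B' C' * dualN n) 1 j).coeff r) ((n.1 1 j).coeff r)
        ((D (OBN.a 1 j r)).1 (HB.mk b, n))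
      rw [(movedN_mul_apply n j).2, h1, Polynomial.coeff_add, epsP, Polynomial.coeff_C_mul,
        Polynomial.coeff_map, Polynomial.coeff_map]
      exact isFirstOrder_add _ _

/-- The value of a function at a point. -/
def OB.ev (p : HB) : OB →+* ℂ := (Pi.evalRingHom (fun _ : HB => ℂ) p).comp OB.val.toRingHom

theorem OB.map_ev_u (b : Bminus ℂ) : PowerSeries.map (OB.ev (HB.mk b)) (genSer OB.u) = uCl b.1 :=
  (map_genSer _ _).trans (genSer_uCoord b.1)

theorem OB.map_ev_m (b : Bminus ℂ) : PowerSeries.map (OB.ev (HB.mk b)) (genSer OB.m) = mCl b.1 :=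
  (map_genSer _ _).trans (genSer_mCoord b.1)

theorem OBN.map_ev_u (b : Bminus ℂ) (n : Nplus ℂ) :
    PowerSeries.map (OBN.ev (HB.mk b, n)) (genSer OBN.u) = uCl b.1 :=
  (map_genSer _ _).trans (genSer_uCoord b.1)

theorem OBN.map_ev_m (b : Bminus ℂ) (n : Nplus ℂ) :
    PowerSeries.map (OBN.ev (HB.mk b, n)) (genSer OBN.m) = mCl b.1 :=
  (map_genSer _ _).trans (genSer_mCoord b.1)

theorem genSer_der {O : Type} [CommRing O] [Algebra ℂ O] [Algebra Kq O] [QActsAsOne O]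
    {d : ℕ → Derivation ℂ O O} {c : ℕ → O} {F : O⟦X⟧⟦X⟧} (φ : O →+* ℂ)
    (h : serMap (flowDer d : O →+ O⟦X⟧) (genSer c) = F) (k : ℕ) :
    genSer (fun i => 2 * φ (d k (c i))) =
      2 * muCoeff (k + 1) (PowerSeries.map (PowerSeries.map φ) F) := by
  ext i
  rw [coeff_genSer, ← h, ← map_ofNat (PowerSeries.C (R := ℂ)) 2, PowerSeries.coeff_C_mul,
    coeff_muCoeff, PowerSeries.coeff_map, PowerSeries.coeff_map, coeff_serMap, coeff_genSer]
  have e := map_neg_one_pow_mul (flowDer d : O →+ O⟦X⟧) i (c i)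
  rw [e]
  change _ = 2 * φ (coeff (k + 1) ((-1) ^ i * flowDer d (c i)))
  have e2 : ((-1) ^ i : O⟦X⟧) = PowerSeries.C ((-1) ^ i) := by simp
  rw [e2, PowerSeries.coeff_C_mul, coeff_succ_flowDer, map_mul, map_pow, map_neg, map_one]
  ring

theorem OB.isInf (a : hPlus) : IsInfB a.1 (rhoOf OB.der a) := by
  refine rhoOf_induction OB.der ?_ ?_ ?_ a
  · intro a₁ a₂ D E hD hE b
    obtain ⟨A, B, C, A', B', C', h⟩ := hD b
    obtain ⟨A₂, B₂, C₂, A₂', B₂', C₂', h₂⟩ := hE b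
    have := h.add h₂
    rw [genSer_add, genSer_add] at this
    exact ⟨_, _, _, _, _, _, this⟩
  · intro c a₁ D hD b
    obtain ⟨A, B, C, A', B', C', h⟩ := hD b
    have := h.smul c
    rw [genSer_mul, genSer_mul] at this
    exact ⟨_, _, _, _, _, _, this⟩
  · intro k b
    have h := infFactor_X_pow k (uCl b.1) (mCl b.1)
    have eu := genSer_der (OB.ev (HB.mk b)) OB.qFlow.on_u k
    have em := genSer_der (OB.ev (HB.mk b)) OB.qFlow.on_m k
    rw [map_flowU, OB.map_ev_u, OB.map_ev_m] at eu
    rw [map_flowM, OB.map_ev_u, OB.map_ev_m] at em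
    rw [← eu, ← em, ← vCl_eq b.2] at h
    exact ⟨_, _, _, _, _, _, h⟩

theorem OBN.map_ev_V (b : Bminus ℂ) (n : Nplus ℂ) :
    PowerSeries.map (OBN.ev (HB.mk b, n)) OBN.V = negInvAdd (uCl b.1) (mCl b.1) := by
  rw [OBN.V, map_negInvAdd, OBN.map_ev_u, OBN.map_ev_m]

theorem OBN.coeff_ev (p : HBN) (P Q : OBN[X]) (j : Fin 2) (r : ℕ) :
    (coeff r ((P : OBN⟦X⟧) * OBN.aSer 0 j + (Q : OBN⟦X⟧) * OBN.aSer 1 j)).1 p =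
      (P.map (OBN.ev p) * p.2.1 0 j + Q.map (OBN.ev p) * p.2.1 1 j).coeff r := by
  rw [← OBN.ev_apply, ← PowerSeries.coeff_map, ← Polynomial.coeff_coe]
  simp only [map_add, map_mul, map_coe_polynomial, OBN.map_ev_aSer, Polynomial.coe_add,
    Polynomial.coe_mul]

theorem OBN.coeff_ev_sub (p : HBN) (P Q : OBN[X]) (j : Fin 2) (r : ℕ) :
    (coeff r ((P : OBN⟦X⟧) * OBN.aSer 0 j - (Q : OBN⟦X⟧) * OBN.aSer 1 j)).1 p =
      (P.map (OBN.ev p) * p.2.1 0 j - Q.map (OBN.ev p) * p.2.1 1 j).coeff r := by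
  rw [← OBN.ev_apply, ← PowerSeries.coeff_map, ← Polynomial.coeff_coe]
  simp only [map_sub, map_mul, map_coe_polynomial, OBN.map_ev_aSer, Polynomial.coe_sub,
    Polynomial.coe_mul]

theorem coeff_two_mul (p : ℂ[X]) (r : ℕ) : (2 * p).coeff r = 2 * p.coeff r := by
  rw [two_mul, Polynomial.coeff_add, two_mul]

theorem OBN.isInf (a : hPlus) : IsInfBN a.1 (rhoOf OBN.der a) := by
  refine rhoOf_induction OBN.der ?_ ?_ ?_ a
  · intro a₁ a₂ D E hD hE b n
    obtain ⟨A, B, C, A', B', C', h, h0, h1⟩ := hD b n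
    obtain ⟨A₂, B₂, C₂, A₂', B₂', C₂', h₂, h0₂, h1₂⟩ := hE b n
    have := h.add h₂
    rw [genSer_add, genSer_add] at this
    refine ⟨_, _, _, _, _, _, this, fun j r => (congrArg₂ (· + ·) (h0 j r) (h0₂ j r)).trans ?_,
      fun j r => (congrArg₂ (· + ·) (h1 j r) (h1₂ j r)).trans ?_⟩
    all_goals
      refine (Polynomial.coeff_add _ _ _).symm.trans (congrArg (Polynomial.coeff · r) ?_)
      ring
  · intro c a₁ D hD b n
    obtain ⟨A, B, C, A', B', C', h, h0, h1⟩ := hD b n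
    have := h.smul c
    rw [genSer_mul, genSer_mul] at this
    refine ⟨_, _, _, _, _, _, this, fun j r => (congrArg (c * ·) (h0 j r)).trans ?_,
      fun j r => (congrArg (c * ·) (h1 j r)).trans ?_⟩
    all_goals
      refine (Polynomial.coeff_C_mul _).symm.trans (congrArg (Polynomial.coeff · r) ?_)
      ring
  · intro k b n
    have h := infFactor_X_pow k (uCl b.1) (mCl b.1)
    have eu := genSer_der (OBN.ev (HB.mk b, n)) OBN.qFlow.on_u k
    have em := genSer_der (OBN.ev (HB.mk b, n)) OBN.qFlow.on_m k
    rw [map_flowU, OBN.map_ev_u, OBN.map_ev_m] at eu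
    rw [map_flowM, OBN.map_ev_u, OBN.map_ev_m] at em
    rw [← eu, ← em, ← OBN.map_ev_V b n] at h
    have hv : PowerSeries.map (OBN.ev (HB.mk b, n)) OBN.V = vCl b.1 :=
      (OBN.map_ev_V b n).trans (vCl_eq b.2).symm
    have hc : PowerSeries.map (OBN.ev (HB.mk b, n)) OBN.W =
        PowerSeries.C (1 / 2) + uCl b.1 * vCl b.1 := by
      rw [OBN.W, map_add, map_mul, PowerSeries.map_C, OBN.map_ev_u, hv]
      rfl
    rw [hv] at h
    refine ⟨_, _, _, _, _, _, h, fun j r => ?_, fun j r => ?_⟩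
    · refine (congrArg (2 * ·) ((congrArg (fun f : OBN => f.1 (HB.mk b, n))
        (OBN.der_a_zero k j r)).trans (OBN.coeff_ev _ _ _ j r))).trans ?_
      rw [map_posPart, Polynomial.map_add, map_posPart, Polynomial.map_C, ← PowerSeries.coeff_map,
        hc, hv]
      refine (coeff_two_mul _ r).symm.trans (congrArg (Polynomial.coeff · r) ?_)
      ring
    · refine (congrArg (2 * ·) ((congrArg (fun f : OBN => f.1 (HB.mk b, n))
        (OBN.der_a_one k j r)).trans (OBN.coeff_ev_sub _ _ _ j r))).trans ?_
      rw [map_posPart, map_posPart, hc, map_neg, map_mul, map_add, map_one, map_mul, OBN.map_ev_u, hv]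
      refine (coeff_two_mul _ r).symm.trans (congrArg (Polynomial.coeff · r) ?_)
      ring

/-- The classical flows correspond to `diag(λ^n, -λ^n) / 2`, whence the factor `1 / 2`. -/
theorem flowOf_limit {A O : Type} [Ring A] [Algebra Kq A] [CommRing O] [Algebra ℂ O] [Algebra Kq O]
    [QActsAsOne O] {D : A →ₗ[Kq] A⟦X⟧} {d : ℕ → Derivation ℂ O O} {σ : A →+* O}
    (h : ∀ x, PowerSeries.map σ (D x) = flowDer d (σ x)) (n : ℕ+) (x : A) :
    σ ((-1) ^ (n : ℕ) * flowOf D n x) = (1 / 2 : ℂ) • rhoOf d (hGen n) (σ x) := by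
  obtain ⟨k, hk⟩ : ∃ k : ℕ, n = ⟨k + 1, k.succ_pos⟩ :=
    ⟨n - 1, PNat.eq (Nat.succ_pred_eq_of_pos n.pos).symm⟩
  rw [flowOf_apply, ← mul_assoc, neg_one_pow_mul_self', one_mul, ← PowerSeries.coeff_map, h, hk,
    rhoOf_hGen]
  change coeff (k + 1) _ = (1 / 2 : ℂ) • (2 : ℂ) • d k (σ x)
  rw [coeff_succ_flowDer, smul_smul]
  norm_num

end

end

end QDS

theorem proposition2p5 :
    -- the derivations exist, are determined by the formulas, and extend one another
    ∃ (H : ℕ+ → QDS.QB →ₗ[QDS.Kq] QDS.QB) (HN : ℕ+ → QDS.QBN →ₗ[QDS.Kq] QDS.QBN),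
      (QDS.IsFlowB H ∧ ∀ H₂, QDS.IsFlowB H₂ → H₂ = H) ∧
      (QDS.IsFlowBN HN ∧ ∀ H₂, QDS.IsFlowBN H₂ → H₂ = HN) ∧
      (∃ j : QDS.QB →ₐ[QDS.Kq] QDS.QBN,
        (∀ i, j (QDS.QB.u i) = QDS.QBN.u i) ∧ (∀ i, j (QDS.QB.m i) = QDS.QBN.m i) ∧
        ∀ n x, j (H n x) = HN n (j x)) ∧
      -- they commute
      (∀ n k x, H n (H k x) = H k (H n x)) ∧
      (∀ n k x, HN n (HN k x) = HN k (HN n x)) ∧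
      -- they commute with the action of the quantum group
      (∃ act : QDS.Uq →ₐ[QDS.Kq] Module.End QDS.Kq QDS.QBN,
        QDS.IsUqAction act ∧ (∀ act₂, QDS.IsUqAction act₂ → act₂ = act) ∧
        ∀ h n x, act h (HN n x) = HN n (act h x)) ∧
      -- they deform the classical action on the smaller homogeneous space
      (∃ (ρ : QDS.hPlus →ₗ[ℂ] Derivation ℂ QDS.OB QDS.OB) (σ : QDS.QB →+* QDS.OB),
        (∀ a, QDS.IsVectorFieldB a.1 (ρ a)) ∧ (∀ a b, ⁅ρ a, ρ b⁆ = 0) ∧ QDS.IsLimitB σ ∧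
        ∀ (n : ℕ+) (x : QDS.QB),
          σ ((-1) ^ (n : ℕ) * H n x) = (1 / 2 : ℂ) • ρ (QDS.hGen n) (σ x)) ∧
      -- they deform the classical action on the larger homogeneous space
      (∃ (ρ : QDS.hPlus →ₗ[ℂ] Derivation ℂ QDS.OBN QDS.OBN) (σ : QDS.QBN →+* QDS.OBN),
        (∀ a, QDS.IsVectorFieldBN a.1 (ρ a)) ∧ (∀ a b, ⁅ρ a, ρ b⁆ = 0) ∧ QDS.IsLimitBN σ ∧
        ∀ (n : ℕ+) (x : QDS.QBN),
          σ ((-1) ^ (n : ℕ) * HN n x) = (1 / 2 : ℂ) • ρ (QDS.hGen n) (σ x)) := by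
  refine ⟨QDS.flowOf QDS.QB.flow, QDS.flowOf QDS.QBN.flow, ⟨QDS.QB.isFlow, fun _ h => QDS.QB.flow_unique h⟩,
    ⟨QDS.QBN.isFlow, fun _ h => QDS.QBN.flow_unique h⟩,
    ⟨QDS.QB.toQBN, fun i => QDS.QB.lift_u _ i, fun i => QDS.QB.lift_m _ i, QDS.QB.toQBN_flowOf⟩,
    QDS.QB.flow_comm, QDS.QBN.flow_comm,
    ⟨QDS.QBN.act, QDS.QBN.isUqAction, fun _ h => QDS.QBN.act_unique h, QDS.QBN.act_flow⟩, ?_, ?_⟩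
  · exact ⟨QDS.rhoOf QDS.OB.der, (QDS.limitB : QDS.QB →+* QDS.OB),
      fun a => (QDS.OB.isInf a).isVectorField, QDS.rhoOf_comm QDS.OB.der_comm, QDS.isLimitB,
      QDS.flowOf_limit QDS.map_limitB_flow⟩
  · exact ⟨QDS.rhoOf QDS.OBN.der, (QDS.limitBN : QDS.QBN →+* QDS.OBN),
      fun a => (QDS.OBN.isInf a).isVectorField, QDS.rhoOf_comm QDS.OBN.der_comm, QDS.isLimitBN,
      QDS.flowOf_limit QDS.map_limitBN_flow⟩
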